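/- **Theorem (reconstruction formula).** Let $\sigma,\delta\in\{1,-1\}$, $q_-\in\mathbb R\setminus\{0\}$, $q_+=\delta q_-$, $q_0=|q_\pm|$, and let $q:\mathbb R^2\to\mathbb R$ be a classical solution (with $q,q_x,q_{xx},q_{xxx}$ continuous in $(x,t)$ and $q$ differentiable in $t$) of the nonlocal mKdV equation $$q_t(x,t)-6\sigma\,q(-x,-t)\,q(x,t)\,q_x(x,t)+q_{xxx}(x,t)=0$$ such that, as $x\to\pm\infty$, $q\to q_\pm$, $q_x\to0$, $q_{xx}\to0$ locally uniformly in $t$, and such that for every $t$ one has $(1+|x|)(q(x,t)-q_\pm)\in L^1(\mathbb R^\pm)$ and $q_x(\cdot,t)\in L^1(\mathbb R)$. *Notation.* $k(z)=\frac12(z+\delta\sigma q_0^2/z)$, $\lambda(z)=\frac12(z-\delta\sigma q_0^2/z)$, $\theta(x,t;z)=\lambda\,[x+(4k^2+2\sigma\delta q_0^2)t]$, $\sigma_3=\mathrm{diag}(1,-1)$, $$Q=\begin{bmatrix}0&q(x,t)\\ \sigma q(-x,-t)&0\end{bmatrix},\quad Q_\pm=\begin{bmatrix}0&q_\pm\\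 \delta\sigma q_\pm&0\end{bmatrix},\quad E_\pm(z)=\begin{bmatrix}1&iq_\pm/z\\-\delta\sigma\, iq_\pm/z&1\end{bmatrix},\quad X_\pm=ik\sigma_3+Q_\pm .$$ If $\delta\sigma=1$, $D_\pm=\{\pm\operatorname{Im}z>0\}$ and $\Sigma=\mathbb R\setminus\{0\}$; if $\delta\sigma=-1$, $D_\pm=\{\pm(|z|-q_0)\operatorname{Im}z>0\}$ and $\Sigma=(\mathbb R\setminus\{0\})\cup\{|z|=q_0\}$. $\Sigma$ is oriented with $D_+$ on its left, and $\Sigma^0$ is $\Sigma$ without the branch points $z^2=\delta\sigma q_0^2$. *Jost solutions.* $\mu_\pm(x,t;z)$ is the solution, continuous in $x$ and tending to $E_\pm(z)$ as $x\to\pm\infty$, of $$\mu_\pm(x,t;z)=E_\pm+\int_{\pm\infty}^xE_\pm e^{i\lambda(x-y)\sigma_3}E_\pm^{-1}\,(Q(y,t)-Q_\pm)\,\mu_\pm(y,t;z)\,e^{-i\lambda(x-y)\sigma_3}\,dy$$ (at the branch points the kernel is $I+(x-y)X_\pm$). The equation is taken column by column: the first column $\mu_{+1}$ of $\mu_+$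 and the second column $\mu_{-2}$ of $\mu_-$ are defined for $z\in D_+\cup\Sigma$, and $\mu_{-1}$, $\mu_{+2}$ for $z\in D_-\cup\Sigma$. Put $\Phi_\pm=\mu_\pm e^{i\theta\sigma_3}$. The scattering matrix $S(z)=(s_{ij}(z))$, which does not depend on $(x,t)$, is given by $\Phi_+=\Phi_-S$, that is, with $d(z)=1-\delta\sigma q_0^2/z^2$ and $(x,t)=(0,0)$, $$s_{11}=\tfrac{\det(\Phi_{+1},\Phi_{-2})}{d},\quad s_{12}=\tfrac{\det(\Phi_{+2},\Phi_{-2})}{d},\quad s_{21}=\tfrac{\det(\Phi_{-1},\Phi_{+1})}{d},\quad s_{22}=\tfrac{\det(\Phi_{-1},\Phi_{+2})}{d};$$ these formulas also define $s_{11}$ in $D_+$ and $s_{22}$ in $D_-$. Put $\varrho=s_{21}/s_{11}$, $\tilde\varrho=s_{12}/s_{22}$. *Assumptions on the spectrum.* There are no spectral singularities: $s_{11},s_{22}\neq0$ on $\Sigma^0$, and near each branch point $|s_{11}|$ is bounded away from $0$ on $D_+\cup\Sigma^0$ and $|s_{22}|$ on $D_-\cup\Sigma^0$. The zeros of $s_{11}$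 in $D_+$ with positive real part are finitely many distinct points $z_1,\dots,z_{N_1}$, those with zero real part are finitely many distinct points $iw_1,\dots,iw_{N_2}$ ($N_1,N_2\ge0$), and all of these are simple. Let $(\eta_n)_{n=1}^{2N_1+N_2}$ be the list $z_1,\dots,z_{N_1},-z_1^*,\dots,-z_{N_1}^*,iw_1,\dots,iw_{N_2}$ and $\widehat\eta_n=\delta\sigma q_0^2/\eta_n\in D_-$. Let $b[\widehat\eta_n]$ be the constant with $\Phi_{+2}(x,t;\widehat\eta_n)=b[\widehat\eta_n]\,\Phi_{-1}(x,t;\widehat\eta_n)$ for all $x,t$, and $A[\widehat\eta_n]=b[\widehat\eta_n]/s_{22}'(\widehat\eta_n)$. *Riemann–Hilbert data.* On $\Sigma$ let $$M^+=\Big(\frac{\mu_{+1}}{s_{11}},\ \mu_{-2}\Big),\qquad J=e^{i\theta\sigma_3}\begin{bmatrix}0&-\tilde\varrho\\ \varrho&\varrho\tilde\varrho\end{bmatrix}e^{-i\theta\sigma_3}.$$ *Conclusion.* For all $x,t\in\mathbb R$, the function $(M^+J)_{12}(x,t;\cdot)$ is integrable on every bounded part of $\Sigma$, its integrals over $\Sigma\cap\{|\zeta|\le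 R\}$ converge as $R\to\infty$, and, with $\int_\Sigma$ denoting the limit, $$q(x,t)=q_--i\sum_{n=1}^{2N_1+N_2}A[\widehat\eta_n]\,e^{2i\theta(x,t;\widehat\eta_n)}\,\mu_{-11}(x,t;\widehat\eta_n)+\frac1{2\pi}\int_\Sigma (M^+J)_{12}(x,t;\zeta)\,d\zeta ,$$ where $\mu_{-11}$ is the first entry of $\mu_{-1}$. -/

import Mathlib

open Filter Topology MeasureTheory

noncomputable section

namespace NonlocalMKdV

/-- The constants of the problem: `σ = ± 1` (the sign in the equation), `δ = ± 1` (the sign relating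
the two boundary values) and the non-zero left boundary value `q₋`. -/
structure Background where
  σ : ℝ
  δ : ℝ
  qm : ℝ
  sigma_eq : σ = 1 ∨ σ = -1
  delta_eq : δ = 1 ∨ δ = -1
  qm_ne : qm ≠ 0

/-- The two ends of the real line, labelling the Jost solutions `Φ₊` and `Φ₋`. -/
inductive Side where
  | plus : Side
  | minus : Side

namespace Background

variable (B : Background)

/-- The right boundary value `q₊ = δ q₋`. -/
def qp : ℝ := B.δ * B.qm

/-- The amplitude `q₀ = |q₋| = |q₊| > 0`. -/
def q0 : ℝ := |B.qm|

/-- The sign `δσ`. -/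
def κ : ℝ := B.δ * B.σ

/-- The boundary value at an end. -/
def bv : Side → ℝ
  | .plus => B.qp
  | .minus => B.qm

end Background

/-- The filter on the real line that approaches an end. -/
def Side.filter : Side → Filter ℝ
  | .plus => atTop
  | .minus => atBot

/-! ### The equation and its boundary conditions -/

/-- `q` is a classical real solution of
`q_t(x,t) - 6 σ q(-x,-t) q(x,t) q_x(x,t) + q_xxx(x,t) = 0` on the plane. -/
structure IsClassicalSolution (B : Background) (q : ℝ → ℝ → ℝ) : Prop where
  smooth_x : ∀ t, ContDiff ℝ 3 (fun x => q x t)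
  smooth_t : ∀ x, Differentiable ℝ (fun t => q x t)
  cont : ∀ j ≤ 3, Continuous (fun p : ℝ × ℝ => iteratedDeriv j (fun x => q x p.2) p.1)
  eqn : ∀ x t, deriv (fun s => q x s) t
      - 6 * B.σ * q (-x) (-t) * q x t * deriv (fun y => q y t) x
      + iteratedDeriv 3 (fun y => q y t) x = 0

/-- The non-zero boundary conditions: `q → q_±`, `q_x → 0`, `q_xx → 0` as `x → ± ∞`, locally uniformly
in `t`; for each `t`, `(1 + |x|) (q - q_±)` is integrable on the corresponding half-line and `q_x` is
integrable. -/
structure HasNZBC (B : Background) (q : ℝ → ℝ → ℝ) : Prop where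
  lim : ∀ e : Side, TendstoLocallyUniformly (fun x t => q x t) (fun _ => B.bv e) e.filter
  lim_deriv : ∀ e : Side, ∀ j, j = 1 ∨ j = 2 →
    TendstoLocallyUniformly (fun x t => iteratedDeriv j (fun y => q y t) x) (fun _ => 0) e.filter
  weight_plus : ∀ t, IntegrableOn (fun x => (1 + |x|) * (q x t - B.qp)) (Set.Ici 0)
  weight_minus : ∀ t, IntegrableOn (fun x => (1 + |x|) * (q x t - B.qm)) (Set.Iic 0)
  integrable_deriv : ∀ t, Integrable (fun x => deriv (fun y => q y t) x)

/-! ### The uniformization variable, the regions and the contour -/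

/-- `k(z) = (z + δσ q₀² / z) / 2`. -/
def kz (B : Background) (z : ℂ) : ℂ := (z + B.κ * B.q0 ^ 2 / z) / 2

/-- `λ(z) = (z - δσ q₀² / z) / 2`. -/
def lam (B : Background) (z : ℂ) : ℂ := (z - B.κ * B.q0 ^ 2 / z) / 2

/-- `θ(x,t;z) = λ (x + (4 k² + 2 σδ q₀²) t)`. -/
def theta (B : Background) (x t : ℝ) (z : ℂ) : ℂ :=
  lam B z * (x + (4 * kz B z ^ 2 + 2 * B.κ * B.q0 ^ 2) * t)

/-- The region `D₊`, where `Im λ > 0`. -/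
def Dplus (B : Background) : Set ℂ :=
  {z | (B.κ = 1 ∧ 0 < z.im) ∨ (B.κ = -1 ∧ 0 < (‖z‖ - B.q0) * z.im)}

/-- The region `D₋`, where `Im λ < 0`. -/
def Dminus (B : Background) : Set ℂ :=
  {z | (B.κ = 1 ∧ z.im < 0) ∨ (B.κ = -1 ∧ (‖z‖ - B.q0) * z.im < 0)}

/-- The continuous spectrum: the real axis without `0`, together with the circle `|z| = q₀` if
`δσ = -1`. -/
def contour (B : Background) : Set ℂ :=
  {z | (z.im = 0 ∧ z ≠ 0) ∨ (B.κ = -1 ∧ ‖z‖ = B.q0)}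

/-- The branch points `± √(δσ) q₀`, at which `λ = 0`. -/
def branchPoints (B : Background) : Set ℂ := {z | z ^ 2 = B.κ * B.q0 ^ 2}

/-- The continuous spectrum without the branch points. -/
def contour0 (B : Background) : Set ℂ := contour B \ branchPoints B

/-! ### Jost solutions -/

/-- The Pauli matrix `σ₃`. -/
def pauli3 : Matrix (Fin 2) (Fin 2) ℂ := !![1, 0; 0, -1]

/-- `e^{i c σ₃}`. -/
def expPauli3 (c : ℂ) : Matrix (Fin 2) (Fin 2) ℂ :=
  !![Complex.exp (Complex.I * c), 0; 0, Complex.exp (-(Complex.I * c))]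

/-- The potential matrix `Q(x,t)`. -/
def potQ (B : Background) (q : ℝ → ℝ → ℝ) (x t : ℝ) : Matrix (Fin 2) (Fin 2) ℂ :=
  !![0, (q x t : ℂ); (B.σ * q (-x) (-t) : ℂ), 0]

/-- The limit `Q_±` of the potential matrix. -/
def limQ (B : Background) (e : Side) : Matrix (Fin 2) (Fin 2) ℂ :=
  !![0, (B.bv e : ℂ); (B.κ * B.bv e : ℂ), 0]

/-- `X_±(z) = i k(z) σ₃ + Q_±`. -/
def limX (B : Background) (e : Side) (z : ℂ) : Matrix (Fin 2) (Fin 2) ℂ :=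
  (Complex.I * kz B z) • pauli3 + limQ B e

/-- The eigenvector matrix `E_±(z)` of `X_±(z)`. -/
def eigE (B : Background) (e : Side) (z : ℂ) : Matrix (Fin 2) (Fin 2) ℂ :=
  !![1, Complex.I * B.bv e / z; -(B.κ * (Complex.I * B.bv e / z)), 1]

/-- The sign with which `i θ` occurs in the `j`-th diagonal entry of `e^{i θ σ₃}`. -/
def colSign : Fin 2 → ℂ := ![1, -1]

/-- The kernel of the Jost integral equation for the `j`-th column, with `s = x - y`: for a matrix
`A` with `j`-th column `a`, the `j`-th column of `E_± e^{i λ s σ₃} (E_±⁻¹ A) e^{-i λ s σ₃}` is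
`jostKernel B e j z s *ᵥ a`; at the branch points the kernel is `I + s X_±`. -/
def jostKernel (B : Background) (e : Side) (j : Fin 2) (z : ℂ) (s : ℝ) :
    Matrix (Fin 2) (Fin 2) ℂ :=
  open Classical in
  if z ∈ branchPoints B then 1 + (s : ℂ) • limX B e z
  else Complex.exp (-(Complex.I * colSign j * lam B z * s)) •
    (eigE B e z * expPauli3 (lam B z * s) * (eigE B e z)⁻¹)

/-- The integral of `f` from `± ∞` to `x`. -/
def integralFrom (e : Side) (f : ℝ → Fin 2 → ℂ) (x : ℝ) : Fin 2 → ℂ :=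
  match e with
  | .plus => -∫ y in Set.Ioi x, f y
  | .minus => ∫ y in Set.Iic x, f y

/-- `μ` is, at time `t` and spectral parameter `z`, the `j`-th column of the modified Jost solution
normalized at the end `e`: the continuous solution, tending to the `j`-th column of `E_±(z)` at that
end, of the Jost integral equation. -/
def IsModifiedJost (B : Background) (q : ℝ → ℝ → ℝ) (e : Side) (j : Fin 2) (t : ℝ) (z : ℂ)
    (μ : ℝ → Fin 2 → ℂ) : Prop :=
  Continuous μ ∧ Tendsto μ e.filter (𝓝 (fun i => eigE B e z i j)) ∧
  ∀ x, μ x = (fun i => eigE B e z i j) +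
    integralFrom e (fun y =>
      (jostKernel B e j z (x - y)).mulVec ((potQ B q y t - limQ B e).mulVec (μ y))) x

/-- The `j`-th column `μ_{± j}(x,t;z)` of the modified Jost solution, as the solution of the Jost
integral equation. It is used for `z ∈ D₊ ∪ Σ` for the columns `μ_{+1}`, `μ_{-2}` and for
`z ∈ D₋ ∪ Σ` for the columns `μ_{-1}`, `μ_{+2}`, where the equation has exactly one solution, which
is the analytic extension off `Σ`. -/
def modJost (B : Background) (q : ℝ → ℝ → ℝ) (e : Side) (j : Fin 2) (x t : ℝ) (z : ℂ) :
    Fin 2 → ℂ :=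
  Classical.epsilon (fun μ : ℝ → Fin 2 → ℂ => IsModifiedJost B q e j t z μ) x

/-- The `j`-th column of the Jost solution `Φ_± = μ_± e^{i θ σ₃}`. -/
def jost (B : Background) (q : ℝ → ℝ → ℝ) (e : Side) (j : Fin 2) (x t : ℝ) (z : ℂ) :
    Fin 2 → ℂ :=
  Complex.exp (Complex.I * colSign j * theta B x t z) • modJost B q e j x t z

/-! ### Scattering data -/

/-- The Wronskian of two vectors: the determinant of the matrix with columns `u`, `v`. -/
def wr (u v : Fin 2 → ℂ) : ℂ := u 0 * v 1 - u 1 * v 0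

/-- `det Φ_± = 1 - δσ q₀² / z²`. -/
def detE (B : Background) (z : ℂ) : ℂ := 1 - B.κ * B.q0 ^ 2 / z ^ 2

/-- The scattering coefficients, defined by `Φ₊ = Φ₋ S` with `S` independent of `(x,t)`; here through
their Wronskian representations, evaluated at `(x,t) = (0,0)`. -/
def s11 (B : Background) (q : ℝ → ℝ → ℝ) (z : ℂ) : ℂ :=
  wr (jost B q .plus 0 0 0 z) (jost B q .minus 1 0 0 z) / detE B z

/-- A scattering coefficient, as for `s₁₁`. -/
def s12 (B : Background) (q : ℝ → ℝ → ℝ) (z : ℂ) : ℂ :=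
  wr (jost B q .plus 1 0 0 z) (jost B q .minus 1 0 0 z) / detE B z

/-- A scattering coefficient, as for `s₁₁`. -/
def s21 (B : Background) (q : ℝ → ℝ → ℝ) (z : ℂ) : ℂ :=
  wr (jost B q .minus 0 0 0 z) (jost B q .plus 0 0 0 z) / detE B z

/-- A scattering coefficient, as for `s₁₁`. -/
def s22 (B : Background) (q : ℝ → ℝ → ℝ) (z : ℂ) : ℂ :=
  wr (jost B q .minus 0 0 0 z) (jost B q .plus 1 0 0 z) / detE B z

/-- The reflection coefficient `ρ = s₂₁ / s₁₁`. -/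
def refl (B : Background) (q : ℝ → ℝ → ℝ) (z : ℂ) : ℂ := s21 B q z / s11 B q z

/-- The reflection coefficient `ρ̃ = s₁₂ / s₂₂`. -/
def reflTilde (B : Background) (q : ℝ → ℝ → ℝ) (z : ℂ) : ℂ := s12 B q z / s22 B q z

/-- There are no spectral singularities: `s₁₁` and `s₂₂` do not vanish on the continuous spectrum. At
the branch points, where they may be infinite and are defined only through nearby values, this
means that they stay bounded away from `0` nearby. -/
structure NoSpectralSingularities (B : Background) (q : ℝ → ℝ → ℝ) : Prop where
  s11_ne : ∀ z ∈ contour0 B, s11 B q z ≠ 0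
  s22_ne : ∀ z ∈ contour0 B, s22 B q z ≠ 0
  s11_branch : ∀ z ∈ branchPoints B,
    ∃ c > 0, ∀ᶠ w in 𝓝[Dplus B ∪ contour0 B] z, c ≤ ‖s11 B q w‖
  s22_branch : ∀ z ∈ branchPoints B,
    ∃ c > 0, ∀ᶠ w in 𝓝[Dminus B ∪ contour0 B] z, c ≤ ‖s22 B q w‖

/-- `z₁, …, z_{N₁}` are the distinct zeros of `s₁₁` in `D₊` with positive real part and
`i w₁, …, i w_{N₂}` those on the imaginary axis, and all of them are simple. -/
structure IsDiscreteSpectrum (B : Background) (q : ℝ → ℝ → ℝ) {N₁ N₂ : ℕ}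
    (z : Fin N₁ → ℂ) (w : Fin N₂ → ℝ) : Prop where
  z_inj : Function.Injective z
  w_inj : Function.Injective w
  z_range : Set.range z = {ζ | ζ ∈ Dplus B ∧ 0 < ζ.re ∧ s11 B q ζ = 0}
  w_range : Set.range (fun n => Complex.I * (w n : ℂ)) =
    {ζ | ζ ∈ Dplus B ∧ ζ.re = 0 ∧ s11 B q ζ = 0}
  z_simple : ∀ n, deriv (s11 B q) (z n) ≠ 0
  w_simple : ∀ n, deriv (s11 B q) (Complex.I * (w n : ℂ)) ≠ 0

/-- The points `η_n`: the concatenation of the lists `z_n`, `-z_n^*` and `i w_n`. -/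
def etaPt {N₁ N₂ : ℕ} (z : Fin N₁ → ℂ) (w : Fin N₂ → ℝ) : Fin N₁ ⊕ Fin N₁ ⊕ Fin N₂ → ℂ
  | .inl n => z n
  | .inr (.inl n) => -(starRingEnd ℂ) (z n)
  | .inr (.inr n) => Complex.I * (w n : ℂ)

/-- The points `η̂_n = δσ q₀² / η_n`. -/
def etaHat (B : Background) {N₁ N₂ : ℕ} (z : Fin N₁ → ℂ) (w : Fin N₂ → ℝ)
    (n : Fin N₁ ⊕ Fin N₁ ⊕ Fin N₂) : ℂ :=
  B.κ * B.q0 ^ 2 / etaPt z w n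

/-- The proportionality coefficient `b[z₀]` at a point `z₀` of the discrete spectrum:
`Φ_{+1}(x,t;z₀) = b[z₀] Φ_{-2}(x,t;z₀)` if `z₀ ∈ D₊`, and
`Φ_{+2}(x,t;z₀) = b[z₀] Φ_{-1}(x,t;z₀)` if `z₀ ∈ D₋`, for all `x`, `t`. -/
def propCoeff (B : Background) (q : ℝ → ℝ → ℝ) (z₀ : ℂ) : ℂ :=
  Classical.epsilon (fun b : ℂ =>
    (z₀ ∈ Dplus B → ∀ x t, jost B q .plus 0 x t z₀ = b • jost B q .minus 1 x t z₀) ∧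
    (z₀ ∈ Dminus B → ∀ x t, jost B q .plus 1 x t z₀ = b • jost B q .minus 0 x t z₀))

/-- The residue constant `A[z₀]`: `b[z₀] / s₁₁'(z₀)` if `z₀ ∈ D₊` and `b[z₀] / s₂₂'(z₀)` if
`z₀ ∈ D₋`. -/
def resConst (B : Background) (q : ℝ → ℝ → ℝ) (z₀ : ℂ) : ℂ :=
  open Classical in
  if z₀ ∈ Dplus B then propCoeff B q z₀ / deriv (s11 B q) z₀
  else propCoeff B q z₀ / deriv (s22 B q) z₀

/-! ### The Riemann-Hilbert problem -/

/-- `M⁺ = (μ_{+1} / s₁₁, μ_{-2})`. -/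
def Mplus (B : Background) (q : ℝ → ℝ → ℝ) (x t : ℝ) (z : ℂ) : Matrix (Fin 2) (Fin 2) ℂ :=
  !![modJost B q .plus 0 x t z 0 / s11 B q z, modJost B q .minus 1 x t z 0;
     modJost B q .plus 0 x t z 1 / s11 B q z, modJost B q .minus 1 x t z 1]

/-- The jump matrix `J = e^{i θ σ₃} [[0, -ρ̃], [ρ, ρ ρ̃]] e^{-i θ σ₃}`. -/
def jumpJ (B : Background) (q : ℝ → ℝ → ℝ) (x t : ℝ) (z : ℂ) : Matrix (Fin 2) (Fin 2) ℂ :=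
  expPauli3 (theta B x t z) *
    !![0, -reflTilde B q z; refl B q z, refl B q z * reflTilde B q z] *
    expPauli3 (-theta B x t z)

/-- The integral of `f` along the part of the contour in `|z| ≤ R` (for `R > q₀`), oriented so that
`D₊` lies to the left. If `δσ = 1` this is the real axis from left to right. If `δσ = -1` it
consists of the real axis, from left to right outside the circle `|z| = q₀` and from right to left
inside it, of the upper half of the circle clockwise and of the lower half counterclockwise. -/
def truncIntegral (B : Background) (f : ℂ → ℂ) (R : ℝ) : ℂ :=
  open Classical in
  if B.κ = 1 then ∫ x in (-R)..R, f (x : ℂ)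
  else
    (∫ x in (-R)..(-B.q0), f (x : ℂ)) + (∫ x in B.q0..R, f (x : ℂ))
      - (∫ x in (-B.q0)..B.q0, f (x : ℂ))
      - (∫ φ in (0 : ℝ)..Real.pi, f (circleMap 0 B.q0 φ) * (circleMap 0 B.q0 φ * Complex.I))
      + (∫ φ in Real.pi..(2 * Real.pi),
          f (circleMap 0 B.q0 φ) * (circleMap 0 B.q0 φ * Complex.I))

/-- `f` has the integral `I` along the whole oriented contour: `f` is integrable over every bounded
part of the contour and the integrals over `|z| ≤ R` converge to `I` as `R → ∞`. (If `f` is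
absolutely integrable along the contour, `I` is its ordinary integral.) -/
def HasContourIntegral (B : Background) (f : ℂ → ℂ) (I : ℂ) : Prop :=
  LocallyIntegrable (fun x : ℝ => f (x : ℂ)) ∧
  (B.κ = -1 → CircleIntegrable f 0 B.q0) ∧
  Tendsto (fun R : ℝ => truncIntegral B f R) atTop (𝓝 I)

end NonlocalMKdV

end

noncomputable section

namespace NonlocalMKdV

section

/-! ### Holomorphic dependence of integrals on a parameter -/

/-! The formula is Cauchy's theorem for one scalar function that is sectionally meromorphic off the
contour: the first entry of μ_{-2} in D₊, and the first entry of μ_{+2} divided by s₂₂ in D₋. The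
scattering relation shows that its jump across Σ⁰ is (M⁺J)₁₂ (`Mplus_mul_jumpJ`). On both sides z
times the function tends to i q(x,t) at infinity and to i q₋ at the origin. In D₋ its only
singularities are simple poles at the η̂_n, where s₂₂ vanishes and Φ_{+2} is a multiple of Φ_{-1};
the residues are A[η̂_n] e^{2iθ} μ_{-11}. Subtracting the same sum of poles on both sides keeps the
jump and leaves two holomorphic functions. Cauchy's theorem then evaluates the integral of the jump
as 2πi (c₀ - c₁), with c₀ = i q₋ from small arcs about 0 and c₁ = i q(x,t) minus the sum of the
residues from large arcs (`hasContourIntegral_jump`, `reconstruction`). Solving for q gives the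
formula.

The contour argument uses upper and lower half-annuli outside and inside |z| = q₀. The functions are
only bounded near the branch points, so Cauchy's theorem is needed in a form that tolerates finitely
many exceptional boundary points (`integral_halfAnnulus_eq_zero`). Each function behaves like i q₋/z
at the origin, but the two singular parts agree and the jump stays bounded there
(`jump_bounded_zero`).

The analytic input on the Jost solutions has four sources. (1) Reflecting the + end and rewriting
the kernel as I plus a scalar times a matrix turns all four columns into one Volterra problem on a
half-line (`isModifiedJost_iff_halfLine`). Its kernel is bounded by 1 + (x - y) uniformly through λ
= 0, which explains the weight 1 + |x|; this gives existence, uniqueness, holomorphy, and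
boundedness near the branch points. (2) Off the branch points the integral equation is equivalent to
the spatial Lax equation with a limit at one end (`isModifiedJost_iff`), so every later identity
follows by checking an ODE and a limit. (3) Zero curvature together with Grönwall shows that the
Jost solutions also satisfy the temporal Lax equation (`hasDerivAt_jost_time`), so Wronskians and
proportionality constants do not depend on (x,t). (4) Integration by parts and the Riemann-Lebesgue
lemma give the expansion for large z (`modJost_asymptotics`); the symmetry z ↦ δσ q₀²/z carries it
to z → 0 and relates s₂₂ to s₁₁, while z ↦ -z^* makes the list of zeros complete. -/

theorem differentiableOn_integral_of_dominated {α E : Type*} [MeasurableSpace α] {μ : Measure α}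
    [NormedAddCommGroup E] [NormedSpace ℂ E] [CompleteSpace E] {U : Set ℂ} (hU : IsOpen U)
    {f : ℂ → α → E} {g : α → ℝ} (hm : ∀ z ∈ U, AEStronglyMeasurable (f z) μ)
    (hd : ∀ a, DifferentiableOn ℂ (fun z => f z a) U) (hb : ∀ z ∈ U, ∀ a, ‖f z a‖ ≤ g a)
    (hg : Integrable g μ) : DifferentiableOn ℂ (fun z => ∫ a, f z a ∂μ) U := by
  intro z₀ hz₀
  obtain ⟨r, hr, hrU⟩ := Metric.isOpen_iff.1 hU z₀ hz₀
  have hr2 : 0 < r / 2 := by positivity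
  have hsub : Metric.ball z₀ (r / 2) ⊆ U := (Metric.ball_subset_ball (by linarith)).trans hrU
  -- Cauchy's estimate on discs of radius r/2 turns the bound on f into a bound on its derivative,
  -- so only f itself has to be dominated.
  have hder : ∀ a, ∀ z ∈ Metric.ball z₀ (r / 2), ‖deriv (fun z => f z a) z‖ ≤ g a / (r / 2) := by
    intro a z hz
    have hcl : Metric.closedBall z (r / 2) ⊆ U := by
      refine fun w hw => hrU ?_
      rw [Metric.mem_ball] at hz ⊢
      rw [Metric.mem_closedBall] at hw
      linarith [dist_triangle w z z₀]
    refine Complex.norm_deriv_le_of_forall_mem_sphere_norm_le hr2 ?_ ?_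
    · refine DifferentiableOn.diffContOnCl_ball (U := U) (hd a) hcl
    · exact fun w hw => hb w (hcl (Metric.sphere_subset_closedBall hw)) a
  have hda : ∀ a, ∀ z ∈ Metric.ball z₀ (r / 2),
      HasDerivAt (fun z => f z a) (deriv (fun z => f z a) z) z := fun a z hz =>
    ((hd a).differentiableAt (hU.mem_nhds (hsub hz))).hasDerivAt
  have hz₀' : z₀ ∈ Metric.ball z₀ (r / 2) := Metric.mem_ball_self hr2
  -- The derivative is measurable in the integration variable as a limit of difference quotients
  -- along a sequence. The denominator n + 2 keeps every increment strictly below r/2.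
  have hmeas : AEStronglyMeasurable (fun a => deriv (fun z => f z a) z₀) μ := by
    set c : ℕ → ℂ := fun n => ((r / 2 / (n + 2) : ℝ) : ℂ) with hc
    have hc0 : ∀ n, c n ≠ 0 := by
      intro n
      simp only [hc, ne_eq, Complex.ofReal_eq_zero]
      positivity
    have hct : Tendsto c atTop (𝓝[≠] 0) := by
      refine tendsto_nhdsWithin_iff.2 ⟨?_, Eventually.of_forall hc0⟩
      have : Tendsto (fun n : ℕ => r / 2 / ((n : ℝ) + 2)) atTop (𝓝 0) :=
        tendsto_const_nhds.div_atTop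
          (tendsto_atTop_add_const_right _ _ tendsto_natCast_atTop_atTop)
      simpa [hc, Function.comp_def] using (Complex.continuous_ofReal.tendsto 0).comp this
    have hcU : ∀ n, z₀ + c n ∈ U := by
      intro n
      refine hsub ?_
      rw [Metric.mem_ball, dist_eq_norm, add_sub_cancel_left, hc, Complex.norm_real,
        Real.norm_of_nonneg (by positivity)]
      exact div_lt_self hr2 (by linarith [(Nat.cast_nonneg n : (0 : ℝ) ≤ n)])
    refine aestronglyMeasurable_of_tendsto_ae (u := atTop)
      (f := fun n a => (c n)⁻¹ • (f (z₀ + c n) a - f z₀ a)) ?_ ?_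
    · exact fun n => ((hm _ (hcU n)).sub (hm _ hz₀)).const_smul _
    · refine Eventually.of_forall fun a => ?_
      exact ((hda a z₀ hz₀').tendsto_slope_zero).comp hct
  have hg0 : ∀ a, 0 ≤ g a := fun a => (norm_nonneg _).trans (hb z₀ hz₀ a)
  have key := hasDerivAt_integral_of_dominated_loc_of_deriv_le (𝕜 := ℂ) (μ := μ) (F := f)
    (F' := fun z a => deriv (fun z => f z a) z) (x₀ := z₀) (s := Metric.ball z₀ (r / 2))
    (bound := fun a => g a / (r / 2)) (Metric.ball_mem_nhds _ hr2)
    (by filter_upwards [hU.mem_nhds hz₀] with z hz using hm z hz)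
    (hg.mono' (hm z₀ hz₀) (Eventually.of_forall (hb z₀ hz₀))) hmeas
    (Eventually.of_forall fun a z hz => hder a z hz) (hg.div_const _)
    (Eventually.of_forall fun a z hz => hda a z hz)
  exact key.2.differentiableAt.differentiableWithinAt

/-! ### Volterra equations with a parameter -/

/-- The terms of the Neumann series of the integral equation `m = e + ∫ k m`. -/
def neumannTerm {ι : Type*} [Fintype ι] (k : ℂ → ℝ → ℝ → Matrix ι ι ℂ) (e : ℂ → ι → ℂ) :
    ℕ → ℂ → ℝ → ι → ℂ
  | 0, z, _ => e z
  | n + 1, z, x => ∫ y, (k z x y).mulVec (neumannTerm k e n z y)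

theorem aestronglyMeasurable_mulVec {ι : Type*} [Fintype ι] {μ : Measure ℝ}
    {A : ℝ → Matrix ι ι ℂ} {v : ℝ → ι → ℂ}
    (hA : AEStronglyMeasurable A μ) (hv : AEStronglyMeasurable v μ) :
    AEStronglyMeasurable (fun y => (A y).mulVec (v y)) μ := by
  have h : Continuous (fun p : Matrix ι ι ℂ × (ι → ℂ) => p.1.mulVec p.2) := by fun_prop
  exact h.comp_aestronglyMeasurable (hA.prodMk hv)

/-- The weight W acts as in a Bielecki norm: `hbW` makes the integral operator a contraction with
constant 1/2 in the W-weighted supremum norm, so the Neumann series is dominated by a geometric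
series. The bound b does not depend on the parameter, so the domination is uniform in z, and joint
continuity and holomorphy pass from the terms to the sum. It serves both linear ODEs and the
half-line problem for the Jost solutions. -/
theorem exists_volterra_solution {ι : Type*} [Fintype ι] {Z : Set ℂ}
    {k : ℂ → ℝ → ℝ → Matrix ι ι ℂ} {e : ℂ → ι → ℂ} {b : ℝ → ℝ → ℝ} {W : ℝ → ℝ} {C : ℝ}
    (hC : 0 ≤ C) (he : ContinuousOn e Z) (heb : ∀ z ∈ Z, ∀ x, ‖e z‖ ≤ C * W x)
    (hW0 : ∀ x, 0 < W x)
    (hb : ∀ x y, 0 ≤ b x y)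
    (hk : ∀ z ∈ Z, ∀ x y v, ‖(k z x y).mulVec v‖ ≤ b x y * ‖v‖)
    (hkm : ∀ z ∈ Z, ∀ x, AEStronglyMeasurable (fun y => k z x y) volume)
    (hkc : ∀ z ∈ Z, ∀ x, ∀ᵐ y,
      ContinuousWithinAt (fun p : ℝ × ℂ => k p.2 p.1 y) (Set.univ ×ˢ Z) (x, z))
    (hbW : ∀ x, ∫ y, b x y * W y ≤ W x / 2)
    (hdom : ∀ x₀, ∃ g : ℝ → ℝ, Integrable g ∧ ∀ᶠ x in 𝓝 x₀, ∀ y, b x y * W y ≤ g y)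
    (hbm : ∀ x, AEStronglyMeasurable (fun y => b x y * W y) volume) :
    ∃ m : ℂ → ℝ → ι → ℂ,
      ContinuousOn (fun p : ℝ × ℂ => m p.2 p.1) (Set.univ ×ˢ Z) ∧
      (∀ z ∈ Z, ∀ x, ‖m z x‖ ≤ 2 * C * W x) ∧
      (∀ z ∈ Z, ∀ x, m z x = e z + ∫ y, (k z x y).mulVec (m z y)) ∧
      (∀ U ⊆ Z, IsOpen U → DifferentiableOn ℂ e U →
        (∀ x y i j, DifferentiableOn ℂ (fun z => k z x y i j) U) →
        ∀ x, DifferentiableOn ℂ (fun z => m z x) U) := by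
  have hbi : ∀ x, Integrable (fun y => b x y * W y) := by
    intro x
    obtain ⟨g, hg, hgx⟩ := hdom x
    refine hg.mono' (hbm x) (Eventually.of_forall fun y => ?_)
    rw [Real.norm_of_nonneg (mul_nonneg (hb x y) (hW0 y).le)]
    exact hgx.self_of_nhds y
  set T := neumannTerm k e with hT
  have hcont_of : ∀ n, ContinuousOn (fun p : ℝ × ℂ => T n p.2 p.1) (Set.univ ×ˢ Z) →
      ∀ z ∈ Z, Continuous (T n z) := by
    intro n h z hz
    exact h.comp_continuous (f := fun x : ℝ => (x, z)) (by fun_prop) fun x => ⟨trivial, hz⟩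
  have hpw : ∀ n z, z ∈ Z → (∀ x, ‖T n z x‖ ≤ C * (1 / 2) ^ n * W x) → ∀ x y,
      ‖(k z x y).mulVec (T n z y)‖ ≤ C * (1 / 2) ^ n * (b x y * W y) := by
    intro n z hz h x y
    calc _ ≤ b x y * ‖T n z y‖ := hk z hz x y _
      _ ≤ b x y * (C * (1 / 2) ^ n * W y) := mul_le_mul_of_nonneg_left (h y) (hb x y)
      _ = _ := by ring
  have hbound : ∀ n, ∀ z ∈ Z, ∀ x, ‖T n z x‖ ≤ C * (1 / 2) ^ n * W x := by
    intro n
    induction n with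
    | zero => intro z hz x; simpa [hT, neumannTerm] using heb z hz x
    | succ n ih =>
      intro z hz x
      have : ‖∫ y, (k z x y).mulVec (T n z y)‖ ≤ ∫ y, C * (1 / 2) ^ n * (b x y * W y) :=
        norm_integral_le_of_norm_le ((hbi x).const_mul _)
          (Eventually.of_forall (hpw n z hz (ih z hz) x))
      rw [integral_const_mul] at this
      calc ‖T (n + 1) z x‖ ≤ C * (1 / 2) ^ n * ∫ y, b x y * W y := this
        _ ≤ C * (1 / 2) ^ n * (W x / 2) := by
          refine mul_le_mul_of_nonneg_left (hbW x) (by positivity)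
        _ = _ := by ring
  have hcont : ∀ n, ContinuousOn (fun p : ℝ × ℂ => T n p.2 p.1) (Set.univ ×ˢ Z) := by
    intro n
    induction n with
    | zero =>
      exact he.comp continuousOn_snd fun p hp => hp.2
    | succ n ih =>
      rintro ⟨x₀, z₀⟩ ⟨-, hz₀⟩
      obtain ⟨g, hg, hgx⟩ := hdom x₀
      refine continuousWithinAt_of_dominated (bound := fun y => C * (1 / 2) ^ n * g y) ?_ ?_
        (hg.const_mul _) ?_
      · filter_upwards [self_mem_nhdsWithin] with p hp
        exact aestronglyMeasurable_mulVec (hkm p.2 hp.2 p.1)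
          (hcont_of n ih p.2 hp.2).aestronglyMeasurable
      · have h1 : ∀ᶠ p : ℝ × ℂ in 𝓝[Set.univ ×ˢ Z] (x₀, z₀), ∀ y, b p.1 y * W y ≤ g y :=
          (continuous_fst.tendsto (x₀, z₀)).mono_left nhdsWithin_le_nhds hgx
        filter_upwards [self_mem_nhdsWithin, h1] with p hp hp1
        refine Eventually.of_forall fun y => ?_
        refine (hpw n p.2 hp.2 (hbound n p.2 hp.2) p.1 y).trans ?_
        exact mul_le_mul_of_nonneg_left (hp1 y) (by positivity)
      · filter_upwards [hkc z₀ hz₀ x₀] with y hy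
        have h2 : ContinuousWithinAt (fun p : ℝ × ℂ => T n p.2 y) (Set.univ ×ˢ Z) (x₀, z₀) :=
          (ih (y, z₀) ⟨trivial, hz₀⟩).comp (f := fun p : ℝ × ℂ => (y, p.2)) (x := (x₀, z₀))
            (by fun_prop) fun p hp => ⟨trivial, hp.2⟩
        have h : Continuous (fun p : Matrix ι ι ℂ × (ι → ℂ) => p.1.mulVec p.2) := by fun_prop
        exact (h.continuousAt).comp_continuousWithinAt (hy.prodMk h2)
  have hsumx : ∀ x : ℝ, Summable (fun n : ℕ => C * (1 / 2 : ℝ) ^ n * W x) := fun x =>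
    ((summable_geometric_two).mul_left C).mul_right (W x)
  have htsx : ∀ x : ℝ, ∑' n : ℕ, C * (1 / 2 : ℝ) ^ n * W x = 2 * C * W x := by
    intro x
    rw [tsum_mul_right, tsum_mul_left, tsum_geometric_two]
    ring
  have hsum : ∀ z ∈ Z, ∀ x, Summable (fun n => T n z x) := fun z hz x =>
    Summable.of_norm_bounded (hsumx x) fun n => hbound n z hz x
  have hmb : ∀ z ∈ Z, ∀ x, ‖∑' n, T n z x‖ ≤ 2 * C * W x := by
    intro z hz x
    rw [← htsx x]
    exact tsum_of_norm_bounded (hsumx x).hasSum fun n => hbound n z hz x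
  refine ⟨fun z x => ∑' n, T n z x, ?_, hmb, ?_, ?_⟩
  · rintro ⟨x₀, z₀⟩ ⟨-, hz₀⟩
    obtain ⟨g, hg, hgx⟩ := hdom x₀
    -- No local bound on W is assumed, so near x₀ the terms are dominated through the integrable
    -- majorant g instead. This covers every term except the zeroth, which is split off.
    have hGle : ∀ᶠ x in 𝓝 x₀, ∀ z ∈ Z, ∀ n, ‖T (n + 1) z x‖ ≤ C * (1 / 2) ^ n * ∫ y, g y := by
      filter_upwards [hgx] with x hx z hz n
      have : ‖∫ y, (k z x y).mulVec (T n z y)‖ ≤ ∫ y, C * (1 / 2) ^ n * g y :=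
        norm_integral_le_of_norm_le (hg.const_mul _) (Eventually.of_forall fun y =>
          (hpw n z hz (hbound n z hz) x y).trans
            (mul_le_mul_of_nonneg_left (hx y) (by positivity)))
      rwa [integral_const_mul] at this
    obtain ⟨V, hV, hVo, hxV⟩ := eventually_nhds_iff.1 hGle
    have hco : ContinuousOn (fun p : ℝ × ℂ => ∑' n, T (n + 1) p.2 p.1) (V ×ˢ Z) := by
      refine continuousOn_tsum (u := fun n => C * (1 / 2) ^ n * ∫ y, g y) ?_ ?_ ?_
      · exact fun n => (hcont (n + 1)).mono fun p hp => ⟨trivial, hp.2⟩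
      · exact ((summable_geometric_two).mul_left C).mul_right _
      · exact fun n p hp => hV p.1 hp.1 p.2 hp.2 n
    have hmem : V ×ˢ Z ∈ 𝓝[Set.univ ×ˢ Z] (x₀, z₀) := by
      rw [nhdsWithin_prod_eq]
      exact prod_mem_prod (by simpa using hVo.mem_nhds hxV) self_mem_nhdsWithin
    have h1 := (hco (x₀, z₀) ⟨hxV, hz₀⟩).mono_of_mem_nhdsWithin hmem
    have h2 := (hcont 0 (x₀, z₀) ⟨trivial, hz₀⟩).add h1
    refine h2.congr (fun p hp => ?_) ?_
    · exact (hsum p.2 hp.2 p.1).tsum_eq_zero_add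
    · exact (hsum z₀ hz₀ x₀).tsum_eq_zero_add
  · intro z hz x
    have hs : HasSum (fun n => ∫ y, (k z x y).mulVec (T n z y))
        (∫ y, (k z x y).mulVec (∑' n, T n z y)) := by
      refine hasSum_integral_of_dominated_convergence
        (fun n y => C * (1 / 2) ^ n * (b x y * W y)) ?_ ?_ ?_ ?_ ?_
      · exact fun n => aestronglyMeasurable_mulVec (hkm z hz x)
          (hcont_of n (hcont n) z hz).aestronglyMeasurable
      · exact fun n => Eventually.of_forall (hpw n z hz (hbound n z hz) x)
      · exact Eventually.of_forall fun y => ((summable_geometric_two).mul_left C).mul_right _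
      · simp_rw [tsum_mul_right]
        exact (hbi x).const_mul _
      · refine Eventually.of_forall fun y => ?_
        have h : Continuous fun v : ι → ℂ => (k z x y).mulVec v := by fun_prop
        exact (hsum z hz y).hasSum.map ((k z x y).mulVecLin.toAddMonoidHom) h
    have h0 := (hsum z hz x).tsum_eq_zero_add
    simp only at h0 ⊢
    rw [h0, ← hs.tsum_eq]
    rfl
  · intro U hUZ hU heU hkU
    have hdT : ∀ n x, DifferentiableOn ℂ (fun z => T n z x) U := by
      intro n
      induction n with
      | zero => exact fun x => heU
      | succ n ih =>
        intro x
        refine differentiableOn_integral_of_dominated hU (g := fun y => C * (1 / 2) ^ n * (b x y * W y))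
          ?_ ?_ ?_ ((hbi x).const_mul _)
        · exact fun z hz => aestronglyMeasurable_mulVec (hkm z (hUZ hz) x)
            (hcont_of n (hcont n) z (hUZ hz)).aestronglyMeasurable
        · intro y
          rw [differentiableOn_pi]
          intro i
          simp only [Matrix.mulVec, dotProduct]
          refine DifferentiableOn.fun_sum fun j _ => (hkU x y i j).mul ?_
          exact differentiableOn_pi.1 (ih y) j
        · exact fun z hz y => hpw n z (hUZ hz) (hbound n z (hUZ hz)) x y
    intro x
    exact Complex.differentiableOn_tsum_of_summable_norm (hsumx x) (fun n => hdT n x) hU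
      fun n z hz => hbound n z (hUZ hz) x

/-! ### Linear ordinary differential equations -/

/-- The sum of the absolute values of the entries of a matrix. -/
def absSum {ι : Type*} [Fintype ι] (A : Matrix ι ι ℂ) : ℝ := ∑ i, ∑ j, ‖A i j‖

theorem absSum_nonneg {ι : Type*} [Fintype ι] (A : Matrix ι ι ℂ) : 0 ≤ absSum A :=
  Finset.sum_nonneg fun _ _ => Finset.sum_nonneg fun _ _ => norm_nonneg _

theorem continuous_absSum {ι : Type*} [Fintype ι] : Continuous (absSum (ι := ι)) := by
  unfold absSum
  fun_prop

theorem norm_mulVec_le {ι : Type*} [Fintype ι] (A : Matrix ι ι ℂ) (v : ι → ℂ) :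
    ‖A.mulVec v‖ ≤ absSum A * ‖v‖ := by
  refine (pi_norm_le_iff_of_nonneg (mul_nonneg (absSum_nonneg A) (norm_nonneg v))).2 fun i => ?_
  calc ‖∑ j, A i j * v j‖ ≤ ∑ j, ‖A i j * v j‖ := norm_sum_le _ _
    _ ≤ ∑ j, ‖A i j‖ * ‖v‖ := Finset.sum_le_sum fun j _ => by
        rw [norm_mul]
        exact mul_le_mul_of_nonneg_left (norm_le_pi_norm v j) (norm_nonneg _)
    _ = (∑ j, ‖A i j‖) * ‖v‖ := by rw [Finset.sum_mul]
    _ ≤ _ := mul_le_mul_of_nonneg_right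
        (Finset.single_le_sum (f := fun i => ∑ j, ‖A i j‖)
          (fun i _ => Finset.sum_nonneg fun _ _ => norm_nonneg _) (Finset.mem_univ i))
        (norm_nonneg v)

/-- A two-sided Grönwall inequality. -/
theorem norm_le_gronwallBound_of_uIcc {E : Type*} [NormedAddCommGroup E] [NormedSpace ℝ E]
    {f f' : ℝ → E} {K ε a b : ℝ} (hf : ∀ s ∈ Set.uIcc a b, HasDerivAt f (f' s) s)
    (hb : ∀ s ∈ Set.uIcc a b, ‖f' s‖ ≤ K * ‖f s‖ + ε) :
    ‖f b‖ ≤ gronwallBound ‖f a‖ K ε |b - a| := by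
  rcases le_total a b with h | h
  · rw [Set.uIcc_of_le h] at hf hb
    rw [abs_of_nonneg (by linarith)]
    exact norm_le_gronwallBound_of_norm_deriv_right_le
      (fun s hs => (hf s hs).continuousAt.continuousWithinAt)
      (fun s hs => (hf s ⟨hs.1, hs.2.le⟩).hasDerivWithinAt) le_rfl
      (fun s hs => hb s ⟨hs.1, hs.2.le⟩) b ⟨h, le_rfl⟩
  · rw [Set.uIcc_of_ge h] at hf hb
    rw [abs_of_nonpos (by linarith)]
    have hd : ∀ s ∈ Set.Icc (-a) (-b), HasDerivAt (fun s => f (-s)) (-f' (-s)) s := by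
      intro s hs
      have := (hf (-s) ⟨by linarith [hs.2], by linarith [hs.1]⟩).scomp s (hasDerivAt_neg s)
      simpa [Function.comp_def] using this
    have := norm_le_gronwallBound_of_norm_deriv_right_le (f := fun s => f (-s))
      (f' := fun s => -f' (-s)) (δ := ‖f a‖) (K := K) (ε := ε) (a := -a) (b := -b)
      (fun s hs => (hd s hs).continuousAt.continuousWithinAt)
      (fun s hs => (hd s ⟨hs.1, hs.2.le⟩).hasDerivWithinAt) (by simp)
      (fun s hs => by
        rw [norm_neg]
        exact hb (-s) ⟨by linarith [hs.2], by linarith [hs.1]⟩) (-b) ⟨by linarith, le_rfl⟩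
    simp only [neg_neg] at this
    convert this using 2
    ring

theorem aestronglyMeasurable_matrix {ι : Type*} [Fintype ι] {μ : Measure ℝ}
    {A : ℝ → Matrix ι ι ℂ} (hA : Continuous A) : AEStronglyMeasurable A μ :=
  Continuous.aestronglyMeasurable (β := ι → ι → ℂ) hA

theorem linearODE_eq_zero {ι : Type*} [Fintype ι] {A : ℝ → Matrix ι ι ℂ} (hA : Continuous A)
    {f : ℝ → ι → ℂ} (hf : ∀ s, HasDerivAt f ((A s).mulVec (f s)) s) {s₀ : ℝ} (h0 : f s₀ = 0)
    (s : ℝ) : f s = 0 := by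
  obtain ⟨K, hK⟩ := (isCompact_uIcc (a := s₀) (b := s)).exists_bound_of_continuousOn
    (continuous_absSum.comp hA).continuousOn
  have := norm_le_gronwallBound_of_uIcc (f := f) (K := K) (ε := 0) (a := s₀) (b := s)
    (fun s _ => hf s) fun s hs => by
      rw [add_zero]
      exact (norm_mulVec_le _ _).trans
        (mul_le_mul_of_nonneg_right ((Real.le_norm_self _).trans (hK s hs)) (norm_nonneg _))
  rw [h0, norm_zero, gronwallBound_ε0_δ0] at this
  exact norm_le_zero_iff.1 this

/-- The integrand is the derivative of e^{cH}/c, where H is the primitive of a. With c = ±2 it is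
the contraction by 1/2 required of the weight e^{2|H|}. -/
theorem integral_mul_exp_primitive_eq {a : ℝ → ℝ} (ha : Continuous a) (c : ℝ) (hc : c ≠ 0) (x : ℝ) :
    ∫ y in (0 : ℝ)..x, a y * Real.exp (c * ∫ s in (0 : ℝ)..y, a s) =
      (Real.exp (c * ∫ s in (0 : ℝ)..x, a s) - 1) / c := by
  have hH : ∀ y, HasDerivAt (fun y => ∫ s in (0 : ℝ)..y, a s) (a y) y := fun y =>
    ha.integral_hasStrictDerivAt 0 y |>.hasDerivAt
  have hcH : Continuous fun y => ∫ s in (0 : ℝ)..y, a s :=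
    continuous_iff_continuousAt.2 fun y => (hH y).continuousAt
  rw [intervalIntegral.integral_eq_sub_of_hasDerivAt
    (f := fun y => Real.exp (c * ∫ s in (0 : ℝ)..y, a s) / c)]
  · simp [sub_div]
  · intro y _
    have := (((hH y).const_mul c).exp).div_const c
    have e : a y * Real.exp (c * ∫ s in (0 : ℝ)..y, a s) =
        Real.exp (c * ∫ s in (0 : ℝ)..y, a s) * (c * a y) / c := by
      field_simp
    rwa [e]
  · exact (ha.mul (Real.continuous_exp.comp (hcH.const_mul c))).intervalIntegrable _ _

/-- The integrated equation is a Volterra equation on the whole line, contracting for the weight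
exp(2|∫₀ˣ a|) with a the entry norm of A. The solution is therefore global at once, without
continuation from short intervals. The spectral parameter is idle and is fixed to 0. -/
theorem exists_linearODE_solution_zero {ι : Type*} [Fintype ι] {A : ℝ → Matrix ι ι ℂ}
    (hA : Continuous A) (v : ι → ℂ) :
    ∃ f : ℝ → ι → ℂ, f 0 = v ∧ ∀ s, HasDerivAt f ((A s).mulVec (f s)) s := by
  set a : ℝ → ℝ := fun y => absSum (A y) with ha
  have hac : Continuous a := continuous_absSum.comp hA
  have ha0 : ∀ y, 0 ≤ a y := fun y => absSum_nonneg _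
  set H : ℝ → ℝ := fun y => ∫ s in (0 : ℝ)..y, a s with hH
  have hHc : Continuous H := continuous_iff_continuousAt.2 fun y =>
    (hac.integral_hasStrictDerivAt 0 y).hasDerivAt.continuousAt
  have hH0 : ∀ y, 0 ≤ y → 0 ≤ H y := fun y hy =>
    intervalIntegral.integral_nonneg hy fun _ _ => ha0 _
  have hH1 : ∀ y, y ≤ 0 → H y ≤ 0 := fun y hy => by
    rw [hH]
    simp only
    rw [intervalIntegral.integral_symm, neg_nonpos]
    exact intervalIntegral.integral_nonneg hy fun _ _ => ha0 _
  set W : ℝ → ℝ := fun y => Real.exp (2 * |H y|) with hW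
  have hWc : Continuous W := by fun_prop
  set b : ℝ → ℝ → ℝ := fun x => (Set.uIoc 0 x).indicator a with hb
  -- The oriented integral from 0 to x is written as an integral over the whole line; the minus sign
  -- accounts for the orientation when x ≤ 0.
  set k : ℂ → ℝ → ℝ → Matrix ι ι ℂ := fun _ x y =>
    if 0 < x then (Set.Ioc 0 x).indicator A y else (Set.Ioc x 0).indicator (fun y => -A y) y
    with hk
  have hbWi : ∀ x, (fun y => b x y * W y) = (Set.uIoc 0 x).indicator fun y => a y * W y := by
    intro x
    ext y
    by_cases hy : y ∈ Set.uIoc 0 x <;> simp [hb, hy]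
  have hkI : ∀ x y v, ‖(k 0 x y).mulVec v‖ ≤ b x y * ‖v‖ := by
    intro x y v
    simp only [hk, hb]
    split_ifs with hx
    · rw [Set.uIoc_of_le hx.le]
      by_cases hy : y ∈ Set.Ioc 0 x
      · simpa [hy] using norm_mulVec_le _ _
      · simp [hy]
    · rw [Set.uIoc_of_ge (not_lt.1 hx)]
      by_cases hy : y ∈ Set.Ioc x 0
      · simpa [hy, Matrix.neg_mulVec] using norm_mulVec_le _ _
      · simp [hy]
  have hkint : ∀ x (f : ℝ → ι → ℂ), ∫ y, (k 0 x y).mulVec (f y) =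
      ∫ y in (0 : ℝ)..x, (A y).mulVec (f y) := by
    intro x f
    simp only [hk]
    split_ifs with hx
    · rw [intervalIntegral.integral_of_le hx.le, ← integral_indicator measurableSet_Ioc]
      congr 1 with y
      by_cases hy : y ∈ Set.Ioc 0 x <;> simp [hy]
    · rw [intervalIntegral.integral_of_ge (not_lt.1 hx), ← integral_neg,
        ← integral_indicator measurableSet_Ioc]
      congr 1 with y
      by_cases hy : y ∈ Set.Ioc x 0 <;> simp [hy, Matrix.neg_mulVec]
  refine Exists.elim (exists_volterra_solution (Z := {0}) (k := k) (e := fun _ => v)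
    (b := b) (W := W) (C := ‖v‖) (norm_nonneg _) continuousOn_const ?_ (fun x => Real.exp_pos _) ?_ ?_
    ?_ ?_ ?_ ?_ ?_) fun m hm => ?_
  · intro z _ x
    exact le_mul_of_one_le_right (norm_nonneg _) (Real.one_le_exp (by positivity))
  · intro x y
    exact Set.indicator_nonneg (fun y _ => ha0 y) y
  · exact fun z _ => hkI
  · intro z _ x
    simp only [hk]
    split_ifs
    · exact (aestronglyMeasurable_matrix hA).indicator measurableSet_Ioc
    · exact (aestronglyMeasurable_matrix hA.neg).indicator measurableSet_Ioc
  -- For fixed y the kernel is locally constant in x except at x = y, and at x = 0 when y = 0. Two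
  -- values of y are discarded.
  · intro z _ x
    have h0 : ∀ᵐ y : ℝ, y ≠ 0 := by simp [ae_iff, measure_singleton]
    have hx : ∀ᵐ y : ℝ, y ≠ x := by simp [ae_iff, measure_singleton]
    filter_upwards [h0, hx] with y hy0 hyx
    have : ∀ᶠ x' in 𝓝 x, k 0 x' y = k 0 x y := by
      have e1 : ∀ᶠ x' in 𝓝 x, (y ≤ x' ↔ y ≤ x) ∧ (x' < y ↔ x < y) := by
        rcases lt_or_gt_of_ne hyx with h | h
        · filter_upwards [eventually_gt_nhds h] with x' hx'
          exact ⟨by simp [h.le, hx'.le], by simp [not_lt.2 h.le, not_lt.2 hx'.le]⟩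
        · filter_upwards [eventually_lt_nhds h] with x' hx'
          exact ⟨by simp [not_le.2 h, not_le.2 hx'], by simp [h, hx']⟩
      filter_upwards [e1] with x' hx'
      have hform : ∀ x', k 0 x' y = if 0 < y ∧ y ≤ x' then A y else
          if x' < y ∧ y ≤ 0 then -A y else 0 := by
        intro x'
        simp only [hk, Set.indicator, Set.mem_Ioc]
        split_ifs <;> first | rfl | (exfalso; grind)
      rw [hform, hform]
      simp only [hx'.1, hx'.2]
    refine ContinuousAt.continuousWithinAt ?_
    refine (continuousAt_const (y := k 0 x y)).congr ?_
    have h3 : Tendsto (fun p : ℝ × ℂ => p.1) (𝓝 (x, z)) (𝓝 x) := continuous_fst.tendsto _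
    filter_upwards [h3 this] with p hp using hp.symm
  · intro x
    rw [hbWi, integral_indicator measurableSet_uIoc]
    rcases le_total 0 x with hx | hx
    · rw [Set.uIoc_of_le hx]
      have : ∫ y in Set.Ioc 0 x, a y * W y = ∫ y in (0 : ℝ)..x, a y * Real.exp (2 * H y) := by
        rw [intervalIntegral.integral_of_le hx]
        refine setIntegral_congr_fun measurableSet_Ioc fun y hy => ?_
        simp only [hW]
        rw [abs_of_nonneg (hH0 y hy.1.le)]
      rw [this, integral_mul_exp_primitive_eq hac 2 (by norm_num)]
      simp only [hW]
      rw [abs_of_nonneg (hH0 x hx)]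
      linarith
    · rw [Set.uIoc_of_ge hx]
      have : ∫ y in Set.Ioc x 0, a y * W y = -∫ y in (0 : ℝ)..x, a y * Real.exp (-2 * H y) := by
        rw [intervalIntegral.integral_of_ge hx, neg_neg]
        refine setIntegral_congr_fun measurableSet_Ioc fun y hy => ?_
        simp only [hW]
        rw [abs_of_nonpos (hH1 y hy.2)]
        ring_nf
      rw [this, integral_mul_exp_primitive_eq hac (-2) (by norm_num)]
      simp only [hW]
      rw [abs_of_nonpos (hH1 x hx)]
      have : -2 * H x = 2 * -H x := by ring
      rw [this]
      linarith
  · intro x₀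
    set s := Set.Icc (-(|x₀| + 1)) (|x₀| + 1) with hs
    refine ⟨s.indicator fun y => a y * W y, ?_, ?_⟩
    · rw [integrable_indicator_iff measurableSet_Icc]
      exact (hac.mul hWc).continuousOn.integrableOn_compact isCompact_Icc
    · filter_upwards [Metric.ball_mem_nhds x₀ one_pos] with x hx y
      rw [congrFun (hbWi x) y]
      refine Set.indicator_le_indicator_of_subset ?_
        (fun y => mul_nonneg (ha0 y) (Real.exp_pos _).le) y
      rw [Metric.mem_ball, Real.dist_eq] at hx
      intro y hy
      rw [Set.mem_uIoc] at hy
      have h1 := abs_lt.1 hx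
      have h2 := neg_abs_le x₀
      have h3 := le_abs_self x₀
      constructor <;> rcases hy with hy | hy <;> linarith [hy.1, hy.2, abs_nonneg x₀]
  · intro x
    rw [hbWi]
    exact (hac.mul hWc).aestronglyMeasurable.indicator measurableSet_uIoc
  · obtain ⟨hmc, -, hm, -⟩ := hm
    have hmcont : Continuous (m 0) :=
      hmc.comp_continuous (f := fun x : ℝ => (x, (0 : ℂ))) (by fun_prop) fun x => ⟨trivial, rfl⟩
    have hm' : ∀ x, m 0 x = v + ∫ y in (0 : ℝ)..x, (A y).mulVec (m 0 y) := by
      intro x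
      rw [← hkint, ← hm 0 rfl x]
    refine ⟨m 0, by simpa using hm' 0, fun s => ?_⟩
    have hi : Continuous fun y => (A y).mulVec (m 0 y) := by fun_prop
    have := ((hi.integral_hasStrictDerivAt 0 s).hasDerivAt).const_add v
    rwa [← funext hm'] at this

theorem exists_linearODE_solution {ι : Type*} [Fintype ι] {A : ℝ → Matrix ι ι ℂ}
    (hA : Continuous A) (s₀ : ℝ) (v : ι → ℂ) :
    ∃ f : ℝ → ι → ℂ, f s₀ = v ∧ ∀ s, HasDerivAt f ((A s).mulVec (f s)) s := by
  obtain ⟨f, hf0, hf⟩ := exists_linearODE_solution_zero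
    (A := fun s => A (s + s₀)) (hA.comp (continuous_add_const s₀)) v
  refine ⟨fun s => f (s - s₀), by simpa using hf0, fun s => ?_⟩
  have := (hf (s - s₀)).comp_sub_const s s₀
  simpa using this

end

section

/-! ### Contour integrals of bounded holomorphic functions -/

theorem intervalIntegrable_of_continuousOn_diff {g : ℝ → ℂ} {p q C : ℝ} {S : Set ℝ}
    (hS : S.Countable) (hc : ContinuousOn g (Set.uIcc p q \ S))
    (hb : ∀ x ∈ Set.uIcc p q \ S, ‖g x‖ ≤ C) : IntervalIntegrable g volume p q := by
  rw [intervalIntegrable_iff]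
  have h1 : IntegrableOn g (Set.uIoc p q \ S) := by
    have hm := measurableSet_uIoc.diff hS.measurableSet (s₁ := Set.uIoc p q)
    have hfin : volume (Set.uIoc p q \ S) ≠ ⊤ :=
      ((measure_mono Set.sdiff_subset).trans_lt (by simp [Set.uIoc])).ne
    refine (integrableOn_const (C := C) hfin).mono' ?_ ?_
    · exact (hc.mono (Set.sdiff_subset_sdiff_left Set.uIoc_subset_uIcc)).aestronglyMeasurable hm
    · refine (ae_restrict_iff' hm).2
        (Eventually.of_forall fun x hx => hb x ⟨Set.uIoc_subset_uIcc hx.1, hx.2⟩)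
  refine h1.congr_set_ae ?_
  refine (sdiff_null_ae_eq_self ?_).symm
  exact hS.measure_zero _

theorem exists_bound_of_locally {X : Type*} [TopologicalSpace X] {K A : Set X} (hK : IsCompact K)
    {F : X → ℂ} (h : ∀ z ∈ K, ∃ C : ℝ, ∀ᶠ w in 𝓝[A] z, ‖F w‖ ≤ C) :
    ∃ C : ℝ, ∀ w ∈ K ∩ A, ‖F w‖ ≤ C := by
  refine hK.induction_on (p := fun s => ∃ C : ℝ, ∀ w ∈ s ∩ A, ‖F w‖ ≤ C) ⟨0, by simp⟩ ?_ ?_ ?_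
  · rintro s t hst ⟨C, hC⟩
    exact ⟨C, fun w hw => hC w ⟨hst hw.1, hw.2⟩⟩
  · rintro s t ⟨C, hC⟩ ⟨C', hC'⟩
    refine ⟨max C C', fun w hw => ?_⟩
    rcases hw with ⟨hw | hw, hA⟩
    · exact (hC w ⟨hw, hA⟩).trans (le_max_left _ _)
    · exact (hC' w ⟨hw, hA⟩).trans (le_max_right _ _)
  · intro z hz
    obtain ⟨C, hC⟩ := h z hz
    obtain ⟨V, hV, hVC⟩ := mem_nhdsWithin_iff_exists_mem_nhds_inter.1 hC
    exact ⟨V, mem_nhdsWithin_of_mem_nhds hV, C, fun w hw => hVC hw⟩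

/-- The function is not controlled at the points of S, so Cauchy's theorem is applied to G composed
with contractions towards the centre of the rectangle, which map the closed rectangle into the open
one. The bound on the interior allows dominated convergence on the four edges, where S is a null
set. -/
theorem integral_boundary_rect_eq_zero_of_bounded {G : ℂ → ℂ} {a b c d C : ℝ} (hab : a < b)
    (hcd : c < d) {S : Set ℂ} (hS : S.Finite)
    (hd : DifferentiableOn ℂ G (Set.Ioo a b ×ℂ Set.Ioo c d))
    (hc : ContinuousOn G ((Set.Icc a b ×ℂ Set.Icc c d) \ S))
    (hb : ∀ w ∈ Set.Ioo a b ×ℂ Set.Ioo c d, ‖G w‖ ≤ C) :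
    (∫ x in a..b, G (x + c * Complex.I)) - (∫ x in a..b, G (x + d * Complex.I)) +
      Complex.I • (∫ y in c..d, G (b + y * Complex.I)) -
      Complex.I • (∫ y in c..d, G (a + y * Complex.I)) = 0 := by
  set m : ℂ := ((a + b) / 2 : ℝ) + ((c + d) / 2 : ℝ) * Complex.I with hm
  set η : ℕ → ℝ := fun n => 1 / ((n : ℝ) + 2) with hη
  have hη0 : ∀ n, 0 < η n := fun n => by positivity
  have hη1 : ∀ n, η n < 1 := fun n => by
    simp only [hη]
    rw [div_lt_one (by positivity)]
    linarith [(Nat.cast_nonneg n : (0 : ℝ) ≤ n)]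
  have hηt : Tendsto η atTop (𝓝 0) := tendsto_const_nhds.div_atTop
    (tendsto_atTop_add_const_right _ _ tendsto_natCast_atTop_atTop)
  set h : ℕ → ℂ → ℂ := fun n w => m + ((1 - η n : ℝ) : ℂ) * (w - m) with hh
  have hre : ∀ n w, (h n w).re = (a + b) / 2 + (1 - η n) * (w.re - (a + b) / 2) := by
    intro n w
    simp only [hh, hm, Complex.add_re, Complex.ofReal_re, Complex.mul_re, Complex.I_re,
      Complex.ofReal_im, Complex.I_im, Complex.sub_re]
    ring
  have him : ∀ n w, (h n w).im = (c + d) / 2 + (1 - η n) * (w.im - (c + d) / 2) := by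
    intro n w
    simp only [hh, hm, Complex.add_im, Complex.ofReal_im, Complex.mul_im, Complex.I_re,
      Complex.ofReal_re, Complex.I_im, Complex.sub_im]
    ring
  have hin : ∀ n, ∀ w ∈ Set.Icc a b ×ℂ Set.Icc c d, h n w ∈ Set.Ioo a b ×ℂ Set.Ioo c d := by
    intro n w hw
    rw [Complex.mem_reProdIm] at hw ⊢
    rw [hre, him]
    obtain ⟨⟨h1, h2⟩, h3, h4⟩ := hw
    have e0 := hη0 n
    have e1 := hη1 n
    refine ⟨⟨?_, ?_⟩, ?_, ?_⟩ <;> nlinarith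
  have hhc : ∀ n, Continuous (h n) := fun n => by fun_prop
  have hhd : ∀ n, Differentiable ℂ (h n) := fun n => by fun_prop
  have hht : ∀ w, Tendsto (fun n => h n w) atTop (𝓝 w) := by
    intro w
    have e : Tendsto (fun n => m + ((1 - η n : ℝ) : ℂ) * (w - m)) atTop
        (𝓝 (m + ((1 - 0 : ℝ) : ℂ) * (w - m))) :=
      ((((Complex.continuous_ofReal.tendsto _).comp (hηt.const_sub 1))).mul_const _).const_add _
    simpa [hh] using e
  have hzero : ∀ n, (∫ x in a..b, G (h n (x + c * Complex.I))) -
      (∫ x in a..b, G (h n (x + d * Complex.I))) +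
      Complex.I • (∫ y in c..d, G (h n (b + y * Complex.I))) -
      Complex.I • (∫ y in c..d, G (h n (a + y * Complex.I))) = 0 := by
    intro n
    have := Complex.integral_boundary_rect_eq_zero_of_differentiableOn (fun w => G (h n w))
      (a + c * Complex.I) (b + d * Complex.I) ?_
    · simpa using this
    · simp only [Complex.add_re, Complex.ofReal_re, Complex.mul_re, Complex.I_re, mul_zero,
        Complex.ofReal_im, Complex.I_im, mul_one, sub_self, add_zero, Complex.add_im,
        Complex.mul_im, zero_add, Set.uIcc_of_le hab.le, Set.uIcc_of_le hcd.le]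
      exact hd.comp (hhd n).differentiableOn (hin n)
  have hedge : ∀ (γ : ℝ → ℂ) (p q : ℝ), Continuous γ → Function.Injective γ →
      (∀ x ∈ Set.uIcc p q, γ x ∈ Set.Icc a b ×ℂ Set.Icc c d) →
      Tendsto (fun n => ∫ x in p..q, G (h n (γ x))) atTop (𝓝 (∫ x in p..q, G (γ x))) := by
    intro γ p q hγ hγi hγm
    refine intervalIntegral.tendsto_integral_filter_of_dominated_convergence (fun _ => C) ?_ ?_ ?_ ?_
    · refine Eventually.of_forall fun n => ContinuousOn.aestronglyMeasurable ?_ measurableSet_uIoc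
      refine hd.continuousOn.comp ((hhc n).comp hγ).continuousOn fun x hx => ?_
      exact hin n _ (hγm x (Set.uIoc_subset_uIcc hx))
    · refine Eventually.of_forall fun n => Eventually.of_forall fun x hx => ?_
      exact hb _ (hin n _ (hγm x (Set.uIoc_subset_uIcc hx)))
    · exact intervalIntegrable_const
    · have hfin : (γ ⁻¹' S).Finite := hS.preimage hγi.injOn
      have hae : ∀ᵐ x : ℝ, x ∉ γ ⁻¹' S := hfin.countable.ae_notMem _
      filter_upwards [hae] with x hxS hx
      have hxm := hγm x (Set.uIoc_subset_uIcc hx)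
      refine (hc (γ x) ⟨hxm, hxS⟩).tendsto.comp (tendsto_nhdsWithin_iff.2 ⟨hht _, ?_⟩)
      have hSc : ∀ᶠ w in 𝓝 (γ x), w ∉ S := hS.isClosed.isOpen_compl.mem_nhds hxS
      filter_upwards [(hht (γ x)).eventually hSc] with n hn
      refine ⟨?_, hn⟩
      have := hin n _ hxm
      rw [Complex.mem_reProdIm] at this ⊢
      exact ⟨Set.Ioo_subset_Icc_self this.1, Set.Ioo_subset_Icc_self this.2⟩
  have hor : ∀ s ∈ Set.Icc c d, Tendsto (fun n => ∫ x in a..b, G (h n (x + s * Complex.I))) atTop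
      (𝓝 (∫ x in a..b, G (x + s * Complex.I))) := by
    intro s hs
    refine hedge (fun x : ℝ => (x : ℂ) + s * Complex.I) a b (by fun_prop) ?_ ?_
    · intro x y hxy
      simpa using hxy
    · intro x hx
      rw [Set.uIcc_of_le hab.le] at hx
      simpa [Complex.mem_reProdIm] using ⟨hx, hs⟩
  have hve : ∀ s ∈ Set.Icc a b, Tendsto (fun n => ∫ y in c..d, G (h n (s + y * Complex.I))) atTop
      (𝓝 (∫ y in c..d, G (s + y * Complex.I))) := by
    intro s hs
    refine hedge (fun y : ℝ => (s : ℂ) + y * Complex.I) c d (by fun_prop) ?_ ?_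
    · intro x y hxy
      simpa using hxy
    · intro x hx
      rw [Set.uIcc_of_le hcd.le] at hx
      simpa [Complex.mem_reProdIm] using ⟨hs, hx⟩
  have hlim := (((hor c ⟨le_rfl, hcd.le⟩).sub (hor d ⟨hcd.le, le_rfl⟩)).add
    ((hve b ⟨hab.le, le_rfl⟩).const_smul Complex.I)).sub
    ((hve a ⟨le_rfl, hab.le⟩).const_smul Complex.I)
  simp only [hzero] at hlim
  exact (tendsto_nhds_unique hlim tendsto_const_nhds)

/-- The closed half-annulus `r₁ ≤ |z| ≤ r₂`, `Im z ≥ 0`. -/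
def halfAnnulus (r₁ r₂ : ℝ) : Set ℂ := {z | r₁ ≤ ‖z‖ ∧ ‖z‖ ≤ r₂ ∧ 0 ≤ z.im}

/-- The open half-annulus `r₁ < |z| < r₂`, `Im z > 0`. -/
def openHalfAnnulus (r₁ r₂ : ℝ) : Set ℂ := {z | r₁ < ‖z‖ ∧ ‖z‖ < r₂ ∧ 0 < z.im}

theorem openHalfAnnulus_subset (r₁ r₂ : ℝ) : openHalfAnnulus r₁ r₂ ⊆ halfAnnulus r₁ r₂ :=
  fun _ h => ⟨h.1.le, h.2.1.le, h.2.2.le⟩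

theorem isCompact_halfAnnulus (r₁ r₂ : ℝ) : IsCompact (halfAnnulus r₁ r₂) := by
  refine (isCompact_closedBall (0 : ℂ) r₂).of_isClosed_subset ?_ fun z hz => by
    simpa using hz.2.1
  exact (isClosed_le continuous_const continuous_norm).inter
    ((isClosed_le continuous_norm continuous_const).inter
      (isClosed_le continuous_const Complex.continuous_im))

/-- The integral over the two real segments of the boundary of the half-annuli. -/
def segIntegral (f : ℂ → ℂ) (r₁ r₂ : ℝ) : ℂ :=
  (∫ x in r₁..r₂, f (x : ℂ)) + ∫ x in (-r₂)..(-r₁), f (x : ℂ)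

/-- The integral along the circle of radius `r` from the argument `a` to the argument `b`. -/
def arcIntegral (f : ℂ → ℂ) (a b r : ℝ) : ℂ :=
  ∫ φ in a..b, f (circleMap 0 r φ) * (circleMap 0 r φ * Complex.I)

theorem circleMap_zero_mem {r φ : ℝ} (hr : 0 ≤ r) (hφ : φ ∈ Set.Icc 0 Real.pi) {r₁ r₂ : ℝ}
    (h : r ∈ Set.Icc r₁ r₂) : circleMap 0 r φ ∈ halfAnnulus r₁ r₂ := by
  refine ⟨?_, ?_, ?_⟩
  · rw [norm_circleMap_zero, abs_of_nonneg hr]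
    exact h.1
  · rw [norm_circleMap_zero, abs_of_nonneg hr]
    exact h.2
  · simp only [circleMap_zero, Complex.im_ofReal_mul,
      Complex.exp_ofReal_mul_I_im]
    exact mul_nonneg hr (Real.sin_nonneg_of_mem_Icc hφ)

theorem ofReal_mem_halfAnnulus {x r₁ r₂ : ℝ} (h : |x| ∈ Set.Icc r₁ r₂) :
    (x : ℂ) ∈ halfAnnulus r₁ r₂ := by
  refine ⟨?_, ?_, ?_⟩ <;> simp [h.1, h.2]

/-- The exponential carries the rectangle log r₁ ≤ Re w ≤ log r₂, 0 ≤ Im w ≤ π onto the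
half-annulus, and F(z) dz pulls back to F(e^w) e^w dw. The bottom edge becomes the positive segment,
the top edge the negative one because e^{iπ} = -1, and the vertical edges become the arcs. -/
theorem integral_halfAnnulus_eq_zero {F : ℂ → ℂ} {r₁ r₂ C : ℝ} (h1 : 0 < r₁) (h12 : r₁ < r₂)
    {S : Set ℂ} (hS : S.Finite) (hd : DifferentiableOn ℂ F (openHalfAnnulus r₁ r₂))
    (hc : ContinuousOn F (halfAnnulus r₁ r₂ \ S)) (hb : ∀ z ∈ openHalfAnnulus r₁ r₂, ‖F z‖ ≤ C) :
    segIntegral F r₁ r₂ + arcIntegral F 0 Real.pi r₂ - arcIntegral F 0 Real.pi r₁ = 0 := by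
  have h2 : 0 < r₂ := h1.trans h12
  have hC : 0 ≤ C := by
    have : (((r₁ + r₂) / 2 : ℝ) : ℂ) * Complex.I ∈ openHalfAnnulus r₁ r₂ := by
      refine ⟨?_, ?_, ?_⟩
      · rw [norm_mul, Complex.norm_real, Real.norm_of_nonneg (by positivity)]; simp; linarith
      · rw [norm_mul, Complex.norm_real, Real.norm_of_nonneg (by positivity)]; simp; linarith
      · simp only [Complex.im_ofReal_mul, Complex.I_im]; linarith
    exact (norm_nonneg _).trans (hb _ this)
  have hlog : Real.log r₁ < Real.log r₂ := Real.log_lt_log h1 h12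
  set R := Set.Icc (Real.log r₁) (Real.log r₂) ×ℂ Set.Icc 0 Real.pi with hR
  set Ro := Set.Ioo (Real.log r₁) (Real.log r₂) ×ℂ Set.Ioo 0 Real.pi with hRo
  have him : ∀ w : ℂ, (Complex.exp w).im = Real.exp w.re * Real.sin w.im := Complex.exp_im
  have hexpR : ∀ w ∈ R, Complex.exp w ∈ halfAnnulus r₁ r₂ := by
    intro w hw
    rw [hR, Complex.mem_reProdIm] at hw
    refine ⟨?_, ?_, ?_⟩
    · rw [Complex.norm_exp, ← Real.log_le_iff_le_exp h1]
      exact hw.1.1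
    · rw [Complex.norm_exp, ← Real.le_log_iff_exp_le h2]
      exact hw.1.2
    · rw [him]
      exact mul_nonneg (Real.exp_pos _).le (Real.sin_nonneg_of_mem_Icc hw.2)
  have hexpRo : ∀ w ∈ Ro, Complex.exp w ∈ openHalfAnnulus r₁ r₂ := by
    intro w hw
    rw [hRo, Complex.mem_reProdIm] at hw
    refine ⟨?_, ?_, ?_⟩
    · rw [Complex.norm_exp, ← Real.log_lt_iff_lt_exp h1]
      exact hw.1.1
    · rw [Complex.norm_exp, ← Real.lt_log_iff_exp_lt h2]
      exact hw.1.2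
    · rw [him]
      exact mul_pos (Real.exp_pos _) (Real.sin_pos_of_mem_Ioo hw.2)
  -- The exponential is injective on 0 ≤ Im w ≤ π, so finitely many exceptional points stay finitely
  -- many.
  set S' := {w | w ∈ R ∧ Complex.exp w ∈ S} with hS'
  have hS'f : S'.Finite := by
    refine Set.Finite.of_finite_image (f := Complex.exp) (hS.subset ?_) ?_
    · rintro _ ⟨w, hw, rfl⟩
      exact hw.2
    · intro w hw w' hw' h
      have a1 := (Complex.mem_reProdIm.1 hw.1).2
      have a2 := (Complex.mem_reProdIm.1 hw'.1).2
      exact Complex.exp_inj_of_neg_pi_lt_of_le_pi (by linarith [Real.pi_pos, a1.1]) a1.2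
        (by linarith [Real.pi_pos, a2.1]) a2.2 h
  have key := integral_boundary_rect_eq_zero_of_bounded (G := fun w => F (Complex.exp w) *
    Complex.exp w) (C := C * r₂) hlog Real.pi_pos hS'f
    ((hd.comp Complex.differentiable_exp.differentiableOn hexpRo).mul
      Complex.differentiable_exp.differentiableOn)
    ((hc.comp Complex.continuous_exp.continuousOn fun w hw =>
      ⟨hexpR w hw.1, fun h => hw.2 ⟨hw.1, h⟩⟩).mul Complex.continuous_exp.continuousOn)
    (fun w hw => by
      rw [norm_mul]
      exact mul_le_mul (hb _ (hexpRo w hw)) (hexpRo w hw).2.1.le (norm_nonneg _) hC)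
  have hbot : ∫ x in Real.log r₁..Real.log r₂, F (Complex.exp (x + (0 : ℝ) * Complex.I)) *
      Complex.exp (x + (0 : ℝ) * Complex.I) = ∫ x in r₁..r₂, F (x : ℂ) := by
    rw [intervalIntegral.integral_of_le hlog.le, intervalIntegral.integral_of_le h12.le]
    have himg : Real.exp '' Set.Ioc (Real.log r₁) (Real.log r₂) = Set.Ioc r₁ r₂ := by
      ext x
      constructor
      · rintro ⟨y, hy, rfl⟩
        exact ⟨(Real.log_lt_iff_lt_exp h1).1 hy.1, (Real.le_log_iff_exp_le h2).1 hy.2⟩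
      · intro hx
        have hx0 : 0 < x := h1.trans hx.1
        exact ⟨Real.log x, ⟨Real.log_lt_log h1 hx.1, Real.log_le_log hx0 hx.2⟩, Real.exp_log hx0⟩
    rw [← himg, integral_image_eq_integral_abs_deriv_smul measurableSet_Ioc
      (fun x _ => (Real.hasDerivAt_exp x).hasDerivWithinAt) Real.exp_injective.injOn]
    refine setIntegral_congr_fun measurableSet_Ioc fun x _ => ?_
    simp only [Complex.ofReal_zero, zero_mul, add_zero, abs_of_pos (Real.exp_pos x),
      Complex.ofReal_exp, Complex.real_smul]
    ring
  have htop : ∫ x in Real.log r₁..Real.log r₂, F (Complex.exp (x + Real.pi * Complex.I)) *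
      Complex.exp (x + Real.pi * Complex.I) = -∫ x in (-r₂)..(-r₁), F (x : ℂ) := by
    rw [intervalIntegral.integral_of_le hlog.le, intervalIntegral.integral_of_le (by linarith),
      ← integral_Ico_eq_integral_Ioc (x := -r₂)]
    have himg : (fun x => -Real.exp x) '' Set.Ioc (Real.log r₁) (Real.log r₂) =
        Set.Ico (-r₂) (-r₁) := by
      ext x
      constructor
      · rintro ⟨y, hy, rfl⟩
        exact ⟨neg_le_neg ((Real.le_log_iff_exp_le h2).1 hy.2),
          neg_lt_neg ((Real.log_lt_iff_lt_exp h1).1 hy.1)⟩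
      · intro hx
        have hx0 : 0 < -x := by linarith [hx.2]
        refine ⟨Real.log (-x), ⟨Real.log_lt_log h1 (by linarith [hx.2]),
          Real.log_le_log hx0 (by linarith [hx.1])⟩, ?_⟩
        simp only [Real.exp_log hx0, neg_neg]
    rw [← himg, integral_image_eq_integral_abs_deriv_smul measurableSet_Ioc
      (f := fun x => -Real.exp x) (f' := fun x => -Real.exp x)
      (fun x _ => (Real.hasDerivAt_exp x).fun_neg.hasDerivWithinAt)
      (fun x _ y _ h => Real.exp_injective (neg_injective h)), ← integral_neg]
    refine setIntegral_congr_fun measurableSet_Ioc fun x _ => ?_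
    simp only [Complex.exp_add, Complex.exp_pi_mul_I, abs_neg, abs_of_pos (Real.exp_pos x),
      Complex.ofReal_neg, Complex.ofReal_exp, Complex.real_smul]
    rw [mul_neg_one]
    ring
  have harc : ∀ r, 0 < r → Complex.I • (∫ y in (0 : ℝ)..Real.pi,
      F (Complex.exp (Real.log r + y * Complex.I)) * Complex.exp (Real.log r + y * Complex.I)) =
      arcIntegral F 0 Real.pi r := by
    intro r hr
    rw [arcIntegral, ← intervalIntegral.integral_smul]
    refine intervalIntegral.integral_congr fun y _ => ?_
    have : Complex.exp (Real.log r + y * Complex.I) = circleMap 0 r y := by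
      rw [Complex.exp_add, ← Complex.ofReal_exp, Real.exp_log hr, circleMap_zero]
    simp only [this, smul_eq_mul]
    ring
  rw [hbot, htop, harc r₁ h1, harc r₂ h2] at key
  rw [segIntegral, ← key]
  ring

end

/-! ### Cauchy's theorem for functions holomorphic up to the contour -/

section

/-- `F` is holomorphic in `D`, continuous on the larger set `A` and bounded near the exceptional
points `S`. -/
structure IsHolomorphicUpTo (F : ℂ → ℂ) (D A S : Set ℂ) : Prop where
  subset : D ⊆ A
  diff : DifferentiableOn ℂ F D
  cont : ContinuousOn F A
  bdd : ∀ z ∈ S, ∃ C : ℝ, ∀ᶠ w in 𝓝[A] z, ‖F w‖ ≤ C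

theorem IsHolomorphicUpTo.exists_bound {F : ℂ → ℂ} {D A S K : Set ℂ} (h : IsHolomorphicUpTo F D A S)
    (hK : IsCompact K) (hKA : K \ S ⊆ A) : ∃ C : ℝ, ∀ w ∈ K ∩ A, ‖F w‖ ≤ C := by
  refine exists_bound_of_locally hK fun z hz => ?_
  by_cases hzS : z ∈ S
  · exact h.bdd z hzS
  · refine ⟨‖F z‖ + 1, ?_⟩
    have := (h.cont z (hKA ⟨hz, hzS⟩)).norm
    exact (this.eventually (gt_mem_nhds (lt_add_one _))).mono fun _ => le_of_lt

/-- The conclusions of Cauchy's theorem on a half-annulus. -/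
theorem IsHolomorphicUpTo.upper {F : ℂ → ℂ} {D A S : Set ℂ} (h : IsHolomorphicUpTo F D A S)
    (hS : S.Finite) {r₁ r₂ : ℝ} (h1 : 0 < r₁) (h12 : r₁ < r₂) (hD : openHalfAnnulus r₁ r₂ ⊆ D)
    (hA : halfAnnulus r₁ r₂ \ S ⊆ A) :
    segIntegral F r₁ r₂ + arcIntegral F 0 Real.pi r₂ - arcIntegral F 0 Real.pi r₁ = 0 ∧
    IntervalIntegrable (fun x : ℝ => F x) volume r₁ r₂ ∧
    IntervalIntegrable (fun x : ℝ => F x) volume (-r₂) (-r₁) ∧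
    ∀ r ∈ Set.Icc r₁ r₂, IntervalIntegrable
      (fun φ => F (circleMap 0 r φ) * (circleMap 0 r φ * Complex.I)) volume 0 Real.pi := by
  obtain ⟨C, hC⟩ := h.exists_bound (isCompact_halfAnnulus r₁ r₂) hA
  have hre : ∀ p q : ℝ, (∀ x ∈ Set.uIcc p q, |x| ∈ Set.Icc r₁ r₂) →
      IntervalIntegrable (fun x : ℝ => F x) volume p q := by
    intro p q hpq
    refine intervalIntegrable_of_continuousOn_diff (C := C) (S := (fun x : ℝ => (x : ℂ)) ⁻¹' S)
      ((hS.preimage Complex.ofReal_injective.injOn).countable) ?_ ?_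
    · refine h.cont.comp Complex.continuous_ofReal.continuousOn fun x hx => ?_
      exact hA ⟨ofReal_mem_halfAnnulus (hpq x hx.1), hx.2⟩
    · intro x hx
      have := ofReal_mem_halfAnnulus (hpq x hx.1)
      exact hC _ ⟨this, hA ⟨this, hx.2⟩⟩
  refine ⟨?_, ?_, ?_, ?_⟩
  · refine integral_halfAnnulus_eq_zero h1 h12 hS (h.diff.mono hD) (h.cont.mono hA) (C := C) ?_
    exact fun z hz => hC z ⟨openHalfAnnulus_subset _ _ hz, h.subset (hD hz)⟩
  · refine hre _ _ fun x hx => ?_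
    rw [Set.uIcc_of_le h12.le] at hx
    rwa [abs_of_pos (h1.trans_le hx.1)]
  · refine hre _ _ fun x hx => ?_
    rw [Set.uIcc_of_le (by linarith)] at hx
    rw [abs_of_neg (by linarith [hx.2])]
    exact ⟨by linarith [hx.2], by linarith [hx.1]⟩
  · intro r hr
    have hr0 : 0 < r := h1.trans_le hr.1
    have hm : ∀ φ ∈ Set.uIcc 0 Real.pi, circleMap 0 r φ ∈ halfAnnulus r₁ r₂ := fun φ hφ => by
      rw [Set.uIcc_of_le Real.pi_pos.le] at hφ
      exact circleMap_zero_mem hr0.le hφ hr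
    refine intervalIntegrable_of_continuousOn_diff (C := C * r) (S := circleMap 0 r ⁻¹' S)
      (hS.countable.preimage_circleMap 0 hr0.ne') ?_ ?_
    · refine ContinuousOn.mul ?_ (by fun_prop)
      refine h.cont.comp (continuous_circleMap 0 r).continuousOn fun x hx => ?_
      exact hA ⟨hm x hx.1, hx.2⟩
    · intro x hx
      have h3 := hC _ ⟨hm x hx.1, hA ⟨hm x hx.1, hx.2⟩⟩
      rw [norm_mul, norm_mul, norm_circleMap_zero, abs_of_pos hr0, Complex.norm_I, mul_one]
      exact mul_le_mul_of_nonneg_right h3 hr0.le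

theorem IsHolomorphicUpTo.neg {F : ℂ → ℂ} {D A S : Set ℂ} (h : IsHolomorphicUpTo F D A S) :
    IsHolomorphicUpTo (fun z => F (-z)) {z | -z ∈ D} {z | -z ∈ A} {z | -z ∈ S} where
  subset := fun _ hz => h.subset hz
  diff := h.diff.comp differentiable_neg.differentiableOn fun _ hz => hz
  cont := h.cont.comp continuous_neg.continuousOn fun _ hz => hz
  bdd := by
    intro z hz
    obtain ⟨C, hC⟩ := h.bdd (-z) hz
    refine ⟨C, ?_⟩
    exact (tendsto_nhdsWithin_iff.2 ⟨(continuous_neg.tendsto z).mono_left nhdsWithin_le_nhds,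
      eventually_mem_nhdsWithin⟩).eventually hC

theorem segIntegral_comp_neg (F : ℂ → ℂ) (r₁ r₂ : ℝ) :
    segIntegral (fun z => F (-z)) r₁ r₂ = segIntegral F r₁ r₂ := by
  have e1 := intervalIntegral.integral_comp_neg (a := r₁) (b := r₂) (fun x : ℝ => F x)
  have e2 := intervalIntegral.integral_comp_neg (a := -r₂) (b := -r₁) (fun x : ℝ => F x)
  simp only [Complex.ofReal_neg, neg_neg] at e1 e2
  rw [segIntegral, segIntegral, e1, e2, add_comm]

theorem circleMap_zero_add_pi (r φ : ℝ) : circleMap 0 r (φ + Real.pi) = -circleMap 0 r φ := by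
  simp [circleMap_zero, add_mul, Complex.exp_add]

theorem arcIntegral_comp_neg (F : ℂ → ℂ) (r : ℝ) :
    arcIntegral (fun z => F (-z)) 0 Real.pi r = -arcIntegral F Real.pi (2 * Real.pi) r := by
  have e := intervalIntegral.integral_comp_add_right (a := 0) (b := Real.pi)
    (fun φ => F (circleMap 0 r φ) * (circleMap 0 r φ * Complex.I)) Real.pi
  rw [zero_add, ← two_mul] at e
  rw [arcIntegral, arcIntegral, ← e, ← intervalIntegral.integral_neg]
  refine intervalIntegral.integral_congr fun φ _ => ?_
  simp only [circleMap_zero_add_pi]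
  ring

/-- The map z ↦ -z reduces this to the upper half-plane. It exchanges the two real segments, so
their sum is preserved, while the arcs change sign because dz does. -/
theorem IsHolomorphicUpTo.lower {F : ℂ → ℂ} {D A S : Set ℂ} (h : IsHolomorphicUpTo F D A S)
    (hS : S.Finite) {r₁ r₂ : ℝ} (h1 : 0 < r₁) (h12 : r₁ < r₂)
    (hD : ∀ z ∈ openHalfAnnulus r₁ r₂, -z ∈ D)
    (hA : ∀ z ∈ halfAnnulus r₁ r₂, -z ∉ S → -z ∈ A) :
    segIntegral F r₁ r₂ - arcIntegral F Real.pi (2 * Real.pi) r₂ +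
      arcIntegral F Real.pi (2 * Real.pi) r₁ = 0 ∧
    IntervalIntegrable (fun x : ℝ => F x) volume r₁ r₂ ∧
    IntervalIntegrable (fun x : ℝ => F x) volume (-r₂) (-r₁) ∧
    ∀ r ∈ Set.Icc r₁ r₂, IntervalIntegrable
      (fun φ => F (circleMap 0 r φ) * (circleMap 0 r φ * Complex.I)) volume Real.pi
        (2 * Real.pi) := by
  obtain ⟨k1, k2, k3, k4⟩ := h.neg.upper (hS.preimage neg_injective.injOn) h1 h12 hD
    fun z hz => hA z hz.1 hz.2
  rw [segIntegral_comp_neg, arcIntegral_comp_neg, arcIntegral_comp_neg] at k1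
  refine ⟨by rw [← k1]; ring, ?_, ?_, fun r hr => ?_⟩
  · have := (k3.comp_sub_left 0).symm
    simpa using this
  · have := (k2.comp_sub_left 0).symm
    simpa using this
  · have := ((k4 r hr).comp_add_right (-Real.pi)).neg
    simp only [sub_neg_eq_add, zero_add] at this
    rw [← two_mul] at this
    refine this.congr fun φ _ => ?_
    have := circleMap_zero_add_pi r (φ + -Real.pi)
    rw [neg_add_cancel_right] at this
    simp only [Pi.neg_apply, this]
    ring

/-- On a circle F(z) dz = i z F(z) dφ, and z F(z) is close to c uniformly in the angle. The filter
on radii is left free so that the same statement covers r → ∞ and r → 0⁺. -/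
theorem tendsto_arcIntegral {F : ℂ → ℂ} {l : Filter ℝ} [l.IsCountablyGenerated] {A : Set ℂ} {c : ℂ}
    {a b : ℝ} (h : Tendsto (fun z => z * F z) (comap norm l ⊓ 𝓟 A) (𝓝 c))
    (hl : ∀ᶠ r in l, 0 < r) (hA : ∀ᶠ r in l, ∀ φ ∈ Set.uIoc a b, circleMap 0 r φ ∈ A)
    (hi : ∀ᶠ r in l, IntervalIntegrable
      (fun φ => F (circleMap 0 r φ) * (circleMap 0 r φ * Complex.I)) volume a b) :
    Tendsto (arcIntegral F a b) l (𝓝 ((b - a) * (Complex.I * c))) := by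
  have hu : ∀ V ∈ 𝓝 c, ∀ᶠ r in l, ∀ φ ∈ Set.uIoc a b,
      circleMap 0 r φ * F (circleMap 0 r φ) ∈ V := by
    intro V hV
    have := h hV
    rw [mem_map, mem_inf_principal, mem_comap] at this
    obtain ⟨t, ht, htV⟩ := this
    filter_upwards [ht, hA, hl] with r hr hrA hr0 φ hφ
    refine htV ?_ (hrA φ hφ)
    rwa [Set.mem_preimage, norm_circleMap_zero, abs_of_pos hr0]
  have hint : ∫ φ in a..b, Complex.I * c = (b - a) * (Complex.I * c) := by
    simp; ring
  rw [← hint]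
  refine intervalIntegral.tendsto_integral_filter_of_dominated_convergence (fun _ => ‖c‖ + 1)
    ?_ ?_ intervalIntegrable_const ?_
  · filter_upwards [hi] with r hr
    exact hr.def'.aestronglyMeasurable
  · have : ∀ᶠ w in 𝓝 c, ‖w‖ < ‖c‖ + 1 :=
      continuous_norm.continuousAt.eventually (gt_mem_nhds (lt_add_one _))
    filter_upwards [hu _ this] with r hr
    refine Eventually.of_forall fun φ hφ => ?_
    have := (hr φ hφ).le
    have e : F (circleMap 0 r φ) * (circleMap 0 r φ * Complex.I) =
        (circleMap 0 r φ * F (circleMap 0 r φ)) * Complex.I := by ring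
    rw [e, norm_mul, Complex.norm_I, mul_one]
    exact this
  · refine Eventually.of_forall fun φ hφ => ?_
    have : Tendsto (fun r => circleMap 0 r φ * F (circleMap 0 r φ)) l (𝓝 c) := fun V hV =>
      (hu V hV).mono fun r hr => hr φ hφ
    refine (this.const_mul Complex.I).congr fun r => by ring

/-! ### The regions -/

variable (B : Background)

theorem Background.q0_pos : 0 < B.q0 := abs_pos.2 B.qm_ne

theorem Background.kappa_eq : B.κ = 1 ∨ B.κ = -1 := by
  rcases B.sigma_eq with h | h <;> rcases B.delta_eq with h' | h' <;> simp [Background.κ, h, h']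

theorem Background.kappa_sq : (B.κ : ℂ) ^ 2 = 1 := by
  rcases B.kappa_eq with h | h <;> simp [h]

theorem finite_branchPoints : (branchPoints B).Finite := by
  obtain ⟨a, ha⟩ := IsAlgClosed.exists_pow_nat_eq ((B.κ : ℂ) * B.q0 ^ 2) (n := 2) two_pos
  refine (Set.toFinite {a, -a}).subset fun z hz => ?_
  have : z ^ 2 = a ^ 2 := by rw [ha]; exact hz
  simpa using sq_eq_sq_iff_eq_or_eq_neg.1 this

theorem norm_of_mem_branchPoints {z : ℂ} (hz : z ∈ branchPoints B) : ‖z‖ = B.q0 := by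
  have h : ‖z‖ ^ 2 = B.q0 ^ 2 := by
    rw [← norm_pow, show z ^ 2 = _ from hz, norm_mul, norm_pow, Complex.norm_real,
      Complex.norm_real, Real.norm_eq_abs, Real.norm_of_nonneg B.q0_pos.le]
    rcases B.kappa_eq with h | h <;> simp [h]
  exact (pow_left_inj₀ (norm_nonneg _) B.q0_pos.le two_ne_zero).1 h

theorem neg_mem_branchPoints {z : ℂ} : -z ∈ branchPoints B ↔ z ∈ branchPoints B := by
  simp [branchPoints]

theorem openHalfAnnulus_outer {r₁ r₂ : ℝ} (h : B.q0 ≤ r₁) {z : ℂ} (hz : z ∈ openHalfAnnulus r₁ r₂) :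
    z ∈ Dplus B ∧ -z ∈ Dminus B := by
  obtain ⟨h1, -, h3⟩ := hz
  have h4 : 0 < ‖z‖ - B.q0 := by linarith
  rcases B.kappa_eq with hκ | hκ
  · exact ⟨Or.inl ⟨hκ, h3⟩, Or.inl ⟨hκ, by simpa using h3⟩⟩
  · refine ⟨Or.inr ⟨hκ, mul_pos h4 h3⟩, Or.inr ⟨hκ, ?_⟩⟩
    rw [norm_neg, Complex.neg_im]
    nlinarith

theorem halfAnnulus_outer {r₁ r₂ : ℝ} (h : B.q0 ≤ r₁) {z : ℂ} (hz : z ∈ halfAnnulus r₁ r₂)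
    (hzb : z ∉ branchPoints B) : z ∈ Dplus B ∪ contour0 B ∧ -z ∈ Dminus B ∪ contour0 B := by
  obtain ⟨h1, -, h3⟩ := hz
  have h0 : z ≠ 0 := norm_pos_iff.1 (B.q0_pos.trans_le (h.trans h1))
  have hzb' : -z ∉ branchPoints B := by rwa [neg_mem_branchPoints]
  by_cases hc : z ∈ contour B
  · refine ⟨Or.inr ⟨hc, hzb⟩, Or.inr ⟨?_, hzb'⟩⟩
    rcases hc with hc | hc
    · exact Or.inl ⟨by simpa using hc.1, by simpa using h0⟩
    · exact Or.inr ⟨hc.1, by simpa using hc.2⟩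
  · have him : 0 < z.im := lt_of_le_of_ne h3 fun h => hc (Or.inl ⟨h.symm, h0⟩)
    rcases B.kappa_eq with hκ | hκ
    · exact ⟨Or.inl (Or.inl ⟨hκ, him⟩), Or.inl (Or.inl ⟨hκ, by simpa using him⟩)⟩
    · have h4 : 0 < ‖z‖ - B.q0 := by
        have : ‖z‖ ≠ B.q0 := fun h => hc (Or.inr ⟨hκ, h⟩)
        have := lt_of_le_of_ne (h.trans h1) this.symm
        linarith
      refine ⟨Or.inl (Or.inr ⟨hκ, mul_pos h4 him⟩), Or.inl (Or.inr ⟨hκ, ?_⟩)⟩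
      rw [norm_neg, Complex.neg_im]
      nlinarith

/-- Inside |z| = q₀ the factor |z| - q₀ is negative, so for δσ = -1 the two regions exchange
half-planes. This is the origin of the reversed inner segment in the oriented contour. -/
theorem openHalfAnnulus_inner {r₁ r₂ : ℝ} (h : r₂ ≤ B.q0) {z : ℂ} (hz : z ∈ openHalfAnnulus r₁ r₂) :
    (B.κ = 1 → z ∈ Dplus B ∧ -z ∈ Dminus B) ∧ (B.κ = -1 → z ∈ Dminus B ∧ -z ∈ Dplus B) := by
  obtain ⟨-, h2, h3⟩ := hz
  have h4 : ‖z‖ - B.q0 < 0 := by linarith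
  refine ⟨fun hκ => ⟨Or.inl ⟨hκ, h3⟩, Or.inl ⟨hκ, by simpa using h3⟩⟩, fun hκ =>
    ⟨Or.inr ⟨hκ, by nlinarith⟩, Or.inr ⟨hκ, ?_⟩⟩⟩
  rw [norm_neg, Complex.neg_im]
  nlinarith

theorem halfAnnulus_inner {r₁ r₂ : ℝ} (h0 : 0 < r₁) (h : r₂ ≤ B.q0) {z : ℂ}
    (hz : z ∈ halfAnnulus r₁ r₂) (hzb : z ∉ branchPoints B) :
    (B.κ = 1 → z ∈ Dplus B ∪ contour0 B ∧ -z ∈ Dminus B ∪ contour0 B) ∧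
    (B.κ = -1 → z ∈ Dminus B ∪ contour0 B ∧ -z ∈ Dplus B ∪ contour0 B) := by
  obtain ⟨h1, h2, h3⟩ := hz
  have h0 : z ≠ 0 := norm_pos_iff.1 (h0.trans_le h1)
  have hzb' : -z ∉ branchPoints B := by rwa [neg_mem_branchPoints]
  by_cases hc : z ∈ contour B
  · have hc1 : z ∈ contour0 B := ⟨hc, hzb⟩
    have hc2 : -z ∈ contour0 B := by
      refine ⟨?_, hzb'⟩
      rcases hc with hc | hc
      · exact Or.inl ⟨by simpa using hc.1, by simpa using h0⟩
      · exact Or.inr ⟨hc.1, by simpa using hc.2⟩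
    exact ⟨fun _ => ⟨Or.inr hc1, Or.inr hc2⟩, fun _ => ⟨Or.inr hc1, Or.inr hc2⟩⟩
  · have him : 0 < z.im := lt_of_le_of_ne h3 fun h => hc (Or.inl ⟨h.symm, h0⟩)
    refine ⟨fun hκ => ⟨Or.inl (Or.inl ⟨hκ, him⟩), Or.inl (Or.inl ⟨hκ, by simpa using him⟩)⟩,
      fun hκ => ?_⟩
    have h4 : ‖z‖ - B.q0 < 0 := by
      have : ‖z‖ ≠ B.q0 := fun h => hc (Or.inr ⟨hκ, h⟩)
      have := lt_of_le_of_ne (h2.trans h) this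
      linarith
    refine ⟨Or.inl (Or.inr ⟨hκ, by nlinarith⟩), Or.inl (Or.inr ⟨hκ, ?_⟩)⟩
    rw [norm_neg, Complex.neg_im]
    nlinarith

/-! ### The scalar Riemann-Hilbert problem -/

theorem tendsto_segIntegral {f : ℂ → ℂ}
    (hi : ∀ p q : ℝ, IntervalIntegrable (fun x : ℝ => f x) volume p q) (R : ℝ) :
    Tendsto (fun ε => segIntegral f ε R) (𝓝[>] 0) (𝓝 (∫ x in (-R)..R, f (x : ℂ))) := by
  have h1 : ∀ ε, segIntegral f ε R = (∫ x in (0 : ℝ)..R, f (x : ℂ)) - (∫ x in (0 : ℝ)..ε, f (x : ℂ)) +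
      ((∫ x in (0 : ℝ)..(-ε), f (x : ℂ)) - ∫ x in (0 : ℝ)..(-R), f (x : ℂ)) := by
    intro ε
    rw [segIntegral, intervalIntegral.integral_interval_sub_left (hi _ _) (hi _ _),
      intervalIntegral.integral_interval_sub_left (hi _ _) (hi _ _)]
  have hc : Continuous fun ε : ℝ => ∫ x in (0 : ℝ)..ε, f (x : ℂ) :=
    intervalIntegral.continuous_primitive (fun p q => hi p q) 0
  have hc2 : Continuous fun ε => segIntegral f ε R := by
    simp only [h1]
    exact (continuous_const.sub hc).add ((hc.comp continuous_neg).sub continuous_const)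
  have h0 : segIntegral f 0 R = ∫ x in (-R)..R, f (x : ℂ) := by
    rw [h1]
    simp only [neg_zero, intervalIntegral.integral_same, sub_zero, zero_sub]
    rw [← intervalIntegral.integral_interval_sub_left (hi 0 R) (hi 0 (-R))]
    ring
  rw [← h0]
  exact (hc2.tendsto 0).mono_left nhdsWithin_le_nhds

theorem segIntegral_add_segIntegral {f : ℂ → ℂ}
    (hi : ∀ p q : ℝ, IntervalIntegrable (fun x : ℝ => f x) volume p q) (r₁ r₂ r₃ : ℝ) :
    segIntegral f r₁ r₂ + segIntegral f r₂ r₃ = segIntegral f r₁ r₃ := by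
  rw [segIntegral, segIntegral, segIntegral, ← intervalIntegral.integral_add_adjacent_intervals
    (hi r₁ r₂) (hi r₂ r₃), ← intervalIntegral.integral_add_adjacent_intervals
    (hi (-r₃) (-r₂)) (hi (-r₂) (-r₁))]
  ring

theorem segIntegral_eq_sub {f F G : ℂ → ℂ} {r₁ r₂ : ℝ} (h1 : 0 < r₁) (h12 : r₁ ≤ r₂)
    (hf : ∀ᵐ x : ℝ, x ≠ 0 → f x = F x - G x)
    (hF : IntervalIntegrable (fun x : ℝ => F x) volume r₁ r₂)
    (hF' : IntervalIntegrable (fun x : ℝ => F x) volume (-r₂) (-r₁))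
    (hG : IntervalIntegrable (fun x : ℝ => G x) volume r₁ r₂)
    (hG' : IntervalIntegrable (fun x : ℝ => G x) volume (-r₂) (-r₁)) :
    segIntegral f r₁ r₂ = segIntegral F r₁ r₂ - segIntegral G r₁ r₂ := by
  have e1 : ∫ x in r₁..r₂, f (x : ℂ) = ∫ x in r₁..r₂, (F (x : ℂ) - G (x : ℂ)) := by
    refine intervalIntegral.integral_congr_ae ?_
    filter_upwards [hf] with x hx hx'
    rw [Set.uIoc_of_le h12] at hx'
    exact hx (by linarith [hx'.1])
  have e2 : ∫ x in (-r₂)..(-r₁), f (x : ℂ) = ∫ x in (-r₂)..(-r₁), (F (x : ℂ) - G (x : ℂ)) := by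
    refine intervalIntegral.integral_congr_ae ?_
    filter_upwards [hf] with x hx hx'
    rw [Set.uIoc_of_le (by linarith)] at hx'
    exact hx (by linarith [hx'.2])
  rw [segIntegral, e1, e2, intervalIntegral.integral_sub hF hG, intervalIntegral.integral_sub hF' hG',
    segIntegral, segIntegral]
  ring

theorem arcIntegral_eq_sub {f F G : ℂ → ℂ} {a b r : ℝ}
    (hf : ∀ᵐ φ : ℝ, f (circleMap 0 r φ) = F (circleMap 0 r φ) - G (circleMap 0 r φ))
    (hF : IntervalIntegrable
      (fun φ => F (circleMap 0 r φ) * (circleMap 0 r φ * Complex.I)) volume a b)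
    (hG : IntervalIntegrable
      (fun φ => G (circleMap 0 r φ) * (circleMap 0 r φ * Complex.I)) volume a b) :
    arcIntegral f a b r = arcIntegral F a b r - arcIntegral G a b r := by
  rw [arcIntegral, arcIntegral, arcIntegral, ← intervalIntegral.integral_sub hF hG]
  refine intervalIntegral.integral_congr_ae ?_
  filter_upwards [hf] with φ hφ _
  rw [hφ]
  ring

theorem zero_notMem_contour : (0 : ℂ) ∉ contour B := by
  rintro (h | h)
  · exact h.2 rfl
  · have := B.q0_pos
    rw [← h.2] at this
    simp at this

/-- A general parametrization γ is allowed in order to treat the real line and the circle |z| = q₀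
together. Compactness turns the local bounds, including those at the exceptional points, into one
bound on the interval. -/
theorem intervalIntegrable_comp_of_contour {f : ℂ → ℂ} (hc : ContinuousOn f (contour0 B))
    (hb : ∀ z ∈ branchPoints B ∪ {0}, ∃ C : ℝ, ∀ᶠ w in 𝓝[contour0 B] z, ‖f w‖ ≤ C) {γ : ℝ → ℂ}
    (hγ : Continuous γ) (hγc : (γ ⁻¹' (branchPoints B ∪ {0})).Countable)
    (hγm : ∀ x, γ x ∉ branchPoints B ∪ {0} → γ x ∈ contour0 B) (p q : ℝ) :
    IntervalIntegrable (fun x => f (γ x)) volume p q := by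
  set A := γ ⁻¹' contour0 B with hA
  have ht : ∀ x, Tendsto γ (𝓝[A] x) (𝓝[contour0 B] (γ x)) := fun x =>
    tendsto_nhdsWithin_iff.2 ⟨(hγ.tendsto x).mono_left nhdsWithin_le_nhds,
      eventually_mem_nhdsWithin⟩
  obtain ⟨C, hC⟩ := exists_bound_of_locally (F := fun x => f (γ x)) (A := A)
    (isCompact_uIcc (a := p) (b := q)) fun x _ => by
    by_cases hx : γ x ∈ branchPoints B ∪ {0}
    · obtain ⟨C, hC⟩ := hb _ hx
      exact ⟨C, (ht x).eventually hC⟩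
    · refine ⟨‖f (γ x)‖ + 1, ?_⟩
      have := (hc _ (hγm x hx)).norm
      exact (ht x).eventually
        ((this.eventually (gt_mem_nhds (lt_add_one _))).mono fun _ => le_of_lt)
  refine intervalIntegrable_of_continuousOn_diff (C := C) hγc ?_ ?_
  · exact hc.comp hγ.continuousOn fun x hx => hγm x hx.2
  · exact fun x hx => hC x ⟨hx.1, hγm x hx.2⟩

end

section

theorem ofReal_mem_contour0 (B : Background) {x : ℝ} (h : (x : ℂ) ∉ branchPoints B ∪ {0}) :
    (x : ℂ) ∈ contour0 B :=
  ⟨Or.inl ⟨by simp, fun h0 => h (Or.inr h0)⟩, fun hb => h (Or.inl hb)⟩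

theorem countable_ofReal_preimage (B : Background) :
    ((fun x : ℝ => (x : ℂ)) ⁻¹' (branchPoints B ∪ {0})).Countable :=
  (((finite_branchPoints B).union (Set.finite_singleton 0)).preimage
    Complex.ofReal_injective.injOn).countable

theorem circleMap_mem_contour0 (B : Background) (hκ : B.κ = -1) {φ : ℝ}
    (h : circleMap 0 B.q0 φ ∉ branchPoints B ∪ {0}) : circleMap 0 B.q0 φ ∈ contour0 B :=
  ⟨Or.inr ⟨hκ, by rw [norm_circleMap_zero, abs_of_pos B.q0_pos]⟩, fun hb => h (Or.inl hb)⟩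

theorem countable_circleMap_preimage (B : Background) :
    ((circleMap 0 B.q0) ⁻¹' (branchPoints B ∪ {0})).Countable :=
  (((finite_branchPoints B).union (Set.finite_singleton 0)).countable).preimage_circleMap 0
    B.q0_pos.ne'

/-- The contour integral of the jump of a sectionally holomorphic function without poles. -/
theorem hasContourIntegral_jump (B : Background) {Fp Fm f : ℂ → ℂ} {c₀ c₁ : ℂ}
    (hp : IsHolomorphicUpTo Fp (Dplus B) (Dplus B ∪ contour0 B) (branchPoints B))
    (hm : IsHolomorphicUpTo Fm (Dminus B) (Dminus B ∪ contour0 B) (branchPoints B))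
    (hp1 : Tendsto (fun z => z * Fp z) (comap norm atTop ⊓ 𝓟 (Dplus B ∪ contour0 B)) (𝓝 c₁))
    (hm1 : Tendsto (fun z => z * Fm z) (comap norm atTop ⊓ 𝓟 (Dminus B ∪ contour0 B)) (𝓝 c₁))
    (hp0 : Tendsto (fun z => z * Fp z) (comap norm (𝓝[>] 0) ⊓ 𝓟 (Dplus B ∪ contour0 B)) (𝓝 c₀))
    (hm0 : Tendsto (fun z => z * Fm z) (comap norm (𝓝[>] 0) ⊓ 𝓟 (Dminus B ∪ contour0 B)) (𝓝 c₀))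
    (hf : ∀ z ∈ contour0 B, f z = Fp z - Fm z)
    (hf0 : ∃ C : ℝ, ∀ᶠ w in 𝓝[contour0 B] 0, ‖f w‖ ≤ C) :
    HasContourIntegral B f (2 * Real.pi * Complex.I * (c₀ - c₁)) := by
  have hq := B.q0_pos
  have hS := finite_branchPoints B
  have hcf : ContinuousOn f (contour0 B) :=
    ((hp.cont.mono Set.subset_union_right).sub (hm.cont.mono Set.subset_union_right)).congr hf
  have hbf : ∀ z ∈ branchPoints B ∪ {0}, ∃ C : ℝ, ∀ᶠ w in 𝓝[contour0 B] z, ‖f w‖ ≤ C := by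
    rintro z (hz | hz)
    · obtain ⟨C, hC⟩ := hp.bdd z hz
      obtain ⟨C', hC'⟩ := hm.bdd z hz
      refine ⟨C + C', ?_⟩
      filter_upwards [nhdsWithin_mono z Set.subset_union_right hC,
        nhdsWithin_mono z Set.subset_union_right hC', self_mem_nhdsWithin] with w h1 h2 h3
      rw [hf w h3]
      exact (norm_sub_le _ _).trans (add_le_add h1 h2)
    · rw [Set.mem_singleton_iff.1 hz]
      exact hf0
  have hi : ∀ p q : ℝ, IntervalIntegrable (fun x : ℝ => f x) volume p q :=
    intervalIntegrable_comp_of_contour B hcf hbf Complex.continuous_ofReal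
      (countable_ofReal_preimage B) fun x hx => ofReal_mem_contour0 B hx
  have hae : ∀ᵐ x : ℝ, x ≠ 0 → f x = Fp x - Fm x := by
    filter_upwards [(countable_ofReal_preimage B).ae_notMem volume] with x hx _
    exact hf _ (ofReal_mem_contour0 B hx)
  have hcirc : B.κ = -1 → ∀ a b : ℝ,
      IntervalIntegrable (fun φ => f (circleMap 0 B.q0 φ)) volume a b := fun hκ =>
    intervalIntegrable_comp_of_contour B hcf hbf (continuous_circleMap 0 B.q0)
      (countable_circleMap_preimage B) fun φ hφ => circleMap_mem_contour0 B hκ hφ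
  have hae' : B.κ = -1 → ∀ᵐ φ : ℝ, f (circleMap 0 B.q0 φ) =
      Fp (circleMap 0 B.q0 φ) - Fm (circleMap 0 B.q0 φ) := by
    intro hκ
    filter_upwards [(countable_circleMap_preimage B).ae_notMem volume] with φ hφ
    exact hf _ (circleMap_mem_contour0 B hκ hφ)
  refine ⟨?_, fun hκ => hcirc hκ _ _, ?_⟩
  -- Boundedness of f near 0 and near the branch points gives local integrability on the whole line,
  -- although the separate boundary functions need not be integrable at 0.
  · intro x
    refine ⟨Set.Ioc (x - 1) (x + 1), Ioc_mem_nhds (by linarith) (by linarith), ?_⟩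
    exact (intervalIntegrable_iff_integrableOn_Ioc_of_le (by linarith)).1 (hi _ _)
  have hpi : Set.uIoc 0 Real.pi ⊆ Set.Icc 0 Real.pi := by
    rw [Set.uIoc_of_le Real.pi_pos.le]
    exact Set.Ioc_subset_Icc_self
  have hpi2 : ∀ φ ∈ Set.uIoc Real.pi (2 * Real.pi), φ - Real.pi ∈ Set.Icc 0 Real.pi := by
    intro φ hφ
    rw [Set.uIoc_of_le (by linarith [Real.pi_pos])] at hφ
    exact ⟨by linarith [hφ.1], by linarith [hφ.2]⟩
  have hcm : ∀ r φ, circleMap 0 r φ = -circleMap 0 r (φ - Real.pi) := by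
    intro r φ
    rw [← circleMap_zero_add_pi, sub_add_cancel]
  have hnb : ∀ r φ, 0 < r → r ≠ B.q0 → circleMap 0 r φ ∉ branchPoints B := by
    intro r φ hr hrq hb
    have := norm_of_mem_branchPoints B hb
    rw [norm_circleMap_zero, abs_of_pos hr] at this
    exact hrq this
  -- the outer half-annuli
  have upO : ∀ R, B.q0 < R → _ := fun R hR => hp.upper hS hq hR
    (fun z hz => (openHalfAnnulus_outer B le_rfl hz).1)
    (fun z hz => (halfAnnulus_outer B le_rfl hz.1 hz.2).1)
  have loO : ∀ R, B.q0 < R → _ := fun R hR => hm.lower hS hq hR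
    (fun z hz => (openHalfAnnulus_outer B le_rfl hz).2)
    (fun z hz hzb => (halfAnnulus_outer B le_rfl hz
      fun h => hzb ((neg_mem_branchPoints B).2 h)).2)
  have hsegO : ∀ R, B.q0 < R → segIntegral f B.q0 R =
      segIntegral Fp B.q0 R - segIntegral Fm B.q0 R := fun R hR =>
    segIntegral_eq_sub hq hR.le hae (upO R hR).2.1 (upO R hR).2.2.1 (loO R hR).2.1
      (loO R hR).2.2.1
  -- the limits of the outer arcs
  have limO : Tendsto (fun R => arcIntegral Fp 0 Real.pi R +
      arcIntegral Fm Real.pi (2 * Real.pi) R) atTop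
      (𝓝 (2 * Real.pi * Complex.I * c₁)) := by
    have e : (2 * Real.pi * Complex.I * c₁ : ℂ) = ((Real.pi : ℝ) - (0 : ℝ) : ℂ) * (Complex.I * c₁) +
        ((2 * Real.pi : ℝ) - (Real.pi : ℝ) : ℂ) * (Complex.I * c₁) := by
      push_cast
      ring
    rw [e]
    refine (tendsto_arcIntegral hp1 (eventually_gt_atTop 0) ?_ ?_).add
      (tendsto_arcIntegral hm1 (eventually_gt_atTop 0) ?_ ?_)
    · filter_upwards [eventually_gt_atTop B.q0] with R hR φ hφ
      exact (halfAnnulus_outer B le_rfl (circleMap_zero_mem (hq.trans hR).le (hpi hφ)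
        ⟨hR.le, le_rfl⟩) (hnb R φ (hq.trans hR) hR.ne')).1
    · filter_upwards [eventually_gt_atTop B.q0] with R hR
      exact (upO R hR).2.2.2 R ⟨hR.le, le_rfl⟩
    · filter_upwards [eventually_gt_atTop B.q0] with R hR φ hφ
      rw [hcm]
      exact (halfAnnulus_outer B le_rfl (circleMap_zero_mem (hq.trans hR).le (hpi2 φ hφ)
        ⟨hR.le, le_rfl⟩) (hnb R _ (hq.trans hR) hR.ne')).2
    · filter_upwards [eventually_gt_atTop B.q0] with R hR
      exact (loO R hR).2.2.2 R ⟨hR.le, le_rfl⟩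
  have hev : ∀ᶠ ε in 𝓝[>] (0 : ℝ), 0 < ε ∧ ε < B.q0 := by
    filter_upwards [Ioo_mem_nhdsGT hq] with ε hε using hε
  have h0ev : ∀ᶠ ε in 𝓝[>] (0 : ℝ), 0 < ε := hev.mono fun _ h => h.1
  have e0 : (2 * Real.pi * Complex.I * c₀ : ℂ) = ((Real.pi : ℝ) - (0 : ℝ) : ℂ) * (Complex.I * c₀) +
      ((2 * Real.pi : ℝ) - (Real.pi : ℝ) : ℂ) * (Complex.I * c₀) := by
    push_cast
    ring
  -- For each finite R the identity is exact: the limit at the origin has been taken, and only the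
  -- two outer arcs of radius R remain. Convergence as R → ∞ then needs no absolute integrability at
  -- infinity.
  suffices hmain : ∀ R, B.q0 < R → truncIntegral B f R = 2 * Real.pi * Complex.I * c₀ -
      (arcIntegral Fp 0 Real.pi R + arcIntegral Fm Real.pi (2 * Real.pi) R) by
    rw [mul_sub]
    refine (limO.const_sub _).congr' ?_
    filter_upwards [eventually_gt_atTop B.q0] with R hR using (hmain R hR).symm
  intro R hR
  rcases B.kappa_eq with hκ | hκ
  -- If δσ = 1 the circle |z| = q₀ is not part of the contour. The same function lives on both sides
  -- of each half of it, so the arcs of radius q₀ cancel between the inner and outer half-annuli.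
  · have upI : ∀ ε, 0 < ε ∧ ε < B.q0 → _ := fun ε hε => hp.upper hS hε.1 hε.2
      (fun z hz => ((openHalfAnnulus_inner B le_rfl hz).1 hκ).1)
      (fun z hz => ((halfAnnulus_inner B hε.1 le_rfl hz.1 hz.2).1 hκ).1)
    have loI : ∀ ε, 0 < ε ∧ ε < B.q0 → _ := fun ε hε => hm.lower hS hε.1 hε.2
      (fun z hz => ((openHalfAnnulus_inner B le_rfl hz).1 hκ).2)
      (fun z hz hzb => ((halfAnnulus_inner B hε.1 le_rfl hz
        fun h => hzb ((neg_mem_branchPoints B).2 h)).1 hκ).2)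
    have limI : Tendsto (fun ε => arcIntegral Fp 0 Real.pi ε +
        arcIntegral Fm Real.pi (2 * Real.pi) ε) (𝓝[>] 0) (𝓝 (2 * Real.pi * Complex.I * c₀)) := by
      rw [e0]
      refine (tendsto_arcIntegral hp0 h0ev ?_ ?_).add (tendsto_arcIntegral hm0 h0ev ?_ ?_)
      · filter_upwards [hev] with ε hε φ hφ
        exact ((halfAnnulus_inner B hε.1 le_rfl (circleMap_zero_mem hε.1.le (hpi hφ)
          ⟨le_rfl, hε.2.le⟩) (hnb ε φ hε.1 hε.2.ne)).1 hκ).1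
      · filter_upwards [hev] with ε hε
        exact (upI ε hε).2.2.2 ε ⟨le_rfl, hε.2.le⟩
      · filter_upwards [hev] with ε hε φ hφ
        rw [hcm]
        exact ((halfAnnulus_inner B hε.1 le_rfl (circleMap_zero_mem hε.1.le (hpi2 φ hφ)
          ⟨le_rfl, hε.2.le⟩) (hnb ε _ hε.1 hε.2.ne)).1 hκ).2
      · filter_upwards [hev] with ε hε
        exact (loI ε hε).2.2.2 ε ⟨le_rfl, hε.2.le⟩
    have hl := limI.sub_const (arcIntegral Fp 0 Real.pi R + arcIntegral Fm Real.pi (2 * Real.pi) R)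
    rw [truncIntegral, if_pos hκ]
    refine tendsto_nhds_unique (tendsto_segIntegral hi R) (hl.congr' ?_)
    filter_upwards [hev] with ε hε
    rw [← segIntegral_add_segIntegral hi ε B.q0 R, hsegO R hR,
      segIntegral_eq_sub hε.1 hε.2.le hae (upI ε hε).2.1 (upI ε hε).2.2.1 (loI ε hε).2.1
      (loI ε hε).2.2.1]
    linear_combination -(upO R hR).1 + (loO R hR).1 - (upI ε hε).1 + (loI ε hε).1
  -- If δσ = -1 the minus function occupies the inner upper half and the plus function the inner
  -- lower half. The inner segments enter with the opposite sign, and the arcs of radius q₀ combine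
  -- into integrals of the jump.
  · have upI : ∀ ε, 0 < ε ∧ ε < B.q0 → _ := fun ε hε => hm.upper hS hε.1 hε.2
      (fun z hz => ((openHalfAnnulus_inner B le_rfl hz).2 hκ).1)
      (fun z hz => ((halfAnnulus_inner B hε.1 le_rfl hz.1 hz.2).2 hκ).1)
    have loI : ∀ ε, 0 < ε ∧ ε < B.q0 → _ := fun ε hε => hp.lower hS hε.1 hε.2
      (fun z hz => ((openHalfAnnulus_inner B le_rfl hz).2 hκ).2)
      (fun z hz hzb => ((halfAnnulus_inner B hε.1 le_rfl hz
        fun h => hzb ((neg_mem_branchPoints B).2 h)).2 hκ).2)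
    have limI : Tendsto (fun ε => arcIntegral Fm 0 Real.pi ε +
        arcIntegral Fp Real.pi (2 * Real.pi) ε) (𝓝[>] 0) (𝓝 (2 * Real.pi * Complex.I * c₀)) := by
      rw [e0]
      refine (tendsto_arcIntegral hm0 h0ev ?_ ?_).add (tendsto_arcIntegral hp0 h0ev ?_ ?_)
      · filter_upwards [hev] with ε hε φ hφ
        exact ((halfAnnulus_inner B hε.1 le_rfl (circleMap_zero_mem hε.1.le (hpi hφ)
          ⟨le_rfl, hε.2.le⟩) (hnb ε φ hε.1 hε.2.ne)).2 hκ).1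
      · filter_upwards [hev] with ε hε
        exact (upI ε hε).2.2.2 ε ⟨le_rfl, hε.2.le⟩
      · filter_upwards [hev] with ε hε φ hφ
        rw [hcm]
        exact ((halfAnnulus_inner B hε.1 le_rfl (circleMap_zero_mem hε.1.le (hpi2 φ hφ)
          ⟨le_rfl, hε.2.le⟩) (hnb ε _ hε.1 hε.2.ne)).2 hκ).2
      · filter_upwards [hev] with ε hε
        exact (loI ε hε).2.2.2 ε ⟨le_rfl, hε.2.le⟩
    obtain ⟨ε₁, hε₁⟩ := hev.exists
    have hU : arcIntegral f 0 Real.pi B.q0 =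
        arcIntegral Fp 0 Real.pi B.q0 - arcIntegral Fm 0 Real.pi B.q0 :=
      arcIntegral_eq_sub (hae' hκ) ((upO R hR).2.2.2 _ ⟨le_rfl, hR.le⟩)
        ((upI ε₁ hε₁).2.2.2 _ ⟨hε₁.2.le, le_rfl⟩)
    have hV : arcIntegral f Real.pi (2 * Real.pi) B.q0 =
        arcIntegral Fp Real.pi (2 * Real.pi) B.q0 - arcIntegral Fm Real.pi (2 * Real.pi) B.q0 :=
      arcIntegral_eq_sub (hae' hκ) ((loI ε₁ hε₁).2.2.2 _ ⟨hε₁.2.le, le_rfl⟩)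
        ((loO R hR).2.2.2 _ ⟨le_rfl, hR.le⟩)
    have htr : truncIntegral B f R = segIntegral f B.q0 R -
        (∫ x in (-B.q0)..B.q0, f (x : ℂ)) - arcIntegral f 0 Real.pi B.q0 +
        arcIntegral f Real.pi (2 * Real.pi) B.q0 := by
      rw [truncIntegral, if_neg (by rw [hκ]; norm_num), segIntegral, arcIntegral, arcIntegral]
      ring
    have hl := limI.sub_const (arcIntegral Fp 0 Real.pi R + arcIntegral Fm Real.pi (2 * Real.pi) R)
    have hs := ((((tendsto_segIntegral hi B.q0).const_sub (segIntegral f B.q0 R))).sub_const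
      (arcIntegral f 0 Real.pi B.q0)).add_const (arcIntegral f Real.pi (2 * Real.pi) B.q0)
    rw [htr]
    refine tendsto_nhds_unique hs (hl.congr' ?_)
    filter_upwards [hev] with ε hε
    rw [hsegO R hR, hU, hV,
      segIntegral_eq_sub hε.1 hε.2.le hae (loI ε hε).2.1 (loI ε hε).2.2.1 (upI ε hε).2.1
      (upI ε hε).2.2.1]
    linear_combination -(upO R hR).1 + (loO R hR).1 - (upI ε hε).1 + (loI ε hε).1

/-! ### Removing simple poles -/

/-- After subtraction, z - p_n times the function tends to 0 at each p_n, and Riemann's theorem on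
removable singularities applies. The values of f at the poles, which come from a division by zero in
the application, are irrelevant. -/
theorem exists_differentiableOn_sub_poles {D : Set ℂ} (hD : IsOpen D) {ι : Type*} [Fintype ι]
    {p : ι → ℂ} (hp : Function.Injective p) {f : ℂ → ℂ} {r : ι → ℂ}
    (hf : DifferentiableOn ℂ f (D \ Set.range p))
    (hr : ∀ n, Tendsto (fun z => (z - p n) * f z) (𝓝[≠] (p n)) (𝓝 (r n))) :
    ∃ F : ℂ → ℂ, DifferentiableOn ℂ F D ∧
      ∀ z, z ∉ Set.range p → F z = f z - ∑ n, r n / (z - p n) := by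
  classical
  set g : ℂ → ℂ := fun z => f z - ∑ n, r n / (z - p n) with hg
  have hfin : (Set.range p).Finite := Set.finite_range p
  have hgd : DifferentiableOn ℂ g (D \ Set.range p) := by
    refine hf.sub (DifferentiableOn.fun_sum fun n _ => ?_)
    refine DifferentiableOn.div (by fun_prop) (by fun_prop) fun z hz h => hz.2 ⟨n, ?_⟩
    exact (sub_eq_zero.1 h).symm
  set F : ℂ → ℂ := fun z => if z ∈ Set.range p then limUnder (𝓝[≠] z) g else g z with hF
  refine ⟨F, fun z hz => ?_, fun z hz => by simp only [hF, if_neg hz, hg]⟩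
  refine DifferentiableAt.differentiableWithinAt ?_
  by_cases hzp : z ∈ Set.range p
  · obtain ⟨n, rfl⟩ := hzp
    have hV : IsOpen ((Set.range p \ {p n})ᶜ) := (hfin.subset Set.sdiff_subset).isClosed.isOpen_compl
    set V := D ∩ (Set.range p \ {p n})ᶜ with hVdef
    have hVn : V ∈ 𝓝 (p n) := (hD.inter hV).mem_nhds ⟨hz, by simp⟩
    have hVs : V \ {p n} ⊆ D \ Set.range p := by
      rintro w ⟨⟨h1, h2⟩, h3⟩
      exact ⟨h1, fun h4 => h2 ⟨h4, h3⟩⟩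
    have hlim : Tendsto (fun z => (z - p n) * g z) (𝓝[≠] (p n)) (𝓝 0) := by
      have e : ∀ z ≠ p n, (z - p n) * g z = (z - p n) * f z - r n -
          (z - p n) * ∑ k ∈ Finset.univ.erase n, r k / (z - p k) := by
        intro z hz'
        simp only [hg]
        rw [← Finset.add_sum_erase _ _ (Finset.mem_univ n)]
        have := sub_ne_zero.2 hz'
        field_simp
        ring
      have hc : ContinuousAt (fun z => (z - p n) * ∑ k ∈ Finset.univ.erase n, r k / (z - p k))
          (p n) := by
        refine (by fun_prop : ContinuousAt (fun z => z - p n) (p n)).mul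
          (tendsto_finsetSum _ fun k hk => ?_)
        refine ContinuousAt.div (by fun_prop) (by fun_prop) ?_
        exact sub_ne_zero.2 fun h => (Finset.ne_of_mem_erase hk) (hp h).symm
      have h0 := hc.tendsto.mono_left (nhdsWithin_le_nhds (s := {p n}ᶜ))
      simp only [sub_self, zero_mul] at h0
      have := ((hr n).sub_const (r n)).sub h0
      rw [sub_self, sub_zero] at this
      refine this.congr' ?_
      filter_upwards [self_mem_nhdsWithin] with z hz' using (e z hz').symm
    have ho : (fun z => g z - g (p n)) =o[𝓝[≠] (p n)] fun z => (z - p n)⁻¹ := by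
      refine Asymptotics.isLittleO_of_tendsto' ?_ ?_
      · filter_upwards [self_mem_nhdsWithin] with z hz' h
        exact absurd (inv_eq_zero.1 h) (sub_ne_zero.2 hz')
      · have h1 : Tendsto (fun z => (z - p n) * g (p n)) (𝓝[≠] (p n)) (𝓝 0) := by
          have : ContinuousAt (fun z => (z - p n) * g (p n)) (p n) := by fun_prop
          simpa using this.tendsto.mono_left nhdsWithin_le_nhds
        have h2 := hlim.sub h1
        rw [sub_zero] at h2
        refine h2.congr fun z => ?_
        rw [div_inv_eq_mul]
        ring
    have key := Complex.differentiableOn_update_limUnder_of_isLittleO hVn (hgd.mono hVs) ho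
    refine (key.differentiableAt hVn).congr_of_eventuallyEq ?_
    filter_upwards [hVn] with w hw
    by_cases hwn : w = p n
    · subst hwn
      simp [hF]
    · rw [Function.update_of_ne hwn]
      simp only [hF]
      rw [if_neg fun h => hw.2 ⟨h, hwn⟩]
  · have hV : IsOpen (D \ Set.range p) := hD.sdiff hfin.isClosed
    have := hgd.differentiableAt (hV.mem_nhds ⟨hz, hzp⟩)
    refine this.congr_of_eventuallyEq ?_
    filter_upwards [hV.mem_nhds ⟨hz, hzp⟩] with w hw
    simp only [hF]
    rw [if_neg hw.2]

end

section

/-! ### Half-line integrals -/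

theorem hasDerivAt_integral_Iic {E : Type*} [NormedAddCommGroup E] [NormedSpace ℝ E]
    [CompleteSpace E] {f : ℝ → E} (hf : Continuous f) (hi : ∀ x, IntegrableOn f (Set.Iic x)) (x : ℝ) :
    HasDerivAt (fun x => ∫ y in Set.Iic x, f y) (f x) x := by
  have h : (fun x => ∫ y in Set.Iic x, f y) =
      fun x => (∫ y in Set.Iic (0 : ℝ), f y) + ∫ y in (0 : ℝ)..x, f y := by
    ext x
    rw [← intervalIntegral.integral_Iic_sub_Iic (hi 0) (hi x)]
    abel
  rw [h]
  exact ((hf.integral_hasStrictDerivAt 0 x).hasDerivAt).const_add _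

theorem tendsto_integral_Iic {E : Type*} [NormedAddCommGroup E] [NormedSpace ℝ E]
    [CompleteSpace E] {f : ℝ → E} (hi : ∀ x, IntegrableOn f (Set.Iic x)) :
    Tendsto (fun x => ∫ y in Set.Iic x, f y) atBot (𝓝 0) := by
  have h : (fun x => ∫ y in Set.Iic x, f y) =
      fun x => (∫ y in Set.Iic (0 : ℝ), f y) - ∫ y in x..(0 : ℝ), f y := by
    ext x
    rw [← intervalIntegral.integral_Iic_sub_Iic (hi x) (hi 0)]
    abel
  rw [h]
  simpa using (intervalIntegral_tendsto_integral_Iic (0 : ℝ) (hi 0) tendsto_id).const_sub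
    (∫ y in Set.Iic (0 : ℝ), f y)

theorem integral_mulVec {ι : Type*} [Fintype ι] {μ : Measure ℝ} (M : Matrix ι ι ℂ)
    {f : ℝ → ι → ℂ} (hf : Integrable f μ) :
    ∫ y, M.mulVec (f y) ∂μ = M.mulVec (∫ y, f y ∂μ) :=
  (LinearMap.toContinuousLinearMap M.mulVecLin).integral_comp_comm hf

theorem integrable_mulVec {ι : Type*} [Fintype ι] {μ : Measure ℝ} (M : Matrix ι ι ℂ)
    {f : ℝ → ι → ℂ} (hf : Integrable f μ) : Integrable (fun y => M.mulVec (f y)) μ :=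
  (LinearMap.toContinuousLinearMap M.mulVecLin).integrable_comp hf

theorem integrableOn_Iic_of_continuous {E : Type*} [NormedAddCommGroup E] {f : ℝ → E}
    (hf : Continuous f) {x₀ : ℝ} (hi : IntegrableOn f (Set.Iic x₀)) (x : ℝ) :
    IntegrableOn f (Set.Iic x) := by
  refine (hi.union (hf.continuousOn.integrableOn_compact (isCompact_Icc (a := x₀) (b := x)))).mono_set
    fun y hy => ?_
  rcases le_total y x₀ with h | h
  · exact Or.inl h
  · exact Or.inr ⟨h, hy⟩

theorem exists_bound_Iic {E : Type*} [NormedAddCommGroup E] {f : ℝ → E}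
    (hf : Continuous f) {e : E} (hl : Tendsto f atBot (𝓝 e)) (x : ℝ) :
    ∃ C, ∀ y ≤ x, ‖f y‖ ≤ C := by
  have h1 : ∀ᶠ y in atBot, ‖f y‖ < ‖e‖ + 1 := hl.norm.eventually (gt_mem_nhds (lt_add_one _))
  obtain ⟨a, ha⟩ := eventually_atBot.1 h1
  obtain ⟨C, hC⟩ := (isCompact_Icc (a := a) (b := x)).exists_bound_of_continuousOn hf.continuousOn
  refine ⟨max (‖e‖ + 1) C, fun y hy => ?_⟩
  rcases le_total y a with h | h
  · exact (ha y h).le.trans (le_max_left _ _)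
  · exact (hC y ⟨h, hy⟩).trans (le_max_right _ _)

theorem integral_Iic_mul_exp_primitive {h : ℝ → ℝ} (hc : Continuous h) (h0 : ∀ y, 0 ≤ h y)
    (hi : ∀ x, IntegrableOn h (Set.Iic x)) {c : ℝ} (hc0 : 0 < c) (x : ℝ) :
    IntegrableOn (fun y => h y * Real.exp (c * ∫ s in Set.Iic y, h s)) (Set.Iic x) ∧
    ∫ y in Set.Iic x, h y * Real.exp (c * ∫ s in Set.Iic y, h s) =
      (Real.exp (c * ∫ s in Set.Iic x, h s) - 1) / c := by
  have hd := hasDerivAt_integral_Iic hc hi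
  have hHc : Continuous fun y => ∫ s in Set.Iic y, h s :=
    continuous_iff_continuousAt.2 fun y => (hd y).continuousAt
  have hmono : ∀ y ≤ x, ∫ s in Set.Iic y, h s ≤ ∫ s in Set.Iic x, h s := fun y hy =>
    setIntegral_mono_set (hi x) (Eventually.of_forall h0) (Set.Iic_subset_Iic.2 hy).eventuallyLE
  have hint : IntegrableOn (fun y => h y * Real.exp (c * ∫ s in Set.Iic y, h s)) (Set.Iic x) := by
    refine ((hi x).mul_const (Real.exp (c * ∫ s in Set.Iic x, h s))).mono' ?_ ?_
    · exact (hc.mul (Real.continuous_exp.comp (hHc.const_mul c))).aestronglyMeasurable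
    · refine (ae_restrict_iff' measurableSet_Iic).2 (Eventually.of_forall fun y hy => ?_)
      rw [Real.norm_of_nonneg (mul_nonneg (h0 y) (Real.exp_pos _).le)]
      exact mul_le_mul_of_nonneg_left (Real.exp_le_exp.2
        (mul_le_mul_of_nonneg_left (hmono y hy) hc0.le)) (h0 y)
  refine ⟨hint, ?_⟩
  rw [integral_Iic_of_hasDerivAt_of_tendsto' (f := fun y => Real.exp (c * ∫ s in Set.Iic y, h s) / c)
    (m := 1 / c) ?_ hint ?_]
  · rw [sub_div]
  · intro y _
    have := (((hd y).const_mul c).exp).div_const c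
    have e : h y * Real.exp (c * ∫ s in Set.Iic y, h s) =
        Real.exp (c * ∫ s in Set.Iic y, h s) * (c * h y) / c := by
      field_simp
    rwa [e]
  · have := ((tendsto_integral_Iic hi).const_mul c)
    rw [mul_zero] at this
    simpa using ((Real.continuous_exp.tendsto 0).comp this).div_const c

/-! ### The half-line problem -/

/-- `∫₀ˢ e^{-2iar} dr`. -/
def expPrimitive (a : ℂ) (s : ℝ) : ℂ :=
  s * dslope Complex.exp 0 (-(2 * Complex.I * a * s))

/-- The difference quotient (e^w - 1)/w extends to an entire function. This makes the kernel
holomorphic in the rate a through a = 0, hence regular at the branch points, where λ = 0. -/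
theorem differentiable_dslope_exp : Differentiable ℂ (dslope Complex.exp 0) := by
  have := (Complex.differentiableOn_dslope (f := Complex.exp) (c := 0) univ_mem).2
    Complex.differentiable_exp.differentiableOn
  exact differentiableOn_univ.1 this

theorem expPrimitive_of_ne {a : ℂ} (ha : a ≠ 0) (s : ℝ) :
    expPrimitive a s = (2 * Complex.I * a)⁻¹ * (1 - Complex.exp (-(2 * Complex.I * a * s))) := by
  rw [expPrimitive]
  by_cases hs : s = 0
  · simp [hs]
  have hc : 2 * Complex.I * a ≠ 0 := by simp [ha]
  have hs' : (s : ℂ) ≠ 0 := Complex.ofReal_ne_zero.2 hs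
  rw [dslope_of_ne _ (by simp [ha, hs]), slope_def_field, Complex.exp_zero]
  generalize Complex.exp (-(2 * Complex.I * a * s)) = E
  generalize 2 * Complex.I * a = c at hc
  field_simp
  ring

theorem continuous_expPrimitive : Continuous fun p : ℂ × ℝ => expPrimitive p.1 p.2 := by
  unfold expPrimitive
  have := differentiable_dslope_exp.continuous
  fun_prop

theorem differentiable_expPrimitive (s : ℝ) : Differentiable ℂ fun a => expPrimitive a s := by
  unfold expPrimitive
  exact (differentiable_const _).mul (differentiable_dslope_exp.comp (by fun_prop))

/-- The half-plane Re w ≤ 0 is convex and the derivative of exp has modulus at most 1 there, so the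
mean value inequality applies. -/
theorem norm_dslope_exp_le {w : ℂ} (hw : w.re ≤ 0) : ‖dslope Complex.exp 0 w‖ ≤ 1 := by
  by_cases h0 : w = 0
  · simp [h0]
  rw [dslope_of_ne _ h0, slope_def_field, norm_div, sub_zero,
    div_le_one (norm_pos_iff.2 h0)]
  have := Convex.norm_image_sub_le_of_norm_hasDerivWithin_le (f := Complex.exp) (f' := Complex.exp)
    (s := {w : ℂ | w.re ≤ 0}) (C := 1) (x := 0) (y := w)
    (fun x _ => (Complex.hasDerivAt_exp x).hasDerivWithinAt)
    (fun x hx => by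
      rw [Complex.norm_exp]
      exact Real.exp_le_one_iff.2 hx)
    (convex_halfSpace_re_le 0) (by simp) hw
  simpa using this

/-- The estimate is uniform down to a = 0, at the price of linear growth in s. That growth is what
the weight 1 + |x| in the boundary conditions pays for. -/
theorem norm_expPrimitive_le {a : ℂ} (ha : a.im ≤ 0) {s : ℝ} (hs : 0 ≤ s) :
    ‖expPrimitive a s‖ ≤ s := by
  rw [expPrimitive, norm_mul, Complex.norm_real, Real.norm_of_nonneg hs]
  refine mul_le_of_le_one_right hs (norm_dslope_exp_le ?_)
  have : (-(2 * Complex.I * a * s)).re = 2 * a.im * s := by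
    simp
  rw [this]
  nlinarith

/-- The kernel of the half-line problem. -/
def halfKernel (a : ℂ) (A : Matrix (Fin 2) (Fin 2) ℂ) (s : ℝ) : Matrix (Fin 2) (Fin 2) ℂ :=
  1 + expPrimitive a s • A

/-- The half-line integral equation `m(x) = e + ∫_{-∞}^x (1 + G(x-y) A) P(y) m(y) dy`. -/
def IsHalfLineSolution (a : ℂ) (A : Matrix (Fin 2) (Fin 2) ℂ) (P : ℝ → Matrix (Fin 2) (Fin 2) ℂ)
    (e : Fin 2 → ℂ) (m : ℝ → Fin 2 → ℂ) : Prop :=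
  Continuous m ∧ Tendsto m atBot (𝓝 e) ∧
  ∀ x, m x = e + ∫ y in Set.Iic x, (halfKernel a A (x - y)).mulVec ((P y).mulVec (m y))

theorem norm_halfKernel_mulVec_le {a : ℂ} (ha : a.im ≤ 0) {A : Matrix (Fin 2) (Fin 2) ℂ} {C s : ℝ}
    (hA : absSum A ≤ C) (hs : 0 ≤ s) (P : Matrix (Fin 2) (Fin 2) ℂ) (v : Fin 2 → ℂ) :
    ‖(halfKernel a A s * P).mulVec v‖ ≤ (1 + C) * (1 + s) * absSum P * ‖v‖ := by
  have hC : 0 ≤ C := (absSum_nonneg A).trans hA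
  rw [← Matrix.mulVec_mulVec, halfKernel, Matrix.add_mulVec, Matrix.one_mulVec, Matrix.smul_mulVec]
  have h1 := norm_mulVec_le P v
  have h2 := norm_mulVec_le A (P.mulVec v)
  have h3 := norm_expPrimitive_le ha hs
  have h4 : ‖A.mulVec (P.mulVec v)‖ ≤ C * ‖P.mulVec v‖ :=
    h2.trans (mul_le_mul_of_nonneg_right hA (norm_nonneg _))
  calc _ ≤ ‖P.mulVec v‖ + ‖expPrimitive a s • A.mulVec (P.mulVec v)‖ := norm_add_le _ _
    _ ≤ ‖P.mulVec v‖ + s * (C * ‖P.mulVec v‖) := by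
        rw [norm_smul]
        exact add_le_add_right (mul_le_mul h3 h4 (norm_nonneg _) hs) _
    _ = (1 + s * C) * ‖P.mulVec v‖ := by ring
    _ ≤ ((1 + C) * (1 + s)) * (absSum P * ‖v‖) := by
        refine mul_le_mul ?_ h1 (norm_nonneg _) (by positivity)
        nlinarith
    _ = _ := by ring

/-- The bound for the kernel of the half-line problem. -/
def halfBound (C : ℝ) (p : ℝ → ℝ) (x : ℝ) : ℝ → ℝ :=
  (Set.Iic x).indicator fun y => C * (1 + (x - y)) * p y

theorem halfBound_nonneg {C : ℝ} (hC : 0 ≤ C) {p : ℝ → ℝ} (hp : ∀ y, 0 ≤ p y) (x y : ℝ) :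
    0 ≤ halfBound C p x y := by
  refine Set.indicator_nonneg (fun y hy => ?_) y
  have : 0 ≤ x - y := sub_nonneg.2 hy
  have := hp y
  positivity

/-- For y ≤ x the growth factor 1 + (x - y) is at most (1 + max x 0)(1 + |y|). The second factor
goes into the integrable density h, the first into the weight W(x) = (1 + max x 0) exp(2 ∫_{-∞}^x
h). Since W also occurs under the integral, h has to carry the factor 1 + max y 0 as well. -/
theorem exists_halfLine_weight {C : ℝ} (hC : 0 < C) {p : ℝ → ℝ} (hpc : Continuous p)
    (hp0 : ∀ y, 0 ≤ p y) (hpi : IntegrableOn (fun y => (1 + |y|) * p y) (Set.Iic 0)) :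
    ∃ W : ℝ → ℝ, Continuous W ∧ (∀ x, 1 ≤ W x) ∧
      (∀ x, AEStronglyMeasurable (fun y => halfBound C p x y * W y) volume) ∧
      (∀ x, ∫ y, halfBound C p x y * W y ≤ W x / 2) ∧
      ∀ x₀, ∃ g : ℝ → ℝ, Integrable g ∧ ∀ᶠ x in 𝓝 x₀, ∀ y, halfBound C p x y * W y ≤ g y := by
  set h : ℝ → ℝ := fun y => C * ((1 + max y 0) * ((1 + |y|) * p y)) with hh
  have hm1 : ∀ y : ℝ, 1 ≤ 1 + max y 0 := fun y => by linarith [le_max_right y 0]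
  have hhc : Continuous h := by fun_prop
  have hh0 : ∀ y, 0 ≤ h y := fun y => by
    have := hp0 y
    have := hm1 y
    positivity
  have hhi : ∀ x, IntegrableOn h (Set.Iic x) := by
    refine integrableOn_Iic_of_continuous hhc (x₀ := 0) ?_
    refine IntegrableOn.congr_fun (hpi.const_mul C) (fun y hy => ?_) measurableSet_Iic
    simp only [hh, max_eq_right (Set.mem_Iic.1 hy)]
    ring
  have hHd := hasDerivAt_integral_Iic hhc hhi
  have hHc : Continuous fun y => ∫ s in Set.Iic y, h s :=
    continuous_iff_continuousAt.2 fun y => (hHd y).continuousAt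
  have hH0 : ∀ x, 0 ≤ ∫ s in Set.Iic x, h s := fun x => integral_nonneg hh0
  set V : ℝ → ℝ := fun y => Real.exp (2 * ∫ s in Set.Iic y, h s) with hV
  have hVc : Continuous V := by fun_prop
  set W : ℝ → ℝ := fun y => (1 + max y 0) * V y with hW
  have hWc : Continuous W := by fun_prop
  have hW1 : ∀ x, 1 ≤ W x := fun x =>
    one_le_mul_of_one_le_of_one_le (hm1 x) (Real.one_le_exp (by linarith [hH0 x]))
  have hle : ∀ x y, y ≤ x → C * (1 + (x - y)) * p y * W y ≤ (1 + max x 0) * (h y * V y) := by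
    intro x y hyx
    have h1 : 1 + (x - y) ≤ (1 + max x 0) * (1 + |y|) := by
      have := le_max_left x 0
      have := le_max_right x 0
      have := neg_le_abs y
      have := abs_nonneg y
      nlinarith
    have h2 : 0 ≤ C * p y * W y := by
      have := hp0 y
      have := hW1 y
      positivity
    calc C * (1 + (x - y)) * p y * W y = (1 + (x - y)) * (C * p y * W y) := by ring
      _ ≤ (1 + max x 0) * (1 + |y|) * (C * p y * W y) := mul_le_mul_of_nonneg_right h1 h2
      _ = _ := by simp only [hW, hh]; ring
  have hbe : ∀ x, (fun y => halfBound C p x y * W y) =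
      (Set.Iic x).indicator fun y => C * (1 + (x - y)) * p y * W y := by
    intro x
    ext y
    by_cases hy : y ∈ Set.Iic x <;> simp [halfBound, hy]
  have key := fun x => integral_Iic_mul_exp_primitive hhc hh0 hhi two_pos x
  have hmeas : ∀ x, AEStronglyMeasurable (fun y => halfBound C p x y * W y) volume := by
    intro x
    rw [hbe]
    have : Continuous fun y => C * (1 + (x - y)) * p y * W y := by fun_prop
    exact this.aestronglyMeasurable.indicator measurableSet_Iic
  have hble : ∀ x y, halfBound C p x y * W y ≤
      (Set.Iic x).indicator (fun y => (1 + max x 0) * (h y * V y)) y := by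
    intro x y
    rw [congrFun (hbe x) y]
    exact Set.indicator_le_indicator' fun hy => hle x y hy
  have hgi : ∀ x, Integrable ((Set.Iic x).indicator (fun y => (1 + max x 0) * (h y * V y))) :=
    fun x => (integrable_indicator_iff measurableSet_Iic).2 ((key x).1.const_mul _)
  refine ⟨W, hWc, hW1, hmeas, fun x => ?_, fun x₀ => ?_⟩
  · have hi : Integrable (fun y => halfBound C p x y * W y) := by
      refine (hgi x).mono' (hmeas x) (Eventually.of_forall fun y => ?_)
      rw [Real.norm_of_nonneg (mul_nonneg (halfBound_nonneg hC.le hp0 x y)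
        (by linarith [hW1 y]))]
      exact hble x y
    calc ∫ y, halfBound C p x y * W y
        ≤ ∫ y, (Set.Iic x).indicator (fun y => (1 + max x 0) * (h y * V y)) y :=
          integral_mono hi (hgi x) (hble x)
      _ = (1 + max x 0) * ((V x - 1) / 2) := by
          rw [integral_indicator measurableSet_Iic, integral_const_mul, (key x).2]
      _ ≤ W x / 2 := by
          simp only [hW]
          nlinarith [hm1 x]
  · refine ⟨(Set.Iic (x₀ + 1)).indicator (fun y => (1 + max (x₀ + 1) 0) * (h y * V y)),
      hgi _, ?_⟩
    filter_upwards [eventually_lt_nhds (lt_add_one x₀)] with x hx y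
    refine (hble x y).trans ?_
    have h0 : ∀ y, 0 ≤ h y * V y := fun y => mul_nonneg (hh0 y) (Real.exp_pos _).le
    refine (Set.indicator_le_indicator (g := fun y => (1 + max (x₀ + 1) 0) * (h y * V y))
      ?_).trans (Set.indicator_le_indicator_of_subset (Set.Iic_subset_Iic.2 hx.le) (fun y => ?_) y)
    · exact mul_le_mul_of_nonneg_right (add_le_add_right (max_le_max_right 0 hx.le) 1) (h0 y)
    · exact mul_nonneg (by linarith [hm1 (x₀ + 1)]) (h0 y)

/-- Uniform bounds on the coefficients let one weight serve all parameters in Z. The rate may vanish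
on Z, which is how bounds near the branch points are obtained. -/
theorem exists_halfLine_solution {Z : Set ℂ} {a : ℂ → ℂ} {A : ℂ → Matrix (Fin 2) (Fin 2) ℂ}
    {e : ℂ → Fin 2 → ℂ} {P : ℝ → Matrix (Fin 2) (Fin 2) ℂ} {CA Ce : ℝ} (hPc : Continuous P)
    (hP : IntegrableOn (fun y => (1 + |y|) * absSum (P y)) (Set.Iic 0))
    (hac : ContinuousOn a Z) (hAc : ContinuousOn A Z) (hec : ContinuousOn e Z)
    (ha : ∀ z ∈ Z, (a z).im ≤ 0) (hCA : 0 ≤ CA) (hA : ∀ z ∈ Z, absSum (A z) ≤ CA)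
    (hCe : 0 ≤ Ce) (he : ∀ z ∈ Z, ‖e z‖ ≤ Ce) :
    ∃ m : ℂ → ℝ → Fin 2 → ℂ,
      ContinuousOn (fun p : ℝ × ℂ => m p.2 p.1) (Set.univ ×ˢ Z) ∧
      (∀ x, ∃ C, ∀ z ∈ Z, ‖m z x‖ ≤ C) ∧
      (∀ z ∈ Z, IsHalfLineSolution (a z) (A z) P (e z) (m z)) ∧
      (∀ U ⊆ Z, IsOpen U → DifferentiableOn ℂ a U → (∀ i j, DifferentiableOn ℂ (fun z => A z i j) U) →
        DifferentiableOn ℂ e U → ∀ x, DifferentiableOn ℂ (fun z => m z x) U) := by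
  have hpc : Continuous fun y => absSum (P y) := continuous_absSum.comp hPc
  obtain ⟨W, hWc, hW1, hmeas, hbW, hdom⟩ := exists_halfLine_weight (C := 1 + CA) (by positivity)
    hpc (fun y => absSum_nonneg _) hP
  set k : ℂ → ℝ → ℝ → Matrix (Fin 2) (Fin 2) ℂ := fun z x =>
    (Set.Iic x).indicator fun y => halfKernel (a z) (A z) (x - y) * P y with hk
  have hkb : ∀ z ∈ Z, ∀ x y v, ‖(k z x y).mulVec v‖ ≤
      halfBound (1 + CA) (fun y => absSum (P y)) x y * ‖v‖ := by
    intro z hz x y v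
    by_cases hy : y ∈ Set.Iic x
    · simp only [hk, halfBound, Set.indicator_of_mem hy]
      exact norm_halfKernel_mulVec_le (ha z hz) (hA z hz) (sub_nonneg.2 hy) _ _
    · simp [hk, halfBound, Set.indicator_of_notMem hy]
  have hkc : ∀ z x, Continuous fun y => halfKernel (a z) (A z) (x - y) * P y := by
    intro z x
    have h1 : Continuous fun y : ℝ => expPrimitive (a z) (x - y) :=
      continuous_expPrimitive.comp (by fun_prop : Continuous fun y : ℝ => (a z, x - y))
    unfold halfKernel
    exact (continuous_const.add (h1.smul continuous_const)).mul hPc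
  obtain ⟨m, hm1, hm2, hm3, hm4⟩ := exists_volterra_solution (Z := Z) (k := k) (e := e) (W := W)
    (b := halfBound (1 + CA) fun y => absSum (P y)) (C := Ce) hCe hec
    (fun z hz x => (he z hz).trans (le_mul_of_one_le_right hCe (hW1 x)))
    (fun x => by linarith [hW1 x])
    (halfBound_nonneg (by positivity) fun y => absSum_nonneg _) hkb
    (fun z _ x => (aestronglyMeasurable_matrix (hkc z x)).indicator measurableSet_Iic)
    (by
      intro z hz x
      have hx : ∀ᵐ y : ℝ, y ≠ x := by simp [ae_iff, measure_singleton]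
      filter_upwards [hx] with y hyx
      rcases lt_or_gt_of_ne hyx with h | h
      · have h1 : ContinuousOn (fun p : ℝ × ℂ => halfKernel (a p.2) (A p.2) (p.1 - y) * P y)
            (Set.univ ×ˢ Z) := by
          have c1 : ContinuousOn (fun p : ℝ × ℂ => a p.2) (Set.univ ×ˢ Z) :=
            hac.comp continuousOn_snd fun p hp => hp.2
          have c2 : ContinuousOn (fun p : ℝ × ℂ => A p.2) (Set.univ ×ˢ Z) :=
            hAc.comp continuousOn_snd fun p hp => hp.2
          have c3 : ContinuousOn (fun p : ℝ × ℂ => expPrimitive (a p.2) (p.1 - y))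
              (Set.univ ×ˢ Z) :=
            continuous_expPrimitive.comp_continuousOn
              (f := fun p : ℝ × ℂ => (a p.2, p.1 - y)) (c1.prodMk (by fun_prop))
          unfold halfKernel
          exact (continuousOn_const.add (c3.smul c2)).mul continuousOn_const
        refine (h1 (x, z) ⟨trivial, hz⟩).congr_of_eventuallyEq ?_ ?_
        · have : ∀ᶠ p : ℝ × ℂ in 𝓝[Set.univ ×ˢ Z] (x, z), y < p.1 :=
            (continuous_fst.tendsto (x, z)).mono_left nhdsWithin_le_nhds (eventually_gt_nhds h)
          filter_upwards [this] with p hp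
          simp only [hk, Set.indicator_of_mem (show y ∈ Set.Iic p.1 from hp.le)]
        · simp only [hk, Set.indicator_of_mem (show y ∈ Set.Iic x from h.le)]
      · refine (continuousWithinAt_const (b := (0 : Matrix (Fin 2) (Fin 2) ℂ))).congr_of_eventuallyEq
          ?_ ?_
        · have : ∀ᶠ p : ℝ × ℂ in 𝓝[Set.univ ×ˢ Z] (x, z), p.1 < y :=
            (continuous_fst.tendsto (x, z)).mono_left nhdsWithin_le_nhds (eventually_lt_nhds h)
          filter_upwards [this] with p hp
          simp only [hk, Set.indicator_of_notMem (show y ∉ Set.Iic p.1 from not_le.2 hp)]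
        · simp only [hk, Set.indicator_of_notMem (show y ∉ Set.Iic x from not_le.2 h)])
    hbW hdom hmeas
  have hcont : ∀ z ∈ Z, Continuous (m z) := fun z hz =>
    hm1.comp_continuous (f := fun x : ℝ => (x, z)) (by fun_prop) fun x => ⟨trivial, hz⟩
  have hkI : ∀ z x, ∫ y, (k z x y).mulVec (m z y) =
      ∫ y in Set.Iic x, (halfKernel (a z) (A z) (x - y)).mulVec ((P y).mulVec (m z y)) := by
    intro z x
    rw [← integral_indicator measurableSet_Iic]
    refine integral_congr_ae (Eventually.of_forall fun y => ?_)
    by_cases hy : y ∈ Set.Iic x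
    · simp only [hk, Set.indicator_of_mem hy, Matrix.mulVec_mulVec]
    · simp only [hk, Set.indicator_of_notMem hy, Matrix.zero_mulVec]
  refine ⟨m, hm1, fun x => ⟨2 * Ce * W x, fun z hz => hm2 z hz x⟩, fun z hz =>
    ⟨hcont z hz, ?_, fun x => by rw [← hkI]; exact hm3 z hz x⟩, fun U hUZ hU hau hAu heu x =>
    hm4 U hUZ hU heu (fun x y i j => ?_) x⟩
  -- For y ≤ x ≤ 0 the kernel bound at x is at most the one at 0. The deviation from e is thus
  -- bounded by the tail of one fixed convergent integral.
  · obtain ⟨g, hg, hgx⟩ := hdom 0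
    set w : ℝ → ℝ := fun x => 2 * Ce * ∫ y in Set.Iic x, (fun y => halfBound (1 + CA)
      (fun y => absSum (P y)) 0 y * W y) y with hw
    have hib : Integrable fun y => halfBound (1 + CA) (fun y => absSum (P y)) 0 y * W y := by
      refine hg.mono' (hmeas 0) (Eventually.of_forall fun y => ?_)
      rw [Real.norm_of_nonneg (mul_nonneg (halfBound_nonneg (by positivity)
        (fun y => absSum_nonneg _) 0 y) (by linarith [hW1 y]))]
      exact hgx.self_of_nhds y
    have hw0 : Tendsto w atBot (𝓝 0) := by
      have := (tendsto_integral_Iic (fun x => hib.integrableOn (s := Set.Iic x))).const_mul (2 * Ce)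
      rwa [mul_zero] at this
    rw [tendsto_iff_norm_sub_tendsto_zero]
    refine squeeze_zero' (Eventually.of_forall fun x => norm_nonneg _) ?_ hw0
    filter_upwards [eventually_le_atBot 0] with x hx
    rw [hm3 z hz x, add_sub_cancel_left, hw]
    simp only
    rw [← integral_const_mul, ← integral_indicator measurableSet_Iic]
    refine norm_integral_le_of_norm_le ?_ (Eventually.of_forall fun y => ?_)
    · exact (integrable_indicator_iff measurableSet_Iic).2 (hib.integrableOn.const_mul _)
    · by_cases hy : y ∈ Set.Iic x
      · rw [Set.indicator_of_mem hy]
        have h1 := hkb z hz x y (m z y)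
        have h2 := hm2 z hz y
        have hy0 : y ∈ Set.Iic (0 : ℝ) := (Set.mem_Iic.1 hy).trans hx
        have h3 : halfBound (1 + CA) (fun y => absSum (P y)) x y ≤
            halfBound (1 + CA) (fun y => absSum (P y)) 0 y := by
          simp only [halfBound, Set.indicator_of_mem hy, Set.indicator_of_mem hy0]
          refine mul_le_mul_of_nonneg_right ?_ (absSum_nonneg _)
          exact mul_le_mul_of_nonneg_left (by linarith) (by positivity)
        have h4 := halfBound_nonneg (C := 1 + CA) (by positivity)
          (fun y => absSum_nonneg (P y)) 0 y
        calc _ ≤ _ := h1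
          _ ≤ halfBound (1 + CA) (fun y => absSum (P y)) 0 y * (2 * Ce * W y) :=
            mul_le_mul h3 h2 (norm_nonneg _) h4
          _ = _ := by ring
      · rw [Set.indicator_of_notMem hy]
        simp [hk, Set.indicator_of_notMem hy]
  · by_cases hy : y ∈ Set.Iic x
    · simp only [hk, Set.indicator_of_mem hy, Matrix.mul_apply, halfKernel, Matrix.add_apply,
        Matrix.smul_apply, smul_eq_mul]
      refine DifferentiableOn.fun_sum fun l _ => DifferentiableOn.mul_const ?_ _
      refine (differentiableOn_const _).add (DifferentiableOn.mul ?_ (hAu i l))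
      exact (differentiable_expPrimitive (x - y)).comp_differentiableOn hau
    · simp only [hk, Set.indicator_of_notMem hy]
      exact differentiableOn_const _

/-- The limit at -∞ makes the difference of two solutions bounded on each (-∞, X]. It solves the
homogeneous equation, and n iterations improve the bound to C 2^{-n} W. -/
theorem IsHalfLineSolution.unique {a : ℂ} {A : Matrix (Fin 2) (Fin 2) ℂ}
    {P : ℝ → Matrix (Fin 2) (Fin 2) ℂ} {e : Fin 2 → ℂ} {m m' : ℝ → Fin 2 → ℂ} (ha : a.im ≤ 0)
    (hPc : Continuous P) (hP : IntegrableOn (fun y => (1 + |y|) * absSum (P y)) (Set.Iic 0))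
    (h : IsHalfLineSolution a A P e m) (h' : IsHalfLineSolution a A P e m') : m = m' := by
  have hpc : Continuous fun y => absSum (P y) := continuous_absSum.comp hPc
  have hCA := absSum_nonneg A
  obtain ⟨W, hWc, hW1, hmeas, hbW, hdom⟩ := exists_halfLine_weight (C := 1 + absSum A)
    (by positivity) hpc (fun y => absSum_nonneg _) hP
  have hbi : ∀ x, Integrable fun y => halfBound (1 + absSum A) (fun y => absSum (P y)) x y * W y := by
    intro x
    obtain ⟨g, hg, hgx⟩ := hdom x
    refine hg.mono' (hmeas x) (Eventually.of_forall fun y => ?_)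
    rw [Real.norm_of_nonneg (mul_nonneg (halfBound_nonneg (by positivity)
      (fun y => absSum_nonneg _) x y) (by linarith [hW1 y]))]
    exact hgx.self_of_nhds y
  set k : ℝ → ℝ → Matrix (Fin 2) (Fin 2) ℂ := fun x =>
    (Set.Iic x).indicator fun y => halfKernel a A (x - y) * P y with hk
  have hkb : ∀ x y v, ‖(k x y).mulVec v‖ ≤
      halfBound (1 + absSum A) (fun y => absSum (P y)) x y * ‖v‖ := by
    intro x y v
    by_cases hy : y ∈ Set.Iic x
    · simp only [hk, halfBound, Set.indicator_of_mem hy]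
      exact norm_halfKernel_mulVec_le ha le_rfl (sub_nonneg.2 hy) _ _
    · simp [hk, halfBound, Set.indicator_of_notMem hy]
  have hkc : ∀ x, Continuous fun y => halfKernel a A (x - y) * P y := by
    intro x
    have h1 : Continuous fun y : ℝ => expPrimitive a (x - y) :=
      continuous_expPrimitive.comp (by fun_prop : Continuous fun y : ℝ => (a, x - y))
    unfold halfKernel
    exact (continuous_const.add (h1.smul continuous_const)).mul hPc
  have hkI : ∀ (f : ℝ → Fin 2 → ℂ) x, ∫ y, (k x y).mulVec (f y) =
      ∫ y in Set.Iic x, (halfKernel a A (x - y)).mulVec ((P y).mulVec (f y)) := by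
    intro f x
    rw [← integral_indicator measurableSet_Iic]
    refine integral_congr_ae (Eventually.of_forall fun y => ?_)
    by_cases hy : y ∈ Set.Iic x
    · simp only [hk, Set.indicator_of_mem hy, Matrix.mulVec_mulVec]
    · simp only [hk, Set.indicator_of_notMem hy, Matrix.zero_mulVec]
  have hint : ∀ f : ℝ → Fin 2 → ℂ, Continuous f → Tendsto f atBot (𝓝 e) → ∀ x,
      Integrable fun y => (k x y).mulVec (f y) := by
    intro f hf hfl x
    obtain ⟨C, hC⟩ := exists_bound_Iic hf hfl x
    have hC0 : 0 ≤ C := (norm_nonneg _).trans (hC x le_rfl)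
    refine ((hbi x).const_mul C).mono' ?_ (Eventually.of_forall fun y => ?_)
    · exact aestronglyMeasurable_mulVec
        ((aestronglyMeasurable_matrix (hkc x)).indicator measurableSet_Iic) hf.aestronglyMeasurable
    · by_cases hy : y ∈ Set.Iic x
      · have h4 := halfBound_nonneg (C := 1 + absSum A) (by positivity)
          (fun y => absSum_nonneg (P y)) x y
        calc _ ≤ _ := hkb x y (f y)
          _ ≤ halfBound (1 + absSum A) (fun y => absSum (P y)) x y * (C * W y) :=
            mul_le_mul_of_nonneg_left ((hC y hy).trans (le_mul_of_one_le_right hC0 (hW1 y))) h4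
          _ = _ := by ring
      · simp [hk, halfBound, Set.indicator_of_notMem hy]
  have hd : ∀ x, m x - m' x = ∫ y, (k x y).mulVec (m y - m' y) := by
    intro x
    simp_rw [Matrix.mulVec_sub]
    rw [integral_sub (hint m h.1 h.2.1 x) (hint m' h'.1 h'.2.1 x), hkI, hkI, h.2.2 x, h'.2.2 x]
    abel
  funext X
  obtain ⟨C, hC⟩ := exists_bound_Iic (h.1.sub h'.1) (h.2.1.sub h'.2.1) X
  have hC0 : 0 ≤ C := (norm_nonneg _).trans (hC X le_rfl)
  have hn : ∀ n : ℕ, ∀ x ≤ X, ‖m x - m' x‖ ≤ C * (1 / 2) ^ n * W x := by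
    intro n
    induction n with
    | zero =>
      intro x hx
      simpa using (hC x hx).trans (le_mul_of_one_le_right hC0 (hW1 x))
    | succ n ih =>
      intro x hx
      rw [hd x]
      have : ‖∫ y, (k x y).mulVec (m y - m' y)‖ ≤
          ∫ y, C * (1 / 2) ^ n * (halfBound (1 + absSum A) (fun y => absSum (P y)) x y * W y) := by
        refine norm_integral_le_of_norm_le ((hbi x).const_mul _) (Eventually.of_forall fun y => ?_)
        by_cases hy : y ∈ Set.Iic x
        · have h4 := halfBound_nonneg (C := 1 + absSum A) (by positivity)
            (fun y => absSum_nonneg (P y)) x y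
          calc _ ≤ _ := hkb x y _
            _ ≤ halfBound (1 + absSum A) (fun y => absSum (P y)) x y * (C * (1 / 2) ^ n * W y) :=
              mul_le_mul_of_nonneg_left (ih y ((Set.mem_Iic.1 hy).trans hx)) h4
            _ = _ := by ring
        · simp [hk, halfBound, Set.indicator_of_notMem hy]
      rw [integral_const_mul] at this
      calc _ ≤ _ := this
        _ ≤ C * (1 / 2) ^ n * (W x / 2) := mul_le_mul_of_nonneg_left (hbW x) (by positivity)
        _ = _ := by ring
  have hlim : Tendsto (fun n : ℕ => C * (1 / 2 : ℝ) ^ n * W X) atTop (𝓝 0) := by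
    have := (tendsto_pow_atTop_nhds_zero_of_lt_one (r := (1 / 2 : ℝ)) (by norm_num)
      (by norm_num)).const_mul C |>.mul_const (W X)
    simpa using this
  have := ge_of_tendsto' hlim fun n => hn n X le_rfl
  exact sub_eq_zero.1 (norm_le_zero_iff.1 this)

end

section

/-! ### The differential equation -/

theorem hasDerivAt_mulVec_const {M : Matrix (Fin 2) (Fin 2) ℂ} {f : ℝ → Fin 2 → ℂ} {f' : Fin 2 → ℂ}
    {x : ℝ} (hf : HasDerivAt f f' x) : HasDerivAt (fun y => M.mulVec (f y)) (M.mulVec f') x :=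
  ((LinearMap.toContinuousLinearMap M.mulVecLin).restrictScalars ℝ).hasFDerivAt.comp_hasDerivAt x hf

/-- For a ≠ 0 the kernel is a constant plus a product of a function of x and a function of y. The
integral operator can then be differentiated by the fundamental theorem of calculus. -/
theorem halfKernel_eq {a : ℂ} (ha : a ≠ 0) (A : Matrix (Fin 2) (Fin 2) ℂ) (x y : ℝ) :
    halfKernel a A (x - y) = (1 + (2 * Complex.I * a)⁻¹ • A) -
      (Complex.exp (-(2 * Complex.I * a * x)) * Complex.exp (2 * Complex.I * a * y)) •
        ((2 * Complex.I * a)⁻¹ • A) := by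
  rw [halfKernel, expPrimitive_of_ne ha, ← Complex.exp_add, smul_smul, add_sub_assoc, ← sub_smul]
  congr 2
  have : -(2 * Complex.I * a * ((x - y : ℝ) : ℂ)) = -(2 * Complex.I * a * x) + 2 * Complex.I * a * y := by
    push_cast
    ring
  rw [this]
  ring

theorem hasDerivAt_cexp_mul (c : ℂ) (x : ℝ) :
    HasDerivAt (fun y : ℝ => Complex.exp (c * y)) (c * Complex.exp (c * x)) x := by
  have h1 : HasDerivAt (fun y : ℂ => Complex.exp (c * y)) (Complex.exp (c * x) * (c * 1)) (x : ℂ) :=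
    ((hasDerivAt_id (x : ℂ)).const_mul c).cexp
  have := h1.comp_ofReal
  rwa [mul_one, mul_comm] at this

theorem norm_cexp_two_I_mul_le {a : ℂ} (ha : a.im ≤ 0) {x y : ℝ} (hxy : y ≤ x) :
    ‖Complex.exp (2 * Complex.I * a * y)‖ ≤ Real.exp (-2 * a.im * x) := by
  rw [Complex.norm_exp]
  refine Real.exp_le_exp.2 ?_
  have : (2 * Complex.I * a * y).re = -2 * a.im * y := by simp
  rw [this]
  nlinarith

section

variable {a : ℂ} {A : Matrix (Fin 2) (Fin 2) ℂ} {P : ℝ → Matrix (Fin 2) (Fin 2) ℂ} {e : Fin 2 → ℂ}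
  {m : ℝ → Fin 2 → ℂ}

theorem integrableOn_mulVec_of_tendsto (hPc : Continuous P)
    (hP : ∀ x, IntegrableOn (fun y => absSum (P y)) (Set.Iic x)) (hm : Continuous m)
    (hl : Tendsto m atBot (𝓝 e)) (x : ℝ) :
    IntegrableOn (fun y => (P y).mulVec (m y)) (Set.Iic x) := by
  obtain ⟨C, hC⟩ := exists_bound_Iic hm hl x
  refine ((hP x).mul_const C).mono' (by fun_prop : Continuous fun y =>
    (P y).mulVec (m y)).aestronglyMeasurable ?_
  refine (ae_restrict_iff' measurableSet_Iic).2 (Eventually.of_forall fun y hy => ?_)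
  exact (norm_mulVec_le _ _).trans (mul_le_mul_of_nonneg_left (hC y hy) (absSum_nonneg _))

theorem integrableOn_cexp_smul {f : ℝ → Fin 2 → ℂ} (ha : a.im ≤ 0) (hf : Continuous f)
    (hi : ∀ x, IntegrableOn f (Set.Iic x)) (x : ℝ) :
    IntegrableOn (fun y : ℝ => Complex.exp (2 * Complex.I * a * y) • f y) (Set.Iic x) := by
  refine ((hi x).norm.const_mul (Real.exp (-2 * a.im * x))).mono'
    (by fun_prop : Continuous fun y : ℝ =>
      Complex.exp (2 * Complex.I * a * y) • f y).aestronglyMeasurable ?_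
  refine (ae_restrict_iff' measurableSet_Iic).2 (Eventually.of_forall fun y hy => ?_)
  rw [norm_smul]
  exact mul_le_mul_of_nonneg_right (norm_cexp_two_I_mul_le ha hy) (norm_nonneg _)

theorem integral_halfKernel (ha0 : a ≠ 0) (ha : a.im ≤ 0) {f : ℝ → Fin 2 → ℂ} (hf : Continuous f)
    (hi : ∀ x, IntegrableOn f (Set.Iic x)) (x : ℝ) :
    ∫ y in Set.Iic x, (halfKernel a A (x - y)).mulVec (f y) =
      (1 + (2 * Complex.I * a)⁻¹ • A).mulVec (∫ y in Set.Iic x, f y) -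
      Complex.exp (-(2 * Complex.I * a) * x) • ((2 * Complex.I * a)⁻¹ • A).mulVec
        (∫ y in Set.Iic x, Complex.exp (2 * Complex.I * a * y) • f y) := by
  have hi2 := integrableOn_cexp_smul ha hf hi x
  have hi3 : IntegrableOn (fun y : ℝ => Complex.exp (-(2 * Complex.I * a) * x) •
      ((2 * Complex.I * a)⁻¹ • A).mulVec (Complex.exp (2 * Complex.I * a * y) • f y)) (Set.Iic x) :=
    Integrable.smul (Complex.exp (-(2 * Complex.I * a) * x))
      (integrable_mulVec ((2 * Complex.I * a)⁻¹ • A) hi2)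
  rw [← integral_mulVec _ (hi x), ← integral_mulVec _ hi2, ← integral_smul, ← integral_sub
    (integrable_mulVec _ (hi x)) hi3]
  congr 1 with y : 1
  rw [halfKernel_eq ha0, Matrix.sub_mulVec, Matrix.smul_mulVec, Matrix.mulVec_smul, smul_smul,
    neg_mul]

/-- The half-line integral equation is equivalent to a differential equation. -/
theorem isHalfLineSolution_iff (ha0 : a ≠ 0) (ha : a.im ≤ 0) (hA : A * A = -(2 * Complex.I * a) • A)
    (hAe : A.mulVec e = 0) (hPc : Continuous P)
    (hP : ∀ x, IntegrableOn (fun y => absSum (P y)) (Set.Iic x)) :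
    IsHalfLineSolution a A P e m ↔
      Tendsto m atBot (𝓝 e) ∧ ∀ x, HasDerivAt m ((P x + A).mulVec (m x)) x := by
  set c := 2 * Complex.I * a with hc
  have hc0 : c ≠ 0 := by simp [hc, ha0]
  -- The hypothesis on A² gives N² = -N, so -N and 1 + N are complementary projections. The
  -- component along 1 + N feels no exponential, the one along N carries the factor e^{-cx}, and e
  -- lies in the kernel of N.
  set N := c⁻¹ • A with hN
  have hAN : A = c • N := by rw [hN, smul_smul, mul_inv_cancel₀ hc0, one_smul]
  have hNN : N * N = -N := by
    rw [hN, Matrix.smul_mul, Matrix.mul_smul, hA, smul_smul, smul_smul, ← neg_smul]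
    congr 1
    field_simp
  have hNe : N.mulVec e = 0 := by rw [hN, Matrix.smul_mulVec, hAe, smul_zero]
  have hNNv : ∀ v, N.mulVec (N.mulVec v) = -N.mulVec v := fun v => by
    rw [Matrix.mulVec_mulVec, hNN, Matrix.neg_mulVec]
  constructor
  · rintro ⟨hmc, hml, hm⟩
    refine ⟨hml, fun x => ?_⟩
    set f : ℝ → Fin 2 → ℂ := fun y => (P y).mulVec (m y) with hf
    have hfc : Continuous f := by fun_prop
    have hfi := integrableOn_mulVec_of_tendsto hPc hP hmc hml
    have hgi := integrableOn_cexp_smul ha hfc hfi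
    have hgc : Continuous fun y : ℝ => Complex.exp (c * y) • f y := by fun_prop
    set Y₁ : ℝ → Fin 2 → ℂ := fun x => ∫ y in Set.Iic x, f y with hY₁
    set Y₂ : ℝ → Fin 2 → ℂ := fun x => ∫ y in Set.Iic x, Complex.exp (c * y) • f y with hY₂
    have hform : m = fun x : ℝ => e + ((1 + N).mulVec (Y₁ x) -
        Complex.exp (-c * x) • N.mulVec (Y₂ x)) := by
      ext1 x
      rw [hm x, integral_halfKernel ha0 ha hfc hfi]
    have h1 : HasDerivAt Y₁ (f x) x := hasDerivAt_integral_Iic hfc hfi x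
    have h2 : HasDerivAt Y₂ (Complex.exp (c * x) • f x) x := hasDerivAt_integral_Iic hgc hgi x
    have hd := ((hasDerivAt_mulVec_const (M := 1 + N) h1).fun_sub
      ((hasDerivAt_cexp_mul (-c) x).fun_smul (hasDerivAt_mulVec_const (M := N) h2))).const_add e
    have hE : Complex.exp (-c * x) * Complex.exp (c * x) = 1 := by
      rw [← Complex.exp_add]
      simp
    have hval : (P x + A).mulVec (m x) = (1 + N).mulVec (f x) -
        (Complex.exp (-c * x) • N.mulVec (Complex.exp (c * x) • f x) +
          (-c * Complex.exp (-c * x)) • N.mulVec (Y₂ x)) := by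
      have h3 : A.mulVec (m x) = (c * Complex.exp (-c * x)) • N.mulVec (Y₂ x) := by
        rw [congrFun hform x, hAN, Matrix.smul_mulVec, Matrix.mulVec_add, hNe, Matrix.mulVec_sub,
          Matrix.add_mulVec, Matrix.one_mulVec, Matrix.mulVec_add, hNNv, Matrix.mulVec_smul, hNNv,
          add_neg_cancel, zero_add, zero_sub, smul_neg, smul_neg, smul_neg, neg_neg, smul_smul]
      rw [Matrix.add_mulVec, h3, Matrix.mulVec_smul, smul_smul, hE, Matrix.add_mulVec,
        Matrix.one_mulVec]
      simp only [one_smul, neg_mul, neg_smul]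
      abel
    rw [hval, hform]
    exact hd
  · rintro ⟨hml, hm⟩
    have hmc : Continuous m := continuous_iff_continuousAt.2 fun x => (hm x).continuousAt
    refine ⟨hmc, hml, fun x => ?_⟩
    set f : ℝ → Fin 2 → ℂ := fun y => (P y).mulVec (m y) with hf
    have hfc : Continuous f := by fun_prop
    have hfi := integrableOn_mulVec_of_tendsto hPc hP hmc hml
    have hgi := integrableOn_cexp_smul ha hfc hfi
    have hmcont : ∀ M : Matrix (Fin 2) (Fin 2) ℂ, Continuous fun v : Fin 2 → ℂ => M.mulVec v :=
      fun M => by fun_prop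
    -- Applying 1 + N kills the term A m, and multiplying N m by e^{cy} absorbs it. Each projected
    -- equation is then integrated from -∞, and m is recovered as (1 + N) m - N m.
    have e1 : ∫ y in Set.Iic x, (1 + N).mulVec (f y) = (1 + N).mulVec (m x) - e := by
      refine integral_Iic_of_hasDerivAt_of_tendsto' (f := fun y => (1 + N).mulVec (m y))
        (fun y _ => ?_) (integrable_mulVec _ (hfi x)) ?_
      · refine (hasDerivAt_mulVec_const (M := 1 + N) (hm y)).congr_deriv ?_
        rw [Matrix.add_mulVec (P y), Matrix.mulVec_add, hAN, Matrix.smul_mulVec c N, Matrix.mulVec_smul,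
          Matrix.add_mulVec 1 N (N.mulVec (m y)), hNNv, Matrix.one_mulVec, add_neg_cancel, smul_zero,
          add_zero]
      · have := ((hmcont (1 + N)).tendsto e).comp hml
        rwa [Matrix.add_mulVec, hNe, Matrix.one_mulVec, add_zero] at this
    have e2 : ∫ y in Set.Iic x, N.mulVec (Complex.exp (c * y) • f y) =
        Complex.exp (c * x) • N.mulVec (m x) - 0 := by
      refine integral_Iic_of_hasDerivAt_of_tendsto'
        (f := fun y : ℝ => Complex.exp (c * y) • N.mulVec (m y)) (fun y _ => ?_)
        (integrable_mulVec _ (hgi x)) ?_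
      · refine ((hasDerivAt_cexp_mul c y).fun_smul
          (hasDerivAt_mulVec_const (M := N) (hm y))).congr_deriv ?_
        rw [Matrix.add_mulVec (P y), Matrix.mulVec_add, hAN, Matrix.smul_mulVec c N, Matrix.mulVec_smul,
          hNNv, smul_add, smul_neg, smul_neg, smul_smul, mul_comm c]
        simp only [hf, Matrix.mulVec_smul]
        module
      · have h1 : Tendsto (fun y => N.mulVec (m y)) atBot (𝓝 0) := by
          rw [← hNe]
          exact ((hmcont N).tendsto e).comp hml
        refine squeeze_zero_norm' (a := fun y => Real.exp (-2 * a.im * 0) * ‖N.mulVec (m y)‖) ?_ ?_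
        · filter_upwards [eventually_le_atBot 0] with y hy
          rw [norm_smul]
          exact mul_le_mul_of_nonneg_right (norm_cexp_two_I_mul_le ha hy) (norm_nonneg _)
        · simpa using h1.norm
    have hE : Complex.exp (-c * x) * Complex.exp (c * x) = 1 := by
      rw [← Complex.exp_add]
      simp
    rw [integral_mulVec _ (hfi x)] at e1
    rw [integral_mulVec _ (hgi x), sub_zero] at e2
    rw [integral_halfKernel ha0 ha hfc hfi, e1, e2, smul_smul, hE, one_smul, Matrix.add_mulVec,
      Matrix.one_mulVec]
    abel

end

end

section

/-! ### The Jost integral equation as a half-line problem -/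

/-- The sign that turns an end of the line into `- ∞`. -/
def Side.sgn : Side → ℝ
  | .plus => -1
  | .minus => 1

theorem Side.sgn_mul_self (e : Side) : e.sgn * e.sgn = 1 := by cases e <;> simp [Side.sgn]

theorem Side.tendsto_sgn_mul (e : Side) : Tendsto (fun x => e.sgn * x) atBot e.filter := by
  cases e
  · simpa [Side.sgn, Side.filter] using tendsto_neg_atBot_atTop
  · simp only [Side.sgn, one_mul]
    exact tendsto_id

theorem Side.tendsto_sgn_mul' (e : Side) : Tendsto (fun x => e.sgn * x) e.filter atBot := by
  cases e
  · simpa [Side.sgn, Side.filter] using tendsto_neg_atTop_atBot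
  · simp only [Side.sgn, one_mul]
    exact tendsto_id

theorem colSign_mul_self (j : Fin 2) : colSign j * colSign j = 1 := by
  fin_cases j <;> simp [colSign]

variable (B : Background)

theorem Background.bv_sq (e : Side) : B.bv e ^ 2 = B.q0 ^ 2 := by
  rcases B.delta_eq with h | h <;> cases e <;>
    simp [Background.bv, Background.q0, Background.qp, h, sq_abs]

theorem Background.bv_sq_complex (e : Side) : (B.bv e : ℂ) ^ 2 = (B.q0 : ℂ) ^ 2 := by
  exact_mod_cast B.bv_sq e

theorem Background.q0_ne : (B.q0 : ℂ) ≠ 0 := Complex.ofReal_ne_zero.2 B.q0_pos.ne'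

theorem kz_add_lam (z : ℂ) : kz B z + lam B z = z := by
  rw [kz, lam]
  ring

theorem kz_sub_lam (z : ℂ) : kz B z - lam B z = B.κ * B.q0 ^ 2 / z := by
  rw [kz, lam]
  ring

theorem kz_sq_sub_lam_sq {z : ℂ} (hz : z ≠ 0) : kz B z ^ 2 - lam B z ^ 2 = B.κ * B.q0 ^ 2 := by
  rw [sq_sub_sq, kz_add_lam, kz_sub_lam]
  field_simp

theorem mem_branchPoints_iff {z : ℂ} (hz : z ≠ 0) : z ∈ branchPoints B ↔ lam B z = 0 := by
  rw [lam, div_eq_zero_iff, or_iff_left (two_ne_zero), sub_eq_zero, eq_div_iff hz, ← sq]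
  rfl

theorem limX_mul_eigE (e : Side) {z : ℂ} (hz : z ≠ 0) :
    limX B e z * eigE B e z = (Complex.I * lam B z) • (eigE B e z * pauli3) := by
  have h1 := kz_sub_lam B z
  have h2 := kz_add_lam B z
  have h3 := B.bv_sq_complex e
  have hI := Complex.I_sq
  have hk : kz B z = (z + B.κ * B.q0 ^ 2 / z) / 2 := rfl
  have hl : lam B z = (z - B.κ * B.q0 ^ 2 / z) / 2 := rfl
  ext i j
  fin_cases i <;> fin_cases j <;>
    simp [limX, eigE, limQ, pauli3, Matrix.mul_apply, Fin.sum_univ_two, hk, hl] <;>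
    field_simp <;> ring_nf <;> simp only [hI, h3] <;> ring

theorem limX_mul_limX (e : Side) {z : ℂ} (hz : z ≠ 0) :
    limX B e z * limX B e z = -(lam B z ^ 2) • (1 : Matrix (Fin 2) (Fin 2) ℂ) := by
  have h1 := kz_sq_sub_lam_sq B hz
  have h3 := B.bv_sq_complex e
  have hI := Complex.I_sq
  ext i j
  fin_cases i <;> fin_cases j <;>
    simp [limX, limQ, pauli3, Matrix.mul_apply, Fin.sum_univ_two] <;>
    first | (ring; done) | linear_combination (-1 : ℂ) * h1 + B.κ * h3 + kz B z ^ 2 * hI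

/-- The rate `± c_j λ` of the half-line problem for the `j`-th column at an end. -/
def jostRate (e : Side) (j : Fin 2) (z : ℂ) : ℂ := e.sgn * (colSign j * lam B z)

/-- The constant matrix in the half-line problem for the `j`-th column at an end. -/
def jostMat (e : Side) (j : Fin 2) (z : ℂ) : Matrix (Fin 2) (Fin 2) ℂ :=
  (e.sgn : ℂ) • (limX B e z - (Complex.I * (colSign j * lam B z)) • 1)

/-- The perturbation in the half-line problem at an end. -/
def jostPot (q : ℝ → ℝ → ℝ) (e : Side) (t y : ℝ) : Matrix (Fin 2) (Fin 2) ℂ :=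
  (e.sgn : ℂ) • (potQ B q (e.sgn * y) t - limQ B e)

/-- The matrix of the spatial part of the Lax pair. -/
def laxX (q : ℝ → ℝ → ℝ) (x t : ℝ) (z : ℂ) : Matrix (Fin 2) (Fin 2) ℂ :=
  (Complex.I * kz B z) • pauli3 + potQ B q x t

/-- The part of the plane in which the `j`-th column at an end is defined. -/
def jostRegion (e : Side) (j : Fin 2) : Set ℂ := {z | z ≠ 0 ∧ (jostRate B e j z).im ≤ 0}

/-- The `j`-th column of `E_±`. -/
def eigCol (e : Side) (j : Fin 2) (z : ℂ) : Fin 2 → ℂ := fun i => eigE B e z i j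

variable {B}

theorem sgn_mul_self_complex (e : Side) : (e.sgn : ℂ) * e.sgn = 1 := by
  exact_mod_cast e.sgn_mul_self

/-- Since X² = -λ² and c_j² = 1, the factors X - i c_j λ and X + i c_j λ annihilate each other. This
is the quadratic relation under which the half-line equation is equivalent to an ODE. -/
theorem jostMat_mul_self (e : Side) (j : Fin 2) {z : ℂ} (hz : z ≠ 0) :
    jostMat B e j z * jostMat B e j z = -(2 * Complex.I * jostRate B e j z) • jostMat B e j z := by
  have h := limX_mul_limX B e hz
  have hc := colSign_mul_self j
  have hs := sgn_mul_self_complex e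
  have hI := Complex.I_sq
  set l := lam B z
  set c := colSign j
  set X := limX B e z
  have e1 : (X - (Complex.I * (c * l)) • 1) * (X - (Complex.I * (c * l)) • 1) =
      -(2 * Complex.I * (c * l)) • (X - (Complex.I * (c * l)) • (1 : Matrix (Fin 2) (Fin 2) ℂ)) := by
    rw [sub_mul, mul_sub, mul_sub, h]
    simp only [Matrix.smul_mul, Matrix.mul_smul, Matrix.mul_one, Matrix.one_mul, smul_sub, smul_smul]
    have e2 : Complex.I * (c * l) * (Complex.I * (c * l)) = -(l ^ 2) := by
      linear_combination c * c * l ^ 2 * hI - l ^ 2 * hc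
    have e3 : -(2 * Complex.I * (c * l)) * (Complex.I * (c * l)) = 2 * l ^ 2 := by
      linear_combination (-2) * c * c * l ^ 2 * hI + 2 * l ^ 2 * hc
    rw [e2, e3]
    module
  rw [jostMat, jostRate, Matrix.smul_mul, Matrix.mul_smul, e1, smul_smul, smul_smul, smul_smul]
  congr 1
  ring

theorem jostMat_mulVec_eigCol (e : Side) (j : Fin 2) {z : ℂ} (hz : z ≠ 0) :
    (jostMat B e j z).mulVec (eigCol B e j z) = 0 := by
  have h := limX_mul_eigE B e hz
  have h2 : (limX B e z).mulVec (eigCol B e j z) =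
      (Complex.I * (colSign j * lam B z)) • eigCol B e j z := by
    ext i
    have := congrFun (congrFun h i) j
    rw [Matrix.mul_apply] at this
    simp only [Matrix.mulVec, dotProduct, eigCol, this]
    fin_cases j <;> simp [pauli3, Matrix.mul_apply, Fin.sum_univ_two, colSign, eigCol]
  rw [jostMat, Matrix.smul_mulVec, Matrix.sub_mulVec, h2, Matrix.smul_mulVec, Matrix.one_mulVec,
    sub_self, smul_zero]

theorem detE_eq {z : ℂ} (e : Side) : (eigE B e z).det = detE B z := by
  have h3 := B.bv_sq_complex e
  have hI := Complex.I_sq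
  rw [Matrix.det_fin_two, detE]
  simp only [eigE, Matrix.of_apply, Matrix.cons_val', Matrix.cons_val_zero, Matrix.cons_val_one,
    Matrix.cons_val_fin_one]
  by_cases hz : z = 0
  · simp [hz]
  field_simp
  linear_combination B.κ * h3 * Complex.I ^ 2 + B.κ * B.q0 ^ 2 * hI

theorem detE_ne_zero {z : ℂ} (hz : z ≠ 0) (hb : z ∉ branchPoints B) : detE B z ≠ 0 := by
  intro h
  refine hb ?_
  rw [detE, sub_eq_zero, eq_div_iff (pow_ne_zero 2 hz), one_mul] at h
  exact h

/-- In the eigenbasis E the kernel is diagonal, with entry 1 on the j-th eigenvector and e^{-2 i c_j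
λ s} on the other one. It is therefore I plus a multiple of X - i c_j λ. This form no longer
contains E⁻¹, so it makes sense at the branch points too. -/
theorem jostKernel_eq (e : Side) (j : Fin 2) {z : ℂ} (hz : z ≠ 0) (hb : z ∉ branchPoints B)
    (s : ℝ) : jostKernel B e j z (e.sgn * s) = halfKernel (jostRate B e j z) (jostMat B e j z) s := by
  have hl : lam B z ≠ 0 := fun h => hb ((mem_branchPoints_iff B hz).2 h)
  have hc0 : colSign j ≠ 0 := fun h => by simpa [h] using colSign_mul_self j
  have hs0 : (e.sgn : ℂ) ≠ 0 := fun h => by simpa [h] using sgn_mul_self_complex e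
  have hr0 : jostRate B e j z ≠ 0 := by
    rw [jostRate]
    exact mul_ne_zero hs0 (mul_ne_zero hc0 hl)
  have hdet : IsUnit (eigE B e z).det := by
    rw [detE_eq]
    exact (detE_ne_zero hz hb).isUnit
  have hXE := limX_mul_eigE B e hz
  set E := eigE B e z with hE
  have key : Complex.exp (-(Complex.I * colSign j * lam B z * (e.sgn * s : ℝ))) •
      (E * expPauli3 (lam B z * (e.sgn * s : ℝ))) =
      halfKernel (jostRate B e j z) (jostMat B e j z) s * E := by
    have hME : jostMat B e j z * E = ((e.sgn : ℂ) * (Complex.I * lam B z)) •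
        (E * (pauli3 - colSign j • 1)) := by
      rw [jostMat, Matrix.smul_mul, sub_mul, hXE, Matrix.smul_mul, Matrix.one_mul, mul_sub,
        Matrix.mul_smul, Matrix.mul_one]
      module
    rw [halfKernel, add_mul, Matrix.smul_mul, hME, Matrix.one_mul, expPrimitive_of_ne hr0, smul_smul]
    have hfac : E + ((2 * Complex.I * jostRate B e j z)⁻¹ *
        (1 - Complex.exp (-(2 * Complex.I * jostRate B e j z * s))) *
        ((e.sgn : ℂ) * (Complex.I * lam B z))) • (E * (pauli3 - colSign j • 1)) =
        E * (1 + ((2 * colSign j)⁻¹ *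
        (1 - Complex.exp (-(2 * Complex.I * jostRate B e j z * s)))) •
          (pauli3 - colSign j • 1)) := by
      rw [mul_add, Matrix.mul_one, Matrix.mul_smul]
      congr 2
      rw [jostRate]
      have hI := Complex.I_ne_zero
      generalize Complex.exp _ = F
      field_simp
    rw [hfac, ← Matrix.mul_smul]
    congr 1
    have hexp : -(2 * Complex.I * jostRate B e j z * s) =
        -(2 * Complex.I * colSign j * lam B z * (e.sgn * s : ℝ)) := by
      rw [jostRate]
      push_cast
      ring
    rw [hexp]
    generalize (e.sgn * s : ℝ) = r
    ext i k
    fin_cases j <;> fin_cases i <;> fin_cases k <;>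
      simp [expPauli3, pauli3, colSign, ← Complex.exp_add] <;> ring_nf <;> simp
  rw [jostKernel, if_neg hb, ← Matrix.smul_mul, ← hE, key, Matrix.mul_assoc,
    Matrix.mul_nonsing_inv _ hdet, Matrix.mul_one]

/-- Reflecting the line at the + end turns the integral from +∞ into one from -∞, so all four
columns become instances of a single problem. -/
theorem isModifiedJost_iff_halfLine (q : ℝ → ℝ → ℝ) (e : Side) (j : Fin 2) (t : ℝ) {z : ℂ}
    (hz : z ≠ 0) (hb : z ∉ branchPoints B) (μ : ℝ → Fin 2 → ℂ) :
    IsModifiedJost B q e j t z μ ↔ IsHalfLineSolution (jostRate B e j z) (jostMat B e j z)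
      (jostPot B q e t) (eigCol B e j z) (fun x => μ (e.sgn * x)) := by
  have hss : ∀ x : ℝ, e.sgn * (e.sgn * x) = x := fun x => by
    rw [← mul_assoc, e.sgn_mul_self, one_mul]
  have hint : ∀ x, integralFrom e (fun y => (jostKernel B e j z (e.sgn * x - y)).mulVec
      ((potQ B q y t - limQ B e).mulVec (μ y))) (e.sgn * x) =
      ∫ y in Set.Iic x, (halfKernel (jostRate B e j z) (jostMat B e j z) (x - y)).mulVec
        ((jostPot B q e t y).mulVec (μ (e.sgn * y))) := by
    intro x
    have h1 : ∀ y, (halfKernel (jostRate B e j z) (jostMat B e j z) (x - y)).mulVec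
        ((jostPot B q e t y).mulVec (μ (e.sgn * y))) = e.sgn • ((jostKernel B e j z
          (e.sgn * x - e.sgn * y)).mulVec ((potQ B q (e.sgn * y) t - limQ B e).mulVec
          (μ (e.sgn * y)))) := by
      intro y
      rw [← mul_sub, jostKernel_eq e j hz hb, jostPot, Matrix.smul_mulVec, Matrix.mulVec_smul]
      rfl
    simp only [h1]
    rw [integral_smul]
    cases e
    · have := integral_comp_neg_Iic x fun y => (jostKernel B .plus j z (-x - y)).mulVec
        ((potQ B q y t - limQ B .plus).mulVec (μ y))
      simp only [Side.sgn, neg_mul, one_mul, integralFrom, neg_smul, one_smul] at this ⊢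
      rw [this]
    · simp only [Side.sgn, one_mul, integralFrom, one_smul]
  have hcont : Continuous (fun x => μ (e.sgn * x)) ↔ Continuous μ := by
    constructor
    · intro h
      have := h.comp (continuous_const_mul e.sgn)
      simpa only [Function.comp_def, hss] using this
    · exact fun h => h.comp (continuous_const_mul e.sgn)
  have hlim : Tendsto (fun x => μ (e.sgn * x)) atBot (𝓝 (eigCol B e j z)) ↔
      Tendsto μ e.filter (𝓝 (eigCol B e j z)) := by
    constructor
    · intro h
      have := h.comp e.tendsto_sgn_mul'
      simpa only [Function.comp_def, hss] using this
    · exact fun h => h.comp e.tendsto_sgn_mul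
  rw [IsModifiedJost, IsHalfLineSolution, hcont, hlim]
  refine and_congr Iff.rfl (and_congr Iff.rfl ⟨fun h x => ?_, fun h x => ?_⟩)
  · rw [← hint x]
    exact h (e.sgn * x)
  · have := h (e.sgn * x)
    rw [← hint] at this
    simp only [hss] at this
    exact this

end

section

variable {B : Background} {q : ℝ → ℝ → ℝ}

/-! ### Existence and uniqueness of the Jost solutions -/

theorem IsClassicalSolution.continuous (hq : IsClassicalSolution B q) (t : ℝ) :
    Continuous fun x => q x t := (hq.smooth_x t).continuous

theorem continuous_matrix_two {f g h k : ℝ → ℂ} (hf : Continuous f) (hg : Continuous g)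
    (hh : Continuous h) (hk : Continuous k) : Continuous fun x => !![f x, g x; h x, k x] := by
  refine continuous_matrix fun i j => ?_
  fin_cases i <;> fin_cases j <;> simpa

theorem continuous_potQ (hq : IsClassicalSolution B q) (t : ℝ) :
    Continuous fun x => potQ B q x t := by
  have h1 := hq.continuous t
  have h2 := (hq.continuous (-t)).comp continuous_neg
  exact continuous_matrix_two continuous_const (Complex.continuous_ofReal.comp h1)
    (continuous_const.mul (Complex.continuous_ofReal.comp h2)) continuous_const

theorem continuous_jostPot (hq : IsClassicalSolution B q) (e : Side) (t : ℝ) :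
    Continuous (jostPot B q e t) := by
  have := (continuous_potQ hq t).comp (continuous_const_mul e.sgn)
  exact (this.sub continuous_const).const_smul (e.sgn : ℂ)

theorem integrableOn_comp_neg_iff {f : ℝ → ℝ} :
    IntegrableOn (fun x => f (-x)) (Set.Iic 0) ↔ IntegrableOn f (Set.Ici 0) := by
  have := (Measure.measurePreserving_neg (volume : Measure ℝ)).integrableOn_comp_preimage
    (Homeomorph.neg ℝ).measurableEmbedding (f := f) (s := Set.Ici 0)
  rw [← this]
  simp [Function.comp_def]

/-- The lower entry of the potential at one end is governed by q(·,-t) at the opposite end, and q₊ =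
δ q₋ makes its limit equal to δσ q_±. Both weighted conditions, at the times t and -t, are therefore
needed at each end. -/
theorem integrableOn_jostPot (_hq : IsClassicalSolution B q) (hbc : HasNZBC B q) (e : Side) (t : ℝ) :
    IntegrableOn (fun y => (1 + |y|) * absSum (jostPot B q e t y)) (Set.Iic 0) := by
  have hσ : |B.σ| = 1 := by rcases B.sigma_eq with h | h <;> simp [h]
  have hσ2 : B.σ * B.σ = 1 := by rcases B.sigma_eq with h | h <;> simp [h]
  have hδ2 : B.δ * B.δ = 1 := by rcases B.delta_eq with h | h <;> simp [h]
  have hs : ‖(e.sgn : ℂ)‖ = 1 := by cases e <;> simp [Side.sgn]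
  have hform : ∀ y, absSum (jostPot B q e t y) =
      |q (e.sgn * y) t - B.bv e| + |B.σ * q (-(e.sgn * y)) (-t) - B.κ * B.bv e| := by
    intro y
    simp only [absSum, jostPot, Fin.sum_univ_two, Matrix.smul_apply, Matrix.sub_apply, norm_smul, hs,
      one_mul, potQ, limQ, Matrix.of_apply, Matrix.cons_val', Matrix.cons_val_zero,
      Matrix.cons_val_one, Matrix.cons_val_fin_one, sub_self, norm_zero, zero_add, add_zero]
    norm_cast
  have hp : ∀ τ, IntegrableOn (fun y => (1 + |y|) * |q (-y) τ - B.qp|) (Set.Iic 0) := by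
    intro τ
    have h1 := integrableOn_comp_neg_iff.2 (hbc.weight_plus τ)
    refine IntegrableOn.congr_fun (Integrable.norm h1) (fun y _ => ?_) measurableSet_Iic
    simp only [abs_neg, norm_mul, Real.norm_eq_abs]
    rw [abs_of_nonneg (by positivity : 0 ≤ 1 + |y|)]
  have hm : ∀ τ, IntegrableOn (fun y => (1 + |y|) * |q y τ - B.qm|) (Set.Iic 0) := by
    intro τ
    refine IntegrableOn.congr_fun (Integrable.norm (hbc.weight_minus τ)) (fun y _ => ?_)
      measurableSet_Iic
    simp only [norm_mul, Real.norm_eq_abs]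
    rw [abs_of_nonneg (by positivity : 0 ≤ 1 + |y|)]
  have hsum : ∀ τ τ', IntegrableOn (fun y => (1 + |y|) * |q (-y) τ - B.qp| +
      (1 + |y|) * |q y τ' - B.qm|) (Set.Iic 0) := fun τ τ' => Integrable.add (hp τ) (hm τ')
  cases e
  · refine IntegrableOn.congr_fun (hsum t (-t)) (fun y _ => ?_) measurableSet_Iic
    rw [hform]
    have h1 : B.σ * q y (-t) - B.κ * B.qp = B.σ * (q y (-t) - B.qm) := by
      rw [Background.κ, Background.qp]
      linear_combination (-B.σ * B.qm) * hδ2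
    simp only [Side.sgn, Background.bv, neg_mul, one_mul, neg_neg, h1, abs_mul, hσ]
    ring
  · refine IntegrableOn.congr_fun (hsum (-t) t) (fun y _ => ?_) measurableSet_Iic
    rw [hform]
    have h1 : B.σ * q (-y) (-t) - B.κ * B.qm = B.σ * (q (-y) (-t) - B.qp) := by
      rw [Background.κ, Background.qp]
      ring
    simp only [Side.sgn, Background.bv, one_mul, h1, abs_mul, hσ]
    ring

theorem integrableOn_absSum_jostPot (hq : IsClassicalSolution B q) (hbc : HasNZBC B q) (e : Side)
    (t x : ℝ) : IntegrableOn (fun y => absSum (jostPot B q e t y)) (Set.Iic x) := by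
  have hc : Continuous fun y => absSum (jostPot B q e t y) :=
    continuous_absSum.comp (continuous_jostPot hq e t)
  refine integrableOn_Iic_of_continuous hc (x₀ := 0) ?_ x
  refine (integrableOn_jostPot hq hbc e t).mono' hc.aestronglyMeasurable
    (Eventually.of_forall fun y => ?_)
  rw [Real.norm_of_nonneg (absSum_nonneg _)]
  exact le_mul_of_one_le_left (absSum_nonneg _) (by linarith [abs_nonneg y])

theorem jostRate_ne_zero (e : Side) (j : Fin 2) {z : ℂ} (hz : z ≠ 0) (hb : z ∉ branchPoints B) :
    jostRate B e j z ≠ 0 := by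
  have hl : lam B z ≠ 0 := fun h => hb ((mem_branchPoints_iff B hz).2 h)
  have hc0 : colSign j ≠ 0 := fun h => by simpa [h] using colSign_mul_self j
  have hs0 : (e.sgn : ℂ) ≠ 0 := fun h => by simpa [h] using sgn_mul_self_complex e
  exact mul_ne_zero hs0 (mul_ne_zero hc0 hl)

theorem hasDerivAt_comp_sgn {μ : ℝ → Fin 2 → ℂ} {F : ℝ → Fin 2 → ℂ} (e : Side) :
    (∀ x, HasDerivAt (fun x => μ (e.sgn * x)) (e.sgn • F (e.sgn * x)) x) ↔
      ∀ x, HasDerivAt μ (F x) x := by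
  have hss : ∀ x : ℝ, e.sgn * (e.sgn * x) = x := fun x => by
    rw [← mul_assoc, e.sgn_mul_self, one_mul]
  have hmul : ∀ x : ℝ, HasDerivAt (fun x => e.sgn * x) e.sgn x := fun x => by
    simpa using (hasDerivAt_id x).const_mul e.sgn
  constructor
  · intro h x
    have := (h (e.sgn * x)).scomp x (hmul x)
    simpa only [Function.comp_def, hss, smul_smul, e.sgn_mul_self, one_smul] using this
  · intro h x
    exact (h (e.sgn * x)).scomp x (hmul x)

/-- The Jost integral equation is equivalent to the spatial part of the Lax pair. -/
theorem isModifiedJost_iff (hq : IsClassicalSolution B q) (hbc : HasNZBC B q) {e : Side} {j : Fin 2}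
    (t : ℝ) {z : ℂ} (hz : z ∈ jostRegion B e j) (hb : z ∉ branchPoints B) (μ : ℝ → Fin 2 → ℂ) :
    IsModifiedJost B q e j t z μ ↔ Tendsto μ e.filter (𝓝 (eigCol B e j z)) ∧
      ∀ x, HasDerivAt μ
        ((laxX B q x t z - (Complex.I * (colSign j * lam B z)) • 1).mulVec (μ x)) x := by
  have hss : ∀ x : ℝ, e.sgn * (e.sgn * x) = x := fun x => by
    rw [← mul_assoc, e.sgn_mul_self, one_mul]
  rw [isModifiedJost_iff_halfLine q e j t hz.1 hb, isHalfLineSolution_iff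
    (jostRate_ne_zero e j hz.1 hb) hz.2 (jostMat_mul_self e j hz.1) (jostMat_mulVec_eigCol e j hz.1)
    (continuous_jostPot hq e t) (integrableOn_absSum_jostPot hq hbc e t)]
  have hlim : Tendsto (fun x => μ (e.sgn * x)) atBot (𝓝 (eigCol B e j z)) ↔
      Tendsto μ e.filter (𝓝 (eigCol B e j z)) := by
    constructor
    · intro h
      have := h.comp e.tendsto_sgn_mul'
      simpa only [Function.comp_def, hss] using this
    · exact fun h => h.comp e.tendsto_sgn_mul
  rw [hlim, ← hasDerivAt_comp_sgn (μ := μ) (F := fun x =>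
    (laxX B q x t z - (Complex.I * (colSign j * lam B z)) • 1).mulVec (μ x)) e]
  refine and_congr Iff.rfl (forall_congr' fun x => ?_)
  have : (jostPot B q e t x + jostMat B e j z).mulVec (μ (e.sgn * x)) = e.sgn •
      (laxX B q (e.sgn * x) t z - (Complex.I * (colSign j * lam B z)) • 1).mulVec
        (μ (e.sgn * x)) := by
    have h1 : jostPot B q e t x + jostMat B e j z = (e.sgn : ℂ) •
        (laxX B q (e.sgn * x) t z - (Complex.I * (colSign j * lam B z)) • 1) := by
      rw [jostPot, jostMat, laxX, limX]
      module
    rw [h1, Matrix.smul_mulVec]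
    rfl
  rw [this]

theorem differentiableOn_lam : DifferentiableOn ℂ (lam B) {0}ᶜ := by
  unfold lam
  refine DifferentiableOn.div_const (differentiableOn_id.sub ?_) 2
  exact (differentiableOn_const _).div differentiableOn_id fun z hz => hz

theorem differentiableOn_kz : DifferentiableOn ℂ (kz B) {0}ᶜ := by
  unfold kz
  refine DifferentiableOn.div_const (differentiableOn_id.add ?_) 2
  exact (differentiableOn_const _).div differentiableOn_id fun z hz => hz

theorem differentiableOn_jostRate (e : Side) (j : Fin 2) :
    DifferentiableOn ℂ (jostRate B e j) {0}ᶜ := by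
  unfold jostRate
  exact (differentiableOn_lam.const_mul _).const_mul _

theorem differentiableOn_jostMat (e : Side) (j i k : Fin 2) :
    DifferentiableOn ℂ (fun z => jostMat B e j z i k) {0}ᶜ := by
  have h1 := differentiableOn_kz (B := B)
  have h2 := differentiableOn_lam (B := B)
  simp only [jostMat, limX, Matrix.smul_apply, Matrix.sub_apply, Matrix.add_apply, smul_eq_mul]
  fun_prop

theorem differentiableOn_eigCol (e : Side) (j : Fin 2) :
    DifferentiableOn ℂ (eigCol B e j) {0}ᶜ := by
  rw [differentiableOn_pi]
  intro i
  have h : DifferentiableOn ℂ (fun z : ℂ => Complex.I * B.bv e / z) {0}ᶜ :=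
    (differentiableOn_const _).div differentiableOn_id fun z hz => hz
  unfold eigCol eigE
  fin_cases i <;> fin_cases j <;> simp <;> fun_prop

theorem continuousOn_jostMat (e : Side) (j : Fin 2) : ContinuousOn (jostMat B e j) {0}ᶜ := by
  rw [continuousOn_iff_continuous_domRestrict]
  refine continuous_matrix fun i k => ?_
  exact (continuousOn_iff_continuous_domRestrict.1 (differentiableOn_jostMat e j i k).continuousOn)

/-- The modified Jost solutions near a point, including the branch points. -/
theorem exists_jost_family (hq : IsClassicalSolution B q) (hbc : HasNZBC B q) (e : Side) (j : Fin 2)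
    (t : ℝ) {K : Set ℂ} (hK : IsCompact K) (hK0 : (0 : ℂ) ∉ K) :
    ∃ m : ℂ → ℝ → Fin 2 → ℂ,
      ContinuousOn (fun p : ℝ × ℂ => m p.2 p.1) (Set.univ ×ˢ (jostRegion B e j ∩ K)) ∧
      (∀ x, ∃ C, ∀ z ∈ jostRegion B e j ∩ K, ‖m z x‖ ≤ C) ∧
      (∀ z ∈ jostRegion B e j ∩ K, IsHalfLineSolution (jostRate B e j z) (jostMat B e j z)
        (jostPot B q e t) (eigCol B e j z) (m z)) ∧
      (∀ U ⊆ jostRegion B e j ∩ K, IsOpen U → ∀ x, DifferentiableOn ℂ (fun z => m z x) U) := by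
  have hK' : K ⊆ {0}ᶜ := fun z hz h0 => hK0 (h0 ▸ hz)
  have hZ' : jostRegion B e j ∩ K ⊆ {0}ᶜ := Set.inter_subset_right.trans hK'
  obtain ⟨CA, hCA⟩ := hK.exists_bound_of_continuousOn
    (continuous_absSum.comp_continuousOn ((continuousOn_jostMat e j).mono hK'))
  obtain ⟨Ce, hCe⟩ := hK.exists_bound_of_continuousOn
    ((differentiableOn_eigCol e j).continuousOn.mono hK')
  obtain ⟨m, h1, h2, h3, h4⟩ := exists_halfLine_solution (Z := jostRegion B e j ∩ K)
    (a := jostRate B e j) (A := jostMat B e j) (e := eigCol B e j) (P := jostPot B q e t)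
    (CA := max CA 0) (Ce := max Ce 0) (continuous_jostPot hq e t) (integrableOn_jostPot hq hbc e t)
    ((differentiableOn_jostRate e j).continuousOn.mono hZ') ((continuousOn_jostMat e j).mono hZ')
    ((differentiableOn_eigCol e j).continuousOn.mono hZ') (fun z hz => hz.1.2) (le_max_right _ _)
    (fun z hz => ((Real.le_norm_self _).trans (hCA z hz.2)).trans (le_max_left _ _))
    (le_max_right _ _) (fun z hz => (hCe z hz.2).trans (le_max_left _ _))
  refine ⟨m, h1, h2, h3, fun U hU hUo x => h4 U hU hUo ?_ (fun i k => ?_) ?_ x⟩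
  · exact (differentiableOn_jostRate e j).mono (hU.trans hZ')
  · exact (differentiableOn_jostMat e j i k).mono (hU.trans hZ')
  · exact (differentiableOn_eigCol e j).mono (hU.trans hZ')

/-- Uniqueness identifies the chosen solution with any solution of the half-line problem. Local
families that are continuous or holomorphic in z can thus be substituted for it. -/
theorem modJost_eq_of_halfLine (hq : IsClassicalSolution B q) (hbc : HasNZBC B q) {e : Side}
    {j : Fin 2} {t : ℝ} {z : ℂ} (hz : z ∈ jostRegion B e j) (hb : z ∉ branchPoints B)
    {m : ℝ → Fin 2 → ℂ} (hm : IsHalfLineSolution (jostRate B e j z) (jostMat B e j z)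
      (jostPot B q e t) (eigCol B e j z) m) (x : ℝ) : modJost B q e j x t z = m (e.sgn * x) := by
  have hss : ∀ x : ℝ, e.sgn * (e.sgn * x) = x := fun x => by
    rw [← mul_assoc, e.sgn_mul_self, one_mul]
  have hex : ∃ μ, IsModifiedJost B q e j t z μ := by
    refine ⟨fun x => m (e.sgn * x), ?_⟩
    rw [isModifiedJost_iff_halfLine q e j t hz.1 hb]
    simpa only [hss] using hm
  have hspec := Classical.epsilon_spec hex
  rw [isModifiedJost_iff_halfLine q e j t hz.1 hb] at hspec
  have := hspec.unique hz.2 (continuous_jostPot hq e t) (integrableOn_jostPot hq hbc e t) hm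
  have := congrFun this (e.sgn * x)
  simp only [hss] at this
  exact this

theorem isModifiedJost_modJost (hq : IsClassicalSolution B q) (hbc : HasNZBC B q) {e : Side}
    {j : Fin 2} (t : ℝ) {z : ℂ} (hz : z ∈ jostRegion B e j) (hb : z ∉ branchPoints B) :
    IsModifiedJost B q e j t z fun x => modJost B q e j x t z := by
  obtain ⟨m, -, -, hm, -⟩ := exists_jost_family hq hbc e j t (K := {z}) isCompact_singleton
    fun h => hz.1 (Set.mem_singleton_iff.1 h).symm
  have h := hm z ⟨hz, rfl⟩
  have : (fun x => modJost B q e j x t z) = fun x => m z (e.sgn * x) :=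
    funext fun x => modJost_eq_of_halfLine hq hbc hz hb h x
  rw [this, isModifiedJost_iff_halfLine q e j t hz.1 hb]
  have hss : ∀ x : ℝ, e.sgn * (e.sgn * x) = x := fun x => by
    rw [← mul_assoc, e.sgn_mul_self, one_mul]
  simpa only [hss] using h

theorem tendsto_modJost (hq : IsClassicalSolution B q) (hbc : HasNZBC B q) {e : Side}
    {j : Fin 2} (t : ℝ) {z : ℂ} (hz : z ∈ jostRegion B e j) (hb : z ∉ branchPoints B) :
    Tendsto (fun x => modJost B q e j x t z) e.filter (𝓝 (eigCol B e j z)) :=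
  ((isModifiedJost_iff hq hbc t hz hb _).1 (isModifiedJost_modJost hq hbc t hz hb)).1

theorem hasDerivAt_modJost (hq : IsClassicalSolution B q) (hbc : HasNZBC B q) {e : Side}
    {j : Fin 2} (x t : ℝ) {z : ℂ} (hz : z ∈ jostRegion B e j) (hb : z ∉ branchPoints B) :
    HasDerivAt (fun x => modJost B q e j x t z) ((laxX B q x t z -
      (Complex.I * (colSign j * lam B z)) • 1).mulVec (modJost B q e j x t z)) x :=
  ((isModifiedJost_iff hq hbc t hz hb _).1 (isModifiedJost_modJost hq hbc t hz hb)).2 x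

/-- The Jost solutions are determined by the differential equation and their normalization. -/
theorem modJost_eq (hq : IsClassicalSolution B q) (hbc : HasNZBC B q) {e : Side}
    {j : Fin 2} {t : ℝ} {z : ℂ} (hz : z ∈ jostRegion B e j) (hb : z ∉ branchPoints B)
    {μ : ℝ → Fin 2 → ℂ} (hl : Tendsto μ e.filter (𝓝 (eigCol B e j z)))
    (hd : ∀ x, HasDerivAt μ ((laxX B q x t z -
      (Complex.I * (colSign j * lam B z)) • 1).mulVec (μ x)) x) (x : ℝ) :
    modJost B q e j x t z = μ x := by
  have h := (isModifiedJost_iff hq hbc t hz hb μ).2 ⟨hl, hd⟩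
  rw [isModifiedJost_iff_halfLine q e j t hz.1 hb] at h
  rw [modJost_eq_of_halfLine hq hbc hz hb h, ← mul_assoc, e.sgn_mul_self, one_mul]

theorem exists_closedBall_zero_notMem {z₀ : ℂ} (hz₀ : z₀ ≠ 0) :
    (0 : ℂ) ∉ Metric.closedBall z₀ (‖z₀‖ / 2) := by
  rw [Metric.mem_closedBall, dist_comm, dist_zero_right, not_le]
  linarith [norm_pos_iff.2 hz₀]

/-- Only z₀ ≠ 0 is required: the half-line family lives on a compact ball about z₀, which may
contain branch points. -/
theorem modJost_bounded (hq : IsClassicalSolution B q) (hbc : HasNZBC B q) (e : Side)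
    (j : Fin 2) (x t : ℝ) {z₀ : ℂ} (hz₀ : z₀ ≠ 0) :
    ∃ C, ∀ᶠ z in 𝓝[jostRegion B e j \ branchPoints B] z₀, ‖modJost B q e j x t z‖ ≤ C := by
  obtain ⟨m, -, h2, h3, -⟩ := exists_jost_family hq hbc e j t
    (isCompact_closedBall z₀ (‖z₀‖ / 2)) (exists_closedBall_zero_notMem hz₀)
  obtain ⟨C, hC⟩ := h2 (e.sgn * x)
  refine ⟨C, ?_⟩
  have : Metric.closedBall z₀ (‖z₀‖ / 2) ∈ 𝓝 z₀ :=
    Metric.closedBall_mem_nhds z₀ (by positivity)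
  filter_upwards [mem_nhdsWithin_of_mem_nhds this, self_mem_nhdsWithin] with z hz hzr
  rw [modJost_eq_of_halfLine hq hbc hzr.1 hzr.2 (h3 z ⟨hzr.1, hz⟩)]
  exact hC z ⟨hzr.1, hz⟩

theorem continuousOn_modJost (hq : IsClassicalSolution B q) (hbc : HasNZBC B q) (e : Side)
    (j : Fin 2) (x t : ℝ) :
    ContinuousOn (fun z => modJost B q e j x t z) (jostRegion B e j \ branchPoints B) := by
  intro z₀ hz₀
  have hz0 : z₀ ≠ 0 := hz₀.1.1
  obtain ⟨m, h1, -, h3, -⟩ := exists_jost_family hq hbc e j t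
    (isCompact_closedBall z₀ (‖z₀‖ / 2)) (exists_closedBall_zero_notMem hz0)
  have hV : Metric.closedBall z₀ (‖z₀‖ / 2) ∈ 𝓝 z₀ :=
    Metric.closedBall_mem_nhds z₀ (by positivity)
  have hc : ContinuousOn (fun z => m z (e.sgn * x))
      (jostRegion B e j ∩ Metric.closedBall z₀ (‖z₀‖ / 2)) :=
    h1.comp (f := fun z : ℂ => (e.sgn * x, z)) (by fun_prop) fun z hz => ⟨trivial, hz⟩
  have hc2 : ContinuousOn (fun z => modJost B q e j x t z)
      ((jostRegion B e j \ branchPoints B) ∩ Metric.closedBall z₀ (‖z₀‖ / 2)) :=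
    (hc.mono fun z hz => ⟨hz.1.1, hz.2⟩).congr fun z hz =>
      modJost_eq_of_halfLine hq hbc hz.1.1 hz.1.2 (h3 z ⟨hz.1.1, hz.2⟩) x
  exact (hc2 z₀ ⟨hz₀, mem_of_mem_nhds hV⟩).mono_of_mem_nhdsWithin
    (inter_mem self_mem_nhdsWithin (mem_nhdsWithin_of_mem_nhds hV))

theorem differentiableOn_modJost (hq : IsClassicalSolution B q) (hbc : HasNZBC B q) (e : Side)
    (j : Fin 2) (x t : ℝ) {U : Set ℂ} (hU : IsOpen U) (hUr : U ⊆ jostRegion B e j \ branchPoints B) :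
    DifferentiableOn ℂ (fun z => modJost B q e j x t z) U := by
  intro z₀ hz₀
  have hz0 : z₀ ≠ 0 := (hUr hz₀).1.1
  obtain ⟨m, -, -, h3, h4⟩ := exists_jost_family hq hbc e j t
    (isCompact_closedBall z₀ (‖z₀‖ / 2)) (exists_closedBall_zero_notMem hz0)
  have hr : 0 < ‖z₀‖ / 2 := by positivity
  set V := U ∩ Metric.ball z₀ (‖z₀‖ / 2) with hV
  have hVo : IsOpen V := hU.inter Metric.isOpen_ball
  have hVs : V ⊆ jostRegion B e j ∩ Metric.closedBall z₀ (‖z₀‖ / 2) := fun z hz =>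
    ⟨(hUr hz.1).1, Metric.ball_subset_closedBall hz.2⟩
  have hd := (h4 V hVs hVo (e.sgn * x)).congr fun z hz =>
    modJost_eq_of_halfLine hq hbc (hUr hz.1).1 (hUr hz.1).2 (h3 z (hVs hz)) x
  exact (hd.differentiableAt (hVo.mem_nhds ⟨hz₀, Metric.mem_ball_self hr⟩)).differentiableWithinAt

end

section

/-! ### Asymptotics of the Jost solutions for large spectral parameter -/

section
variable {l : ℂ} {x : ℝ}

theorem norm_cexp_two_I_mul_sub_le (hl : l.im ≤ 0) {y : ℝ} (hy : y ≤ x) :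
    ‖Complex.exp (2 * Complex.I * l * (y - x))‖ ≤ 1 := by
  have h := norm_cexp_two_I_mul_le hl (x := 0) (y := y - x) (by linarith)
  simpa using h

/-- Variation of constants from -∞. As Im l ≤ 0 the integrating factor stays bounded to the left, so
a → 0 removes the boundary term. -/
theorem eq_integral_of_hasDerivAt (hl : l.im ≤ 0) {a F : ℝ → ℂ}
    (ha : ∀ y, HasDerivAt a (-(2 * Complex.I * l) * a y + F y) y) (h0 : Tendsto a atBot (𝓝 0))
    (hFc : Continuous F) (hF : IntegrableOn F (Set.Iic x)) :
    a x = ∫ y in Set.Iic x, Complex.exp (2 * Complex.I * l * (y - x)) * F y := by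
  have hd : ∀ y : ℝ, HasDerivAt (fun y : ℝ => Complex.exp (2 * Complex.I * l * (y - x)) * a y)
      (Complex.exp (2 * Complex.I * l * (y - x)) * F y) y := by
    intro y
    have h1 : HasDerivAt (fun y : ℝ => Complex.exp (2 * Complex.I * l * (y - x)))
        (2 * Complex.I * l * Complex.exp (2 * Complex.I * l * (y - x))) y := by
      have := hasDerivAt_cexp_mul (2 * Complex.I * l) (y - x)
      have := this.comp_sub_const y x
      simpa using this
    refine (h1.fun_mul (ha y)).congr_deriv ?_
    ring
  have hint : IntegrableOn (fun y : ℝ => Complex.exp (2 * Complex.I * l * (y - x)) * F y)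
      (Set.Iic x) := by
    refine Integrable.mono (Integrable.norm hF) (by fun_prop : Continuous fun y : ℝ =>
      Complex.exp (2 * Complex.I * l * (y - x)) * F y).aestronglyMeasurable ?_
    refine (ae_restrict_iff' measurableSet_Iic).2 (Eventually.of_forall fun y hy => ?_)
    rw [norm_mul, norm_norm]
    exact mul_le_of_le_one_left (norm_nonneg _) (norm_cexp_two_I_mul_sub_le hl hy)
  have hlim : Tendsto (fun y : ℝ => Complex.exp (2 * Complex.I * l * (y - x)) * a y) atBot (𝓝 0) := by
    refine squeeze_zero_norm' ?_ (tendsto_zero_iff_norm_tendsto_zero.1 h0)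
    filter_upwards [eventually_le_atBot x] with y hy
    rw [norm_mul]
    exact mul_le_of_le_one_left (norm_nonneg _) (norm_cexp_two_I_mul_sub_le hl hy)
  rw [integral_Iic_of_hasDerivAt_of_tendsto (hd x).continuousAt.continuousWithinAt
    (fun y _ => hd y) hint hlim]
  simp

theorem norm_integral_cexp_mul_le (hl : l.im ≤ 0) {F : ℝ → ℂ} {w : ℝ → ℝ}
    (hw : IntegrableOn w (Set.Iic x)) (hFw : ∀ y ≤ x, ‖F y‖ ≤ w y) :
    ‖∫ y in Set.Iic x, Complex.exp (2 * Complex.I * l * (y - x)) * F y‖ ≤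
      ∫ y in Set.Iic x, w y := by
  refine norm_integral_le_of_norm_le hw ?_
  refine (ae_restrict_iff' measurableSet_Iic).2 (Eventually.of_forall fun y hy => ?_)
  rw [norm_mul]
  exact (mul_le_of_le_one_left (norm_nonneg _) (norm_cexp_two_I_mul_sub_le hl hy)).trans (hFw y hy)

theorem norm_le_of_hasDerivAt (hl : l.im ≤ 0) {a F : ℝ → ℂ} {w : ℝ → ℝ} {c : ℝ} (hc : 0 ≤ c)
    (ha : ∀ y, HasDerivAt a (-(2 * Complex.I * l) * a y + F y) y) (h0 : Tendsto a atBot (𝓝 0))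
    (hFc : Continuous F) (hw : IntegrableOn w (Set.Iic x)) (hw0 : ∀ y, 0 ≤ w y)
    (hFw : ∀ y ≤ x, ‖F y‖ ≤ c * w y) {y : ℝ} (hy : y ≤ x) :
    ‖a y‖ ≤ c * ∫ y in Set.Iic x, w y := by
  have hsub : Set.Iic y ⊆ Set.Iic x := Set.Iic_subset_Iic.2 hy
  have hwi : IntegrableOn (fun y => c * w y) (Set.Iic y) := (hw.mono_set hsub).const_mul c
  have hF : IntegrableOn F (Set.Iic y) := by
    refine Integrable.mono' hwi hFc.aestronglyMeasurable ?_
    exact (ae_restrict_iff' measurableSet_Iic).2 (Eventually.of_forall fun s hs =>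
      hFw s (le_trans hs hy))
  rw [eq_integral_of_hasDerivAt hl ha h0 hFc hF]
  refine (norm_integral_cexp_mul_le hl hwi fun s hs => hFw s (hs.trans hy)).trans ?_
  rw [integral_const_mul]
  refine mul_le_mul_of_nonneg_left ?_ hc
  exact setIntegral_mono_set hw (Eventually.of_forall hw0) (LE.le.eventuallyLE (α := ℝ) hsub)

/-- The Riemann-Lebesgue lemma on a half-line, uniformly in the closed lower half-plane. -/
theorem exists_norm_integral_cexp_mul_le {f f' : ℝ → ℂ} (hf : ∀ y, HasDerivAt f (f' y) y)
    (hf' : Continuous f') (hi : IntegrableOn f (Set.Iic x)) {ε : ℝ} (hε : 0 < ε) :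
    ∃ ρ, ∀ l : ℂ, l.im ≤ 0 → ρ ≤ ‖l‖ →
      ‖∫ y in Set.Iic x, Complex.exp (2 * Complex.I * l * (y - x)) * f y‖ ≤ ε := by
  have hfc : Continuous f := continuous_iff_continuousAt.2 fun y => (hf y).continuousAt
  have htail : Tendsto (fun M => ∫ y in Set.Iic M, ‖f y‖) atBot (𝓝 0) :=
    tendsto_integral_Iic (integrableOn_Iic_of_continuous (by fun_prop) (Integrable.norm hi))
  -- The tail below M is small in L¹ uniformly in l, since the exponential has modulus at most 1
  -- there. On [M, x] an integration by parts gains a factor 1/|l|; the constant 2 + (x - M) below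
  -- counts two boundary terms and the integral of f'.
  obtain ⟨M, hM, hMx⟩ := ((htail.eventually (gt_mem_nhds (half_pos hε))).and
    (eventually_le_atBot x)).exists
  obtain ⟨C, hC⟩ := isCompact_Icc.exists_bound_of_continuousOn (s := Set.Icc M x)
    (f := fun y => ‖f y‖ + ‖f' y‖) (by fun_prop)
  have hC0 : 0 ≤ C := (norm_nonneg _).trans (hC x ⟨hMx, le_rfl⟩)
  have hCf : ∀ y ∈ Set.Icc M x, ‖f y‖ ≤ C ∧ ‖f' y‖ ≤ C := fun y hy => by
    have := (Real.le_norm_self _).trans (hC y hy)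
    exact ⟨by linarith [norm_nonneg (f' y)], by linarith [norm_nonneg (f y)]⟩
  set K := C * (2 + (x - M)) with hK
  have hK0 : 0 ≤ K := mul_nonneg hC0 (by linarith)
  refine ⟨K / ε + 1, fun l hl hρ => ?_⟩
  have hl0 : 0 < ‖l‖ := lt_of_lt_of_le (by positivity) hρ
  have hl0' : l ≠ 0 := norm_pos_iff.1 hl0
  set g : ℝ → ℂ := fun y => Complex.exp (2 * Complex.I * l * (y - x)) * f y with hg
  have hgi : IntegrableOn g (Set.Iic x) := by
    refine Integrable.mono (Integrable.norm hi) (by fun_prop : Continuous g).aestronglyMeasurable ?_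
    refine (ae_restrict_iff' measurableSet_Iic).2 (Eventually.of_forall fun y hy => ?_)
    rw [norm_mul, norm_norm]
    exact mul_le_of_le_one_left (norm_nonneg _) (norm_cexp_two_I_mul_sub_le hl hy)
  have hsplit : ∫ y in Set.Iic x, g y = (∫ y in Set.Iic M, g y) + ∫ y in M..x, g y := by
    rw [← intervalIntegral.integral_Iic_sub_Iic (hgi.mono_set (Set.Iic_subset_Iic.2 hMx)) hgi]
    ring
  have h1 : ‖∫ y in Set.Iic M, g y‖ ≤ ε / 2 := by
    refine (norm_integral_le_of_norm_le
      (Integrable.norm (hi.mono_set (Set.Iic_subset_Iic.2 hMx))) ?_).trans hM.le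
    refine (ae_restrict_iff' measurableSet_Iic).2 (Eventually.of_forall fun y hy => ?_)
    rw [hg, norm_mul]
    exact mul_le_of_le_one_left (norm_nonneg _) (norm_cexp_two_I_mul_sub_le hl (le_trans hy hMx))
  have hc0 : 2 * Complex.I * l ≠ 0 := by simp [hl0']
  have hde : ∀ y : ℝ, HasDerivAt (fun y : ℝ => (2 * Complex.I * l)⁻¹ *
      Complex.exp (2 * Complex.I * l * (y - x))) (Complex.exp (2 * Complex.I * l * (y - x))) y := by
    intro y
    have := (hasDerivAt_cexp_mul (2 * Complex.I * l) (y - x)).comp_sub_const y x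
    refine ((this.const_mul (2 * Complex.I * l)⁻¹).congr_deriv ?_).congr_of_eventuallyEq ?_
    · rw [← mul_assoc, inv_mul_cancel₀ hc0, one_mul]
      push_cast
      rfl
    · exact Eventually.of_forall fun s => by push_cast; rfl
  have hparts : ∫ y in M..x, g y = (2 * Complex.I * l)⁻¹ * (f x -
      Complex.exp (2 * Complex.I * l * (M - x)) * f M -
      ∫ y in M..x, Complex.exp (2 * Complex.I * l * (y - x)) * f' y) := by
    have := intervalIntegral.integral_mul_deriv_eq_deriv_mul (a := M) (b := x)
      (u := f) (u' := f') (fun y _ => hf y) (fun y _ => hde y) (hf'.intervalIntegrable _ _)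
      ((by fun_prop : Continuous fun y : ℝ =>
        Complex.exp (2 * Complex.I * l * (y - x))).intervalIntegrable _ _)
    have e1 : ∫ y in M..x, g y = ∫ y in M..x, f y * Complex.exp (2 * Complex.I * l * (y - x)) :=
      intervalIntegral.integral_congr fun y _ => mul_comm _ _
    have e2 : ∫ y in M..x, f' y * ((2 * Complex.I * l)⁻¹ * Complex.exp (2 * Complex.I * l * (y - x))) =
        (2 * Complex.I * l)⁻¹ * ∫ y in M..x, Complex.exp (2 * Complex.I * l * (y - x)) * f' y := by
      rw [← intervalIntegral.integral_const_mul]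
      exact intervalIntegral.integral_congr fun y _ => by ring
    rw [e1, this, e2, sub_self, mul_zero, Complex.exp_zero]
    ring
  have h2 : ‖∫ y in M..x, g y‖ ≤ ε / 2 := by
    have hb1 := (hCf x ⟨hMx, le_rfl⟩).1
    have hb2 : ‖Complex.exp (2 * Complex.I * l * (M - x)) * f M‖ ≤ C := by
      rw [norm_mul]
      exact (mul_le_of_le_one_left (norm_nonneg _) (norm_cexp_two_I_mul_sub_le hl hMx)).trans
        (hCf M ⟨le_rfl, hMx⟩).1
    have hb3 : ‖∫ y in M..x, Complex.exp (2 * Complex.I * l * (y - x)) * f' y‖ ≤ C * (x - M) := by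
      have := intervalIntegral.norm_integral_le_of_norm_le_const (a := M) (b := x) (C := C)
        (f := fun y : ℝ => Complex.exp (2 * Complex.I * l * (y - x)) * f' y) fun y hy => by
          rw [Set.uIoc_of_le hMx] at hy
          rw [norm_mul]
          exact (mul_le_of_le_one_left (norm_nonneg _) (norm_cexp_two_I_mul_sub_le hl hy.2)).trans
            (hCf y ⟨hy.1.le, hy.2⟩).2
      rwa [abs_of_nonneg (by linarith)] at this
    have hb4 : ‖f x - Complex.exp (2 * Complex.I * l * (M - x)) * f M -
      ∫ y in M..x, Complex.exp (2 * Complex.I * l * (y - x)) * f' y‖ ≤ K := by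
      refine (norm_sub_le _ _).trans ?_
      have := norm_sub_le (f x) (Complex.exp (2 * Complex.I * l * (M - x)) * f M)
      rw [hK]
      linarith
    rw [hparts, norm_mul, norm_inv, norm_mul, norm_mul, Complex.norm_I, Complex.norm_ofNat, mul_one]
    rw [inv_mul_le_iff₀ (by positivity)]
    refine hb4.trans ?_
    have : K / ε ≤ ‖l‖ := by linarith
    rw [div_le_iff₀ hε] at this
    linarith
  rw [hsplit]
  exact (norm_add_le _ _).trans (by linarith)

end

/-- The supremum S satisfies S ≤ 1 + S/2, and it is finite by the a priori bound, so the right-hand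
term can be absorbed. -/
theorem norm_le_two_of_absorb {E : Type*} [NormedAddCommGroup E] {f : ℝ → E} {x : ℝ}
    (hb : ∃ C, ∀ y ≤ x, ‖f y‖ ≤ C)
    (h : ∀ S, (∀ y ≤ x, ‖f y‖ ≤ S) → ∀ y ≤ x, ‖f y‖ ≤ 1 + S / 2) {y : ℝ} (hy : y ≤ x) :
    ‖f y‖ ≤ 2 := by
  obtain ⟨C, hC⟩ := hb
  have hbd : BddAbove (Set.range fun y : Set.Iic x => ‖f y‖) :=
    ⟨C, by rintro _ ⟨y, rfl⟩; exact hC y y.2⟩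
  have : Nonempty (Set.Iic x) := ⟨⟨x, Set.self_mem_Iic⟩⟩
  have h1 : ∀ y ≤ x, ‖f y‖ ≤ ⨆ y : Set.Iic x, ‖f y‖ := fun y hy => le_ciSup hbd ⟨y, hy⟩
  have h2 : ⨆ y : Set.Iic x, ‖f y‖ ≤ 1 + (⨆ y : Set.Iic x, ‖f y‖) / 2 :=
    ciSup_le fun y => h _ h1 y y.2
  linarith [h1 y hy]

/-- The potentials of the scattering problem `p' = i c₀ / z p + u r`, `r' = v p - i z r`, with their
derivatives. -/
structure IsScatteringPotential (u v u' v' v'' : ℝ → ℂ) (c₀ : ℂ) : Prop where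
  hasDerivAt_left : ∀ y, HasDerivAt u (u' y) y
  hasDerivAt_right : ∀ y, HasDerivAt v (v' y) y
  hasDerivAt_right' : ∀ y, HasDerivAt v' (v'' y) y
  continuous_left : Continuous u'
  continuous_right : Continuous v''
  bounded : ∀ x, ∃ K, ∀ y ≤ x, ‖u y‖ ≤ K ∧ ‖v y‖ ≤ K
  integrable_left : ∀ x, IntegrableOn u' (Set.Iic x)
  integrable_right : ∀ x, IntegrableOn v' (Set.Iic x)
  integrable_mul : ∀ x, IntegrableOn (fun y => c₀ - u y * v y) (Set.Iic x)

/-- The solution of the scattering problem normalized at `-∞`. -/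
structure IsNormalizedSolution (u v : ℝ → ℂ) (c₀ z : ℂ) (p r : ℝ → ℂ) : Prop where
  hasDerivAt_fst : ∀ y, HasDerivAt p (Complex.I * c₀ / z * p y + u y * r y) y
  hasDerivAt_snd : ∀ y, HasDerivAt r (v y * p y - Complex.I * z * r y) y
  tendsto_fst : Tendsto p atBot (𝓝 1)
  tendsto_snd : Tendsto (fun y => r y + Complex.I * v y * p y / z) atBot (𝓝 0)

set_option maxHeartbeats 1000000 in
-- The potentials do not decay, so the sources in the system for (p, r) are not integrable. Passing
-- to a = r + i v p/z removes the source v p: a oscillates at the rate 2λ, with a source of order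
-- 1/z built from v' and c₀ - u v. The term u a left in p' is removed by adding β u a to p, with β =
-- 1/(2iλ). Every remaining source contains one of the integrable functions u', v', c₀ - u v and a
-- factor of order 1/z.
theorem IsScatteringPotential.exists_bounds {u v u' v' v'' : ℝ → ℂ} {c₀ : ℂ}
    (h : IsScatteringPotential u v u' v' v'' c₀) (x : ℝ) :
    ∃ C w, 0 ≤ C ∧ IntegrableOn w (Set.Iic x) ∧ (∀ y, 0 ≤ w y) ∧ (∀ y ≤ x, ‖v y‖ ≤ C) ∧
      ∀ z : ℂ, C ≤ ‖z‖ → ((z - c₀ / z) / 2).im ≤ 0 → ∀ p r, IsNormalizedSolution u v c₀ z p r →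
        (∀ y ≤ x, ‖p y - 1‖ ≤ C / ‖z‖ ∧ ‖r y + Complex.I * v y * p y / z‖ ≤ C / ‖z‖) ∧
        ∃ F : ℝ → ℂ, Continuous F ∧ (∀ y ≤ x, ‖F y - Complex.I / z * v' y‖ ≤ C / ‖z‖ ^ 2 * w y) ∧
          (∀ y, HasDerivAt (fun y => r y + Complex.I * v y * p y / z)
            (-(2 * Complex.I * ((z - c₀ / z) / 2)) * (r y + Complex.I * v y * p y / z) + F y) y) := by
  obtain ⟨K', hK'⟩ := h.bounded x
  set K := max K' 1 with hK
  have hK1 : 1 ≤ K := le_max_right _ _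
  have hu : ∀ y ≤ x, ‖u y‖ ≤ K := fun y hy => (hK' y hy).1.trans (le_max_left _ _)
  have hv : ∀ y ≤ x, ‖v y‖ ≤ K := fun y hy => (hK' y hy).2.trans (le_max_left _ _)
  set w : ℝ → ℝ := fun y => ‖u' y‖ + ‖v' y‖ + ‖c₀ - u y * v y‖ with hw
  have hwi : IntegrableOn w (Set.Iic x) :=
    ((h.integrable_left x).norm.add (h.integrable_right x).norm).add (h.integrable_mul x).norm
  have hw0 : ∀ y, 0 ≤ w y := fun y => by positivity
  set L := ∫ y in Set.Iic x, w y with hL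
  have hL0 : 0 ≤ L := integral_nonneg hw0
  have huc : Continuous u := continuous_iff_continuousAt.2 fun y => (h.hasDerivAt_left y).continuousAt
  have hvc : Continuous v := continuous_iff_continuousAt.2 fun y => (h.hasDerivAt_right y).continuousAt
  have hu'c := h.continuous_left
  have hv'c : Continuous v' :=
    continuous_iff_continuousAt.2 fun y => (h.hasDerivAt_right' y).continuousAt
  -- The 7 = 3 + 4 comes from the two coefficients of the source G, and 2K from the correction β u a
  -- with |β| ≤ 2/|z|.
  set c := 7 * K ^ 2 * L + 2 * K with hc
  have hc0 : 0 ≤ c := by positivity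
  set C := 2 * c + 2 * ‖c₀‖ + 10 * K + 2 * K * (2 * c) with hC
  have hCge : 2 * c ≤ C ∧ 1 ≤ C ∧ 2 * ‖c₀‖ ≤ C ∧ K ≤ C ∧ 2 * c + 2 * K + K * (2 * c) ≤ C := by
    have := norm_nonneg c₀
    have : 0 ≤ K * (2 * c) := by positivity
    refine ⟨?_, ?_, ?_, ?_, ?_⟩ <;> linarith
  refine ⟨C, w, by linarith, hwi, hw0, fun y hy => (hv y hy).trans hCge.2.2.2.1,
    fun z hz him p r hpr => ?_⟩
  have hz1 : 1 ≤ ‖z‖ := hCge.2.1.trans hz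
  have hz0 : 0 < ‖z‖ := by linarith
  have hzne : z ≠ 0 := norm_pos_iff.1 hz0
  set l := (z - c₀ / z) / 2 with hl
  have hlz : ‖z‖ / 2 ≤ ‖2 * l‖ := by
    have e1 : 2 * l = z - c₀ / z := by rw [hl]; ring
    have e2 : ‖c₀ / z‖ ≤ ‖z‖ / 2 := by
      rw [norm_div, div_le_iff₀ hz0]
      nlinarith [hCge.2.2.1, norm_nonneg c₀]
    rw [e1]
    linarith [norm_sub_norm_le z (c₀ / z)]
  have hl0 : l ≠ 0 := fun h0 => by
    rw [h0, mul_zero, norm_zero] at hlz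
    linarith
  have hczl : c₀ = z * (z - 2 * l) := by
    rw [hl]
    field_simp
    ring
  set β := (2 * Complex.I * l)⁻¹ with hβ
  have hβl : β * (2 * Complex.I * l) = 1 := inv_mul_cancel₀ (by simp [hl0])
  have hβn : ‖β‖ ≤ 2 / ‖z‖ := by
    have e1 : ‖2 * Complex.I * l‖ = ‖2 * l‖ := by simp
    rw [hβ, norm_inv, e1]
    calc ‖2 * l‖⁻¹ ≤ (‖z‖ / 2)⁻¹ := inv_anti₀ (by positivity) hlz
      _ = 2 / ‖z‖ := by rw [inv_div]
  have hI := Complex.I_sq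
  set a : ℝ → ℂ := fun y => r y + Complex.I * v y * p y / z with ha
  set H : ℝ → ℂ := fun y => c₀ - u y * v y with hH
  set g : ℝ → ℂ := fun y => v' y + Complex.I * v y * H y / z with hg
  set F : ℝ → ℂ := fun y => -(Complex.I * H y / z) * a y + Complex.I / z * g y * p y with hF
  have hpc : Continuous p :=
    continuous_iff_continuousAt.2 fun y => (hpr.hasDerivAt_fst y).continuousAt
  have hrc : Continuous r :=
    continuous_iff_continuousAt.2 fun y => (hpr.hasDerivAt_snd y).continuousAt
  have hac : Continuous a := by fun_prop
  have hFc : Continuous F := by fun_prop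
  have had : ∀ y, HasDerivAt a (-(2 * Complex.I * l) * a y + F y) y := by
    intro y
    refine ((hpr.hasDerivAt_snd y).fun_add ((((h.hasDerivAt_right y).fun_mul
      (hpr.hasDerivAt_fst y)).const_mul (Complex.I / z)))).congr_deriv ?_ |>.congr_of_eventuallyEq ?_
    · simp only [hF, ha, hg, hH]
      rw [hczl]
      field_simp
      ring_nf
      simp only [hI]
      ring
    · exact Eventually.of_forall fun s => by simp only [ha]; ring
  -- Since a' has leading part -2iλ a, the derivative of β u a cancels u a. The result has no
  -- oscillating factor, which is why the rate below is 0.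
  set b : ℝ → ℂ := fun y => p y + β * u y * a y - 1 with hb
  set G : ℝ → ℂ := fun y => (Complex.I * H y / z + Complex.I * β * u y * g y / z) * p y +
    (β * u' y - Complex.I * β * H y * u y / z) * a y with hG
  have hGc : Continuous G := by fun_prop
  have hbd : ∀ y, HasDerivAt b (-(2 * Complex.I * 0) * b y + G y) y := by
    intro y
    refine (((hpr.hasDerivAt_fst y).fun_add (((h.hasDerivAt_left y).const_mul β).fun_mul
      (had y))).sub_const 1).congr_deriv ?_
    have e1 : r y = a y - Complex.I * v y * p y / z := by simp only [ha]; ring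
    rw [e1]
    simp only [hF, hG, hg, hH]
    linear_combination (-(u y * a y)) * hβl
  have hbt : Tendsto b atBot (𝓝 0) := by
    have h1 : Tendsto (fun y => β * u y * a y) atBot (𝓝 0) := by
      have h2 : Tendsto (fun y => ‖β‖ * K * ‖a y‖) atBot (𝓝 0) := by
        simpa using (hpr.tendsto_snd.norm.const_mul (‖β‖ * K))
      refine squeeze_zero_norm' ?_ h2
      filter_upwards [eventually_le_atBot x] with y hy
      rw [norm_mul, norm_mul]
      have := hu y hy
      gcongr
    simpa using (hpr.tendsto_fst.add h1).sub_const 1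
  have hwH : ∀ y, ‖H y‖ ≤ w y := fun y => by
    simp only [hw, hH]; linarith [norm_nonneg (u' y), norm_nonneg (v' y)]
  have hwu : ∀ y, ‖u' y‖ ≤ w y := fun y => by
    simp only [hw]; linarith [norm_nonneg (v' y), norm_nonneg (c₀ - u y * v y)]
  have hgw : ∀ y ≤ x, ‖g y‖ ≤ K * w y := by
    intro y hy
    have e1 : ‖Complex.I * v y * H y / z‖ ≤ K * ‖H y‖ := by
      rw [norm_div, norm_mul, norm_mul, Complex.norm_I, one_mul]
      refine (div_le_self (by positivity) hz1).trans ?_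
      exact mul_le_mul_of_nonneg_right (hv y hy) (norm_nonneg _)
    refine (norm_add_le _ _).trans ?_
    have e2 : ‖v' y‖ ≤ K * ‖v' y‖ := le_mul_of_one_le_left (norm_nonneg _) hK1
    have e3 : 0 ≤ K * ‖u' y‖ := by positivity
    simp only [hw]
    nlinarith
  have hFw : ∀ S, 0 ≤ S → (∀ y ≤ x, ‖p y‖ ≤ S ∧ ‖a y‖ ≤ S) →
      ∀ y ≤ x, ‖F y‖ ≤ (2 * K * S / ‖z‖) * w y := by
    intro S hS0 hS y hy
    refine (norm_add_le _ _).trans ?_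
    rw [norm_mul, norm_neg, norm_div, norm_mul, norm_mul, norm_mul, norm_div, Complex.norm_I, one_mul]
    have e1 : ‖H y‖ / ‖z‖ * ‖a y‖ ≤ K * w y / ‖z‖ * S := by
      have : ‖H y‖ ≤ K * w y := (hwH y).trans (le_mul_of_one_le_left (hw0 y) hK1)
      have := (hS y hy).2
      gcongr
    have e2 : 1 / ‖z‖ * ‖g y‖ * ‖p y‖ ≤ 1 / ‖z‖ * (K * w y) * S := by
      have := (hS y hy).1
      have := hgw y hy
      have := hw0 y
      gcongr
    refine (add_le_add e1 e2).trans (le_of_eq ?_)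
    ring
  have hGw : ∀ S, 0 ≤ S → (∀ y ≤ x, ‖p y‖ ≤ S ∧ ‖a y‖ ≤ S) →
      ∀ y ≤ x, ‖G y‖ ≤ (7 * K ^ 2 * S / ‖z‖) * w y := by
    intro S hS0 hS y hy
    have hw0y := hw0 y
    have hzi : 1 / ‖z‖ ≤ 1 := by rw [div_le_one hz0]; exact hz1
    have hKK : K ≤ K ^ 2 := by nlinarith
    have e1 : ‖Complex.I * H y / z + Complex.I * β * u y * g y / z‖ ≤ 3 * K ^ 2 / ‖z‖ * w y := by
      refine (norm_add_le _ _).trans ?_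
      simp only [norm_mul, norm_div, Complex.norm_I, one_mul]
      have f1 : ‖H y‖ / ‖z‖ ≤ K ^ 2 * w y / ‖z‖ := by
        have : ‖H y‖ ≤ K ^ 2 * w y := (hwH y).trans (le_mul_of_one_le_left hw0y (by linarith))
        gcongr
      have f2 : ‖β‖ * ‖u y‖ * ‖g y‖ / ‖z‖ ≤ 2 * K * (K * w y) / ‖z‖ := by
        have g1 := hu y hy
        have g2 := hgw y hy
        have g3 : ‖β‖ ≤ 2 := hβn.trans (by rw [div_le_iff₀ hz0]; linarith)
        gcongr
      refine (add_le_add f1 f2).trans (le_of_eq ?_)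
      ring
    have e2 : ‖β * u' y - Complex.I * β * H y * u y / z‖ ≤ 4 * K ^ 2 / ‖z‖ * w y := by
      refine (norm_sub_le _ _).trans ?_
      simp only [norm_mul, norm_div, Complex.norm_I, one_mul]
      have f1 : ‖β‖ * ‖u' y‖ ≤ 2 / ‖z‖ * (K ^ 2 * w y) := by
        have : ‖u' y‖ ≤ K ^ 2 * w y := (hwu y).trans (le_mul_of_one_le_left hw0y (by linarith))
        gcongr
      have f2 : ‖β‖ * ‖H y‖ * ‖u y‖ / ‖z‖ ≤ 2 * w y * K ^ 2 / ‖z‖ := by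
        have g1 := (hu y hy).trans hKK
        have g2 := hwH y
        have g3 : ‖β‖ ≤ 2 := hβn.trans (by rw [div_le_iff₀ hz0]; linarith)
        gcongr
      refine (add_le_add f1 f2).trans (le_of_eq ?_)
      ring
    refine (norm_add_le _ _).trans ?_
    rw [norm_mul, norm_mul]
    have e3 := mul_le_mul e1 (hS y hy).1 (norm_nonneg _) (by positivity)
    have e4 := mul_le_mul e2 (hS y hy).2 (norm_nonneg _) (by positivity)
    refine (add_le_add e3 e4).trans (le_of_eq ?_)
    ring
  have hstep : ∀ S, 0 ≤ S → (∀ y ≤ x, ‖p y‖ ≤ S ∧ ‖a y‖ ≤ S) →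
      ∀ y ≤ x, ‖p y - 1‖ ≤ c * S / ‖z‖ ∧ ‖a y‖ ≤ c * S / ‖z‖ := by
    intro S hS0 hS y hy
    have e1 := norm_le_of_hasDerivAt him (by positivity) had hpr.tendsto_snd hFc hwi hw0
      (hFw S hS0 hS) hy
    have e2 := norm_le_of_hasDerivAt (l := 0) (by simp) (by positivity) hbd hbt hGc hwi hw0
      (hGw S hS0 hS) hy
    have e3 : ‖β * u y * a y‖ ≤ 2 / ‖z‖ * K * S := by
      rw [norm_mul, norm_mul]
      have := hu y hy
      have := (hS y hy).2
      gcongr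
    constructor
    · have : p y - 1 = b y - β * u y * a y := by simp only [hb]; ring
      rw [this]
      refine (norm_sub_le _ _).trans ((add_le_add e2 e3).trans (le_of_eq ?_))
      rw [hc]
      ring
    · refine e1.trans ?_
      have : 2 * K * S / ‖z‖ * L = (2 * K * L) * S / ‖z‖ := by ring
      rw [← hL, this]
      have : 2 * K * L ≤ c := by
        rw [hc]
        have : K * L ≤ K ^ 2 * L := mul_le_mul_of_nonneg_right (by nlinarith) hL0
        nlinarith
      gcongr
  have hz2 : 2 * c ≤ ‖z‖ := hCge.1.trans hz
  have htwo : ∀ y ≤ x, ‖p y‖ ≤ 2 ∧ ‖a y‖ ≤ 2 := by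
    intro y hy
    -- Once |z| ≥ 2c, a bound S on the pair gives |p - 1| ≤ S/2 and |a| ≤ S/2, so absorption applies
    -- and yields the bound 2.
    have := norm_le_two_of_absorb (f := fun y => (p y, a y)) (x := x)
      (exists_bound_Iic (by fun_prop) (hpr.tendsto_fst.prodMk_nhds hpr.tendsto_snd) x) ?_ hy
    · rwa [Prod.norm_def, max_le_iff] at this
    intro S hS y hy
    have hS0 : 0 ≤ S := (norm_nonneg _).trans (hS y hy)
    obtain ⟨f1, f2⟩ := hstep S hS0 (fun y hy => by
      have := hS y hy
      rwa [Prod.norm_def, max_le_iff] at this) y hy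
    have f3 : c * S / ‖z‖ ≤ S / 2 := by
      rw [div_le_iff₀ hz0]
      nlinarith
    rw [Prod.norm_def, max_le_iff]
    refine ⟨?_, by simp only; linarith⟩
    have : ‖p y‖ ≤ ‖p y - 1‖ + ‖(1 : ℂ)‖ := by simpa using norm_add_le (p y - 1) 1
    rw [norm_one] at this
    simp only
    linarith
  have hfin : ∀ y ≤ x, ‖p y - 1‖ ≤ 2 * c / ‖z‖ ∧ ‖a y‖ ≤ 2 * c / ‖z‖ := by
    intro y hy
    have := hstep 2 (by norm_num) htwo y hy
    rwa [mul_comm c 2] at this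
  refine ⟨fun y hy => ?_, F, hFc, fun y hy => ?_, had⟩
  · have e1 : 2 * c / ‖z‖ ≤ C / ‖z‖ := by
      have := hCge.1
      gcongr
    exact ⟨(hfin y hy).1.trans e1, (hfin y hy).2.trans e1⟩
  · have hw0y := hw0 y
    -- Beyond the leading source i v'/z, each term has a second factor of order 1/z: a, p - 1, or an
    -- explicit power of z.
    have e0 : F y - Complex.I / z * v' y = -(Complex.I * H y / z) * a y +
        Complex.I / z * v' y * (p y - 1) + Complex.I * Complex.I * v y * H y / z ^ 2 * p y := by
      simp only [hF, hg]
      field_simp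
      ring
    have hwv : ‖v' y‖ ≤ w y := by
      simp only [hw]; linarith [norm_nonneg (u' y), norm_nonneg (c₀ - u y * v y)]
    rw [e0]
    refine (norm_add₃_le).trans ?_
    simp only [norm_mul, norm_div, norm_neg, Complex.norm_I, one_mul, norm_pow]
    have f1 : ‖H y‖ / ‖z‖ * ‖a y‖ ≤ w y / ‖z‖ * (2 * c / ‖z‖) := by
      have := hwH y
      have := (hfin y hy).2
      gcongr
    have f2 : 1 / ‖z‖ * ‖v' y‖ * ‖p y - 1‖ ≤ 1 / ‖z‖ * w y * (2 * c / ‖z‖) := by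
      have := (hfin y hy).1
      gcongr
    have f3 : ‖v y‖ * ‖H y‖ / ‖z‖ ^ 2 * ‖p y‖ ≤ K * w y / ‖z‖ ^ 2 * 2 := by
      have := hv y hy
      have := hwH y
      have := (htwo y hy).1
      gcongr
    refine (add_le_add (add_le_add f1 f2) f3).trans ?_
    have f4 : w y / ‖z‖ * (2 * c / ‖z‖) + 1 / ‖z‖ * w y * (2 * c / ‖z‖) + K * w y / ‖z‖ ^ 2 * 2 =
        (4 * c + 2 * K) / ‖z‖ ^ 2 * w y := by
      field_simp
      ring
    rw [f4]
    have : 4 * c + 2 * K ≤ C := by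
      rw [hC]
      nlinarith [norm_nonneg c₀]
    gcongr

/-- The asymptotics of the normalized solution for large spectral parameter. -/
theorem IsScatteringPotential.asymptotics {u v u' v' v'' : ℝ → ℂ} {c₀ : ℂ}
    (h : IsScatteringPotential u v u' v' v'' c₀) (x : ℝ) :
    (∃ C, ∀ z : ℂ, C ≤ ‖z‖ → ((z - c₀ / z) / 2).im ≤ 0 → ∀ p r,
      IsNormalizedSolution u v c₀ z p r → ‖p x - 1‖ ≤ C / ‖z‖ ∧ ‖r x‖ ≤ C / ‖z‖) ∧
    ∀ ε > 0, ∃ ρ, ∀ z : ℂ, ρ ≤ ‖z‖ → ((z - c₀ / z) / 2).im ≤ 0 → ∀ p r,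
      IsNormalizedSolution u v c₀ z p r → ‖z * r x + Complex.I * v x‖ ≤ ε := by
  obtain ⟨C, w, hC0, hwi, hw0, hvC, hC⟩ := h.exists_bounds x
  refine ⟨⟨C + C * (1 + C) + 1, fun z hz him p r hpr => ?_⟩, fun ε hε => ?_⟩
  · have hCC : 0 ≤ C * (1 + C) := by positivity
    have hz1 : 1 ≤ ‖z‖ := by linarith
    have hz0 : 0 < ‖z‖ := by linarith
    obtain ⟨h1, -⟩ := hC z (by linarith) him p r hpr
    obtain ⟨h2, h3⟩ := h1 x le_rfl
    refine ⟨h2.trans (by gcongr; linarith), ?_⟩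
    have e1 : r x = (r x + Complex.I * v x * p x / z) - Complex.I * v x * p x / z := by ring
    have e2 : ‖p x‖ ≤ 1 + C := by
      have h4 : ‖p x‖ ≤ ‖p x - 1‖ + ‖(1 : ℂ)‖ := by simpa using norm_add_le (p x - 1) 1
      have h5 : C / ‖z‖ ≤ C := div_le_self hC0 hz1
      rw [norm_one] at h4
      linarith
    have e3 : ‖Complex.I * v x * p x / z‖ ≤ C * (1 + C) / ‖z‖ := by
      rw [norm_div, norm_mul, norm_mul, Complex.norm_I, one_mul]
      have := hvC x le_rfl
      gcongr
    rw [e1]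
    refine (norm_sub_le _ _).trans ((add_le_add h3 e3).trans ?_)
    rw [← add_div]
    exact div_le_div_of_nonneg_right (by linarith) hz0.le
  · obtain ⟨ρ, hρ⟩ := exists_norm_integral_cexp_mul_le (x := x) h.hasDerivAt_right'
      h.continuous_right (h.integrable_right x) (half_pos hε)
    set L := ∫ y in Set.Iic x, w y
    have hL0 : 0 ≤ L := integral_nonneg hw0
    refine ⟨C + 1 + 4 * |ρ| + 2 * ‖c₀‖ + (C * L + C * C) / (ε / 2), fun z hz him p r hpr => ?_⟩
    have hQ : 0 ≤ (C * L + C * C) / (ε / 2) := by positivity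
    have hzC : C + 1 ≤ ‖z‖ := by linarith [abs_nonneg ρ, norm_nonneg c₀]
    have hz1 : 1 ≤ ‖z‖ := by linarith
    have hz0 : 0 < ‖z‖ := by linarith
    have hzne : z ≠ 0 := norm_pos_iff.1 hz0
    obtain ⟨h1, F, hFc, hFw, had⟩ := hC z (by linarith) him p r hpr
    set l := (z - c₀ / z) / 2 with hl
    have hlρ : ρ ≤ ‖l‖ := by
      have e2 : ‖c₀ / z‖ ≤ ‖z‖ / 2 := by
        rw [norm_div, div_le_iff₀ hz0]
        nlinarith [norm_nonneg c₀, abs_nonneg ρ]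
      rw [hl, norm_div, Complex.norm_ofNat]
      linarith [norm_sub_norm_le z (c₀ / z), le_abs_self ρ, abs_nonneg ρ, norm_nonneg c₀]
    have hwi' : IntegrableOn (fun y => C / ‖z‖ ^ 2 * w y) (Set.Iic x) := hwi.const_mul _
    have hdi : IntegrableOn (fun y => F y - Complex.I / z * v' y) (Set.Iic x) := by
      refine Integrable.mono' hwi' ?_ ((ae_restrict_iff' measurableSet_Iic).2
        (Eventually.of_forall fun y hy => hFw y hy))
      have hv'c : Continuous v' :=
        continuous_iff_continuousAt.2 fun y => (h.hasDerivAt_right' y).continuousAt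
      exact (by fun_prop : Continuous fun y => F y - Complex.I / z * v' y).aestronglyMeasurable
    have hvi : IntegrableOn (fun y => Complex.I / z * v' y) (Set.Iic x) :=
      (h.integrable_right x).const_mul _
    have hFi : IntegrableOn F (Set.Iic x) :=
      IntegrableOn.congr_fun (hdi.add hvi) (fun y _ => by simp) measurableSet_Iic
    have hcexp : ∀ f : ℝ → ℂ, IntegrableOn f (Set.Iic x) → IntegrableOn (fun y : ℝ =>
        Complex.exp (2 * Complex.I * l * (y - x)) * f y) (Set.Iic x) := by
      intro f hf
      refine Integrable.bdd_mul (c := 1) hf (by fun_prop : Continuous fun y : ℝ =>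
        Complex.exp (2 * Complex.I * l * (y - x))).aestronglyMeasurable
        ((ae_restrict_iff' measurableSet_Iic).2 (Eventually.of_forall fun y hy => ?_))
      exact norm_cexp_two_I_mul_sub_le him hy
    have ha := eq_integral_of_hasDerivAt him had hpr.tendsto_snd hFc hFi
    -- After multiplication by z the first part is of order 1/|z|, and the second tends to 0 by the
    -- Riemann-Lebesgue lemma for v'.
    have hsplit : ∫ y in Set.Iic x, Complex.exp (2 * Complex.I * l * (y - x)) * F y =
        (∫ y in Set.Iic x, Complex.exp (2 * Complex.I * l * (y - x)) * (F y - Complex.I / z * v' y)) +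
        Complex.I / z * ∫ y in Set.Iic x, Complex.exp (2 * Complex.I * l * (y - x)) * v' y := by
      rw [← integral_const_mul, ← integral_add (hcexp _ hdi) ((hcexp _ (h.integrable_right x)).const_mul _)]
      refine integral_congr_ae (Eventually.of_forall fun y => ?_)
      ring
    have e1 := norm_integral_cexp_mul_le him hwi' hFw
    rw [integral_const_mul] at e1
    have e2 := hρ l him hlρ
    have e3 : ‖z * (r x + Complex.I * v x * p x / z)‖ ≤ C * L / ‖z‖ + ε / 2 := by
      rw [ha, hsplit, mul_add]
      refine (norm_add_le _ _).trans (add_le_add ?_ ?_)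
      · rw [norm_mul]
        calc ‖z‖ * _ ≤ ‖z‖ * (C / ‖z‖ ^ 2 * L) := mul_le_mul_of_nonneg_left e1 hz0.le
          _ = C * L / ‖z‖ := by field_simp
      · rw [← mul_assoc, mul_div_cancel₀ _ hzne, norm_mul, Complex.norm_I, one_mul]
        exact e2
    have e4 : ‖Complex.I * v x * (p x - 1)‖ ≤ C * C / ‖z‖ := by
      rw [norm_mul, norm_mul, Complex.norm_I, one_mul, mul_div_assoc]
      exact mul_le_mul (hvC x le_rfl) (h1 x le_rfl).1 (norm_nonneg _) hC0
    have e5 : z * r x + Complex.I * v x =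
        z * (r x + Complex.I * v x * p x / z) - Complex.I * v x * (p x - 1) := by
      field_simp
      ring
    rw [e5]
    refine (norm_sub_le _ _).trans ((add_le_add e3 e4).trans ?_)
    have e6 : (C * L + C * C) / ‖z‖ ≤ ε / 2 := by
      have : (C * L + C * C) / (ε / 2) ≤ ‖z‖ := by linarith [abs_nonneg ρ, norm_nonneg c₀]
      rw [div_le_iff₀ (half_pos hε)] at this
      rw [div_le_iff₀ hz0]
      linarith
    rw [add_div] at e6
    linarith

end

section

variable {B : Background} {q : ℝ → ℝ → ℝ}

/-! ### The potentials as scattering potentials -/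

theorem IsClassicalSolution.hasDerivAt_iteratedDeriv (hq : IsClassicalSolution B q) {j : ℕ}
    (hj : j < 3) (x t : ℝ) : HasDerivAt (fun x => iteratedDeriv j (fun y => q y t) x)
      (iteratedDeriv (j + 1) (fun y => q y t) x) x := by
  have h := ((hq.smooth_x t).differentiable_iteratedDeriv j (by exact_mod_cast hj)) x
  rw [iteratedDeriv_succ]
  exact h.hasDerivAt

theorem IsClassicalSolution.continuous_iteratedDeriv (hq : IsClassicalSolution B q) {j : ℕ}
    (hj : j ≤ 3) (t : ℝ) : Continuous fun x => iteratedDeriv j (fun y => q y t) x :=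
  (hq.cont j hj).comp (by fun_prop : Continuous fun x : ℝ => (x, t))

/-- The properties of a potential at a fixed time that are used in the scattering problem. -/
structure IsStepProfile (f f' f'' : ℝ → ℝ) : Prop where
  hasDerivAt : ∀ x, HasDerivAt f (f' x) x
  hasDerivAt' : ∀ x, HasDerivAt f' (f'' x) x
  continuous' : Continuous f''
  bounded : ∃ K, ∀ x, |f x| ≤ K
  integrable : Integrable f'

theorem HasNZBC.tendsto (hbc : HasNZBC B q) (e : Side) (t : ℝ) :
    Tendsto (fun x => q x t) e.filter (𝓝 (B.bv e)) := by
  have := (hbc.lim e).tendstoLocallyUniformlyOn (s := Set.univ)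
  exact this.tendsto_at (Set.mem_univ t)

theorem isStepProfile_left (hq : IsClassicalSolution B q) (hbc : HasNZBC B q) (t : ℝ) :
    IsStepProfile (fun x => q x t) (fun x => iteratedDeriv 1 (fun y => q y t) x)
      (fun x => iteratedDeriv 2 (fun y => q y t) x) where
  hasDerivAt x := by simpa using hq.hasDerivAt_iteratedDeriv (j := 0) (by norm_num) x t
  hasDerivAt' x := hq.hasDerivAt_iteratedDeriv (j := 1) (by norm_num) x t
  continuous' := hq.continuous_iteratedDeriv (by norm_num) t
  bounded := by
    obtain ⟨K₁, h₁⟩ := exists_bound_Iic (hq.continuous t) (hbc.tendsto .minus t) 0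
    obtain ⟨K₂, h₂⟩ := exists_bound_Iic (f := fun x => q (-x) t)
      ((hq.continuous t).comp continuous_neg)
      ((hbc.tendsto .plus t).comp tendsto_neg_atBot_atTop) 0
    refine ⟨max K₁ K₂, fun x => ?_⟩
    rcases le_total x 0 with h | h
    · exact (h₁ x h).trans (le_max_left _ _)
    · have := h₂ (-x) (by linarith)
      rw [neg_neg] at this
      exact this.trans (le_max_right _ _)
  integrable := by simpa [iteratedDeriv_one] using hbc.integrable_deriv t

theorem IsStepProfile.comp_neg {f f' f'' : ℝ → ℝ} (h : IsStepProfile f f' f'') (c : ℝ) :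
    IsStepProfile (fun x => c * f (-x)) (fun x => -(c * f' (-x))) (fun x => c * f'' (-x)) where
  hasDerivAt x := by
    refine ((((h.hasDerivAt (-x)).comp x (hasDerivAt_neg x))).const_mul c).congr_deriv ?_
    ring
  hasDerivAt' x := by
    refine ((((h.hasDerivAt' (-x)).comp x (hasDerivAt_neg x))).const_mul c).neg.congr_deriv ?_
    ring
  continuous' := continuous_const.mul (h.continuous'.comp continuous_neg)
  bounded := by
    obtain ⟨K, hK⟩ := h.bounded
    refine ⟨|c| * K, fun x => ?_⟩
    rw [abs_mul]
    exact mul_le_mul_of_nonneg_left (hK _) (abs_nonneg _)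
  integrable := (h.integrable.comp_neg.const_mul c).neg

/-- The constant is the product q₊ · σ q₋ of the limits of the two factors at the right end. There
the difference splits into two terms, each bounded times integrable. The left half-line follows
because the product is invariant under (x,t) ↦ (-x,-t). -/
theorem integrable_sub_mul (hq : IsClassicalSolution B q) (hbc : HasNZBC B q) (t : ℝ) :
    Integrable fun x => B.κ * B.q0 ^ 2 - q x t * (B.σ * q (-x) (-t)) := by
  have hconst : B.κ * B.q0 ^ 2 = B.qp * (B.σ * B.qm) := by
    have := B.bv_sq .minus
    rw [← this]
    simp only [Background.κ, Background.bv, Background.qp]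
    ring
  have hIci : ∀ τ, IntegrableOn (fun x => q x τ - B.qp) (Set.Ici 0) := by
    intro τ
    refine Integrable.mono (hbc.weight_plus τ)
      ((hq.continuous τ).sub continuous_const).aestronglyMeasurable ?_
    refine Eventually.of_forall fun y => ?_
    rw [norm_mul]
    refine le_mul_of_one_le_left (norm_nonneg _) ?_
    rw [Real.norm_of_nonneg (by positivity)]
    linarith [abs_nonneg y]
  have hIic : ∀ τ, IntegrableOn (fun x => q x τ - B.qm) (Set.Iic 0) := by
    intro τ
    refine Integrable.mono (hbc.weight_minus τ)
      ((hq.continuous τ).sub continuous_const).aestronglyMeasurable ?_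
    refine Eventually.of_forall fun y => ?_
    rw [norm_mul]
    refine le_mul_of_one_le_left (norm_nonneg _) ?_
    rw [Real.norm_of_nonneg (by positivity)]
    linarith [abs_nonneg y]
  have hIci' : ∀ τ, IntegrableOn (fun x => q (-x) τ - B.qm) (Set.Ici 0) := by
    intro τ
    rw [← integrableOn_comp_neg_iff]
    simpa using hIic τ
  have hpos : ∀ τ, IntegrableOn (fun x => B.κ * B.q0 ^ 2 - q x τ * (B.σ * q (-x) (-τ)))
      (Set.Ici 0) := by
    intro τ
    obtain ⟨K, hK⟩ := (isStepProfile_left hq hbc (-τ)).bounded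
    have h1 : IntegrableOn (fun x => (B.σ * q (-x) (-τ)) * (q x τ - B.qp)) (Set.Ici 0) := by
      refine Integrable.bdd_mul (c := |B.σ| * K) (hIci τ) (continuous_const.mul
        ((hq.continuous (-τ)).comp continuous_neg)).aestronglyMeasurable
        (Eventually.of_forall fun x => ?_)
      rw [Real.norm_eq_abs, abs_mul]
      exact mul_le_mul_of_nonneg_left (hK _) (abs_nonneg _)
    have h2 : IntegrableOn (fun x => B.qp * B.σ * (q (-x) (-τ) - B.qm)) (Set.Ici 0) :=
      Integrable.const_mul (hIci' (-τ)) _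
    refine IntegrableOn.congr_fun (Integrable.neg (Integrable.add h1 h2)) (fun x _ => ?_)
      measurableSet_Ici
    rw [hconst]
    simp only [Pi.neg_apply, Pi.add_apply]
    ring
  have hneg : IntegrableOn (fun x => B.κ * B.q0 ^ 2 - q x t * (B.σ * q (-x) (-t))) (Set.Iic 0) := by
    have := integrableOn_comp_neg_iff.2 (hpos (-t))
    refine IntegrableOn.congr_fun this (fun x _ => ?_) measurableSet_Iic
    simp only [neg_neg]
    ring
  rw [← integrableOn_univ, ← Set.Iic_union_Ici (a := (0 : ℝ))]
  exact hneg.union (hpos t)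

theorem IsStepProfile.isScatteringPotential {f f' f'' g g' g'' : ℝ → ℝ} {c : ℝ}
    (hf : IsStepProfile f f' f'') (hg : IsStepProfile g g' g'')
    (hi : Integrable fun x => c - f x * g x) (e : Side) :
    IsScatteringPotential (fun y => (e.sgn * f (e.sgn * y) : ℂ)) (fun y => (e.sgn * g (e.sgn * y) : ℂ))
      (fun y => (f' (e.sgn * y) : ℂ)) (fun y => (g' (e.sgn * y) : ℂ))
      (fun y => (e.sgn * g'' (e.sgn * y) : ℂ)) c := by
  have hs := e.sgn_mul_self
  have hs0 : e.sgn ≠ 0 := fun h => by simp [h] at hs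
  have habs : |e.sgn| = 1 := by cases e <;> simp [Side.sgn]
  have hder : ∀ {f f' f'' : ℝ → ℝ}, IsStepProfile f f' f'' → ∀ y,
      HasDerivAt (fun y => (e.sgn * f (e.sgn * y) : ℂ)) (f' (e.sgn * y)) y := by
    intro f f' f'' hf y
    have h1 := ((hf.hasDerivAt (e.sgn * y)).comp y ((hasDerivAt_id y).const_mul e.sgn)).const_mul e.sgn
    have h2 := h1.ofReal_comp
    refine (h2.congr_deriv ?_).congr_of_eventuallyEq (Eventually.of_forall fun y => by simp)
    congr 1
    linear_combination f' (e.sgn * y) * hs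
  have hder' : ∀ y, HasDerivAt (fun y => (g' (e.sgn * y) : ℂ)) (e.sgn * g'' (e.sgn * y)) y := by
    intro y
    have h1 := (hg.hasDerivAt' (e.sgn * y)).comp y ((hasDerivAt_id y).const_mul e.sgn)
    refine (h1.ofReal_comp.congr_deriv ?_)
    push_cast
    ring
  have hcont : ∀ {f f' f'' : ℝ → ℝ}, IsStepProfile f f' f'' → Continuous f' := fun hf =>
    continuous_iff_continuousAt.2 fun y => (hf.hasDerivAt' y).continuousAt
  obtain ⟨K₁, h₁⟩ := hf.bounded
  obtain ⟨K₂, h₂⟩ := hg.bounded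
  refine ⟨hder hf, hder hg, hder', ?_, ?_, fun x => ⟨max K₁ K₂, fun y _ => ?_⟩, fun x => ?_, fun x => ?_,
    fun x => ?_⟩
  · exact Complex.continuous_ofReal.comp ((hcont hf).comp (continuous_const_mul _))
  · exact continuous_const.mul
      (Complex.continuous_ofReal.comp (hg.continuous'.comp (continuous_const_mul _)))
  · simp only [norm_mul, Complex.norm_real, Real.norm_eq_abs, habs, one_mul]
    exact ⟨(h₁ _).trans (le_max_left _ _), (h₂ _).trans (le_max_right _ _)⟩
  · exact (hf.integrable.comp_mul_left' hs0).ofReal.integrableOn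
  · exact (hg.integrable.comp_mul_left' hs0).ofReal.integrableOn
  · refine IntegrableOn.congr_fun (hi.comp_mul_left' hs0).ofReal.integrableOn (fun y _ => ?_)
      measurableSet_Iic
    have hsc := sgn_mul_self_complex e
    change ((c - f (e.sgn * y) * g (e.sgn * y) : ℝ) : ℂ) = _
    push_cast
    linear_combination f (e.sgn * y) * g (e.sgn * y) * hsc

/-! ### The asymptotics of the Jost solutions -/

theorem hasDerivAt_modJost_zero (hq : IsClassicalSolution B q) (hbc : HasNZBC B q) {e : Side}
    {j : Fin 2} (x t : ℝ) {z : ℂ} (hz : z ∈ jostRegion B e j) (hb : z ∉ branchPoints B) :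
    HasDerivAt (fun x => modJost B q e j x t z 0)
      (Complex.I * (kz B z - colSign j * lam B z) * modJost B q e j x t z 0 +
        q x t * modJost B q e j x t z 1) x := by
  refine ((hasDerivAt_pi.1 (hasDerivAt_modJost hq hbc x t hz hb)) 0).congr_deriv ?_
  simp only [laxX, potQ, pauli3, Matrix.mulVec, dotProduct, Fin.sum_univ_two, Matrix.sub_apply,
    Matrix.add_apply, Matrix.smul_apply, Matrix.of_apply, Matrix.cons_val', Matrix.cons_val_zero,
    Matrix.cons_val_one, Matrix.cons_val_fin_one, Matrix.one_apply_eq, Matrix.one_apply_ne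
      (zero_ne_one' (Fin 2)), smul_eq_mul]
  ring

theorem hasDerivAt_modJost_one (hq : IsClassicalSolution B q) (hbc : HasNZBC B q) {e : Side}
    {j : Fin 2} (x t : ℝ) {z : ℂ} (hz : z ∈ jostRegion B e j) (hb : z ∉ branchPoints B) :
    HasDerivAt (fun x => modJost B q e j x t z 1)
      (B.σ * q (-x) (-t) * modJost B q e j x t z 0 -
        Complex.I * (kz B z + colSign j * lam B z) * modJost B q e j x t z 1) x := by
  refine ((hasDerivAt_pi.1 (hasDerivAt_modJost hq hbc x t hz hb)) 1).congr_deriv ?_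
  simp only [laxX, potQ, pauli3, Matrix.mulVec, dotProduct, Fin.sum_univ_two, Matrix.sub_apply,
    Matrix.add_apply, Matrix.smul_apply, Matrix.of_apply, Matrix.cons_val', Matrix.cons_val_zero,
    Matrix.cons_val_one, Matrix.cons_val_fin_one, Matrix.one_apply_eq, Matrix.one_apply_ne
      (one_ne_zero' (Fin 2)), smul_eq_mul]
  ring

/-- The asymptotics of the Jost solutions for large spectral parameter. -/
theorem modJost_asymptotics (hq : IsClassicalSolution B q) (hbc : HasNZBC B q) (e : Side)
    (j : Fin 2) (x t : ℝ) :
    (∃ C, ∀ z ∈ jostRegion B e j \ branchPoints B, C ≤ ‖z‖ →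
      ‖modJost B q e j x t z j - 1‖ ≤ C / ‖z‖ ∧ ‖modJost B q e j x t z (1 - j)‖ ≤ C / ‖z‖) ∧
    ∀ ε > 0, ∃ ρ, ∀ z ∈ jostRegion B e j \ branchPoints B, ρ ≤ ‖z‖ →
      ‖z * modJost B q e j x t z (1 - j) + Complex.I * colSign j * potQ B q x t (1 - j) j‖ ≤ ε := by
  have hj : j = 0 ∨ j = 1 := by fin_cases j <;> simp
  have hsgn : ∀ x : ℝ, e.sgn * (e.sgn * x) = x := fun x => by
    rw [← mul_assoc, e.sgn_mul_self, one_mul]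
  have hsc := sgn_mul_self_complex e
  have hs0 : (e.sgn : ℂ) ≠ 0 := fun h => by simp [h] at hsc
  have hsn : ‖(e.sgn : ℂ)‖ = 1 := by cases e <;> simp [Side.sgn]
  have hcc := colSign_mul_self j
  have hc0 : colSign j ≠ 0 := fun h => by simp [h] at hcc
  have hcn : ‖colSign j‖ = 1 := by fin_cases j <;> simp [colSign]
  obtain ⟨u', v', v'', hpot⟩ : ∃ u' v' v'', IsScatteringPotential
      (fun y => e.sgn * potQ B q (e.sgn * y) t j (1 - j))
      (fun y => e.sgn * potQ B q (e.sgn * y) t (1 - j) j) u' v' v'' (B.κ * B.q0 ^ 2) := by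
    have hf := isStepProfile_left hq hbc t
    have hg := (isStepProfile_left hq hbc (-t)).comp_neg B.σ
    have hi := integrable_sub_mul hq hbc t
    have hi' : Integrable fun x => B.κ * B.q0 ^ 2 - B.σ * q (-x) (-t) * q x t := by
      simpa only [mul_comm] using hi
    have h1 : ∃ u' v' v'', IsScatteringPotential (fun y => (e.sgn * q (e.sgn * y) t : ℂ))
        (fun y => (e.sgn * (B.σ * q (-(e.sgn * y)) (-t) : ℝ) : ℂ)) u' v' v''
        ((B.κ * B.q0 ^ 2 : ℝ) : ℂ) := ⟨_, _, _, hf.isScatteringPotential hg hi e⟩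
    have h2 : ∃ u' v' v'', IsScatteringPotential
        (fun y => (e.sgn * (B.σ * q (-(e.sgn * y)) (-t) : ℝ) : ℂ))
        (fun y => (e.sgn * q (e.sgn * y) t : ℂ)) u' v' v''
        ((B.κ * B.q0 ^ 2 : ℝ) : ℂ) := ⟨_, _, _, hg.isScatteringPotential hf hi' e⟩
    rcases hj with rfl | rfl
    · simpa [potQ] using h1
    · simpa [potQ] using h2
  -- With the end moved to -∞ and the j-th component taken first, every column solves the same
  -- scattering problem, with z multiplied by the two signs of the end and of the column.
  have hsol : ∀ z ∈ jostRegion B e j \ branchPoints B, IsNormalizedSolution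
      (fun y => e.sgn * potQ B q (e.sgn * y) t j (1 - j))
      (fun y => e.sgn * potQ B q (e.sgn * y) t (1 - j) j) (B.κ * B.q0 ^ 2) (e.sgn * colSign j * z)
      (fun y => modJost B q e j (e.sgn * y) t z j)
      (fun y => modJost B q e j (e.sgn * y) t z (1 - j)) := by
    intro z hz
    have hz0 : z ≠ 0 := hz.1.1
    have hd0 := fun y => (hasDerivAt_modJost_zero hq hbc (e.sgn * y) t hz.1 hz.2).scomp y
      ((hasDerivAt_id y).const_mul e.sgn)
    have hd1 := fun y => (hasDerivAt_modJost_one hq hbc (e.sgn * y) t hz.1 hz.2).scomp y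
      ((hasDerivAt_id y).const_mul e.sgn)
    have hkp := kz_add_lam B z
    have hkm := kz_sub_lam B z
    have hlim := (tendsto_modJost hq hbc t hz.1 hz.2).comp e.tendsto_sgn_mul
    have hlim0 := (tendsto_pi_nhds.1 hlim) 0
    have hlim1 := (tendsto_pi_nhds.1 hlim) 1
    have hQ0 : Tendsto (fun y => potQ B q (e.sgn * y) t 0 1) atBot (𝓝 (B.bv e : ℂ)) :=
      (Complex.continuous_ofReal.tendsto _).comp ((hbc.tendsto e t).comp e.tendsto_sgn_mul)
    -- The reflected potential takes its limit from the opposite end at the time -t.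
    have hQ1 : Tendsto (fun y => potQ B q (e.sgn * y) t 1 0) atBot (𝓝 (B.κ * B.bv e : ℂ)) := by
      have h1 : ∃ e' : Side, Tendsto (fun y => -(e.sgn * y)) atBot e'.filter ∧
          B.σ * B.bv e' = B.κ * B.bv e := by
        have hδ2 : B.δ * B.δ = 1 := by rcases B.delta_eq with h | h <;> simp [h]
        cases e
        · refine ⟨.minus, ?_, ?_⟩
          · simp only [Side.sgn, Side.filter, neg_mul, one_mul, neg_neg]
            exact tendsto_id
          · simp only [Background.κ, Background.bv, Background.qp]
            linear_combination -(B.σ * B.qm) * hδ2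
        · refine ⟨.plus, ?_, ?_⟩
          · simpa [Side.sgn, Side.filter] using tendsto_neg_atBot_atTop
          · simp only [Background.κ, Background.bv, Background.qp]
            ring
      obtain ⟨e', he', hv⟩ := h1
      have h2 := ((hbc.tendsto e' (-t)).comp he').const_mul B.σ
      rw [hv] at h2
      have h3 := (Complex.continuous_ofReal.tendsto _).comp h2
      simpa [potQ, Function.comp_def] using h3
    have hI := Complex.I_sq
    rcases hj with rfl | rfl
    · simp only [sub_zero, colSign, Matrix.cons_val_zero, mul_one, one_mul]
        at *
      refine ⟨fun y => (hd0 y).congr_deriv ?_, fun y => (hd1 y).congr_deriv ?_, ?_, ?_⟩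
      · rw [Complex.real_smul, hkm]
        simp only [potQ, Matrix.of_apply, Matrix.cons_val', Matrix.cons_val_zero, Matrix.cons_val_one,
          Matrix.cons_val_fin_one]
        field_simp
        linear_combination (Complex.I * B.κ * B.q0 ^ 2 * modJost B q e 0 (e.sgn * y) t z 0) * hsc
      · rw [Complex.real_smul, hkp]
        simp only [potQ, Matrix.of_apply, Matrix.cons_val', Matrix.cons_val_zero, Matrix.cons_val_one,
          Matrix.cons_val_fin_one]
        ring
      · simpa [eigCol, eigE] using hlim0
      · have := hlim1.add (((hQ1.const_mul (Complex.I / z))).mul hlim0)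
        have e0 : eigCol B e 0 z 1 + Complex.I / z * (B.κ * B.bv e) * eigCol B e 0 z 0 = 0 := by
          simp only [eigCol, eigE, Matrix.of_apply, Matrix.cons_val', Matrix.cons_val_zero,
            Matrix.cons_val_one, Matrix.cons_val_fin_one]
          field_simp
          ring
        rw [e0] at this
        refine this.congr fun y => ?_
        simp only [Function.comp]
        field_simp
    · simp only [sub_self, colSign, Matrix.cons_val_one,
        Matrix.cons_val_fin_one, neg_mul, one_mul, mul_neg, mul_one, sub_neg_eq_add,
        ← sub_eq_add_neg] at *
      refine ⟨fun y => (hd1 y).congr_deriv ?_, fun y => (hd0 y).congr_deriv ?_, ?_, ?_⟩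
      · rw [Complex.real_smul, hkm]
        simp only [potQ, Matrix.of_apply, Matrix.cons_val', Matrix.cons_val_zero, Matrix.cons_val_one,
          Matrix.cons_val_fin_one]
        field_simp
        linear_combination -(Complex.I * B.κ * B.q0 ^ 2 * modJost B q e 1 (e.sgn * y) t z 1) * hsc
      · rw [Complex.real_smul, hkp]
        simp only [potQ, Matrix.of_apply, Matrix.cons_val', Matrix.cons_val_zero, Matrix.cons_val_one,
          Matrix.cons_val_fin_one]
        ring
      · simpa [eigCol, eigE] using hlim1
      · have := hlim0.sub (((hQ0.const_mul (Complex.I / z))).mul hlim1)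
        have e0 : eigCol B e 1 z 0 - Complex.I / z * (B.bv e) * eigCol B e 1 z 1 = 0 := by
          simp only [eigCol, eigE, Matrix.of_apply, Matrix.cons_val', Matrix.cons_val_zero,
            Matrix.cons_val_one, Matrix.cons_val_fin_one]
          field_simp
          ring
        rw [e0] at this
        refine this.congr fun y => ?_
        simp only [Function.comp]
        field_simp
        ring
  have hnorm : ∀ z : ℂ, ‖(e.sgn : ℂ) * colSign j * z‖ = ‖z‖ := fun z => by
    rw [norm_mul, norm_mul, hsn, hcn, one_mul, one_mul]
  have him : ∀ z ∈ jostRegion B e j, ((e.sgn * colSign j * z -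
      B.κ * B.q0 ^ 2 / (e.sgn * colSign j * z)) / 2).im ≤ 0 := by
    intro z hz
    have hz0 : z ≠ 0 := hz.1
    have : (e.sgn * colSign j * z - B.κ * B.q0 ^ 2 / (e.sgn * colSign j * z)) / 2 =
        jostRate B e j z := by
      rw [jostRate, lam]
      field_simp
      linear_combination (-(B.κ : ℂ) * B.q0 ^ 2) * (-hsc * colSign j ^ 2 - hcc)
    rw [this]
    exact hz.2
  obtain ⟨⟨C, hC⟩, hε⟩ := hpot.asymptotics (e.sgn * x)
  refine ⟨⟨C, fun z hz hCz => ?_⟩, fun ε hε0 => ?_⟩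
  · have := hC _ (by rwa [hnorm]) (him z hz.1) _ _ (hsol z hz)
    simpa only [hnorm, hsgn] using this
  · obtain ⟨ρ, hρ⟩ := hε ε hε0
    refine ⟨ρ, fun z hz hρz => ?_⟩
    have := hρ _ (by rwa [hnorm]) (him z hz.1) _ _ (hsol z hz)
    simp only [hsgn] at this
    have e1 : z * modJost B q e j x t z (1 - j) + Complex.I * colSign j * potQ B q x t (1 - j) j =
        e.sgn * colSign j * (e.sgn * colSign j * z * modJost B q e j x t z (1 - j) +
          Complex.I * (e.sgn * potQ B q x t (1 - j) j)) := by
      linear_combination (-(z * modJost B q e j x t z (1 - j) * colSign j ^ 2) -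
        colSign j * Complex.I * potQ B q x t (1 - j) j) * hsc -
        z * modJost B q e j x t z (1 - j) * hcc
    rwa [e1, hnorm]

end

section

/-! ### Compatible pairs of linear equations -/

theorem gronwallBound_le {δ K ε x : ℝ} (hK : 1 ≤ K) (hε : 0 ≤ ε) (hx : 0 ≤ x) :
    gronwallBound δ K ε x ≤ (δ + ε) * Real.exp (K * x) := by
  have hK0 : K ≠ 0 := by linarith
  rw [gronwallBound_of_K_ne_0 hK0, add_mul]
  have h1 : 1 ≤ Real.exp (K * x) := Real.one_le_exp (by positivity)
  have h2 : ε / K ≤ ε := div_le_self hε hK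
  have h3 : ε / K * (Real.exp (K * x) - 1) ≤ ε * Real.exp (K * x) :=
    mul_le_mul h2 (by linarith) (by linarith) hε
  linarith

theorem hasDerivAt_mulVec {M : ℝ → Matrix (Fin 2) (Fin 2) ℂ} {M' : Matrix (Fin 2) (Fin 2) ℂ}
    {f : ℝ → Fin 2 → ℂ} {f' : Fin 2 → ℂ} {x : ℝ}
    (hM : ∀ i j, HasDerivAt (fun y => M y i j) (M' i j) x) (hf : HasDerivAt f f' x) :
    HasDerivAt (fun y => (M y).mulVec (f y)) (M'.mulVec (f x) + (M x).mulVec f') x := by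
  refine hasDerivAt_pi.2 fun i => ?_
  have := HasDerivAt.fun_sum (u := Finset.univ) fun j _ => (hM i j).fun_mul (hasDerivAt_pi.1 hf j)
  refine this.congr_deriv ?_
  rw [Pi.add_apply]
  simp only [Matrix.mulVec, dotProduct, Finset.sum_add_distrib]

theorem eventually_forall_absSum_le {M : ℝ → ℝ → Matrix (Fin 2) (Fin 2) ℂ}
    (hM : Continuous fun p : ℝ × ℝ => M p.1 p.2) {K : Set ℝ} (hK : IsCompact K) (t : ℝ) {ε : ℝ}
    (hε : 0 < ε) : ∀ᶠ s in 𝓝 t, ∀ y ∈ K, absSum (M y s - M y t) ≤ ε := by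
  refine hK.eventually_forall_of_forall_eventually (P := fun s y => absSum (M y s - M y t) ≤ ε)
    fun y _ => ?_
  have h1 : Continuous fun p : ℝ × ℝ => M p.2 p.1 := hM.comp (continuous_snd.prodMk continuous_fst)
  have h2 : Continuous fun p : ℝ × ℝ => M p.2 t := hM.comp (continuous_snd.prodMk continuous_const)
  have hc : Continuous fun p : ℝ × ℝ => absSum (M p.2 p.1 - M p.2 t) :=
    continuous_absSum.comp (h1.sub h2)
  have h0 : absSum (M y t - M y t) < ε := by rw [sub_self]; simpa [absSum] using hε
  have h3 : Tendsto (fun p : ℝ × ℝ => absSum (M p.2 p.1 - M p.2 t)) (𝓝 (t, y))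
    (𝓝 (absSum (M y t - M y t))) := hc.tendsto (t, y)
  exact (h3.eventually (gt_mem_nhds h0)).mono fun p hp => le_of_lt hp

section
variable {X T X' : ℝ → ℝ → Matrix (Fin 2) (Fin 2) ℂ} {Ψ : ℝ → ℝ → Fin 2 → ℂ}

/-- Only continuity in time at x = 0 is known beforehand. Grönwall for Ψ(·,s) - Ψ(·,t) spreads it
over [0, x], with η chosen so that the Grönwall factor returns exactly ε. -/
theorem eventually_norm_sub_le_of_hasDerivAt (hXc : Continuous fun p : ℝ × ℝ => X p.1 p.2)
    (hΨx : ∀ x t, HasDerivAt (fun y => Ψ y t) ((X x t).mulVec (Ψ x t)) x) {t : ℝ}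
    (hΨt : ContinuousAt (fun s => Ψ 0 s) t) {K C : ℝ} {x : ℝ} (hK : 1 ≤ K)
    (hKX : ∀ᶠ s in 𝓝 t, ∀ y ∈ Set.uIcc 0 x, absSum (X y s) ≤ K)
    (hC : ∀ y ∈ Set.uIcc 0 x, ‖Ψ y t‖ ≤ C) {ε : ℝ} (hε : 0 < ε) :
    ∀ᶠ s in 𝓝 t, ∀ b ∈ Set.uIcc 0 x, ‖Ψ b s - Ψ b t‖ ≤ ε := by
  have hC0 : 0 ≤ C := (norm_nonneg _).trans (hC 0 Set.left_mem_uIcc)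
  set G := Real.exp (K * |x|) with hG
  have hG0 : 0 < G := Real.exp_pos _
  set η := ε / ((1 + (C + 1)) * G) with hη
  have hη0 : 0 < η := by positivity
  have h1 : ∀ᶠ s in 𝓝 t, ‖Ψ 0 s - Ψ 0 t‖ < η := by
    have := (hΨt.sub (continuousAt_const (y := Ψ 0 t))).norm
    have h0 : ‖Ψ 0 t - Ψ 0 t‖ < η := by simpa using hη0
    exact this.eventually (gt_mem_nhds h0)
  filter_upwards [h1, hKX, eventually_forall_absSum_le hXc isCompact_uIcc t hη0] with s hs1 hs2 hs3
  intro b hb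
  have hbs : Set.uIcc 0 b ⊆ Set.uIcc 0 x := Set.uIcc_subset_uIcc_left hb
  have hgr := norm_le_gronwallBound_of_uIcc (a := 0) (b := b) (K := K) (ε := η * C)
    (f := fun y => Ψ y s - Ψ y t) (fun y _ => (hΨx y s).fun_sub (hΨx y t)) (fun y hy => by
      have e1 : (X y s).mulVec (Ψ y s) - (X y t).mulVec (Ψ y t) =
          (X y s).mulVec (Ψ y s - Ψ y t) + (X y s - X y t).mulVec (Ψ y t) := by
        rw [Matrix.mulVec_sub, Matrix.sub_mulVec]
        abel
      rw [e1]
      refine (norm_add_le _ _).trans (add_le_add ((norm_mulVec_le _ _).trans ?_)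
        ((norm_mulVec_le _ _).trans ?_))
      · exact mul_le_mul_of_nonneg_right (hs2 y (hbs hy)) (norm_nonneg _)
      · exact mul_le_mul (hs3 y (hbs hy)) (hC y (hbs hy)) (norm_nonneg _) hη0.le)
  have hbx : |b - 0| ≤ |x| := by
    rw [sub_zero]
    have := Set.abs_sub_left_of_mem_uIcc hb
    simpa using this
  refine hgr.trans ((gronwallBound_le hK (by positivity) (abs_nonneg _)).trans ?_)
  have e2 : Real.exp (K * |b - 0|) ≤ G := Real.exp_le_exp.2 (by gcongr)
  calc (‖Ψ 0 s - Ψ 0 t‖ + η * C) * Real.exp (K * |b - 0|) ≤ (η + η * (C + 1)) * G := by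
        gcongr
        linarith
    _ = η * ((1 + (C + 1)) * G) := by ring
    _ = ε := div_mul_cancel₀ _ (by positivity)

theorem eventually_norm_mulVec_sub_le (hX'c : Continuous fun p : ℝ × ℝ => X' p.1 p.2)
    (hX : ∀ x t i j, HasDerivAt (fun s => X x s i j) (X' x t i j) t) {K : Set ℝ} (hK : IsCompact K)
    (t : ℝ) {ε : ℝ} (hε : 0 < ε) : ∀ᶠ s in 𝓝 t, ∀ y ∈ K, ∀ w,
      ‖(X y s - X y t - ((s - t : ℝ) : ℂ) • X' y t).mulVec w‖ ≤ ε * |s - t| * ‖w‖ := by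
  obtain ⟨ρ, hρ, h⟩ := Metric.eventually_nhds_iff_ball.1
    (eventually_forall_absSum_le hX'c hK t hε)
  refine Metric.eventually_nhds_iff_ball.2 ⟨ρ, hρ, fun s hs y hy w => ?_⟩
  have hd : ∀ τ, HasDerivAt (fun τ => (X y τ).mulVec w - ((τ : ℝ) : ℂ) • (X' y t).mulVec w)
      ((X' y τ - X' y t).mulVec w) τ := by
    intro τ
    have h1 := hasDerivAt_mulVec (hX y τ) (hasDerivAt_const τ w)
    have h2 : HasDerivAt (fun τ : ℝ => (τ : ℂ) • (X' y t).mulVec w) ((1 : ℂ) • (X' y t).mulVec w) τ :=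
      (hasDerivAt_id τ).ofReal_comp.smul_const _
    refine (h1.fun_sub h2).congr_deriv ?_
    rw [Matrix.mulVec_zero, add_zero, one_smul, Matrix.sub_mulVec]
  have := (convex_ball t ρ).norm_image_sub_le_of_norm_hasDerivWithin_le (C := ε * ‖w‖)
    (fun τ _ => (hd τ).hasDerivWithinAt) (fun τ hτ => (norm_mulVec_le _ _).trans
      (mul_le_mul_of_nonneg_right (h τ hτ y hy) (norm_nonneg _))) (Metric.mem_ball_self hρ) hs
  refine le_trans (le_of_eq ?_) (this.trans (le_of_eq ?_))
  · congr 1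
    rw [Matrix.sub_mulVec, Matrix.sub_mulVec, Matrix.smul_mulVec]
    push_cast
    rw [sub_smul]
    abel
  · rw [Real.norm_eq_abs]
    ring

/-- The error D(y) = Ψ(y,s) - Ψ(y,t) - (s - t) T Ψ(y,t) is o(s - t) at y = 0. By zero curvature it
satisfies D' = X D up to terms that are o(s - t) uniformly on [0, x], so Grönwall carries the
estimate to x. No mixed derivative of Ψ has to exist beforehand. -/
theorem hasDerivAt_of_zeroCurvature (hXc : Continuous fun p : ℝ × ℝ => X p.1 p.2)
    (hX'c : Continuous fun p : ℝ × ℝ => X' p.1 p.2)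
    (hX : ∀ x t i j, HasDerivAt (fun s => X x s i j) (X' x t i j) t)
    (hT : ∀ x t i j, HasDerivAt (fun y => T y t i j)
      ((X' x t + X x t * T x t - T x t * X x t) i j) x)
    (hΨx : ∀ x t, HasDerivAt (fun y => Ψ y t) ((X x t).mulVec (Ψ x t)) x)
    (hΨt : ∀ t, HasDerivAt (fun s => Ψ 0 s) ((T 0 t).mulVec (Ψ 0 t)) t) (x t : ℝ) :
    HasDerivAt (fun s => Ψ x s) ((T x t).mulVec (Ψ x t)) t := by
  have hΨc : Continuous fun y => Ψ y t :=
    continuous_iff_continuousAt.2 fun y => (hΨx y t).continuousAt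
  obtain ⟨C, hC⟩ := (isCompact_uIcc (a := 0) (b := x)).exists_bound_of_continuousOn
    hΨc.continuousOn
  have hC0 : 0 ≤ C := (norm_nonneg _).trans (hC 0 Set.left_mem_uIcc)
  obtain ⟨K₁, hK₁⟩ := (isCompact_uIcc (a := 0) (b := x)).exists_bound_of_continuousOn
    (f := fun y => absSum (X y t) + absSum (X' y t))
    ((continuous_absSum.comp (hXc.comp (by fun_prop : Continuous fun y : ℝ => (y, t)))).add
      (continuous_absSum.comp (hX'c.comp (by fun_prop : Continuous fun y : ℝ => (y, t))))).continuousOn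
  set K := |K₁| + 1 with hKdef
  have hK : 1 ≤ K := by linarith [abs_nonneg K₁]
  have hXK : ∀ y ∈ Set.uIcc 0 x, absSum (X y t) ≤ K - 1 ∧ absSum (X' y t) ≤ K := by
    intro y hy
    have h1 := (Real.le_norm_self _).trans (hK₁ y hy)
    have := le_abs_self K₁
    constructor <;> linarith [absSum_nonneg (X y t), absSum_nonneg (X' y t)]
  have habs : ∀ A B : Matrix (Fin 2) (Fin 2) ℂ, absSum A ≤ absSum (A - B) + absSum B := by
    intro A B
    simp only [absSum, ← Finset.sum_add_distrib]
    refine Finset.sum_le_sum fun i _ => Finset.sum_le_sum fun j _ => ?_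
    simpa using norm_add_le ((A - B) i j) (B i j)
  have hKX : ∀ᶠ s in 𝓝 t, ∀ y ∈ Set.uIcc 0 x, absSum (X y s) ≤ K := by
    filter_upwards [eventually_forall_absSum_le hXc isCompact_uIcc t one_pos] with s hs y hy
    linarith [habs (X y s) (X y t), hs y hy, (hXK y hy).1]
  rw [hasDerivAt_iff_isLittleO, Asymptotics.isLittleO_iff]
  intro c hc
  set G := Real.exp (K * |x|) with hG
  have hG0 : 0 < G := Real.exp_pos _
  set η := c / ((1 + (C + 1 + K)) * G) with hη
  have hη0 : 0 < η := by positivity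
  have h1 := (Asymptotics.isLittleO_iff.1 (hasDerivAt_iff_isLittleO.1 (hΨt t))) hη0
  have h2 := eventually_norm_sub_le_of_hasDerivAt hXc hΨx (hΨt t).continuousAt hK hKX hC
    (ε := min η 1) (by positivity)
  have h3 := eventually_norm_mulVec_sub_le hX'c hX (isCompact_uIcc (a := 0) (b := x)) t hη0
  filter_upwards [h1, h2, h3] with s hs1 hs2 hs3
  rw [Real.norm_eq_abs] at hs1 ⊢
  set D : ℝ → Fin 2 → ℂ := fun y =>
    Ψ y s - Ψ y t - ((s - t : ℝ) : ℂ) • (T y t).mulVec (Ψ y t) with hD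
  set D' : ℝ → Fin 2 → ℂ := fun y => (X y t).mulVec (D y) +
    (X y s - X y t - ((s - t : ℝ) : ℂ) • X' y t).mulVec (Ψ y s) +
    ((s - t : ℝ) : ℂ) • (X' y t).mulVec (Ψ y s - Ψ y t) with hD'
  have hDd : ∀ y, HasDerivAt D (D' y) y := by
    intro y
    have f1 := hasDerivAt_mulVec (hT y t) (hΨx y t)
    refine (((hΨx y s).fun_sub (hΨx y t)).fun_sub (f1.const_smul ((s - t : ℝ) : ℂ))).congr_deriv ?_
    simp only [hD', hD, Matrix.mulVec_sub, Matrix.sub_mulVec, Matrix.add_mulVec, Matrix.smul_mulVec,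
      Matrix.mulVec_smul, Matrix.mulVec_mulVec, smul_sub, smul_add]
    abel
  have hgr := norm_le_gronwallBound_of_uIcc (a := 0) (b := x) (K := K)
    (ε := η * |s - t| * (C + 1 + K)) (fun y _ => hDd y) (fun y hy => by
      have f2 := hs2 y hy
      have f3 : ‖Ψ y s‖ ≤ C + 1 := by
        have : ‖Ψ y s‖ ≤ ‖Ψ y s - Ψ y t‖ + ‖Ψ y t‖ := by
          simpa using norm_add_le (Ψ y s - Ψ y t) (Ψ y t)
        linarith [hC y hy, f2.trans (min_le_right _ _)]
      have g1 : ‖(X y t).mulVec (D y)‖ ≤ K * ‖D y‖ := (norm_mulVec_le _ _).trans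
        (mul_le_mul_of_nonneg_right (by linarith [(hXK y hy).1]) (norm_nonneg _))
      have g2 := (hs3 y hy (Ψ y s)).trans
        (mul_le_mul_of_nonneg_left f3 (by positivity : 0 ≤ η * |s - t|))
      have g3 : ‖((s - t : ℝ) : ℂ) • (X' y t).mulVec (Ψ y s - Ψ y t)‖ ≤ |s - t| * (K * η) := by
        rw [norm_smul, Complex.norm_real, Real.norm_eq_abs]
        refine mul_le_mul_of_nonneg_left ((norm_mulVec_le _ _).trans ?_) (abs_nonneg _)
        exact mul_le_mul (hXK y hy).2 (f2.trans (min_le_left _ _)) (norm_nonneg _) (by linarith)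
      refine (norm_add₃_le).trans ((add_le_add (add_le_add g1 g2) g3).trans (le_of_eq ?_))
      ring)
  have hDx : Ψ x s - Ψ x t - (s - t) • (T x t).mulVec (Ψ x t) = D x := by
    simp only [hD, Complex.coe_smul]
  have hD0 : ‖D 0‖ ≤ η * |s - t| := by
    refine le_trans (le_of_eq ?_) hs1
    simp only [hD, Complex.coe_smul]
  rw [hDx]
  refine hgr.trans ((gronwallBound_le hK (by positivity) (abs_nonneg _)).trans ?_)
  rw [sub_zero]
  calc (‖D 0‖ + η * |s - t| * (C + 1 + K)) * G
      ≤ (η * |s - t| + η * |s - t| * (C + 1 + K)) * G := by gcongr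
    _ = η * ((1 + (C + 1 + K)) * G) * |s - t| := by ring
    _ = c * |s - t| := by rw [hη, div_mul_cancel₀ _ (by positivity)]

/-- A pair of linear equations satisfying the zero-curvature condition has solutions. -/
theorem exists_zeroCurvature_solution (hXc : Continuous fun p : ℝ × ℝ => X p.1 p.2)
    (hX'c : Continuous fun p : ℝ × ℝ => X' p.1 p.2) (hTc : Continuous fun t => T 0 t)
    (hX : ∀ x t i j, HasDerivAt (fun s => X x s i j) (X' x t i j) t)
    (hT : ∀ x t i j, HasDerivAt (fun y => T y t i j)
      ((X' x t + X x t * T x t - T x t * X x t) i j) x) (t₀ : ℝ) (v : Fin 2 → ℂ) :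
    ∃ Ψ : ℝ → ℝ → Fin 2 → ℂ, Ψ 0 t₀ = v ∧
      (∀ x t, HasDerivAt (fun y => Ψ y t) ((X x t).mulVec (Ψ x t)) x) ∧
      ∀ x t, HasDerivAt (fun s => Ψ x s) ((T x t).mulVec (Ψ x t)) t := by
  -- The temporal equation is solved along x = 0, and its values serve as initial data for the
  -- spatial equation at each time. Zero curvature then propagates the temporal equation to all x.
  obtain ⟨ψ, hψ0, hψ⟩ := exists_linearODE_solution hTc t₀ v
  choose f hf0 hf using fun t => exists_linearODE_solution (A := fun y => X y t)
    (hXc.comp (by fun_prop : Continuous fun y : ℝ => (y, t))) 0 (ψ t)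
  refine ⟨fun x t => f t x, (hf0 t₀).trans hψ0, fun x t => hf t x, fun x t => ?_⟩
  refine hasDerivAt_of_zeroCurvature (Ψ := fun x t => f t x) hXc hX'c hX hT (fun x t => hf t x)
    (fun t => ?_) x t
  simpa only [hf0] using hψ t

end

end

section

variable {B : Background} {q : ℝ → ℝ → ℝ}

/-! ### The Lax pair -/

/-- The `x`-derivatives of the potential `q(x,t)`. -/
def qx (q : ℝ → ℝ → ℝ) (j : ℕ) (x t : ℝ) : ℂ := (iteratedDeriv j (fun y => q y t) x : ℝ)

variable (B q) in
/-- The `x`-derivatives of the reflected potential `σ q(-x,-t)`. -/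
def rx (j : ℕ) (x t : ℝ) : ℂ := (-1) ^ j * B.σ * qx q j (-x) (-t)

/-- The matrix of the temporal part of the Lax pair, in terms of the two potentials and their
derivatives. -/
def laxMat (k u u' u'' v v' v'' : ℂ) : Matrix (Fin 2) (Fin 2) ℂ :=
  !![4 * Complex.I * k ^ 3 + 2 * Complex.I * k * (u * v) + (v * u' - u * v'),
      4 * k ^ 2 * u - 2 * Complex.I * k * u' - u'' + 2 * u ^ 2 * v;
     4 * k ^ 2 * v + 2 * Complex.I * k * v' - v'' + 2 * u * v ^ 2,
      -(4 * Complex.I * k ^ 3 + 2 * Complex.I * k * (u * v) + (v * u' - u * v'))]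

variable (B q) in
/-- The matrix of the temporal part of the Lax pair. -/
def laxT (x t : ℝ) (z : ℂ) : Matrix (Fin 2) (Fin 2) ℂ :=
  laxMat (kz B z) (qx q 0 x t) (qx q 1 x t) (qx q 2 x t) (rx B q 0 x t) (rx B q 1 x t) (rx B q 2 x t)

variable (B q) in
/-- The time derivative of the matrix of the spatial part of the Lax pair. -/
def laxX' (x t : ℝ) : Matrix (Fin 2) (Fin 2) ℂ :=
  !![0, 6 * qx q 0 x t * rx B q 0 x t * qx q 1 x t - qx q 3 x t;
     6 * qx q 0 x t * rx B q 0 x t * rx B q 1 x t - rx B q 3 x t, 0]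

theorem laxX_eq (x t : ℝ) (z : ℂ) : laxX B q x t z =
    !![Complex.I * kz B z, qx q 0 x t; rx B q 0 x t, -(Complex.I * kz B z)] := by
  ext i j
  fin_cases i <;> fin_cases j <;> simp [laxX, potQ, pauli3, qx, rx]

theorem continuous_qx (hq : IsClassicalSolution B q) {j : ℕ} (hj : j ≤ 3) :
    Continuous fun p : ℝ × ℝ => qx q j p.1 p.2 :=
  Complex.continuous_ofReal.comp (hq.cont j hj)

theorem continuous_rx (hq : IsClassicalSolution B q) {j : ℕ} (hj : j ≤ 3) :
    Continuous fun p : ℝ × ℝ => rx B q j p.1 p.2 :=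
  continuous_const.mul ((continuous_qx hq hj).comp
    (continuous_fst.neg.prodMk continuous_snd.neg))

theorem hasDerivAt_qx (hq : IsClassicalSolution B q) {j : ℕ} (hj : j < 3) (x t : ℝ) :
    HasDerivAt (fun y => qx q j y t) (qx q (j + 1) x t) x :=
  (hq.hasDerivAt_iteratedDeriv hj x t).ofReal_comp

theorem hasDerivAt_rx (hq : IsClassicalSolution B q) {j : ℕ} (hj : j < 3) (x t : ℝ) :
    HasDerivAt (fun y => rx B q j y t) (rx B q (j + 1) x t) x := by
  have h := ((hasDerivAt_qx hq hj (-x) (-t)).scomp x (hasDerivAt_neg x)).const_mul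
    ((-1) ^ j * B.σ : ℂ)
  refine h.congr_deriv ?_
  rw [rx, pow_succ, neg_one_smul]
  ring

theorem hasDerivAt_qx_time (hq : IsClassicalSolution B q) (x t : ℝ) :
    HasDerivAt (fun s => qx q 0 x s)
      (6 * qx q 0 x t * rx B q 0 x t * qx q 1 x t - qx q 3 x t) t := by
  have h := (hq.smooth_t x t).hasDerivAt.ofReal_comp
  have he : deriv (fun s => q x s) t = 6 * B.σ * q (-x) (-t) * q x t * deriv (fun y => q y t) x -
      iteratedDeriv 3 (fun y => q y t) x := by linarith [hq.eqn x t]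
  rw [he] at h
  refine (h.congr_deriv ?_).congr_of_eventuallyEq (Eventually.of_forall fun s => by simp [qx])
  simp only [qx, rx, iteratedDeriv_zero, iteratedDeriv_one]
  push_cast
  ring

/-- Every term of the equation is odd under (x,t) ↦ (-x,-t), and σ² = 1. Thus v = σ q(-x,-t) obeys
the companion equation, and (u, v) solves the coupled mKdV system whose Lax pair is used here. -/
theorem hasDerivAt_rx_time (hq : IsClassicalSolution B q) (x t : ℝ) :
    HasDerivAt (fun s => rx B q 0 x s)
      (6 * qx q 0 x t * rx B q 0 x t * rx B q 1 x t - rx B q 3 x t) t := by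
  have h := ((hasDerivAt_qx_time hq (-x) (-t)).scomp t (hasDerivAt_neg t)).const_mul
    ((-1) ^ 0 * B.σ : ℂ)
  have hσ : (B.σ : ℂ) * B.σ = 1 := by rcases B.sigma_eq with h | h <;> simp [h]
  refine h.congr_deriv ?_
  simp only [rx, neg_neg, neg_one_smul]
  ring

theorem hasDerivAt_laxX_time (hq : IsClassicalSolution B q) (z : ℂ) (x t : ℝ) (i j : Fin 2) :
    HasDerivAt (fun s => laxX B q x s z i j) (laxX' B q x t i j) t := by
  simp only [laxX_eq]
  fin_cases i <;> fin_cases j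
  · exact hasDerivAt_const t _
  · exact hasDerivAt_qx_time hq x t
  · exact hasDerivAt_rx_time hq x t
  · exact hasDerivAt_const t _

/-- This is the zero-curvature identity. As `laxX'` expresses the time derivative through
x-derivatives by the equation, it is an algebraic identity in derivatives of order at most three. -/
theorem hasDerivAt_laxT (hq : IsClassicalSolution B q) (z : ℂ) (x t : ℝ) (i j : Fin 2) :
    HasDerivAt (fun y => laxT B q y t z i j) ((laxX' B q x t + laxX B q x t z * laxT B q x t z -
      laxT B q x t z * laxX B q x t z) i j) x := by
  have u0 := hasDerivAt_qx hq (j := 0) (by norm_num) x t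
  have u1 := hasDerivAt_qx hq (j := 1) (by norm_num) x t
  have u2 := hasDerivAt_qx hq (j := 2) (by norm_num) x t
  have v0 := hasDerivAt_rx hq (j := 0) (by norm_num) x t
  have v1 := hasDerivAt_rx hq (j := 1) (by norm_num) x t
  have v2 := hasDerivAt_rx hq (j := 2) (by norm_num) x t
  have ha := (((u0.fun_mul v0).const_mul (2 * Complex.I * kz B z)).const_add
    (4 * Complex.I * kz B z ^ 3)).fun_add ((v0.fun_mul u1).fun_sub (u0.fun_mul v1))
  have hI := Complex.I_sq
  rw [laxX_eq]
  fin_cases i <;> fin_cases j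
  · refine ha.congr_deriv ?_
    simp [laxX', laxT, laxMat]
    ring
  · refine ((((u0.const_mul (4 * kz B z ^ 2)).fun_sub
      (u1.const_mul (2 * Complex.I * kz B z))).fun_sub u2).fun_add
      (((u0.fun_pow 2).const_mul 2).fun_mul v0)).congr_deriv ?_
    simp [laxX', laxT, laxMat]
    ring_nf
    simp only [hI]
    ring
  · refine ((((v0.const_mul (4 * kz B z ^ 2)).fun_add
      (v1.const_mul (2 * Complex.I * kz B z))).fun_sub v2).fun_add
      ((u0.const_mul 2).fun_mul (v0.fun_pow 2))).congr_deriv ?_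
    simp [laxX', laxT, laxMat]
    ring_nf
    simp only [hI]
    ring
  · refine ha.fun_neg.congr_deriv ?_
    simp [laxX', laxT, laxMat]
    ring

theorem continuous_matrix_two' {Y : Type*} [TopologicalSpace Y] {f g h k : Y → ℂ} (hf : Continuous f)
    (hg : Continuous g) (hh : Continuous h) (hk : Continuous k) :
    Continuous fun x => !![f x, g x; h x, k x] := by
  refine continuous_matrix fun i j => ?_
  fin_cases i <;> fin_cases j <;> simpa

theorem continuous_laxMat (k : ℂ) : Continuous fun p : ℂ × ℂ × ℂ × ℂ × ℂ × ℂ =>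
    laxMat k p.1 p.2.1 p.2.2.1 p.2.2.2.1 p.2.2.2.2.1 p.2.2.2.2.2 := by
  unfold laxMat
  exact continuous_matrix_two' (by fun_prop) (by fun_prop) (by fun_prop) (by fun_prop)

theorem continuous_laxT (hq : IsClassicalSolution B q) (z : ℂ) :
    Continuous fun p : ℝ × ℝ => laxT B q p.1 p.2 z := by
  have hu0 := continuous_qx hq (j := 0) (by norm_num)
  have hu1 := continuous_qx hq (j := 1) (by norm_num)
  have hu2 := continuous_qx hq (j := 2) (by norm_num)
  have hv0 := continuous_rx hq (j := 0) (by norm_num)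
  have hv1 := continuous_rx hq (j := 1) (by norm_num)
  have hv2 := continuous_rx hq (j := 2) (by norm_num)
  unfold laxT laxMat
  generalize qx q 0 = u0 at *
  generalize qx q 1 = u1 at *
  generalize qx q 2 = u2 at *
  generalize rx B q 0 = v0 at *
  generalize rx B q 1 = v1 at *
  generalize rx B q 2 = v2 at *
  exact continuous_matrix_two' (by fun_prop) (by fun_prop) (by fun_prop) (by fun_prop)

theorem continuous_laxX (hq : IsClassicalSolution B q) (z : ℂ) :
    Continuous fun p : ℝ × ℝ => laxX B q p.1 p.2 z := by
  simp only [laxX_eq]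
  exact continuous_matrix_two' continuous_const (continuous_qx hq (by norm_num))
    (continuous_rx hq (by norm_num)) continuous_const

theorem continuous_laxX' (hq : IsClassicalSolution B q) :
    Continuous fun p : ℝ × ℝ => laxX' B q p.1 p.2 := by
  have hu0 := continuous_qx hq (j := 0) (by norm_num)
  have hu1 := continuous_qx hq (j := 1) (by norm_num)
  have hu3 := continuous_qx hq (j := 3) (by norm_num)
  have hv0 := continuous_rx hq (j := 0) (by norm_num)
  have hv1 := continuous_rx hq (j := 1) (by norm_num)
  have hv3 := continuous_rx hq (j := 3) (by norm_num)
  exact continuous_matrix_two' continuous_const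
    ((((continuous_const.mul hu0).mul hv0).mul hu1).sub hu3)
    ((((continuous_const.mul hu0).mul hv0).mul hv1).sub hv3) continuous_const

/-! ### The time evolution of the Jost solutions -/

variable (B) in
/-- The limit of the matrix of the temporal part at an end is a multiple of `X_±`. -/
theorem laxMat_limit (e : Side) (z : ℂ) :
    laxMat (kz B z) (B.bv e) 0 0 (B.κ * B.bv e) 0 0 =
      (4 * kz B z ^ 2 + 2 * B.κ * B.q0 ^ 2) • limX B e z := by
  have h := B.bv_sq_complex e
  have hκ := B.kappa_sq
  ext i j
  fin_cases i <;> fin_cases j <;> simp [laxMat, limX, limQ, pauli3]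
  · linear_combination (2 * Complex.I * kz B z * B.κ) * h
  · linear_combination (2 * B.κ * B.bv e) * h
  · linear_combination (2 * B.κ ^ 2 * B.bv e) * h
  · linear_combination -(2 * Complex.I * kz B z * B.κ) * h

def Side.opp : Side → Side
  | .plus => .minus
  | .minus => .plus

theorem Side.tendsto_neg (e : Side) : Tendsto (fun x : ℝ => -x) e.filter e.opp.filter := by
  cases e
  · exact tendsto_neg_atTop_atBot
  · exact tendsto_neg_atBot_atTop

variable (B) in
theorem Background.sigma_mul_bv_opp (e : Side) : B.σ * B.bv e.opp = B.κ * B.bv e := by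
  have hδ2 : B.δ * B.δ = 1 := by rcases B.delta_eq with h | h <;> simp [h]
  cases e
  · simp only [Background.κ, Background.bv, Background.qp, Side.opp]
    linear_combination -(B.σ * B.qm) * hδ2
  · simp only [Background.κ, Background.bv, Background.qp, Side.opp]
    ring

theorem tendsto_qx_prod (hbc : HasNZBC B q) (e : Side) {K : Set ℝ} (hK : IsCompact K) {j : ℕ}
    (hj : j ≤ 2) : Tendsto (fun p : ℝ × ℝ => qx q j p.1 p.2) (e.filter ×ˢ 𝓟 K)
      (𝓝 (if j = 0 then (B.bv e : ℂ) else 0)) := by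
  have hu : TendstoLocallyUniformly (fun x t => iteratedDeriv j (fun y => q y t) x)
      (fun _ => if j = 0 then B.bv e else 0) e.filter := by
    interval_cases j
    · simpa using hbc.lim e
    · simpa using hbc.lim_deriv e 1 (Or.inl rfl)
    · simpa using hbc.lim_deriv e 2 (Or.inr rfl)
  have h1 := tendstoLocallyUniformly_iff_forall_isCompact.1 hu K hK
  have h2 := tendsto_prod_principal_iff.2 h1
  have h3 := (Complex.continuous_ofReal.tendsto _).comp h2
  refine (h3.congr fun p => rfl).trans (le_of_eq ?_)
  split_ifs <;> simp

theorem tendsto_rx_prod (hbc : HasNZBC B q) (e : Side) {K : Set ℝ} (hK : IsCompact K) {j : ℕ}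
    (hj : j ≤ 2) : Tendsto (fun p : ℝ × ℝ => rx B q j p.1 p.2) (e.filter ×ˢ 𝓟 K)
      (𝓝 (if j = 0 then (B.κ * B.bv e : ℂ) else 0)) := by
  have hK' : IsCompact ((fun t : ℝ => -t) '' K) := hK.image continuous_neg
  have h1 := tendsto_qx_prod hbc e.opp hK' hj
  have h2 : Tendsto (fun p : ℝ × ℝ => (-p.1, -p.2)) (e.filter ×ˢ 𝓟 K)
      (e.opp.filter ×ˢ 𝓟 ((fun t : ℝ => -t) '' K)) :=
    e.tendsto_neg.prodMap (tendsto_principal_principal.2 fun t ht => ⟨t, ht, rfl⟩)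
  have h3 := (h1.comp h2).const_mul ((-1) ^ j * B.σ : ℂ)
  refine (h3.congr fun p => rfl).trans (le_of_eq ?_)
  have h4 : (B.σ : ℂ) * B.bv e.opp = B.κ * B.bv e := by exact_mod_cast B.sigma_mul_bv_opp e
  split_ifs with h
  · rw [h, pow_zero, one_mul, h4]
  · simp

theorem tendsto_absSum_laxT (hbc : HasNZBC B q) (e : Side) {K : Set ℝ} (hK : IsCompact K) (z : ℂ) :
    Tendsto (fun p : ℝ × ℝ => absSum (laxT B q p.1 p.2 z -
      (4 * kz B z ^ 2 + 2 * B.κ * B.q0 ^ 2) • limX B e z)) (e.filter ×ˢ 𝓟 K) (𝓝 0) := by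
  rw [← laxMat_limit]
  have hc : Continuous fun p : ℂ × ℂ × ℂ × ℂ × ℂ × ℂ =>
      absSum (laxMat (kz B z) p.1 p.2.1 p.2.2.1 p.2.2.2.1 p.2.2.2.2.1 p.2.2.2.2.2 -
        laxMat (kz B z) (B.bv e) 0 0 (B.κ * B.bv e) 0 0) :=
    continuous_absSum.comp ((continuous_laxMat (kz B z)).sub continuous_const)
  have h := ((tendsto_qx_prod hbc e hK (j := 0) (by norm_num)).prodMk_nhds <|
    (tendsto_qx_prod hbc e hK (j := 1) (by norm_num)).prodMk_nhds <|
    (tendsto_qx_prod hbc e hK (j := 2) (by norm_num)).prodMk_nhds <|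
    (tendsto_rx_prod hbc e hK (j := 0) (by norm_num)).prodMk_nhds <|
    (tendsto_rx_prod hbc e hK (j := 1) (by norm_num)).prodMk_nhds
    (tendsto_rx_prod hbc e hK (j := 2) (by norm_num)))
  have h2 := (hc.tendsto _).comp h
  refine (h2.congr fun p => rfl).trans (le_of_eq ?_)
  simp [absSum]

theorem limX_mulVec_eigCol (e : Side) (j : Fin 2) {z : ℂ} (hz : z ≠ 0) :
    (limX B e z).mulVec (eigCol B e j z) = (Complex.I * (colSign j * lam B z)) • eigCol B e j z := by
  have h := jostMat_mulVec_eigCol (B := B) e j hz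
  have hsc := sgn_mul_self_complex e
  have hs0 : (e.sgn : ℂ) ≠ 0 := fun h => by simp [h] at hsc
  rw [jostMat, Matrix.smul_mulVec, smul_eq_zero, or_iff_right hs0, Matrix.sub_mulVec, sub_eq_zero,
    Matrix.smul_mulVec, Matrix.one_mulVec] at h
  exact h

theorem hasDerivAt_theta_space (x t : ℝ) (z : ℂ) :
    HasDerivAt (fun y : ℝ => theta B y t z) (lam B z) x := by
  have h : HasDerivAt (fun y : ℝ => (y : ℂ)) 1 x := (hasDerivAt_id x).ofReal_comp
  refine ((h.add_const ((4 * kz B z ^ 2 + 2 * B.κ * B.q0 ^ 2) * (t : ℂ))).const_mul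
    (lam B z)).congr_deriv (mul_one _)

theorem hasDerivAt_theta_time (x t : ℝ) (z : ℂ) :
    HasDerivAt (fun s : ℝ => theta B x s z)
      (lam B z * (4 * kz B z ^ 2 + 2 * B.κ * B.q0 ^ 2)) t := by
  have h : HasDerivAt (fun y : ℝ => (y : ℂ)) 1 t := (hasDerivAt_id t).ofReal_comp
  refine (((h.const_mul (4 * kz B z ^ 2 + 2 * B.κ * B.q0 ^ 2)).const_add (x : ℂ)).const_mul
    (lam B z)).congr_deriv ?_
  rw [mul_one]

/-- Multiplication of a solution of a linear equation by an exponential factor. -/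
theorem hasDerivAt_cexp_smul {θ : ℝ → ℂ} {θ' c : ℂ} {f : ℝ → Fin 2 → ℂ}
    {M : Matrix (Fin 2) (Fin 2) ℂ} {x : ℝ} (hθ : HasDerivAt θ θ' x)
    (hf : HasDerivAt f (M.mulVec (f x)) x) :
    HasDerivAt (fun y => Complex.exp (c * θ y) • f y)
      ((M + (c * θ') • 1).mulVec (Complex.exp (c * θ x) • f x)) x := by
  refine ((hθ.const_mul c).cexp.fun_smul hf).congr_deriv ?_
  rw [Matrix.add_mulVec, Matrix.mulVec_smul, Matrix.smul_mulVec, Matrix.one_mulVec, smul_smul,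
    mul_comm (c * θ')]

theorem hasDerivAt_jost_space (hq : IsClassicalSolution B q) (hbc : HasNZBC B q) {e : Side}
    {j : Fin 2} (x t : ℝ) {z : ℂ} (hz : z ∈ jostRegion B e j) (hb : z ∉ branchPoints B) :
    HasDerivAt (fun y => jost B q e j y t z) ((laxX B q x t z).mulVec (jost B q e j x t z)) x := by
  refine (hasDerivAt_cexp_smul (c := Complex.I * colSign j) (hasDerivAt_theta_space x t z)
    (hasDerivAt_modJost hq hbc x t hz hb)).congr_deriv ?_
  rw [mul_assoc, sub_add_cancel]
  rfl

/-- The eigencolumn is a stationary solution of the limiting temporal equation. The coefficients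
converge uniformly on the compact time interval, so Grönwall keeps Ξ close to it. The locally
uniform convergence of q, q_x, q_xx is used here. -/
theorem tendsto_of_hasDerivAt_time (hbc : HasNZBC B q) {e : Side} {j : Fin 2} {z : ℂ} (hz : z ≠ 0)
    {Ξ : ℝ → ℝ → Fin 2 → ℂ} (hΞ : ∀ x t, HasDerivAt (fun s => Ξ x s) ((laxT B q x t z -
      (Complex.I * colSign j * (lam B z * (4 * kz B z ^ 2 + 2 * B.κ * B.q0 ^ 2))) • 1).mulVec
        (Ξ x t)) t) {t₀ : ℝ} (h₀ : Tendsto (fun x => Ξ x t₀) e.filter (𝓝 (eigCol B e j z))) (t : ℝ) :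
    Tendsto (fun x => Ξ x t) e.filter (𝓝 (eigCol B e j z)) := by
  set ω := 4 * kz B z ^ 2 + 2 * B.κ * B.q0 ^ 2 with hω
  set L := ω • limX B e z with hL
  set N := (Complex.I * colSign j * (lam B z * ω)) • (1 : Matrix (Fin 2) (Fin 2) ℂ) with hN
  set E := eigCol B e j z with hE
  have hLE : (L - N).mulVec E = 0 := by
    rw [Matrix.sub_mulVec, hL, hN, Matrix.smul_mulVec, Matrix.smul_mulVec, Matrix.one_mulVec,
      limX_mulVec_eigCol e j hz, smul_smul, ← sub_smul]
    rw [show ω * (Complex.I * (colSign j * lam B z)) - Complex.I * colSign j * (lam B z * ω) = 0 by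
      ring, zero_smul]
  have hT := tendsto_absSum_laxT hbc e (isCompact_uIcc (a := t₀) (b := t)) z
  set K := absSum (L - N) + 1 with hK
  have hK1 : 1 ≤ K := by linarith [absSum_nonneg (L - N)]
  rw [tendsto_iff_norm_sub_tendsto_zero] at h₀ ⊢
  rw [Metric.tendsto_nhds]
  intro ε hε
  set G := Real.exp (K * |t - t₀|) with hG
  have hG0 : 0 < G := Real.exp_pos _
  set η := ε / (2 * (1 + (‖E‖ + 1)) * G) with hη
  have hη0 : 0 < η := by positivity
  have h1 : ∀ᶠ x in e.filter, ∀ s ∈ Set.uIcc t₀ t, absSum (laxT B q x s z - L) < min η 1 := by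
    have := hT.eventually (gt_mem_nhds (lt_min hη0 one_pos))
    exact eventually_prod_principal_iff.1 this
  filter_upwards [h1, h₀.eventually (gt_mem_nhds hη0)] with x hx1 hx2
  have hgr := norm_le_gronwallBound_of_uIcc (a := t₀) (b := t) (K := K) (ε := η * ‖E‖)
    (f := fun s => Ξ x s - E) (fun s _ => (hΞ x s).sub_const E) (fun s hs => by
      have e1 : (laxT B q x s z - N).mulVec (Ξ x s) = (laxT B q x s z - L).mulVec (Ξ x s - E) +
          (L - N).mulVec (Ξ x s - E) + (laxT B q x s z - L).mulVec E := by
        have e2 : laxT B q x s z - N = (laxT B q x s z - L) + (L - N) := by abel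
        rw [e2, Matrix.add_mulVec, Matrix.mulVec_sub, Matrix.mulVec_sub, hLE]
        abel
      rw [e1]
      have f1 := (hx1 s hs).le
      have f2 : ‖(laxT B q x s z - L).mulVec (Ξ x s - E)‖ ≤ 1 * ‖Ξ x s - E‖ :=
        (norm_mulVec_le _ _).trans (mul_le_mul_of_nonneg_right (f1.trans (min_le_right _ _))
          (norm_nonneg _))
      have f3 : ‖(L - N).mulVec (Ξ x s - E)‖ ≤ absSum (L - N) * ‖Ξ x s - E‖ := norm_mulVec_le _ _
      have f4 : ‖(laxT B q x s z - L).mulVec E‖ ≤ η * ‖E‖ :=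
        (norm_mulVec_le _ _).trans (mul_le_mul_of_nonneg_right (f1.trans (min_le_left _ _))
          (norm_nonneg _))
      refine (norm_add₃_le).trans ((add_le_add (add_le_add f2 f3) f4).trans (le_of_eq ?_))
      rw [hK]
      ring)
  rw [Real.dist_eq, sub_zero, abs_of_nonneg (norm_nonneg _)]
  refine lt_of_le_of_lt (hgr.trans (gronwallBound_le hK1 (by positivity) (abs_nonneg _))) ?_
  calc (‖Ξ x t₀ - E‖ + η * ‖E‖) * G ≤ (η + η * (‖E‖ + 1)) * G := by
        gcongr
        linarith
    _ = η * (2 * (1 + (‖E‖ + 1)) * G) / 2 := by ring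
    _ = ε / 2 := by rw [hη, div_mul_cancel₀ _ (by positivity)]
    _ < ε := half_lt_self hε

/-- The Jost solutions solve the temporal part of the Lax pair. -/
theorem hasDerivAt_jost_time (hq : IsClassicalSolution B q) (hbc : HasNZBC B q) {e : Side}
    {j : Fin 2} (x t : ℝ) {z : ℂ} (hz : z ∈ jostRegion B e j) (hb : z ∉ branchPoints B) :
    HasDerivAt (fun s => jost B q e j x s z) ((laxT B q x t z).mulVec (jost B q e j x t z)) t := by
  set c := Complex.I * colSign j with hc
  -- The candidate Ψ solves both Lax equations and equals the Jost solution at the origin, hence on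
  -- the line t = 0. With the exponential removed it keeps the normalization at the end for all
  -- times, and uniqueness identifies it with the Jost solution.
  obtain ⟨Ψ, h0, hx, ht⟩ := exists_zeroCurvature_solution (continuous_laxX hq z)
    (continuous_laxX' hq) ((continuous_laxT hq z).comp
      (by fun_prop : Continuous fun t : ℝ => ((0 : ℝ), t)))
    (hasDerivAt_laxX_time hq z) (hasDerivAt_laxT hq z) 0 (jost B q e j 0 0 z)
  have hΨ0 : ∀ y, Ψ y 0 = jost B q e j y 0 z := by
    intro y
    have := linearODE_eq_zero (A := fun y => laxX B q y 0 z) (s₀ := 0)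
      (f := fun y => Ψ y 0 - jost B q e j y 0 z)
      ((continuous_laxX hq z).comp (by fun_prop : Continuous fun y : ℝ => (y, (0 : ℝ))))
      (fun y => ((hx y 0).fun_sub (hasDerivAt_jost_space hq hbc y 0 hz hb)).congr_deriv
        (Matrix.mulVec_sub _ _ _).symm) (by simp [h0]) y
    exact sub_eq_zero.1 this
  set Ξ : ℝ → ℝ → Fin 2 → ℂ := fun x t => Complex.exp (-c * theta B x t z) • Ψ x t with hΞ
  have hΞt : ∀ x t, HasDerivAt (fun s => Ξ x s) ((laxT B q x t z -
      (c * (lam B z * (4 * kz B z ^ 2 + 2 * B.κ * B.q0 ^ 2))) • 1).mulVec (Ξ x t)) t := by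
    intro x t
    refine (hasDerivAt_cexp_smul (c := -c) (hasDerivAt_theta_time x t z) (ht x t)).congr_deriv ?_
    rw [neg_mul, neg_smul, ← sub_eq_add_neg]
  have hΞx : ∀ x t, HasDerivAt (fun y => Ξ y t) ((laxX B q x t z -
      (Complex.I * (colSign j * lam B z)) • 1).mulVec (Ξ x t)) x := by
    intro x t
    refine (hasDerivAt_cexp_smul (c := -c) (hasDerivAt_theta_space x t z) (hx x t)).congr_deriv ?_
    rw [neg_mul, neg_smul, ← sub_eq_add_neg, hc, mul_assoc]
  have hexp : ∀ x t, Complex.exp (-c * theta B x t z) * Complex.exp (c * theta B x t z) = 1 := by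
    intro x t
    rw [← Complex.exp_add, neg_mul, neg_add_cancel, Complex.exp_zero]
  have hlim0 : Tendsto (fun x => Ξ x 0) e.filter (𝓝 (eigCol B e j z)) := by
    refine (tendsto_modJost hq hbc 0 hz hb).congr fun x => ?_
    simp only [hΞ, hΨ0, jost]
    rw [smul_smul, hexp, one_smul]
  have hlim := tendsto_of_hasDerivAt_time hbc hz.1 hΞt hlim0
  have hmod : ∀ x t, jost B q e j x t z = Ψ x t := by
    intro x t
    rw [jost, modJost_eq hq hbc hz hb (hlim t) (fun x => hΞx x t) x]
    simp only [hΞ]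
    rw [smul_smul, ← hc, mul_comm, hexp, one_smul]
  simp only [hmod]
  exact ht x t

/-- The Wronskian of two solutions of an equation with trace-free matrix is constant. -/
theorem wr_eq_of_hasDerivAt {M : ℝ → Matrix (Fin 2) (Fin 2) ℂ} {f g : ℝ → Fin 2 → ℂ}
    (hM : ∀ s, M s 1 1 = -M s 0 0) (hf : ∀ s, HasDerivAt f ((M s).mulVec (f s)) s)
    (hg : ∀ s, HasDerivAt g ((M s).mulVec (g s)) s) (s s' : ℝ) : wr (f s) (g s) = wr (f s') (g s') := by
  refine is_const_of_deriv_eq_zero (f := fun s => wr (f s) (g s)) ?_ ?_ s s'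
  all_goals
    have key : ∀ s, HasDerivAt (fun s => wr (f s) (g s)) 0 s := by
      intro s
      have f0 := hasDerivAt_pi.1 (hf s) 0
      have f1 := hasDerivAt_pi.1 (hf s) 1
      have g0 := hasDerivAt_pi.1 (hg s) 0
      have g1 := hasDerivAt_pi.1 (hg s) 1
      refine ((f0.fun_mul g1).fun_sub (f1.fun_mul g0)).congr_deriv ?_
      simp only [Matrix.mulVec, dotProduct, Fin.sum_univ_two, hM]
      ring
  · exact fun s => (key s).differentiableAt
  · exact fun s => (key s).deriv

/-- Both Lax matrices are trace-free. This justifies evaluating the scattering coefficients at the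
origin. -/
theorem wr_jost_eq (hq : IsClassicalSolution B q) (hbc : HasNZBC B q) {e e' : Side}
    {j j' : Fin 2} (x t : ℝ) {z : ℂ} (hz : z ∈ jostRegion B e j) (hz' : z ∈ jostRegion B e' j')
    (hb : z ∉ branchPoints B) : wr (jost B q e j x t z) (jost B q e' j' x t z) =
      wr (jost B q e j 0 0 z) (jost B q e' j' 0 0 z) := by
  rw [wr_eq_of_hasDerivAt (M := fun y => laxX B q y t z) (fun y => by simp [laxX_eq])
    (fun y => hasDerivAt_jost_space hq hbc y t hz hb)
    (fun y => hasDerivAt_jost_space hq hbc y t hz' hb) x 0]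
  exact wr_eq_of_hasDerivAt (M := fun s => laxT B q 0 s z) (fun y => by simp [laxT, laxMat])
    (fun y => hasDerivAt_jost_time hq hbc 0 y hz hb)
    (fun y => hasDerivAt_jost_time hq hbc 0 y hz' hb) t 0

end

section

variable {B : Background} {q : ℝ → ℝ → ℝ}

/-! ### The regions in terms of `λ` -/

theorem lam_im (z : ℂ) : (lam B z).im = z.im / 2 * (1 + B.κ * B.q0 ^ 2 / Complex.normSq z) := by
  have h1 : (B.κ * B.q0 ^ 2 / z : ℂ) = ((B.κ * B.q0 ^ 2 : ℝ) : ℂ) * z⁻¹ := by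
    push_cast
    rw [div_eq_mul_inv]
  have h2 : lam B z = ((1 / 2 : ℝ) : ℂ) * (z - ((B.κ * B.q0 ^ 2 : ℝ) : ℂ) * z⁻¹) := by
    rw [lam, h1]
    push_cast
    ring
  rw [h2, Complex.im_ofReal_mul, Complex.sub_im, Complex.im_ofReal_mul, Complex.inv_im]
  ring

theorem kappa_cases_lam_im {z : ℂ} (hz : z ≠ 0) :
    (B.κ = 1 ∧ ∃ c > 0, (lam B z).im = c * z.im) ∨
      (B.κ = -1 ∧ ∃ c > 0, (lam B z).im = c * ((‖z‖ - B.q0) * z.im)) := by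
  have hn : 0 < ‖z‖ := norm_pos_iff.2 hz
  have hq := B.q0_pos
  rcases B.kappa_eq with h | h
  · refine Or.inl ⟨h, 1 / 2 * (1 + B.q0 ^ 2 / ‖z‖ ^ 2), by positivity, ?_⟩
    rw [lam_im, h, Complex.normSq_eq_norm_sq]
    ring
  · refine Or.inr ⟨h, (‖z‖ + B.q0) / (2 * ‖z‖ ^ 2), by positivity, ?_⟩
    rw [lam_im, h, Complex.normSq_eq_norm_sq]
    field_simp
    ring

/-- One condition on λ replaces the two geometric cases of δσ and matches the sign condition under
which the columns exist. -/
theorem mem_Dplus_iff {z : ℂ} : z ∈ Dplus B ↔ z ≠ 0 ∧ 0 < (lam B z).im := by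
  by_cases hz : z = 0
  · simp [hz, Dplus]
  simp only [ne_eq, hz, not_false_eq_true, true_and]
  have h11 : (1 : ℝ) ≠ -1 := by norm_num
  rcases kappa_cases_lam_im (B := B) hz with ⟨h, c, hc, hl⟩ | ⟨h, c, hc, hl⟩
  · simp only [Dplus, Set.mem_ofPred_eq, h, true_and, h11, false_and, or_false, hl]
    exact (mul_pos_iff_of_pos_left hc).symm
  · simp only [Dplus, Set.mem_ofPred_eq, h, true_and, h11.symm, false_and, false_or, hl]
    exact (mul_pos_iff_of_pos_left hc).symm

theorem mem_Dminus_iff {z : ℂ} : z ∈ Dminus B ↔ z ≠ 0 ∧ (lam B z).im < 0 := by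
  by_cases hz : z = 0
  · simp [hz, Dminus]
  simp only [ne_eq, hz, not_false_eq_true, true_and]
  have h11 : (1 : ℝ) ≠ -1 := by norm_num
  rcases kappa_cases_lam_im (B := B) hz with ⟨h, c, hc, hl⟩ | ⟨h, c, hc, hl⟩
  · simp only [Dminus, Set.mem_ofPred_eq, h, true_and, h11, false_and, or_false, hl]
    exact ⟨mul_neg_of_pos_of_neg hc, fun h' => by
      by_contra! h2
      exact absurd (mul_nonneg hc.le h2) (not_le.2 h')⟩
  · simp only [Dminus, Set.mem_ofPred_eq, h, true_and, h11.symm, false_and, false_or, hl]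
    exact ⟨mul_neg_of_pos_of_neg hc, fun h' => by
      by_contra! h2
      exact absurd (mul_nonneg hc.le h2) (not_le.2 h')⟩

theorem mem_contour_iff {z : ℂ} : z ∈ contour B ↔ z ≠ 0 ∧ (lam B z).im = 0 := by
  by_cases hz : z = 0
  · simp only [hz, ne_eq, not_true_eq_false, false_and, iff_false]
    exact zero_notMem_contour B
  simp only [ne_eq, hz, not_false_eq_true, true_and]
  have h11 : (1 : ℝ) ≠ -1 := by norm_num
  rcases kappa_cases_lam_im (B := B) hz with ⟨h, c, hc, hl⟩ | ⟨h, c, hc, hl⟩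
  · simp only [contour, Set.mem_ofPred_eq, h, h11, false_and, or_false, hl, ne_eq, hz,
      not_false_eq_true, and_true, mul_eq_zero, hc.ne', false_or]
  · simp only [contour, Set.mem_ofPred_eq, h, true_and, hl, ne_eq, hz,
      not_false_eq_true, and_true, mul_eq_zero, hc.ne', false_or, sub_eq_zero]
    exact or_comm

theorem mem_branchPoints_ne_zero {z : ℂ} (hz : z ∈ branchPoints B) : z ≠ 0 := by
  rintro rfl
  have := norm_of_mem_branchPoints B hz
  rw [norm_zero] at this
  exact B.q0_pos.ne this

theorem Dplus_union_contour0 : Dplus B ∪ contour0 B = {z | z ≠ 0 ∧ 0 ≤ (lam B z).im} \ branchPoints B := by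
  ext z
  simp only [contour0, Set.mem_union, Set.mem_sdiff, mem_Dplus_iff, mem_contour_iff, Set.mem_ofPred_eq]
  constructor
  · rintro (⟨h0, h⟩ | ⟨⟨h0, h⟩, hb⟩)
    · exact ⟨⟨h0, h.le⟩, fun hb => by rw [(mem_branchPoints_iff B h0).1 hb] at h; simp at h⟩
    · exact ⟨⟨h0, h.ge⟩, hb⟩
  · rintro ⟨⟨h0, h⟩, hb⟩
    rcases h.lt_or_eq with h | h
    · exact Or.inl ⟨h0, h⟩
    · exact Or.inr ⟨⟨h0, h.symm⟩, hb⟩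

theorem Dminus_union_contour0 : Dminus B ∪ contour0 B = {z | z ≠ 0 ∧ (lam B z).im ≤ 0} \ branchPoints B := by
  ext z
  simp only [contour0, Set.mem_union, Set.mem_sdiff, mem_Dminus_iff, mem_contour_iff, Set.mem_ofPred_eq]
  constructor
  · rintro (⟨h0, h⟩ | ⟨⟨h0, h⟩, hb⟩)
    · exact ⟨⟨h0, h.le⟩, fun hb => by rw [(mem_branchPoints_iff B h0).1 hb] at h; simp at h⟩
    · exact ⟨⟨h0, h.le⟩, hb⟩
  · rintro ⟨⟨h0, h⟩, hb⟩
    rcases h.lt_or_eq with h | h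
    · exact Or.inl ⟨h0, h⟩
    · exact Or.inr ⟨⟨h0, h⟩, hb⟩

theorem jostRegion_plus_zero : jostRegion B .plus 0 \ branchPoints B = Dplus B ∪ contour0 B := by
  rw [Dplus_union_contour0]
  simp [jostRegion, jostRate, Side.sgn, colSign]

theorem jostRegion_minus_one : jostRegion B .minus 1 \ branchPoints B = Dplus B ∪ contour0 B := by
  rw [Dplus_union_contour0]
  simp [jostRegion, jostRate, Side.sgn, colSign]

theorem jostRegion_minus_zero : jostRegion B .minus 0 \ branchPoints B = Dminus B ∪ contour0 B := by
  rw [Dminus_union_contour0]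
  simp [jostRegion, jostRate, Side.sgn, colSign]

theorem jostRegion_plus_one : jostRegion B .plus 1 \ branchPoints B = Dminus B ∪ contour0 B := by
  rw [Dminus_union_contour0]
  simp [jostRegion, jostRate, Side.sgn, colSign]

theorem isOpen_Dplus : IsOpen (Dplus B) := by
  refine IsOpen.union (isOpen_const.inter ?_) (isOpen_const.inter ?_)
  · exact isOpen_lt continuous_const Complex.continuous_im
  · exact isOpen_lt continuous_const
      ((continuous_norm.sub continuous_const).mul Complex.continuous_im)

theorem isOpen_Dminus : IsOpen (Dminus B) := by
  refine IsOpen.union (isOpen_const.inter ?_) (isOpen_const.inter ?_)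
  · exact isOpen_lt Complex.continuous_im continuous_const
  · exact isOpen_lt ((continuous_norm.sub continuous_const).mul Complex.continuous_im)
      continuous_const

theorem disjoint_Dplus_Dminus {z : ℂ} (hz : z ∈ Dminus B) : z ∉ Dplus B := fun h =>
  lt_asymm (mem_Dplus_iff.1 h).2 (mem_Dminus_iff.1 hz).2

theorem disjoint_Dminus_contour0 {z : ℂ} (hz : z ∈ Dminus B) : z ∉ contour0 B := fun h =>
  (mem_Dminus_iff.1 hz).2.ne (mem_contour_iff.1 h.1).2

/-! ### Symmetries -/

variable (B) in
/-- The reflection `z ↦ δσ q₀² / z`. -/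
def hat (z : ℂ) : ℂ := B.κ * B.q0 ^ 2 / z

theorem kappa_q0_ne_zero : (B.κ * B.q0 ^ 2 : ℂ) ≠ 0 := by
  have h := B.kappa_sq
  exact mul_ne_zero (fun h0 => by simp [h0] at h) (pow_ne_zero 2 B.q0_ne)

theorem hat_ne_zero {z : ℂ} (hz : z ≠ 0) : hat B z ≠ 0 := div_ne_zero kappa_q0_ne_zero hz

theorem hat_hat (z : ℂ) : hat B (hat B z) = z := by
  rw [hat, hat, div_div_eq_mul_div, mul_div_cancel_left₀ _ kappa_q0_ne_zero]

theorem lam_eq_hat (z : ℂ) : lam B z = (z - hat B z) / 2 := rfl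

theorem kz_eq_hat (z : ℂ) : kz B z = (z + hat B z) / 2 := rfl

theorem lam_hat (z : ℂ) : lam B (hat B z) = -lam B z := by
  rw [lam_eq_hat, lam_eq_hat, hat_hat]
  ring

theorem kz_hat (z : ℂ) : kz B (hat B z) = kz B z := by
  rw [kz_eq_hat, kz_eq_hat, hat_hat, add_comm]

theorem hat_mem_branchPoints {z : ℂ} (hz : z ≠ 0) : hat B z ∈ branchPoints B ↔ z ∈ branchPoints B := by
  rw [mem_branchPoints_iff B hz, mem_branchPoints_iff B (hat_ne_zero hz), lam_hat, neg_eq_zero]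

theorem hat_mem_Dplus {z : ℂ} : hat B z ∈ Dplus B ↔ z ∈ Dminus B := by
  rw [mem_Dplus_iff, mem_Dminus_iff, lam_hat]
  by_cases hz : z = 0
  · simp [hz, hat]
  · simp [hz, hat_ne_zero hz]

theorem hat_mem_Dminus {z : ℂ} : hat B z ∈ Dminus B ↔ z ∈ Dplus B := by
  rw [← hat_mem_Dplus, hat_hat]

theorem hat_mem_jostRegion_zero {e : Side} {z : ℂ} :
    hat B z ∈ jostRegion B e 0 ↔ z ∈ jostRegion B e 1 := by
  by_cases hz : z = 0
  · simp [hz, hat, jostRegion]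
  · simp [jostRegion, jostRate, lam_hat, colSign, hz, hat_ne_zero hz]

theorem hat_mem_union {z : ℂ} :
    hat B z ∈ Dplus B ∪ contour0 B ↔ z ∈ Dminus B ∪ contour0 B := by
  rw [← jostRegion_plus_zero, ← jostRegion_plus_one, Set.mem_sdiff, Set.mem_sdiff,
    hat_mem_jostRegion_zero]
  exact and_congr_right fun h => not_congr (hat_mem_branchPoints h.1)

/-- The symmetry of the Jost solutions under `z ↦ δσ q₀² / z`. -/
theorem modJost_one_eq (hq : IsClassicalSolution B q) (hbc : HasNZBC B q) {e : Side} (x t : ℝ)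
    {z : ℂ} (hz : z ∈ jostRegion B e 1 \ branchPoints B) :
    modJost B q e 1 x t z = (Complex.I * B.bv e / z) • modJost B q e 0 x t (hat B z) := by
  have hz0 : z ≠ 0 := hz.1.1
  have hz' : hat B z ∈ jostRegion B e 0 := hat_mem_jostRegion_zero.2 hz.1
  have hb' : hat B z ∉ branchPoints B := fun h => hz.2 ((hat_mem_branchPoints hz0).1 h)
  -- The reflection fixes k and negates λ, so the equation of the first column at δσ q₀²/z is that
  -- of the second column at z. The eigencolumns differ by the factor i q_±/z because q_±² = q₀²,
  -- and uniqueness concludes.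
  refine modJost_eq hq hbc hz.1 hz.2 (μ := fun x => (Complex.I * B.bv e / z) •
    modJost B q e 0 x t (hat B z)) ?_ (fun x => ?_) x
  · have h := (tendsto_modJost hq hbc t hz' hb').const_smul (Complex.I * B.bv e / z)
    refine h.trans (le_of_eq ?_)
    congr 1
    have hq0 := B.q0_ne
    have hκ := B.kappa_sq
    have hI := Complex.I_sq
    have hbv := B.bv_sq_complex e
    have hκ0 : (B.κ : ℂ) ≠ 0 := fun h0 => by simp [h0] at hκ
    ext i
    fin_cases i
    · simp [eigCol, eigE]
    · simp only [eigCol, eigE, hat, Fin.mk_one, Pi.smul_apply, Matrix.of_apply, Matrix.cons_val',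
        Matrix.cons_val_zero, Matrix.cons_val_one, Matrix.cons_val_fin_one, smul_eq_mul]
      field_simp
      rw [hbv, hI]
      ring
  · refine ((hasDerivAt_modJost hq hbc x t hz' hb').const_smul
      (Complex.I * B.bv e / z)).congr_deriv ?_
    rw [← Matrix.mulVec_smul, laxX, laxX, kz_hat, lam_hat]
    congr 3
    simp [colSign]

theorem detE_hat {z : ℂ} (hz : z ≠ 0) : detE B (hat B z) = -(z / hat B z) * detE B z := by
  have hq0 := B.q0_ne
  have hκ := B.kappa_sq
  have hκ0 : (B.κ : ℂ) ≠ 0 := fun h0 => by simp [h0] at hκ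
  simp only [detE, hat]
  field_simp
  ring

theorem jost_zero_zero (e : Side) (j : Fin 2) (z : ℂ) :
    jost B q e j 0 0 z = modJost B q e j 0 0 z := by
  simp [jost, theta]

theorem wr_smul_smul (a b : ℂ) (u v : Fin 2 → ℂ) : wr (a • u) (b • v) = a * b * wr u v := by
  simp only [wr, Pi.smul_apply, smul_eq_mul]
  ring

theorem wr_swap (u v : Fin 2 → ℂ) : wr u v = -wr v u := by
  simp only [wr]
  ring

/-- The symmetry of the scattering coefficients under `z ↦ δσ q₀² / z`. -/
theorem s22_eq (hq : IsClassicalSolution B q) (hbc : HasNZBC B q) {z : ℂ}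
    (hz : z ∈ Dminus B ∪ contour0 B) : s22 B q z = B.δ * s11 B q (hat B z) := by
  have hzp := hz
  rw [← jostRegion_plus_one] at hzp
  have hz0 : z ≠ 0 := hzp.1.1
  have hh0 := hat_ne_zero (B := B) hz0
  have hzm := hat_mem_union.2 hz
  rw [← jostRegion_minus_one] at hzm
  have h1 := modJost_one_eq hq hbc 0 0 hzp
  have h2 := modJost_one_eq hq hbc 0 0 hzm
  rw [hat_hat] at h2
  have hd := detE_ne_zero hz0 hzp.2
  have hqm : (B.qm : ℂ) ≠ 0 := Complex.ofReal_ne_zero.2 B.qm_ne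
  rw [s22, s11, jost_zero_zero, jost_zero_zero, jost_zero_zero, jost_zero_zero, h1, h2, detE_hat hz0,
    wr_swap (modJost B q .plus 0 0 0 (hat B z))]
  have e1 : ∀ (a : ℂ) (u v : Fin 2 → ℂ), wr u (a • v) = a * wr u v := fun a u v => by
    simp only [wr, Pi.smul_apply, smul_eq_mul]
    ring
  have e2 : ∀ (a : ℂ) (u v : Fin 2 → ℂ), wr (a • u) v = a * wr u v := fun a u v => by
    simp only [wr, Pi.smul_apply, smul_eq_mul]
    ring
  -- The factors q₊ and q₋ of the two column symmetries leave the quotient δ. The powers of z and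
  -- the sign of the swap cancel against `detE_hat`.
  rw [e1, e2]
  simp only [Background.bv, Background.qp]
  push_cast
  field_simp

theorem conj_hat (z : ℂ) : hat B (-(starRingEnd ℂ) z) = -(starRingEnd ℂ) (hat B z) := by
  simp [hat, div_neg]

theorem conj_lam (z : ℂ) : lam B (-(starRingEnd ℂ) z) = -(starRingEnd ℂ) (lam B z) := by
  rw [lam_eq_hat, lam_eq_hat, conj_hat]
  simp only [map_div₀, map_sub, Complex.conj_ofNat]
  ring

theorem conj_kz (z : ℂ) : kz B (-(starRingEnd ℂ) z) = -(starRingEnd ℂ) (kz B z) := by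
  rw [kz_eq_hat, kz_eq_hat, conj_hat]
  simp only [map_div₀, map_add, Complex.conj_ofNat]
  ring

theorem neg_conj_mem_jostRegion {e : Side} {j : Fin 2} {z : ℂ} :
    -(starRingEnd ℂ) z ∈ jostRegion B e j ↔ z ∈ jostRegion B e j := by
  have : (jostRate B e j (-(starRingEnd ℂ) z)).im = (jostRate B e j z).im := by
    rw [jostRate, jostRate, conj_lam]
    fin_cases j <;> simp [colSign]
  simp [jostRegion, this]

theorem neg_conj_mem_branchPoints {z : ℂ} :
    -(starRingEnd ℂ) z ∈ branchPoints B ↔ z ∈ branchPoints B := by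
  rw [neg_mem_branchPoints, branchPoints, Set.mem_ofPred_eq, Set.mem_ofPred_eq, ← map_pow]
  have : (B.κ * B.q0 ^ 2 : ℂ) = (starRingEnd ℂ) (B.κ * B.q0 ^ 2) := by simp
  rw [this, (starRingEnd ℂ).injective.eq_iff, ← this]

theorem neg_conj_mem_Dplus {z : ℂ} : -(starRingEnd ℂ) z ∈ Dplus B ↔ z ∈ Dplus B := by
  rw [mem_Dplus_iff, mem_Dplus_iff, conj_lam]
  simp

/-- The potentials are real, and z ↦ -z^* sends k and λ to minus their conjugates. The conjugated
solution therefore satisfies the equation and the normalization at the reflected point. -/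
theorem modJost_neg_conj (hq : IsClassicalSolution B q) (hbc : HasNZBC B q) {e : Side} {j : Fin 2}
    (x t : ℝ) {z : ℂ} (hz : z ∈ jostRegion B e j \ branchPoints B) :
    modJost B q e j x t (-(starRingEnd ℂ) z) = fun i => (starRingEnd ℂ) (modJost B q e j x t z i) := by
  have hz' := neg_conj_mem_jostRegion.2 hz.1
  have hb' : -(starRingEnd ℂ) z ∉ branchPoints B := fun h => hz.2 (neg_conj_mem_branchPoints.1 h)
  refine modJost_eq hq hbc hz' hb' (μ := fun x i => (starRingEnd ℂ) (modJost B q e j x t z i)) ?_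
    (fun x => ?_) x
  · refine tendsto_pi_nhds.2 fun i => ?_
    have h := (Complex.continuous_conj.tendsto _).comp
      (tendsto_pi_nhds.1 (tendsto_modJost hq hbc t hz.1 hz.2) i)
    refine h.trans (le_of_eq ?_)
    congr 1
    fin_cases i <;> fin_cases j <;> simp [eigCol, eigE, div_neg, neg_div]
  · have hc : (starRingEnd ℂ) (colSign j) = colSign j := by fin_cases j <;> simp [colSign]
    have h0 := (Complex.conjCLE.toContinuousLinearMap.hasFDerivAt).comp_hasDerivAt x
      (hasDerivAt_modJost_zero hq hbc x t hz.1 hz.2)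
    have h1 := (Complex.conjCLE.toContinuousLinearMap.hasFDerivAt).comp_hasDerivAt x
      (hasDerivAt_modJost_one hq hbc x t hz.1 hz.2)
    refine hasDerivAt_pi.2 (Fin.forall_fin_two.2 ⟨h0.congr_deriv ?_, h1.congr_deriv ?_⟩)
    all_goals
      simp only [laxX, potQ, pauli3, Matrix.mulVec, dotProduct, Fin.sum_univ_two, Matrix.sub_apply,
        Matrix.add_apply, Matrix.smul_apply, Matrix.of_apply, Matrix.cons_val', Matrix.cons_val_zero,
        Matrix.cons_val_one, Matrix.cons_val_fin_one, Matrix.one_apply_eq, Matrix.one_apply_ne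
        (zero_ne_one' (Fin 2)), Matrix.one_apply_ne (one_ne_zero' (Fin 2)), smul_eq_mul, conj_lam,
        conj_kz, ContinuousLinearEquiv.coe_coe, Complex.conjCLE_apply, map_add, map_sub, map_mul,
        Complex.conj_I, Complex.conj_ofReal, hc]
      ring

theorem s11_neg_conj (hq : IsClassicalSolution B q) (hbc : HasNZBC B q) {z : ℂ}
    (hz : z ∈ Dplus B) : s11 B q (-(starRingEnd ℂ) z) = (starRingEnd ℂ) (s11 B q z) := by
  have h1 : z ∈ jostRegion B .plus 0 \ branchPoints B := by
    rw [jostRegion_plus_zero]; exact Or.inl hz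
  have h2 : z ∈ jostRegion B .minus 1 \ branchPoints B := by
    rw [jostRegion_minus_one]; exact Or.inl hz
  have hd : detE B (-(starRingEnd ℂ) z) = (starRingEnd ℂ) (detE B z) := by simp [detE]
  rw [s11, s11, jost_zero_zero, jost_zero_zero, jost_zero_zero, jost_zero_zero,
    modJost_neg_conj hq hbc 0 0 h1, modJost_neg_conj hq hbc 0 0 h2, hd]
  simp [wr]

end

section

variable {B : Background} {q : ℝ → ℝ → ℝ}

/-! ### The scattering relation -/

theorem mem_region_plus_zero {z : ℂ} (hz : z ∈ Dplus B ∪ contour0 B) :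
    z ∈ jostRegion B .plus 0 \ branchPoints B := by rwa [jostRegion_plus_zero]

theorem mem_region_minus_one {z : ℂ} (hz : z ∈ Dplus B ∪ contour0 B) :
    z ∈ jostRegion B .minus 1 \ branchPoints B := by rwa [jostRegion_minus_one]

theorem mem_region_minus_zero {z : ℂ} (hz : z ∈ Dminus B ∪ contour0 B) :
    z ∈ jostRegion B .minus 0 \ branchPoints B := by rwa [jostRegion_minus_zero]

theorem mem_region_plus_one {z : ℂ} (hz : z ∈ Dminus B ∪ contour0 B) :
    z ∈ jostRegion B .plus 1 \ branchPoints B := by rwa [jostRegion_plus_one]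

/-- The Wronskian is constant and the exponential factors of the two columns cancel, so it equals
its limit det E₋ at -∞. -/
theorem wr_jost_minus (hq : IsClassicalSolution B q) (hbc : HasNZBC B q) (x t : ℝ) {z : ℂ}
    (hz : z ∈ contour0 B) :
    wr (jost B q .minus 0 x t z) (jost B q .minus 1 x t z) = detE B z := by
  have h0 := mem_region_minus_zero (Or.inr hz : z ∈ Dminus B ∪ contour0 B)
  have h1 := mem_region_minus_one (Or.inr hz : z ∈ Dplus B ∪ contour0 B)
  rw [wr_jost_eq hq hbc x t h0.1 h1.1 h0.2]
  have hm : ∀ y, wr (modJost B q .minus 0 y 0 z) (modJost B q .minus 1 y 0 z) =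
      wr (jost B q .minus 0 0 0 z) (jost B q .minus 1 0 0 z) := by
    intro y
    rw [← wr_jost_eq hq hbc y 0 h0.1 h1.1 h0.2, jost, jost, wr_smul_smul, ← Complex.exp_add]
    simp [colSign]
  have hl0 := tendsto_pi_nhds.1 (tendsto_modJost hq hbc 0 h0.1 h0.2)
  have hl1 := tendsto_pi_nhds.1 (tendsto_modJost hq hbc 0 h1.1 h1.2)
  have hl := ((hl0 0).mul (hl1 1)).sub ((hl0 1).mul (hl1 0))
  have hc : Tendsto (fun y => modJost B q .minus 0 y 0 z 0 * modJost B q .minus 1 y 0 z 1 -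
      modJost B q .minus 0 y 0 z 1 * modJost B q .minus 1 y 0 z 0) atBot
      (𝓝 (wr (jost B q .minus 0 0 0 z) (jost B q .minus 1 0 0 z))) :=
    tendsto_const_nhds.congr fun y => (hm y).symm
  rw [tendsto_nhds_unique hc hl, ← detE_eq .minus, Matrix.det_fin_two]
  simp only [eigCol]
  ring

/-- Cramer's rule without division; it produces the expansion of Φ₊ in the columns of Φ₋. -/
theorem wr_smul_eq (u v w : Fin 2 → ℂ) : wr u v • w = wr w v • u + wr u w • v := by
  ext i
  fin_cases i <;> simp [wr] <;> ring

theorem jost_plus_zero_eq (hq : IsClassicalSolution B q) (hbc : HasNZBC B q) (x t : ℝ) {z : ℂ}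
    (hz : z ∈ contour0 B) : jost B q .plus 0 x t z =
      s11 B q z • jost B q .minus 0 x t z + s21 B q z • jost B q .minus 1 x t z := by
  have h0 := mem_region_minus_zero (Or.inr hz : z ∈ Dminus B ∪ contour0 B)
  have h1 := mem_region_minus_one (Or.inr hz : z ∈ Dplus B ∪ contour0 B)
  have hp := mem_region_plus_zero (Or.inr hz : z ∈ Dplus B ∪ contour0 B)
  have hd := detE_ne_zero h0.1.1 h0.2
  have h := wr_smul_eq (jost B q .minus 0 x t z) (jost B q .minus 1 x t z) (jost B q .plus 0 x t z)
  rw [wr_jost_minus hq hbc x t hz, wr_jost_eq hq hbc x t hp.1 h1.1 h0.2,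
    wr_jost_eq hq hbc x t h0.1 hp.1 h0.2] at h
  rw [s11, s21, div_eq_inv_mul, div_eq_inv_mul, mul_smul, mul_smul, ← smul_add, ← h, smul_smul,
    inv_mul_cancel₀ hd, one_smul]

theorem jost_plus_one_eq (hq : IsClassicalSolution B q) (hbc : HasNZBC B q) (x t : ℝ) {z : ℂ}
    (hz : z ∈ contour0 B) : jost B q .plus 1 x t z =
      s12 B q z • jost B q .minus 0 x t z + s22 B q z • jost B q .minus 1 x t z := by
  have h0 := mem_region_minus_zero (Or.inr hz : z ∈ Dminus B ∪ contour0 B)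
  have h1 := mem_region_minus_one (Or.inr hz : z ∈ Dplus B ∪ contour0 B)
  have hp := mem_region_plus_one (Or.inr hz : z ∈ Dminus B ∪ contour0 B)
  have hd := detE_ne_zero h0.1.1 h0.2
  have h := wr_smul_eq (jost B q .minus 0 x t z) (jost B q .minus 1 x t z) (jost B q .plus 1 x t z)
  rw [wr_jost_minus hq hbc x t hz, wr_jost_eq hq hbc x t hp.1 h1.1 h0.2,
    wr_jost_eq hq hbc x t h0.1 hp.1 h0.2] at h
  rw [s12, s22, div_eq_inv_mul, div_eq_inv_mul, mul_smul, mul_smul, ← smul_add, ← h, smul_smul,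
    inv_mul_cancel₀ hd, one_smul]

/-- The jump is the difference of two functions that are meromorphic on the two sides. -/
theorem Mplus_mul_jumpJ (hq : IsClassicalSolution B q) (hbc : HasNZBC B q) (x t : ℝ) {z : ℂ}
    (hz : z ∈ contour0 B) (h11 : s11 B q z ≠ 0) (h22 : s22 B q z ≠ 0) :
    (Mplus B q x t z * jumpJ B q x t z) 0 1 =
      modJost B q .minus 1 x t z 0 - modJost B q .plus 1 x t z 0 / s22 B q z := by
  -- Inserting the first relation into M⁺ cancels the terms with ρ ρ̃ and leaves -ρ̃ e^{2iθ}
  -- μ_{-11}; the second relation, divided by s₂₂, rewrites this as the asserted difference.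
  have e0 := congrFun (jost_plus_zero_eq hq hbc x t hz) 0
  have e1 := congrFun (jost_plus_one_eq hq hbc x t hz) 0
  simp only [jost, Pi.smul_apply, Pi.add_apply, smul_eq_mul, colSign, Matrix.cons_val_zero,
    Matrix.cons_val_one, Matrix.cons_val_fin_one, mul_one, mul_neg, neg_mul] at e0 e1
  have hM : (Mplus B q x t z * jumpJ B q x t z) 0 1 =
      modJost B q .plus 0 x t z 0 / s11 B q z * (Complex.exp (Complex.I * theta B x t z) *
        -(s12 B q z / s22 B q z) * Complex.exp (Complex.I * theta B x t z)) +
      modJost B q .minus 1 x t z 0 * (Complex.exp (-(Complex.I * theta B x t z)) *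
        (s21 B q z / s11 B q z * (s12 B q z / s22 B q z)) *
          Complex.exp (Complex.I * theta B x t z)) := by
    simp [Mplus, jumpJ, expPauli3, refl, reflTilde, Matrix.mul_apply, Fin.sum_univ_two]
  rw [hM]
  set a := Complex.exp (Complex.I * theta B x t z) with ha
  set b := Complex.exp (-(Complex.I * theta B x t z)) with hb
  have hab : a * b = 1 := by rw [ha, hb, ← Complex.exp_add, add_neg_cancel, Complex.exp_zero]
  have hb0 : b ≠ 0 := Complex.exp_ne_zero _
  have ha' : a = b⁻¹ := eq_inv_of_mul_eq_one_left hab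
  rw [ha'] at e0 e1 ⊢
  field_simp at e0 e1 ⊢
  linear_combination (-s12 B q z) * e0 + s11 B q z * e1

/-! ### Analyticity of the scattering coefficients -/

theorem differentiableOn_apply {f : ℂ → Fin 2 → ℂ} {U : Set ℂ} (hf : DifferentiableOn ℂ f U)
    (i : Fin 2) : DifferentiableOn ℂ (fun z => f z i) U := fun z hz =>
  (differentiableWithinAt_pi.1 (hf z hz)) i

theorem differentiableOn_detE : DifferentiableOn ℂ (detE B) {0}ᶜ := by
  unfold detE
  refine (differentiableOn_const _).sub ((differentiableOn_const _).div (by fun_prop) ?_)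
  exact fun z hz => pow_ne_zero 2 hz

theorem s22_eq_modJost (z : ℂ) : s22 B q z = (modJost B q .minus 0 0 0 z 0 * modJost B q .plus 1 0 0 z 1 -
    modJost B q .minus 0 0 0 z 1 * modJost B q .plus 1 0 0 z 0) / detE B z := by
  rw [s22, jost_zero_zero, jost_zero_zero, wr]

theorem differentiableOn_s22 (hq : IsClassicalSolution B q) (hbc : HasNZBC B q) :
    DifferentiableOn ℂ (s22 B q) (Dminus B) := by
  have h0 : Dminus B ⊆ jostRegion B .minus 0 \ branchPoints B := fun z hz =>
    mem_region_minus_zero (Or.inl hz)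
  have h1 : Dminus B ⊆ jostRegion B .plus 1 \ branchPoints B := fun z hz =>
    mem_region_plus_one (Or.inl hz)
  have d0 := differentiableOn_apply (differentiableOn_modJost hq hbc .minus 0 0 0 isOpen_Dminus h0)
  have d1 := differentiableOn_apply (differentiableOn_modJost hq hbc .plus 1 0 0 isOpen_Dminus h1)
  refine DifferentiableOn.congr ?_ fun z _ => s22_eq_modJost z
  refine (((d0 0).mul (d1 1)).sub ((d0 1).mul (d1 0))).div
    (differentiableOn_detE.mono fun z hz => (h0 hz).1.1) fun z hz => ?_
  exact detE_ne_zero (h0 hz).1.1 (h0 hz).2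

theorem continuousOn_s22 (hq : IsClassicalSolution B q) (hbc : HasNZBC B q) :
    ContinuousOn (s22 B q) (Dminus B ∪ contour0 B) := by
  have c0 := continuousOn_modJost hq hbc .minus 0 0 0
  have c1 := continuousOn_modJost hq hbc .plus 1 0 0
  rw [jostRegion_minus_zero] at c0
  rw [jostRegion_plus_one] at c1
  rw [continuousOn_pi] at c0 c1
  refine ContinuousOn.congr ?_ fun z _ => s22_eq_modJost z
  refine (((c0 0).mul (c1 1)).sub ((c0 1).mul (c1 0))).div
    (differentiableOn_detE.continuousOn.mono fun z hz => (mem_region_minus_zero hz).1.1) fun z hz => ?_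
  exact detE_ne_zero (mem_region_minus_zero hz).1.1 (mem_region_minus_zero hz).2

theorem delta_ne_zero (B : Background) : (B.δ : ℂ) ≠ 0 := by
  rcases B.delta_eq with h | h <;> simp [h]

theorem s11_eq (hq : IsClassicalSolution B q) (hbc : HasNZBC B q) {z : ℂ}
    (hz : z ∈ Dplus B) : s11 B q z = (B.δ : ℂ)⁻¹ * s22 B q (hat B z) := by
  rw [s22_eq hq hbc (Or.inl (hat_mem_Dminus.2 hz)), hat_hat, inv_mul_cancel_left₀ (delta_ne_zero B)]

theorem differentiableAt_hat {z : ℂ} (hz : z ≠ 0) : DifferentiableAt ℂ (hat B) z :=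
  (differentiableAt_const _).div differentiableAt_id hz

theorem hasDerivAt_s11 (hq : IsClassicalSolution B q) (hbc : HasNZBC B q) {η : ℂ}
    (hη : η ∈ Dplus B) : HasDerivAt (s11 B q)
      ((B.δ : ℂ)⁻¹ * (deriv (s22 B q) (hat B η) * deriv (hat B) η)) η := by
  have h1 : DifferentiableAt ℂ (s22 B q) (hat B η) :=
    (differentiableOn_s22 hq hbc).differentiableAt (isOpen_Dminus.mem_nhds (hat_mem_Dminus.2 hη))
  have h2 := (h1.hasDerivAt.comp η (differentiableAt_hat (mem_Dplus_iff.1 hη).1).hasDerivAt).const_mul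
    (B.δ : ℂ)⁻¹
  refine h2.congr_of_eventuallyEq ?_
  filter_upwards [isOpen_Dplus.mem_nhds hη] with z hz
  exact s11_eq hq hbc hz

/-- The hypotheses concern zeros of s₁₁, whereas the poles come from zeros of s₂₂. The symmetry and
the chain rule transfer simplicity. -/
theorem deriv_s22_hat_ne_zero (hq : IsClassicalSolution B q) (hbc : HasNZBC B q) {η : ℂ}
    (hη : η ∈ Dplus B) (h : deriv (s11 B q) η ≠ 0) : deriv (s22 B q) (hat B η) ≠ 0 := by
  intro h0
  rw [(hasDerivAt_s11 hq hbc hη).deriv, h0, zero_mul, mul_zero] at h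
  exact h rfl

theorem deriv_s11_neg_conj_ne_zero (hq : IsClassicalSolution B q) (hbc : HasNZBC B q) {η : ℂ}
    (hη : η ∈ Dplus B) (h : deriv (s11 B q) η ≠ 0) :
    deriv (s11 B q) (-(starRingEnd ℂ) η) ≠ 0 := by
  intro h0
  have h1 := (hasDerivAt_s11 hq hbc (neg_conj_mem_Dplus.2 hη)).differentiableAt.hasDerivAt
  rw [h0] at h1
  have h2 : HasDerivAt (fun w => s11 B q (-w)) 0 ((starRingEnd ℂ) η) := by
    refine (HasDerivAt.comp ((starRingEnd ℂ) η) h1 (hasDerivAt_neg _)).congr_deriv ?_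
    rw [zero_mul]
  -- Conjugation on both sides turns w ↦ s₁₁(-w), taken near η^*, back into s₁₁ near η.
  have h3 := h2.conj_conj
  rw [Complex.conj_conj, map_zero] at h3
  have h4 : HasDerivAt (s11 B q) 0 η := by
    refine h3.congr_of_eventuallyEq ?_
    filter_upwards [isOpen_Dplus.mem_nhds hη] with z hz
    simp only [Function.comp]
    rw [s11_neg_conj hq hbc hz, Complex.conj_conj]
  exact h h4.deriv

/-! ### The discrete spectrum -/

section
variable {N₁ N₂ : ℕ} {z : Fin N₁ → ℂ} {w : Fin N₂ → ℝ}

theorem IsDiscreteSpectrum.etaPt_mem (hq : IsClassicalSolution B q) (hbc : HasNZBC B q)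
    (hd : IsDiscreteSpectrum B q z w) (n : Fin N₁ ⊕ Fin N₁ ⊕ Fin N₂) :
    etaPt z w n ∈ Dplus B ∧ s11 B q (etaPt z w n) = 0 ∧ deriv (s11 B q) (etaPt z w n) ≠ 0 := by
  have hz : ∀ n, z n ∈ Dplus B ∧ 0 < (z n).re ∧ s11 B q (z n) = 0 := fun n => by
    have : z n ∈ Set.range z := ⟨n, rfl⟩
    rwa [hd.z_range] at this
  have hw : ∀ n, Complex.I * (w n : ℂ) ∈ Dplus B ∧ (Complex.I * (w n : ℂ)).re = 0 ∧
      s11 B q (Complex.I * (w n : ℂ)) = 0 := fun n => by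
    have : Complex.I * (w n : ℂ) ∈ Set.range fun n => Complex.I * (w n : ℂ) := ⟨n, rfl⟩
    rwa [hd.w_range] at this
  match n with
  | .inl n => exact ⟨(hz n).1, (hz n).2.2, hd.z_simple n⟩
  | .inr (.inl n) =>
    refine ⟨neg_conj_mem_Dplus.2 (hz n).1, ?_,
      deriv_s11_neg_conj_ne_zero hq hbc (hz n).1 (hd.z_simple n)⟩
    rw [etaPt, s11_neg_conj hq hbc (hz n).1, (hz n).2.2, map_zero]
  | .inr (.inr n) => exact ⟨(hw n).1, (hw n).2.2, hd.w_simple n⟩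

theorem IsDiscreteSpectrum.etaPt_injective (hd : IsDiscreteSpectrum B q z w) :
    Function.Injective (etaPt z w) := by
  have hz : ∀ n, 0 < (z n).re := fun n => by
    have : z n ∈ Set.range z := ⟨n, rfl⟩
    rw [hd.z_range] at this
    exact this.2.1
  have hre : ∀ n, (Complex.I * (w n : ℂ)).re = 0 := fun n => by simp
  rintro (n | n | n) (m | m | m) h <;> simp only [etaPt] at h
  · rw [hd.z_inj h]
  · have := congrArg Complex.re h
    simp at this
    linarith [hz n, hz m]
  · have := congrArg Complex.re h
    rw [hre] at this
    linarith [hz n]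
  · have := congrArg Complex.re h
    simp at this
    linarith [hz n, hz m]
  · rw [neg_inj, (starRingEnd ℂ).injective.eq_iff] at h
    rw [hd.z_inj h]
  · have := congrArg Complex.re h
    simp at this
    linarith [hz n]
  · have := congrArg Complex.re h
    rw [hre] at this
    linarith [hz m]
  · have := congrArg Complex.re h
    simp at this
    linarith [hz m]
  · have : w n = w m := by simpa using h
    rw [hd.w_inj this]

/-- A zero with negative real part is the reflection -z^* of one with positive real part. Thus the
list is complete although only half of the zeros are prescribed. -/
theorem IsDiscreteSpectrum.mem_range_etaPt (hq : IsClassicalSolution B q) (hbc : HasNZBC B q)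
    (hd : IsDiscreteSpectrum B q z w) {ζ : ℂ} (hζ : ζ ∈ Dplus B) (h0 : s11 B q ζ = 0) :
    ζ ∈ Set.range (etaPt z w) := by
  rcases lt_trichotomy ζ.re 0 with h | h | h
  · have h1 : -(starRingEnd ℂ) ζ ∈ Set.range z := by
      rw [hd.z_range]
      refine ⟨neg_conj_mem_Dplus.2 hζ, by simpa using h, ?_⟩
      rw [s11_neg_conj hq hbc hζ, h0, map_zero]
    obtain ⟨n, hn⟩ := h1
    exact ⟨.inr (.inl n), by simp [etaPt, hn]⟩
  · have h1 : ζ ∈ Set.range fun n => Complex.I * (w n : ℂ) := by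
      rw [hd.w_range]
      exact ⟨hζ, h, h0⟩
    obtain ⟨n, hn⟩ := h1
    exact ⟨.inr (.inr n), hn⟩
  · have h1 : ζ ∈ Set.range z := by
      rw [hd.z_range]
      exact ⟨hζ, h, h0⟩
    obtain ⟨n, hn⟩ := h1
    exact ⟨.inl n, hn⟩

theorem IsDiscreteSpectrum.etaHat_mem (hq : IsClassicalSolution B q) (hbc : HasNZBC B q)
    (hd : IsDiscreteSpectrum B q z w) (n : Fin N₁ ⊕ Fin N₁ ⊕ Fin N₂) :
    etaHat B z w n ∈ Dminus B ∧ s22 B q (etaHat B z w n) = 0 ∧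
      deriv (s22 B q) (etaHat B z w n) ≠ 0 := by
  obtain ⟨h1, h2, h3⟩ := hd.etaPt_mem hq hbc n
  refine ⟨hat_mem_Dminus.2 h1, ?_, deriv_s22_hat_ne_zero hq hbc h1 h3⟩
  have := s11_eq hq hbc h1
  rw [h2, eq_comm, mul_eq_zero, or_iff_right (inv_ne_zero (delta_ne_zero B))] at this
  exact this

theorem IsDiscreteSpectrum.etaHat_injective (hd : IsDiscreteSpectrum B q z w) :
    Function.Injective (etaHat B z w) := fun n m h => hd.etaPt_injective <| by
  have := congrArg (hat B) (show hat B (etaPt z w n) = hat B (etaPt z w m) from h)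
  rwa [hat_hat, hat_hat] at this

theorem IsDiscreteSpectrum.mem_range_etaHat (hq : IsClassicalSolution B q) (hbc : HasNZBC B q)
    (hd : IsDiscreteSpectrum B q z w) {ζ : ℂ} (hζ : ζ ∈ Dminus B) (h0 : s22 B q ζ = 0) :
    ζ ∈ Set.range (etaHat B z w) := by
  rw [s22_eq hq hbc (Or.inl hζ), mul_eq_zero, or_iff_right (delta_ne_zero B)] at h0
  obtain ⟨n, hn⟩ := hd.mem_range_etaPt hq hbc (hat_mem_Dplus.2 hζ) h0
  exact ⟨n, by rw [← hat_hat (B := B) ζ, ← hn]; rfl⟩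

end

theorem exists_smul_of_wr_eq_zero {u v : Fin 2 → ℂ} (hu : u ≠ 0) (h : wr u v = 0) :
    ∃ b : ℂ, v = b • u := by
  rw [wr, sub_eq_zero] at h
  by_cases h0 : u 0 = 0
  · have h1 : u 1 ≠ 0 := fun h1 => hu (by ext i; fin_cases i <;> simp [h0, h1])
    refine ⟨v 1 / u 1, ?_⟩
    have h2 : v 0 = 0 := by
      rw [h0, zero_mul, eq_comm, mul_eq_zero, or_iff_right h1] at h
      exact h
    ext i
    fin_cases i
    · simp [h0, h2]
    · simp [h1]
  · refine ⟨v 0 / u 0, ?_⟩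
    ext i
    fin_cases i
    · simp [h0]
    · simp only [Fin.mk_one, Pi.smul_apply, smul_eq_mul]
      field_simp
      linear_combination h

/-- At a zero of `s₂₂` the Jost solutions that decay at the two ends are proportional. -/
theorem jost_eq_propCoeff_smul (hq : IsClassicalSolution B q) (hbc : HasNZBC B q) {p : ℂ}
    (hp : p ∈ Dminus B) (h0 : s22 B q p = 0) (x t : ℝ) :
    jost B q .plus 1 x t p = propCoeff B q p • jost B q .minus 0 x t p := by
  have hm := mem_region_minus_zero (Or.inl hp : p ∈ Dminus B ∪ contour0 B)
  have hpl := mem_region_plus_one (Or.inl hp : p ∈ Dminus B ∪ contour0 B)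
  have hd := detE_ne_zero hm.1.1 hm.2
  -- A solution that vanishes at one point vanishes identically, against the limit 1 of its first
  -- entry.
  have hne : jost B q .minus 0 0 0 p ≠ 0 := by
    intro hz
    have hzero : ∀ y, modJost B q .minus 0 y 0 p = 0 := by
      intro y
      have h1 := linearODE_eq_zero (A := fun y => laxX B q y 0 p) (s₀ := 0)
        (f := fun y => jost B q .minus 0 y 0 p)
        ((continuous_laxX hq p).comp (by fun_prop : Continuous fun y : ℝ => (y, (0 : ℝ))))
        (fun y => hasDerivAt_jost_space hq hbc y 0 hm.1 hm.2) hz y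
      exact (smul_eq_zero.1 h1).resolve_left (Complex.exp_ne_zero _)
    have hl := tendsto_pi_nhds.1 (tendsto_modJost hq hbc 0 hm.1 hm.2) 0
    simp only [hzero, Pi.zero_apply] at hl
    have := tendsto_nhds_unique (l := (atBot : Filter ℝ)) hl (tendsto_const_nhds (f := (atBot : Filter ℝ)))
    simp [eigCol, eigE] at this
  have hwr : wr (jost B q .minus 0 0 0 p) (jost B q .plus 1 0 0 p) = 0 := by
    rw [s22, div_eq_zero_iff] at h0
    exact h0.resolve_right hd
  obtain ⟨b, hb⟩ := exists_smul_of_wr_eq_zero hne hwr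
  have hb1 : ∀ y, jost B q .plus 1 y 0 p = b • jost B q .minus 0 y 0 p := by
    intro y
    refine sub_eq_zero.1 (linearODE_eq_zero (A := fun y => laxX B q y 0 p) (s₀ := 0)
      (f := fun y => jost B q .plus 1 y 0 p - b • jost B q .minus 0 y 0 p)
      ((continuous_laxX hq p).comp (by fun_prop : Continuous fun y : ℝ => (y, (0 : ℝ))))
      (fun y => ((hasDerivAt_jost_space hq hbc y 0 hpl.1 hpl.2).fun_sub
        ((hasDerivAt_jost_space hq hbc y 0 hm.1 hm.2).const_smul b)).congr_deriv ?_)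
      (sub_eq_zero.2 hb) y)
    rw [Matrix.mulVec_sub, Matrix.mulVec_smul]
  have hb2 : ∀ y s, jost B q .plus 1 y s p = b • jost B q .minus 0 y s p := by
    intro y s
    have hc : Continuous fun s => laxT B q y s p :=
      Continuous.comp (g := fun r : ℝ × ℝ => laxT B q r.1 r.2 p) (f := fun s : ℝ => (y, s))
        (continuous_laxT hq p) (by fun_prop)
    have hde : ∀ s, HasDerivAt (fun s => jost B q .plus 1 y s p - b • jost B q .minus 0 y s p)
        ((laxT B q y s p).mulVec (jost B q .plus 1 y s p - b • jost B q .minus 0 y s p)) s := by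
      intro s
      refine ((hasDerivAt_jost_time hq hbc y s hpl.1 hpl.2).fun_sub
        ((hasDerivAt_jost_time hq hbc y s hm.1 hm.2).const_smul b)).congr_deriv ?_
      rw [Matrix.mulVec_sub, Matrix.mulVec_smul]
    exact sub_eq_zero.1 (linearODE_eq_zero hc hde (sub_eq_zero.2 (hb1 y)) s)
  -- The regions are disjoint, so the clause for D₊ is vacuous and the chosen coefficient satisfies
  -- the clause for D₋.
  have hex : ∃ b : ℂ, (p ∈ Dplus B → ∀ x t, jost B q .plus 0 x t p = b • jost B q .minus 1 x t p) ∧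
      (p ∈ Dminus B → ∀ x t, jost B q .plus 1 x t p = b • jost B q .minus 0 x t p) :=
    ⟨b, fun h => absurd h (disjoint_Dplus_Dminus hp), fun _ => hb2⟩
  exact (Classical.epsilon_spec hex).2 hp x t

theorem modJost_eq_propCoeff (hq : IsClassicalSolution B q) (hbc : HasNZBC B q) {p : ℂ}
    (hp : p ∈ Dminus B) (h0 : s22 B q p = 0) (x t : ℝ) :
    modJost B q .plus 1 x t p 0 = propCoeff B q p * Complex.exp (2 * Complex.I * theta B x t p) *
      modJost B q .minus 0 x t p 0 := by
  have h := congrFun (jost_eq_propCoeff_smul hq hbc hp h0 x t) 0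
  simp only [jost, Pi.smul_apply, smul_eq_mul, colSign, Matrix.cons_val_zero,
    Matrix.cons_val_one, Matrix.cons_val_fin_one, mul_one, mul_neg, neg_mul] at h
  have e1 : Complex.exp (Complex.I * theta B x t p) * Complex.exp (-(Complex.I * theta B x t p)) = 1 := by
    rw [← Complex.exp_add, add_neg_cancel, Complex.exp_zero]
  have e2 : Complex.exp (2 * Complex.I * theta B x t p) =
      Complex.exp (Complex.I * theta B x t p) * Complex.exp (Complex.I * theta B x t p) := by
    rw [← Complex.exp_add]
    congr 1
    ring
  rw [e2]
  linear_combination Complex.exp (Complex.I * theta B x t p) * h - modJost B q .plus 1 x t p 0 * e1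

end

section

variable {B : Background} {q : ℝ → ℝ → ℝ}

/-! ### Limits at zero and at infinity -/

variable (B) in
/-- The points at which the `j`-th column at an end is defined, without the branch points. -/
def jostDomain (e : Side) (j : Fin 2) : Set ℂ := jostRegion B e j \ branchPoints B

theorem isBigO_modJost (hq : IsClassicalSolution B q) (hbc : HasNZBC B q) (e : Side)
    (j : Fin 2) (x t : ℝ) :
    ((fun z => modJost B q e j x t z j - 1) =O[comap norm atTop ⊓ 𝓟 (jostDomain B e j)]
      fun z => z⁻¹) ∧
    (fun z => modJost B q e j x t z (1 - j)) =O[comap norm atTop ⊓ 𝓟 (jostDomain B e j)]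
      fun z => z⁻¹ := by
  obtain ⟨C, hC⟩ := (modJost_asymptotics hq hbc e j x t).1
  have hev : ∀ᶠ z in comap norm atTop ⊓ 𝓟 (jostDomain B e j), C ≤ ‖z‖ ∧ z ∈ jostDomain B e j :=
    ((tendsto_comap.eventually (eventually_ge_atTop C)).filter_mono inf_le_left).and
      ((eventually_principal.2 fun z hz => hz).filter_mono inf_le_right)
  constructor
  · refine Asymptotics.IsBigO.of_bound C (hev.mono fun z hz => ?_)
    rw [norm_inv, ← div_eq_mul_inv]
    exact (hC z hz.2 hz.1).1
  · refine Asymptotics.IsBigO.of_bound C (hev.mono fun z hz => ?_)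
    rw [norm_inv, ← div_eq_mul_inv]
    exact (hC z hz.2 hz.1).2

theorem tendsto_inv_comap_norm_atTop : Tendsto (fun z : ℂ => z⁻¹) (comap norm atTop) (𝓝 0) := by
  rw [comap_norm_atTop]
  exact tendsto_inv₀_cobounded

theorem tendsto_modJost_one (hq : IsClassicalSolution B q) (hbc : HasNZBC B q) (e : Side)
    (j : Fin 2) (x t : ℝ) : Tendsto (fun z => modJost B q e j x t z j)
      (comap norm atTop ⊓ 𝓟 (jostDomain B e j)) (𝓝 1) := by
  have h := (isBigO_modJost hq hbc e j x t).1.trans_tendsto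
    (tendsto_inv_comap_norm_atTop.mono_left inf_le_left)
  simpa using h.add_const 1

/-- Here q(x,t) enters, as the 1/z coefficient of an off-diagonal entry. It is the same for both
ends, as the contour integral requires. -/
theorem tendsto_mul_modJost_atTop (hq : IsClassicalSolution B q) (hbc : HasNZBC B q) (e : Side)
    (x t : ℝ) : Tendsto (fun z => z * modJost B q e 1 x t z 0)
      (comap norm atTop ⊓ 𝓟 (jostDomain B e 1)) (𝓝 (Complex.I * q x t)) := by
  rw [Metric.tendsto_nhds]
  intro ε hε
  obtain ⟨ρ, hρ⟩ := (modJost_asymptotics hq hbc e 1 x t).2 (ε / 2) (half_pos hε)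
  have hev : ∀ᶠ z in comap norm atTop ⊓ 𝓟 (jostDomain B e 1), ρ ≤ ‖z‖ ∧ z ∈ jostDomain B e 1 :=
    ((tendsto_comap.eventually (eventually_ge_atTop ρ)).filter_mono inf_le_left).and
      ((eventually_principal.2 fun z hz => hz).filter_mono inf_le_right)
  filter_upwards [hev] with z hz
  have h := hρ z hz.2 hz.1
  have e1 : z * modJost B q e 1 x t z 0 - Complex.I * q x t =
      z * modJost B q e 1 x t z (1 - 1) + Complex.I * colSign 1 * potQ B q x t (1 - 1) 1 := by
    simp [colSign, potQ]
    ring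
  rw [dist_eq_norm, e1]
  linarith

theorem norm_hat (z : ℂ) : ‖hat B z‖ = B.q0 ^ 2 * ‖z‖⁻¹ := by
  have hκ : ‖(B.κ : ℂ)‖ = 1 := by rcases B.kappa_eq with h | h <;> simp [h]
  rw [hat, norm_div, norm_mul, norm_pow, hκ, one_mul, Complex.norm_real, Real.norm_eq_abs, sq_abs,
    div_eq_mul_inv]

theorem tendsto_hat (e : Side) : Tendsto (hat B)
    (comap norm (𝓝[>] 0) ⊓ 𝓟 (jostDomain B e 1)) (comap norm atTop ⊓ 𝓟 (jostDomain B e 0)) := by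
  refine tendsto_inf.2 ⟨?_, ?_⟩
  · refine (tendsto_comap_iff.2 ?_).mono_left inf_le_left
    have h1 : Tendsto (fun r : ℝ => B.q0 ^ 2 * r⁻¹) (𝓝[>] 0) atTop :=
      tendsto_inv_nhdsGT_zero.const_mul_atTop (pow_pos B.q0_pos 2)
    exact (h1.comp tendsto_comap).congr fun z => (norm_hat z).symm
  · refine (tendsto_principal_principal.2 fun z hz => ?_).mono_left inf_le_right
    exact ⟨hat_mem_jostRegion_zero.2 hz.1, fun h => hz.2 ((hat_mem_branchPoints hz.1.1).1 h)⟩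

theorem eventually_mem_principal {l : Filter ℂ} {S : Set ℂ} : ∀ᶠ z in l ⊓ 𝓟 S, z ∈ S :=
  (eventually_principal.2 fun _ hz => hz).filter_mono inf_le_right

/-- By the symmetry the second column near 0 is i q_±/z times the first column near infinity, whose
leading entry tends to 1. -/
theorem tendsto_mul_modJost_zero (hq : IsClassicalSolution B q) (hbc : HasNZBC B q) (e : Side)
    (x t : ℝ) : Tendsto (fun z => z * modJost B q e 1 x t z 0)
      (comap norm (𝓝[>] 0) ⊓ 𝓟 (jostDomain B e 1)) (𝓝 (Complex.I * B.bv e)) := by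
  have h := ((tendsto_modJost_one hq hbc e 0 x t).comp (tendsto_hat e)).const_mul
    (Complex.I * B.bv e)
  rw [mul_one] at h
  refine h.congr' ?_
  filter_upwards [eventually_mem_principal] with z hz
  have hz0 : z ≠ 0 := hz.1.1
  rw [modJost_one_eq hq hbc x t hz, Pi.smul_apply, smul_eq_mul, ← mul_assoc, mul_div_cancel₀ _ hz0]
  rfl

/-- The diagonal entries and d(z) are 1 + O(1/z), the off-diagonal ones O(1/z). The rate, and not
only the limit, is needed to bound the jump at the origin. -/
theorem isBigO_wr_div_detE (hq : IsClassicalSolution B q) (hbc : HasNZBC B q) (e e' : Side) {R : Set ℂ}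
    (h0 : R ⊆ jostDomain B e 0) (h1 : R ⊆ jostDomain B e' 1) :
    (fun z => (modJost B q e 0 0 0 z 0 * modJost B q e' 1 0 0 z 1 -
      modJost B q e 0 0 0 z 1 * modJost B q e' 1 0 0 z 0) / detE B z - 1)
      =O[comap norm atTop ⊓ 𝓟 R] fun z => z⁻¹ := by
  set l := comap norm atTop ⊓ 𝓟 R with hl
  have hl0 : l ≤ comap norm atTop ⊓ 𝓟 (jostDomain B e 0) :=
    inf_le_inf_left _ (principal_mono.2 h0)
  have hl1 : l ≤ comap norm atTop ⊓ 𝓟 (jostDomain B e' 1) :=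
    inf_le_inf_left _ (principal_mono.2 h1)
  have ha := (isBigO_modJost hq hbc e 0 0 0).1.mono hl0
  have hb := (isBigO_modJost hq hbc e 0 0 0).2.mono hl0
  have hd := (isBigO_modJost hq hbc e' 1 0 0).1.mono hl1
  have hc := (isBigO_modJost hq hbc e' 1 0 0).2.mono hl1
  rw [sub_zero] at hb
  rw [sub_self] at hc
  have hinv : Tendsto (fun z : ℂ => z⁻¹) l (𝓝 0) := tendsto_inv_comap_norm_atTop.mono_left inf_le_left
  have hi1 : (fun z : ℂ => z⁻¹) =O[l] fun _ => (1 : ℂ) := hinv.isBigO_one ℂ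
  have hprod : ∀ {f g : ℂ → ℂ}, f =O[l] (fun z => z⁻¹) → g =O[l] (fun z => z⁻¹) →
      (fun z => f z * g z) =O[l] fun z => z⁻¹ := by
    intro f g hf hg
    simpa using hf.mul (hg.trans hi1)
  have hE : (fun z => detE B z - 1) =O[l] fun z => z⁻¹ := by
    have h := (hprod (Asymptotics.isBigO_refl _ _) (Asymptotics.isBigO_refl _ _)).const_mul_left
      (-(B.κ * B.q0 ^ 2) : ℂ)
    refine h.congr_left fun z => ?_
    rw [detE]
    ring
  have hEt : Tendsto (detE B) l (𝓝 1) := by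
    simpa using (hE.trans_tendsto hinv).add_const 1
  have hEi : (fun z => (detE B z)⁻¹) =O[l] fun _ => (1 : ℂ) :=
    (hEt.inv₀ one_ne_zero).isBigO_one ℂ
  have hnum := (((((hprod ha hd).add ha).add hd).sub (hprod hb hc)).sub hE).mul hEi
  simp only [mul_one] at hnum
  refine hnum.congr' ?_ EventuallyEq.rfl
  filter_upwards [hEt.eventually_ne one_ne_zero] with z hz
  field_simp
  ring

theorem contour0_subset_jostDomain (e : Side) (j : Fin 2) : contour0 B ⊆ jostDomain B e j := by
  intro z hz
  obtain ⟨h0, h1⟩ := mem_contour_iff.1 hz.1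
  refine ⟨⟨h0, le_of_eq ?_⟩, hz.2⟩
  rw [jostRate]
  cases e <;> fin_cases j <;> simp [colSign, Side.sgn, h1]

theorem isBigO_s11 (hq : IsClassicalSolution B q) (hbc : HasNZBC B q) :
    (fun z => s11 B q z - 1) =O[comap norm atTop ⊓ 𝓟 (Dplus B ∪ contour0 B)] fun z => z⁻¹ := by
  refine (isBigO_wr_div_detE hq hbc .plus .minus (fun z hz => mem_region_plus_zero hz)
    fun z hz => mem_region_minus_one hz).congr_left fun z => ?_
  rw [s11, jost_zero_zero, jost_zero_zero, wr]

theorem tendsto_s11 (hq : IsClassicalSolution B q) (hbc : HasNZBC B q) :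
    Tendsto (s11 B q) (comap norm atTop ⊓ 𝓟 (Dplus B ∪ contour0 B)) (𝓝 1) := by
  simpa using ((isBigO_s11 hq hbc).trans_tendsto
    (tendsto_inv_comap_norm_atTop.mono_left inf_le_left)).add_const 1

theorem tendsto_s22 (hq : IsClassicalSolution B q) (hbc : HasNZBC B q) :
    Tendsto (s22 B q) (comap norm atTop ⊓ 𝓟 (Dminus B ∪ contour0 B)) (𝓝 1) := by
  have h := (isBigO_wr_div_detE hq hbc .minus .plus (R := Dminus B ∪ contour0 B)
    (fun z hz => mem_region_minus_zero hz) fun z hz => mem_region_plus_one hz).congr_left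
    (f₂ := fun z => s22 B q z - 1) fun z => by rw [s22_eq_modJost]
  simpa using (h.trans_tendsto (tendsto_inv_comap_norm_atTop.mono_left inf_le_left)).add_const 1

theorem tendsto_s22_zero (hq : IsClassicalSolution B q) (hbc : HasNZBC B q) :
    Tendsto (s22 B q) (comap norm (𝓝[>] 0) ⊓ 𝓟 (Dminus B ∪ contour0 B)) (𝓝 B.δ) := by
  have h := tendsto_hat (B := B) .plus
  rw [jostDomain, jostDomain, jostRegion_plus_one, jostRegion_plus_zero] at h
  have h2 := ((tendsto_s11 hq hbc).comp h).const_mul (B.δ : ℂ)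
  rw [mul_one] at h2
  refine h2.congr' ?_
  filter_upwards [eventually_mem_principal] with z hz
  exact (s22_eq hq hbc hz).symm

/-- The jump stays bounded near the origin. -/
theorem jump_bounded_zero (hq : IsClassicalSolution B q) (hbc : HasNZBC B q) (x t : ℝ) :
    ∃ C : ℝ, ∀ᶠ z in 𝓝[contour0 B] 0,
      ‖modJost B q .minus 1 x t z 0 - modJost B q .plus 1 x t z 0 / s22 B q z‖ ≤ C := by
  set l := comap norm atTop ⊓ 𝓟 (contour0 B) with hl
  have hle : ∀ e j, l ≤ comap norm atTop ⊓ 𝓟 (jostDomain B e j) := fun e j =>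
    inf_le_inf_left _ (principal_mono.2 (contour0_subset_jostDomain e j))
  have hm := (isBigO_modJost hq hbc .minus 0 x t).1.mono (hle _ _)
  have hp := (isBigO_modJost hq hbc .plus 0 x t).1.mono (hle _ _)
  have hls : l ≤ comap norm atTop ⊓ 𝓟 (Dplus B ∪ contour0 B) :=
    inf_le_inf_left _ (principal_mono.2 Set.subset_union_right)
  have hs := (isBigO_s11 hq hbc).mono hls
  have hst := (tendsto_s11 hq hbc).mono_left hls
  have hsi : (fun z => (s11 B q z)⁻¹) =O[l] fun _ => (1 : ℂ) :=
    (hst.inv₀ one_ne_zero).isBigO_one ℂ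
  -- Both terms are 1 + O(1/z) at infinity, so their difference is O(1/z). Carried to the origin by
  -- the reflection, this factor of order z compensates the common prefactor i q₋/z.
  have hbr : (fun z => modJost B q .minus 0 x t z 0 - modJost B q .plus 0 x t z 0 / s11 B q z)
      =O[l] fun z => z⁻¹ := by
    have h1 := (hp.sub hs).mul hsi
    simp only [mul_one] at h1
    refine (hm.sub h1).congr' ?_ EventuallyEq.rfl
    filter_upwards [hst.eventually_ne one_ne_zero] with z hz
    field_simp
    ring
  have hhat : Tendsto (hat B) (𝓝[contour0 B] 0) l := by
    have hsub : 𝓝[contour0 B] (0 : ℂ) ≤ comap norm (𝓝[>] 0) := by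
      rw [comap_norm_nhdsGT_zero]
      exact nhdsWithin_mono 0 fun z hz h0 => zero_notMem_contour B (h0 ▸ hz.1)
    refine tendsto_inf.2 ⟨?_, ?_⟩
    · have h := (tendsto_inf.1 (tendsto_hat (B := B) .plus)).1
      refine h.mono_left (le_inf hsub ?_)
      exact inf_le_right.trans (principal_mono.2 (contour0_subset_jostDomain _ _))
    · refine (tendsto_principal_principal.2 fun z hz => ?_).mono_left inf_le_right
      have hz0 := (mem_contour_iff.1 hz.1).1
      refine ⟨mem_contour_iff.2 ⟨hat_ne_zero hz0, ?_⟩, fun h => hz.2 ((hat_mem_branchPoints hz0).1 h)⟩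
      rw [lam_hat, Complex.neg_im, (mem_contour_iff.1 hz.1).2, neg_zero]
  have h2 := (Asymptotics.isBigO_refl (fun z : ℂ => Complex.I * B.qm / z) (𝓝[contour0 B] 0)).mul
    (hbr.comp_tendsto hhat)
  have h3 : (fun z => modJost B q .minus 1 x t z 0 - modJost B q .plus 1 x t z 0 / s22 B q z)
      =O[𝓝[contour0 B] 0] fun _ => (1 : ℂ) := by
    refine (h2.congr' (f₂ := fun z => modJost B q .minus 1 x t z 0 -
      modJost B q .plus 1 x t z 0 / s22 B q z)
      (g₂ := fun _ => Complex.I * B.qm / (B.κ * B.q0 ^ 2)) ?_ ?_).trans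
      (Asymptotics.isBigO_const_const _ one_ne_zero _)
    · filter_upwards [self_mem_nhdsWithin] with z hz
      have hz0 := (mem_contour_iff.1 hz.1).1
      rw [modJost_one_eq hq hbc x t (contour0_subset_jostDomain .minus 1 hz),
        modJost_one_eq hq hbc x t (contour0_subset_jostDomain .plus 1 hz),
        s22_eq hq hbc (Or.inr hz)]
      have hδ := delta_ne_zero B
      simp only [Pi.smul_apply, smul_eq_mul, Background.bv, Background.qp, Function.comp]
      push_cast
      by_cases h11 : s11 B q (hat B z) = 0
      · simp [h11]
      · field_simp
    · filter_upwards [self_mem_nhdsWithin] with z hz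
      have hz0 := (mem_contour_iff.1 hz.1).1
      simp only [Function.comp, hat]
      field_simp
  obtain ⟨C, hC⟩ := h3.bound
  exact ⟨C, hC.mono fun z hz => by simpa using hz⟩

/-! ### Subtraction of the poles -/

section
variable {ι : Type*} [Fintype ι] {p r : ι → ℂ} {l : Filter ℂ} {F : ℂ → ℂ} {c : ℂ}

theorem tendsto_mul_sub_poles_atTop (hl : l ≤ comap norm atTop)
    (hF : Tendsto (fun z => z * F z) l (𝓝 c)) :
    Tendsto (fun z => z * (F z - ∑ n, r n / (z - p n))) l (𝓝 (c - ∑ n, r n)) := by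
  have hinv : Tendsto (fun z : ℂ => z⁻¹) l (𝓝 0) := tendsto_inv_comap_norm_atTop.mono_left hl
  have h1 : ∀ n, Tendsto (fun z => r n * (1 - p n * z⁻¹)⁻¹) l (𝓝 (r n)) := by
    intro n
    have h2 : Tendsto (fun z => 1 - p n * z⁻¹) l (𝓝 1) := by
      simpa using (hinv.const_mul (p n)).const_sub 1
    simpa using (h2.inv₀ one_ne_zero).const_mul (r n)
  have h3 := hF.sub (tendsto_finsetSum Finset.univ fun n _ => h1 n)
  refine h3.congr' ?_
  have hne : ∀ᶠ z in l, z ≠ 0 := by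
    have : ∀ᶠ z : ℂ in comap norm atTop, 0 < ‖z‖ :=
      tendsto_comap.eventually (eventually_gt_atTop 0)
    exact (this.filter_mono hl).mono fun z hz => norm_pos_iff.1 hz
  filter_upwards [hne] with z hz
  rw [mul_sub, Finset.mul_sum]
  congr 1
  refine Finset.sum_congr rfl fun n _ => ?_
  have : z - p n = z * (1 - p n * z⁻¹) := by
    field_simp
  rw [this, div_eq_mul_inv, mul_inv]
  field_simp

theorem tendsto_mul_sub_poles_zero (hl : l ≤ 𝓝 0) (hp : ∀ n, p n ≠ 0)
    (hF : Tendsto (fun z => z * F z) l (𝓝 c)) :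
    Tendsto (fun z => z * (F z - ∑ n, r n / (z - p n))) l (𝓝 c) := by
  have hid : Tendsto (fun z : ℂ => z) l (𝓝 0) := hl
  have h1 : ∀ n, Tendsto (fun z => r n / (z - p n)) l (𝓝 (r n / (0 - p n))) := fun n =>
    tendsto_const_nhds.div (hid.sub_const (p n)) (by simpa using hp n)
  have h3 := hF.sub (hid.mul (tendsto_finsetSum Finset.univ fun n _ => h1 n))
  rw [zero_mul, sub_zero] at h3
  exact h3.congr fun z => by ring

theorem continuousAt_sum_poles {z₀ : ℂ} (hz : z₀ ∉ Set.range p) :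
    ContinuousAt (fun z => ∑ n, r n / (z - p n)) z₀ := by
  refine tendsto_finsetSum Finset.univ fun n _ => ?_
  refine Tendsto.div tendsto_const_nhds ((continuousAt_id).sub continuousAt_const) ?_
  exact sub_ne_zero.2 fun h => hz ⟨n, h.symm⟩

theorem eventually_notMem_range {z₀ : ℂ} (hz : z₀ ∉ Set.range p) : ∀ᶠ z in 𝓝 z₀, z ∉ Set.range p :=
  (Set.finite_range p).isClosed.isOpen_compl.mem_nhds hz

end

theorem exists_bound_of_continuousAt {g : ℂ → ℂ} {z₀ : ℂ} (hg : ContinuousAt g z₀) (A : Set ℂ) :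
    ∃ C : ℝ, ∀ᶠ w in 𝓝[A] z₀, ‖g w‖ ≤ C :=
  ⟨‖g z₀‖ + 1, (hg.norm.eventually (gt_mem_nhds (lt_add_one _))).filter_mono nhdsWithin_le_nhds |>.mono
    fun _ => le_of_lt⟩

theorem branchPoints_notMem_Dminus {z : ℂ} (hz : z ∈ branchPoints B) : z ∉ Dminus B := fun h => by
  have h0 := mem_Dminus_iff.1 h
  rw [(mem_branchPoints_iff B h0.1).1 hz] at h0
  simp at h0

theorem modJost_bounded_branch (hq : IsClassicalSolution B q) (hbc : HasNZBC B q) (e : Side)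
    (j i : Fin 2) (x t : ℝ) {z₀ : ℂ} (hz₀ : z₀ ∈ branchPoints B) :
    ∃ C : ℝ, ∀ᶠ z in 𝓝[jostDomain B e j] z₀, ‖modJost B q e j x t z i‖ ≤ C := by
  obtain ⟨C, hC⟩ := modJost_bounded hq hbc e j x t (mem_branchPoints_ne_zero hz₀)
  exact ⟨C, hC.mono fun z hz => (norm_le_pi_norm _ i).trans hz⟩

section
variable {ι : Type*} [Fintype ι] {p r : ι → ℂ}

/-- The poles lie in D₋, so subtracting them here does no harm. The subtraction is made so that the
jump is not changed by the one on the other side. -/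
theorem isHolomorphicUpTo_plus (hq : IsClassicalSolution B q) (hbc : HasNZBC B q) (x t : ℝ)
    (hp : ∀ n, p n ∈ Dminus B) :
    IsHolomorphicUpTo (fun z => modJost B q .minus 1 x t z 0 - ∑ n, r n / (z - p n)) (Dplus B)
      (Dplus B ∪ contour0 B) (branchPoints B) := by
  have hdis : ∀ z ∈ Dplus B ∪ contour0 B, z ∉ Set.range p := by
    rintro _ (h | h) ⟨n, rfl⟩
    · exact disjoint_Dplus_Dminus (hp n) h
    · exact disjoint_Dminus_contour0 (hp n) h
  refine ⟨Set.subset_union_left, ?_, ?_, fun z hz => ?_⟩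
  · refine (differentiableOn_apply (differentiableOn_modJost hq hbc .minus 1 x t isOpen_Dplus
      fun z hz => mem_region_minus_one (Or.inl hz)) 0).sub ?_
    refine DifferentiableOn.fun_sum fun n _ => (differentiableOn_const _).div
      (differentiableOn_id.sub (differentiableOn_const _)) fun z hz => ?_
    exact sub_ne_zero.2 fun h => hdis z (Or.inl hz) ⟨n, h.symm⟩
  · have h := continuousOn_modJost hq hbc .minus 1 x t
    rw [jostRegion_minus_one, continuousOn_pi] at h
    exact (h 0).sub fun z hz => (continuousAt_sum_poles (hdis z hz)).continuousWithinAt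
  · obtain ⟨C, hC⟩ := modJost_bounded_branch hq hbc .minus 1 0 x t hz
    rw [jostDomain, jostRegion_minus_one] at hC
    obtain ⟨C', hC'⟩ := exists_bound_of_continuousAt (continuousAt_sum_poles (p := p) (r := r)
      (z₀ := z) (by rintro ⟨n, rfl⟩; exact branchPoints_notMem_Dminus hz (hp n)))
      (Dplus B ∪ contour0 B)
    refine ⟨C + C', ?_⟩
    filter_upwards [hC, hC'] with w h1 h2
    exact (norm_sub_le _ _).trans (add_le_add h1 h2)

theorem isHolomorphicUpTo_minus (hq : IsClassicalSolution B q) (hbc : HasNZBC B q)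
    (hns : NoSpectralSingularities B q) (x t : ℝ) (hp : ∀ n, p n ∈ Dminus B) {F : ℂ → ℂ}
    (hF : DifferentiableOn ℂ F (Dminus B)) (hFe : ∀ z, z ∉ Set.range p → F z =
      modJost B q .plus 1 x t z 0 / s22 B q z - ∑ n, r n / (z - p n)) :
    IsHolomorphicUpTo F (Dminus B) (Dminus B ∪ contour0 B) (branchPoints B) := by
  have hc := continuousOn_modJost hq hbc .plus 1 x t
  rw [jostRegion_plus_one, continuousOn_pi] at hc
  refine ⟨Set.subset_union_left, hF, ?_, fun z hz => ?_⟩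
  · rintro z (hz | hz)
    · exact (hF.differentiableAt (isOpen_Dminus.mem_nhds hz)).continuousAt.continuousWithinAt
    · have hzr : z ∉ Set.range p := by
        rintro ⟨n, rfl⟩
        exact disjoint_Dminus_contour0 (hp n) hz
      have h1 := ((hc 0 z (Or.inr hz)).div (continuousOn_s22 hq hbc z (Or.inr hz))
        (hns.s22_ne z hz)).sub (continuousAt_sum_poles (r := r) hzr).continuousWithinAt
      refine h1.congr_of_eventuallyEq ?_ (hFe z hzr)
      exact ((eventually_notMem_range hzr).filter_mono nhdsWithin_le_nhds).mono fun w hw => hFe w hw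
  · have hzr : z ∉ Set.range p := by
      rintro ⟨n, rfl⟩
      exact branchPoints_notMem_Dminus hz (hp n)
    obtain ⟨C, hC⟩ := modJost_bounded_branch hq hbc .plus 1 0 x t hz
    rw [jostDomain, jostRegion_plus_one] at hC
    obtain ⟨C', hC'⟩ := exists_bound_of_continuousAt (continuousAt_sum_poles (r := r) hzr)
      (Dminus B ∪ contour0 B)
    -- Near a branch point the column is bounded and |s₂₂| is bounded below, so the quotient is
    -- bounded even where s₂₂ itself may blow up.
    obtain ⟨c, hc0, hc'⟩ := hns.s22_branch z hz
    refine ⟨C / c + C', ?_⟩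
    filter_upwards [hC, hC', hc', (eventually_notMem_range hzr).filter_mono nhdsWithin_le_nhds]
      with w h1 h2 h3 h4
    rw [hFe w h4]
    refine (norm_sub_le _ _).trans (add_le_add ?_ h2)
    rw [norm_div]
    exact div_le_div₀ ((norm_nonneg _).trans h1) h1 hc0 h3

end

/-! ### Residues and the reconstruction formula -/

theorem tendsto_residue {f g : ℂ → ℂ} {p g' : ℂ} (hf : ContinuousAt f p) (hg : HasDerivAt g g' p)
    (h0 : g p = 0) (hg' : g' ≠ 0) :
    Tendsto (fun z => (z - p) * (f z / g z)) (𝓝[≠] p) (𝓝 (f p / g')) := by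
  have h1 := (hasDerivAt_iff_tendsto_slope.1 hg).inv₀ hg'
  have h2 := (hf.tendsto.mono_left nhdsWithin_le_nhds).mul h1
  rw [← div_eq_mul_inv] at h2
  refine h2.congr fun z => ?_
  rw [slope_def_field, h0, sub_zero, inv_div]
  ring

/-- The reconstruction formula. -/
theorem reconstruction (hq : IsClassicalSolution B q) (hbc : HasNZBC B q)
    (hns : NoSpectralSingularities B q) {N₁ N₂ : ℕ} {z : Fin N₁ → ℂ} {w : Fin N₂ → ℝ}
    (hd : IsDiscreteSpectrum B q z w) (x t : ℝ) :
    HasContourIntegral B (fun ζ => (Mplus B q x t ζ * jumpJ B q x t ζ) 0 1)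
      (2 * Real.pi * Complex.I * (Complex.I * B.qm - (Complex.I * q x t -
        ∑ n, resConst B q (etaHat B z w n) *
          Complex.exp (2 * Complex.I * theta B x t (etaHat B z w n)) *
            modJost B q .minus 0 x t (etaHat B z w n) 0))) := by
  set p := etaHat B z w with hp
  have hpm : ∀ n, p n ∈ Dminus B := fun n => (hd.etaHat_mem hq hbc n).1
  set r : Fin N₁ ⊕ Fin N₁ ⊕ Fin N₂ → ℂ := fun n => resConst B q (p n) *
    Complex.exp (2 * Complex.I * theta B x t (p n)) * modJost B q .minus 0 x t (p n) 0 with hr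
  have hμ : DifferentiableOn ℂ (fun ζ => modJost B q .plus 1 x t ζ 0) (Dminus B) :=
    differentiableOn_apply (differentiableOn_modJost hq hbc .plus 1 x t isOpen_Dminus
      fun ζ hζ => mem_region_plus_one (Or.inl hζ)) 0
  have hs := differentiableOn_s22 hq hbc
  have hres : ∀ n, Tendsto (fun ζ => (ζ - p n) * (modJost B q .plus 1 x t ζ 0 / s22 B q ζ))
      (𝓝[≠] (p n)) (𝓝 (r n)) := by
    intro n
    obtain ⟨h1, h2, h3⟩ : p n ∈ Dminus B ∧ s22 B q (p n) = 0 ∧ deriv (s22 B q) (p n) ≠ 0 :=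
      hd.etaHat_mem hq hbc n
    have h4 := tendsto_residue (hμ.differentiableAt (isOpen_Dminus.mem_nhds h1)).continuousAt
      (hs.differentiableAt (isOpen_Dminus.mem_nhds h1)).hasDerivAt h2 h3
    have h5 : modJost B q .plus 1 x t (p n) 0 / deriv (s22 B q) (p n) = r n := by
      rw [modJost_eq_propCoeff hq hbc h1 h2, hr]
      simp only [resConst, if_neg (disjoint_Dplus_Dminus h1)]
      ring
    rw [← h5]
    exact h4
  have hdiff : DifferentiableOn ℂ (fun ζ => modJost B q .plus 1 x t ζ 0 / s22 B q ζ)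
      (Dminus B \ Set.range p) := by
    refine (hμ.mono Set.sdiff_subset).div (hs.mono Set.sdiff_subset) fun ζ hζ h0 => ?_
    exact hζ.2 (hd.mem_range_etaHat hq hbc hζ.1 h0)
  obtain ⟨F, hF, hFe⟩ : ∃ F : ℂ → ℂ, DifferentiableOn ℂ F (Dminus B) ∧ ∀ ζ, ζ ∉ Set.range p →
      F ζ = modJost B q .plus 1 x t ζ 0 / s22 B q ζ - ∑ n, r n / (ζ - p n) :=
    exists_differentiableOn_sub_poles isOpen_Dminus hd.etaHat_injective hdiff hres
  have hp0 : ∀ n, p n ≠ 0 := fun n => (mem_Dminus_iff.1 (hpm n)).1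
  have hbd : comap norm (𝓝[>] (0 : ℝ)) ≤ 𝓝 (0 : ℂ) := by
    rw [comap_norm_nhdsGT_zero]
    exact nhdsWithin_le_nhds
  have h0r : (0 : ℂ) ∉ Set.range p := by
    rintro ⟨n, hn⟩
    exact hp0 n hn
  have hjp : jostDomain B .minus 1 = Dplus B ∪ contour0 B := jostRegion_minus_one
  have hjm : jostDomain B .plus 1 = Dminus B ∪ contour0 B := jostRegion_plus_one
  have hp1 := tendsto_mul_modJost_atTop hq hbc .minus x t
  have hm1 := tendsto_mul_modJost_atTop hq hbc .plus x t
  have hpz := tendsto_mul_modJost_zero hq hbc .minus x t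
  have hmz := tendsto_mul_modJost_zero hq hbc .plus x t
  rw [hjp] at hp1 hpz
  rw [hjm] at hm1 hmz
  have hm1' : Tendsto (fun ζ => ζ * (modJost B q .plus 1 x t ζ 0 / s22 B q ζ))
      (comap norm atTop ⊓ 𝓟 (Dminus B ∪ contour0 B)) (𝓝 (Complex.I * q x t)) := by
    have h := hm1.div (tendsto_s22 hq hbc) one_ne_zero
    rw [div_one] at h
    exact h.congr fun ζ => mul_div_assoc _ _ _
  -- At the origin s₂₂ → δ, which converts i q₊ into i q₋. The limits from D₊ and D₋ therefore
  -- coincide, as Cauchy's theorem requires.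
  have hmz' : Tendsto (fun ζ => ζ * (modJost B q .plus 1 x t ζ 0 / s22 B q ζ))
      (comap norm (𝓝[>] 0) ⊓ 𝓟 (Dminus B ∪ contour0 B)) (𝓝 (Complex.I * B.qm)) := by
    have h := hmz.div (tendsto_s22_zero hq hbc) (delta_ne_zero B)
    have e1 : Complex.I * (B.bv .plus : ℂ) / B.δ = Complex.I * B.qm := by
      have := delta_ne_zero B
      simp only [Background.bv, Background.qp]
      push_cast
      field_simp
    rw [e1] at h
    exact h.congr fun ζ => mul_div_assoc _ _ _
  refine hasContourIntegral_jump B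
    (Fp := fun ζ => modJost B q .minus 1 x t ζ 0 - ∑ n, r n / (ζ - p n)) (Fm := F)
    (isHolomorphicUpTo_plus hq hbc x t hpm) (isHolomorphicUpTo_minus hq hbc hns x t hpm hF hFe)
    (tendsto_mul_sub_poles_atTop inf_le_left hp1) ?_
    (tendsto_mul_sub_poles_zero (inf_le_left.trans hbd) hp0 hpz) ?_ (fun ζ hζ => ?_) ?_
  · refine (tendsto_mul_sub_poles_atTop (p := p) (r := r) inf_le_left hm1').congr' ?_
    have h1 : ∀ᶠ ζ : ℂ in comap norm atTop, ζ ∉ Set.range p := by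
      obtain ⟨R, hR⟩ := (Set.finite_range p).isBounded.exists_norm_le
      filter_upwards [tendsto_comap.eventually (eventually_gt_atTop R)] with ζ hζ hmem
      exact absurd (hR ζ hmem) (not_le.2 hζ)
    exact (h1.filter_mono inf_le_left).mono fun ζ hζ => by
      simp only
      rw [hFe ζ hζ]
  · refine (tendsto_mul_sub_poles_zero (p := p) (r := r) (inf_le_left.trans hbd) hp0 hmz').congr' ?_
    exact ((eventually_notMem_range h0r).filter_mono (inf_le_left.trans hbd)).mono fun ζ hζ => by
      simp only
      rw [hFe ζ hζ]
  · have hζr : ζ ∉ Set.range p := by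
      rintro ⟨n, rfl⟩
      exact disjoint_Dminus_contour0 (hpm n) hζ
    rw [Mplus_mul_jumpJ hq hbc x t hζ (hns.s11_ne ζ hζ) (hns.s22_ne ζ hζ), hFe ζ hζr]
    ring
  · obtain ⟨C, hC⟩ := jump_bounded_zero hq hbc x t
    refine ⟨C, ?_⟩
    filter_upwards [hC, self_mem_nhdsWithin] with ζ hζ hmem
    rwa [Mplus_mul_jumpJ hq hbc x t hmem (hns.s11_ne ζ hmem) (hns.s22_ne ζ hmem)]

end

end NonlocalMKdV

end

theorem mainTheorem1 (B : NonlocalMKdV.Background) (q : ℝ → ℝ → ℝ)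
    (hq : NonlocalMKdV.IsClassicalSolution B q) (hbc : NonlocalMKdV.HasNZBC B q)
    (hns : NonlocalMKdV.NoSpectralSingularities B q)
    {N₁ N₂ : ℕ} (z : Fin N₁ → ℂ) (w : Fin N₂ → ℝ)
    (hd : NonlocalMKdV.IsDiscreteSpectrum B q z w) (x t : ℝ) :
    ∃ I : ℂ,
      NonlocalMKdV.HasContourIntegral B
        (fun ζ => (NonlocalMKdV.Mplus B q x t ζ * NonlocalMKdV.jumpJ B q x t ζ) 0 1) I ∧
      (q x t : ℂ) = (B.qm : ℂ)
        - Complex.I * ∑ n : Fin N₁ ⊕ Fin N₁ ⊕ Fin N₂,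
            NonlocalMKdV.resConst B q (NonlocalMKdV.etaHat B z w n) *
            Complex.exp (2 * Complex.I *
              NonlocalMKdV.theta B x t (NonlocalMKdV.etaHat B z w n)) *
            NonlocalMKdV.modJost B q .minus 0 x t (NonlocalMKdV.etaHat B z w n) 0
        + 1 / (2 * (Real.pi : ℂ)) * I := by
  -- The integral is 2πi (i q₋ - i q + Σ), with Σ the sum of the residues; what remains is to solve
  -- for q.
  refine ⟨_, NonlocalMKdV.reconstruction hq hbc hns hd x t, ?_⟩
  have hπ : (Real.pi : ℂ) ≠ 0 := Complex.ofReal_ne_zero.2 Real.pi_ne_zero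
  have hI := Complex.I_sq
  field_simp
  linear_combination ((q x t : ℂ) - B.qm) * hI
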